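/- **Setting.** Let $p,q$ be natural numbers, $\langle x\rangle=\sqrt{1+x^2}$, $\mathcal H=L^2(\mathbb R^2;\mathbb C^q)$ with points $(x,y)$ and $(f,g)=\int f\cdot\bar g\,dx\,dy$. Let $L^2_s$ be the space of $u$ with $\langle x\rangle^s u\in L^2$, let $H^p_s$ be the space of $u$ with $\langle x\rangle^s\langle y\rangle^p u\in L^2$ and $\langle x\rangle^s D^\alpha u\in L^2$ for $|\alpha|=p$ (weak derivatives, $D=-i\partial$), and let $H^p=H^p_0$. **[H1]** (o) $H_0=\sum_{a+b\le p}c_{ab}(y)D_x^aD_y^b$ is a differential operator with measurable $q\times q$-matrix coefficients independent of $x$, self-adjoint on $\mathcal H$ with domain $H^p$, and $(H_0-i)^{-1}$ is bounded from $\mathcal H$ to $H^p$. (i) For each $\xi\in\mathbb R$ there are an orthonormal basis $(\phi_j(\cdot;\xi))_{j\in\mathbb N}$ of $L^2(\mathbb R_y;\mathbb C^q)$ and real numbers $E_j(\xi)$ such that $\psi_j(x,y;\xi)=(2\pi)^{-1/2}e^{i\xi x}\phi_j(y;\xi)$ lies in $H^p_{-s}$ for all $s>\frac12$ and $H_0\psi_j=E_j(\xi)\psi_j$.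 (ii) For each $j$, $|E_j(\xi)|\to\infty$ as $|\xi|\to\infty$ and $(1+|E_j|^2)^{-1}$ is integrable; for each interval $[a,b]$ only finitely many branches $E_j$ take a value in $[a,b]$. (iii) $\xi\mapsto E_j(\xi)$ and $\xi\mapsto\phi_j(\xi)\otimes\phi_j(\xi)$ are $C^\infty$; each $E_j$ has finitely many critical values; the set $Z=\{E_j(\xi):\partial_\xi E_j(\xi)=0\}$ of all critical values is finite in each bounded interval. (iv) For $E\notin Z$ and $s>\frac12$, every solution $\psi\in H^p_{-s}$ of $H_0\psi=E\psi$ is a linear combination of the $\psi_j(\cdot;\xi)$ with $E_j(\xi)=E$. **Perturbation and [H2].** $H=H_0+Q$, where $Q$ is multiplication by a measurable Hermitian-matrix-valued function with $\langle x\rangle^{1+\varepsilon}|Q(x,y)|\le C$ for some $\varepsilon>0$. There are orthonormal eigenfunctions $H\varphi_n=\lambda_n\varphi_n$ in $\mathcal H$ and, for all $(j,\xi)$, generalized eigenfunctions $\psi^Q_j(\cdot;\xi)\in H^p_{-s}$ ($s>\frac12$), $H\psi_j^Q=E_j(\xi)\psi_j^Q$, with $\xi\mapsto(f,\psi^Q_j(\cdot;\xi))$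 measurable for $f\in L^2_s$, such that $$H=\sum_n\lambda_n\,\varphi_n\otimes\varphi_n+\sum_j\int_{\mathbb R}E_j(\xi)\,\psi_j^Q(\cdot;\xi)\otimes\psi_j^Q(\cdot;\xi)\,d\xi,$$ and such that the same formula with $\lambda_n$, $E_j(\xi)$ replaced by $1$ is a resolution of the identity, i.e. $\|f\|^2=\sum_n|(f,\varphi_n)|^2+\sum_j\int|(f,\psi_j^Q(\cdot;\xi))|^2d\xi$ for $f\in L^2_s$, $s>\frac12$. **[H3]** For $E\notin Z$ let $m,n$ run through the pairs $(j,\xi_m)$ with $E_j(\xi_m)=E$, write $\psi_m,\psi_m^Q$ for the corresponding functions, and put $J_m=\partial_\xi E_j(\xi_m)\ne0$. There are coefficients $\alpha^\pm_{mn}\in\mathbb C$ with $$\Big\|\psi_m^Q(x,\cdot)-\sum_n\alpha_{mn}^\pm\psi_n(x,\cdot)\Big\|_{L^2(\mathbb R_y)}\to0\qquad(x\to\pm\infty),$$ and the incoming part of $\psi^Q_m$ is $\psi_m$: $\alpha^-_{mn}=\delta_{mn}$ if $J_n>0$, and $\alpha^+_{mn}=\delta_{mn}$ if $J_n<0$.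 **Theorem.** Assume [H1]–[H3] and let $E\in\mathbb R\setminus Z$. Then the numbers $n_\pm$ of indices $m$ at energy $E$ with $\pm J_m>0$ are finite. Put $$T^+_{mn}=\sqrt{\tfrac{|J_n|}{|J_m|}}\,\alpha^+_{mn}\ (J_m,J_n>0),\quad T^-_{mn}=\sqrt{\tfrac{|J_n|}{|J_m|}}\,\alpha^-_{mn}\ (J_m,J_n<0),$$ $$R^+_{mn}=\sqrt{\tfrac{|J_n|}{|J_m|}}\,\alpha^+_{mn}\ (J_m<0<J_n),\quad R^-_{mn}=\sqrt{\tfrac{|J_n|}{|J_m|}}\,\alpha^-_{mn}\ (J_n<0<J_m).$$ Then the $(n_++n_-)\times(n_++n_-)$ scattering matrix $S(E)=\begin{pmatrix}T_+&R_-\\R_+&T_-\end{pmatrix}$ is unitary. Moreover, let $E_-\le E\le E_+$ with $[E_-,E_+]\cap Z=\emptyset$, let $\varphi$ be a smooth function with $\varphi=0$ on $(-\infty,E_-)$ and $\varphi=1$ on $(E_+,\infty)$, and let $P=P(x)$ be a smooth function with $P=0$ for $x<c$ and $P=1$ for $x>d$, for some $c<d$. Then $i[H,P]\varphi'(H)$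 is well defined and trace class, and $\sigma_I=\operatorname{Tr}\,i[H,P]\varphi'(H)$ satisfies $$2\pi\sigma_I=\operatorname{tr}T_+^*T_+-\operatorname{tr}T_-^*T_-=n_+-n_-.$$ -/

import Mathlib

open MeasureTheory Filter Topology Set
open scoped ContDiff Matrix ENNReal InnerProductSpace

noncomputable section

namespace EdgeScattering

/-! ### Function spaces and weak derivatives on the plane -/

/-- The fibre `ℂ^q`. -/
abbrev Fibre (q : ℕ) := EuclideanSpace ℂ (Fin q)

/-- The Hilbert space `L²(ℝ²) ⊗ ℂ^q`; a point of the plane is written `z = (x, y)`. -/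
abbrev L2Plane (q : ℕ) := Lp (Fibre q) 2 (volume : Measure (ℝ × ℝ))

/-- The Hilbert space `L²(ℝ_y) ⊗ ℂ^q`. -/
abbrev L2Line (q : ℕ) := Lp (Fibre q) 2 (volume : Measure ℝ)

/-- `⟨x⟩ = √(1 + x²)`. -/
def bracket (x : ℝ) : ℝ := Real.sqrt (1 + x ^ 2)

/-- The classical partial derivative `∂_x^a ∂_y^b θ`. -/
def partialDeriv (a b : ℕ) (θ : ℝ × ℝ → ℂ) (z : ℝ × ℝ) : ℂ :=
  iteratedDeriv a (fun x => iteratedDeriv b (fun y => θ (x, y)) z.2) z.1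

/-- `v` is the weak derivative `∂_x^a ∂_y^b u`, tested against `C_c^∞(ℝ²)`. -/
def HasWeakDeriv {q : ℕ} (a b : ℕ) (u v : ℝ × ℝ → Fibre q) : Prop :=
  LocallyIntegrable u volume ∧ LocallyIntegrable v volume ∧
    ∀ θ : ℝ × ℝ → ℂ, ContDiff ℝ ∞ θ → HasCompactSupport θ →
      ∫ z, partialDeriv a b θ z • u z = (-1 : ℂ) ^ (a + b) • ∫ z, θ z • v z

/-- `u ∈ L²_s`: the function `⟨x⟩^s u` is square integrable. -/
def MemL2s {q : ℕ} (s : ℝ) (u : ℝ × ℝ → Fibre q) : Prop :=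
  MemLp (fun z => (bracket z.1 ^ s) • u z) 2 volume

/-- `u ∈ H^p_s`: the functions `⟨x⟩^s ⟨y⟩^p u` and `⟨x⟩^s D^α u`, `|α| = p`, are square
integrable. -/
def MemHps {q : ℕ} (p : ℕ) (s : ℝ) (u : ℝ × ℝ → Fibre q) : Prop :=
  MemL2s s (fun z => (bracket z.2 ^ p) • u z) ∧
    ∀ a b : ℕ, a + b = p → ∃ v, HasWeakDeriv a b u v ∧ MemL2s s v

/-- `c` is the coefficient family of the differential expression
`∑_{a+b ≤ p} c_{ab}(y) D_x^a D_y^b`, `D = -i∂`, whose coefficients do not depend on `x`; the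
proposition says that this expression, applied to `u` in the sense of weak derivatives, is `w`. -/
def DiffExprApply {q : ℕ} (p : ℕ) (c : ℕ → ℕ → ℝ → Matrix (Fin q) (Fin q) ℂ)
    (u w : ℝ × ℝ → Fibre q) : Prop :=
  ∃ v : ℕ → ℕ → ℝ × ℝ → Fibre q,
    (∀ a b, a + b ≤ p → HasWeakDeriv a b u (v a b)) ∧
    ∀ᵐ z : ℝ × ℝ, w z = ∑ a ∈ Finset.range (p + 1), ∑ b ∈ Finset.range (p + 1 - a),
      Matrix.toEuclideanLin (c a b z.2) ((-Complex.I) ^ (a + b) • v a b z)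

/-- The domain of the multiplication operator: all `u ∈ L²` with `V u ∈ L²`. -/
def mulDomain {q : ℕ} (V : ℝ × ℝ → Matrix (Fin q) (Fin q) ℂ) : Submodule ℂ (L2Plane q) where
  carrier := {u | MemLp (fun z => Matrix.toEuclideanLin (V z) (u z)) 2 volume}
  zero_mem' := by
    refine (MemLp.zero' (p := 2) (μ := volume) (ε := Fibre q)).ae_eq ?_
    filter_upwards [Lp.coeFn_zero (Fibre q) 2 (volume : Measure (ℝ × ℝ))] with z hz
    rw [hz]; simp
  add_mem' := by
    intro u v hu hv
    refine MemLp.ae_eq ?_ (MemLp.add hu hv)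
    filter_upwards [Lp.coeFn_add u v] with z hz
    rw [hz]; simp only [Pi.add_apply, map_add]
  smul_mem' := by
    intro k u hu
    refine MemLp.ae_eq ?_ (MemLp.const_smul hu k)
    filter_upwards [Lp.coeFn_smul k u] with z hz
    rw [hz]; simp only [Pi.smul_apply, map_smul]

/-- The (maximal) operator of multiplication by a matrix-valued function `V`. -/
def mulOp {q : ℕ} (V : ℝ × ℝ → Matrix (Fin q) (Fin q) ℂ) : L2Plane q →ₗ.[ℂ] L2Plane q where
  domain := mulDomain V
  toFun :=
    { toFun := fun u => MemLp.toLp (fun z => Matrix.toEuclideanLin (V z) (u.1 z)) u.2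
      map_add' := by
        intro u v
        refine Eq.trans (MemLp.toLp_congr (u + v).2 (MemLp.add u.2 v.2) ?_)
          (MemLp.toLp_add u.2 v.2)
        filter_upwards [Lp.coeFn_add u.1 v.1] with z hz
        simp only [Submodule.coe_add, hz, Pi.add_apply, map_add]
      map_smul' := by
        intro k u
        refine Eq.trans (MemLp.toLp_congr (k • u).2 (MemLp.const_smul u.2 k) ?_)
          (MemLp.toLp_const_smul k u.2)
        filter_upwards [Lp.coeFn_smul k u.1] with z hz
        simp only [Submodule.coe_smul, hz, Pi.smul_apply, map_smul] }

/-- The pairing `(f, ψ) = ∫ f · ψ̄ dx dy`. -/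
def pairing {q : ℕ} (f ψ : ℝ × ℝ → Fibre q) : ℂ := ∫ z, ⟪ψ z, f z⟫_ℂ

/-! ### Functional calculus, trace, interface current observable -/

/-- `R = (A - z)⁻¹`, an everywhere defined bounded operator. -/
def IsResolvent {q : ℕ} (A : L2Plane q →ₗ.[ℂ] L2Plane q) (z : ℂ)
    (R : L2Plane q →L[ℂ] L2Plane q) : Prop :=
  ∀ f u, u = R f ↔ ∃ hu : u ∈ A.domain, A ⟨u, hu⟩ - z • u = f

/-- `G = g(A)` for a self-adjoint `A` and a continuous compactly supported `g : ℝ → ℝ`.  With the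
bounded normal operator `R = (A - i)⁻¹`, whose spectrum lies in `{0} ∪ {(t - i)⁻¹ : t ∈ ℝ}`, one has
`g(A) = h(R)`, where `h((t - i)⁻¹) = g(t)` and `h(0) = 0`. -/
def IsFunctionOf {q : ℕ} (A : L2Plane q →ₗ.[ℂ] L2Plane q) (g : ℝ → ℝ)
    (G : L2Plane q →L[ℂ] L2Plane q) : Prop :=
  ∃ R, IsResolvent A Complex.I R ∧
    G = cfc (fun w : ℂ => if w = 0 then (0 : ℂ) else ((g (w⁻¹).re : ℝ) : ℂ)) R

/-- `C = i[A, P] G`, where `P` acts as multiplication by `P(x)`: for all `f`, both `G f` and `P G f`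
lie in the domain of `A` and `C f = i (A (P G f) - P (A G f))`. -/
def IsCurrentOperator {q : ℕ} (A : L2Plane q →ₗ.[ℂ] L2Plane q) (P : ℝ → ℝ)
    (G C : L2Plane q →L[ℂ] L2Plane q) : Prop :=
  ∀ f, ∃ (hu : G f ∈ A.domain) (v : A.domain) (w : L2Plane q),
    (∀ᵐ z : ℝ × ℝ, v.1 z = ((P z.1 : ℝ) : ℂ) • G f z) ∧
    (∀ᵐ z : ℝ × ℝ, w z = ((P z.1 : ℝ) : ℂ) • A ⟨G f, hu⟩ z) ∧
    C f = Complex.I • (A v - w)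

/-- `T` is trace class, that is, a sum `∑ₙ ⟨fₙ, ·⟩ gₙ` with `∑ₙ ‖fₙ‖ ‖gₙ‖ < ∞`, and its trace is
`t`, computed in any orthonormal basis. -/
def HasTrace {𝓗 : Type*} [NormedAddCommGroup 𝓗] [InnerProductSpace ℂ 𝓗] (T : 𝓗 →L[ℂ] 𝓗) (t : ℂ) :
    Prop :=
  (∃ f g : ℕ → 𝓗, Summable (fun n => ‖f n‖ * ‖g n‖) ∧
    ∀ x, HasSum (fun n => ⟪f n, x⟫_ℂ • g n) (T x)) ∧
  ∀ (ι : Type) (e : HilbertBasis ι ℂ 𝓗), HasSum (fun i => ⟪e i, T (e i)⟫_ℂ) t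

/-- `σ = Tr i[A, P] g(A)`; the operator is trace class. -/
def IsInterfaceCurrent {q : ℕ} (A : L2Plane q →ₗ.[ℂ] L2Plane q) (P g : ℝ → ℝ) (σ : ℝ) : Prop :=
  ∃ G C, IsFunctionOf A g G ∧ IsCurrentOperator A P G C ∧ HasTrace C (σ : ℂ)

/-- `f` is a smooth switch function, equal to `0` on `(-∞, c)` and to `1` on `(d, ∞)`. -/
def IsSmoothSwitch (c d : ℝ) (f : ℝ → ℝ) : Prop :=
  ContDiff ℝ ∞ f ∧ (∀ x < c, f x = 0) ∧ ∀ x > d, f x = 1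

/-! ### The unperturbed and the perturbed system -/

/-- The objects of the scattering problem.  What they have to satisfy is stated in the hypotheses
below.  A pair `(j, ξ) : ℕ × ℝ` stands for a branch and a wave number. -/
structure ScatteringSystem (p q : ℕ) where
  /-- coefficients of the `x`-independent differential expression -/
  coeff : ℕ → ℕ → ℝ → Matrix (Fin q) (Fin q) ℂ
  /-- the unperturbed operator -/
  H₀ : L2Plane q →ₗ.[ℂ] L2Plane q
  /-- the branches `E_j(ξ)` -/
  energy : ℕ → ℝ → ℝ
  /-- the transverse modes: for each `ξ`, an orthonormal basis `(φ_j(·; ξ))_j` of `L²(ℝ_y) ⊗ ℂ^q` -/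
  mode : ℝ → HilbertBasis ℕ ℂ (L2Line q)
  /-- the perturbation, a matrix-valued function -/
  Q : ℝ × ℝ → Matrix (Fin q) (Fin q) ℂ
  /-- the index set of the point spectrum of the perturbed operator -/
  PointIndex : Type
  /-- the eigenvalues `λ_n` of the perturbed operator -/
  eigval : PointIndex → ℝ
  /-- the eigenfunctions of the perturbed operator -/
  eigvec : PointIndex → L2Plane q
  /-- the perturbed generalized eigenfunctions `ψ^Q_j(x, y; ξ)` -/
  psiQ : ℕ × ℝ → ℝ × ℝ → Fibre q
  /-- the asymptotic coefficients `α⁺` (as `x → +∞`) between two modes -/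
  αplus : ℕ × ℝ → ℕ × ℝ → ℂ
  /-- the asymptotic coefficients `α⁻` (as `x → -∞`) between two modes -/
  αminus : ℕ × ℝ → ℕ × ℝ → ℂ

namespace ScatteringSystem

variable {p q : ℕ} (S : ScatteringSystem p q)

/-- `ψ_j(x, y; ξ) = (2π)^{-1/2} e^{iξx} φ_j(y; ξ)`. -/
def psi (m : ℕ × ℝ) (z : ℝ × ℝ) : Fibre q :=
  (((Real.sqrt (2 * Real.pi))⁻¹ : ℂ) * Complex.exp (Complex.I * m.2 * z.1)) • S.mode m.2 m.1 z.2

/-- The perturbed operator `H = H₀ + Q`. -/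
def H : L2Plane q →ₗ.[ℂ] L2Plane q := S.H₀ + mulOp S.Q

/-- The current `J = ∂_ξ E_j(ξ)`. -/
def current (m : ℕ × ℝ) : ℝ := deriv (S.energy m.1) m.2

/-- The set `Z` of critical values of the branches. -/
def criticalValues : Set ℝ := {e | ∃ j ξ, S.energy j ξ = e ∧ deriv (S.energy j) ξ = 0}

/-- The modes at energy `e`: the pairs `(j, ξ)` with `E_j(ξ) = e`. -/
def modes (e : ℝ) : Set (ℕ × ℝ) := {m | S.energy m.1 m.2 = e}

/-- The hypothesis on the unperturbed operator. -/
structure HypH1 : Prop where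
  coeff_measurable : ∀ a b i j, Measurable fun y => S.coeff a b y i j
  /-- (o) `H₀` has domain `H^p`, acts as the differential expression and is self-adjoint. -/
  mem_domain : ∀ u : L2Plane q, u ∈ S.H₀.domain ↔ MemHps p 0 u
  apply_eq : ∀ u : S.H₀.domain, DiffExprApply p S.coeff u.1 (S.H₀ u)
  selfAdjoint : IsSelfAdjoint S.H₀
  /-- (o) `(H₀ - i)⁻¹` is bounded from `L²` to `H^p` (ellipticity). -/
  elliptic : ∃ C : ℝ, ∀ u : S.H₀.domain,
    eLpNorm (fun z : ℝ × ℝ => (bracket z.2 ^ p) • u.1 z) 2 volume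
        ≤ ENNReal.ofReal (C * ‖S.H₀ u - Complex.I • u.1‖) ∧
    ∀ a b v, a + b = p → HasWeakDeriv a b u.1 v →
      eLpNorm v 2 volume ≤ ENNReal.ofReal (C * ‖S.H₀ u - Complex.I • u.1‖)
  /-- (i) the plane waves are generalized eigenfunctions. -/
  psi_mem : ∀ s : ℝ, 1 / 2 < s → ∀ m, MemHps p (-s) (S.psi m)
  psi_eq : ∀ m : ℕ × ℝ,
    DiffExprApply p S.coeff (S.psi m) (fun z => ((S.energy m.1 m.2 : ℝ) : ℂ) • S.psi m z)
  /-- (ii) the branches are smooth, proper, and finitely many of them meet a compact interval. -/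
  energy_smooth : ∀ j, ContDiff ℝ ∞ (S.energy j)
  energy_tendsto : ∀ j, Tendsto (fun ξ => |S.energy j ξ|) (cocompact ℝ) atTop
  energy_integrable : ∀ j, Integrable fun ξ => (1 + |S.energy j ξ| ^ 2)⁻¹
  finite_branches : ∀ a b : ℝ, {j | ∃ ξ, S.energy j ξ ∈ Icc a b}.Finite
  /-- (iii) the rank-one projectors are smooth, and there are few critical values. -/
  projector_smooth : ∀ j, ContDiff ℝ ∞ fun ξ =>
    InnerProductSpace.rankOne ℂ (S.mode ξ j) (S.mode ξ j)
  finite_critical_branch : ∀ j, {e | ∃ ξ, S.energy j ξ = e ∧ deriv (S.energy j) ξ = 0}.Finite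
  finite_critical : ∀ a b : ℝ, (S.criticalValues ∩ Icc a b).Finite
  /-- (iv) away from the critical values, the plane waves span the generalized eigenspaces. -/
  complete : ∀ e ∉ S.criticalValues, ∀ s : ℝ, 1 / 2 < s → ∀ ψ, MemHps p (-s) ψ →
    DiffExprApply p S.coeff ψ (fun z => (e : ℂ) • ψ z) →
    ∃ k : ℕ × ℝ → ℂ, ∀ᵐ z : ℝ × ℝ, ψ z = ∑ᶠ m ∈ S.modes e, k m • S.psi m z

/-- `Q` is measurable, Hermitian, and decays like `⟨x⟩^{-1-ε}`. -/
structure ShortRange : Prop where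
  measurable : ∀ i j, Measurable fun z => S.Q z i j
  hermitian : ∀ z, (S.Q z).IsHermitian
  decay : ∃ ε > 0, ∃ C : ℝ, ∀ z i j, bracket z.1 ^ (1 + ε) * ‖S.Q z i j‖ ≤ C

/-- The spectral decomposition
`H = ∑ₙ λₙ Πₙ + ∑_j ∫ E_j(ξ) Π^Q_j(ξ) dξ` of the perturbed operator, with
`Π^Q_j(ξ) = ψ^Q_j(·; ξ) ⊗ ψ^Q_j(·; ξ)`, and the corresponding resolution of the identity. -/
structure HypH2 : Prop where
  orthonormal : Orthonormal ℂ S.eigvec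
  eigvec_eq : ∀ n, ∃ h : S.eigvec n ∈ S.H.domain,
    S.H ⟨S.eigvec n, h⟩ = ((S.eigval n : ℝ) : ℂ) • S.eigvec n
  /-- `ψ^Q_j(·; ξ)` lies in `H^p_{-s}` and solves `H ψ = E_j(ξ) ψ`. -/
  psiQ_mem : ∀ s : ℝ, 1 / 2 < s → ∀ m, MemHps p (-s) (S.psiQ m)
  psiQ_eq : ∀ m : ℕ × ℝ, DiffExprApply p S.coeff (S.psiQ m) fun z =>
    ((S.energy m.1 m.2 : ℝ) : ℂ) • S.psiQ m z - Matrix.toEuclideanLin (S.Q z) (S.psiQ m z)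
  measurable : ∀ s : ℝ, 1 / 2 < s → ∀ f : L2Plane q, MemL2s s f → ∀ j,
    AEStronglyMeasurable (fun ξ : ℝ => pairing f (S.psiQ (j, ξ))) volume
  /-- resolution of the identity -/
  parseval : ∀ s : ℝ, 1 / 2 < s → ∀ f : L2Plane q, MemL2s s f →
    ‖f‖ₑ ^ 2 = ∑' n, ‖⟪S.eigvec n, f⟫_ℂ‖ₑ ^ 2 +
      ∑' j, ∫⁻ ξ : ℝ, ‖pairing f (S.psiQ (j, ξ))‖ₑ ^ 2
  /-- spectral decomposition of `H` -/
  decomposition : ∀ s : ℝ, 1 / 2 < s → ∀ (f : S.H.domain) (g : L2Plane q),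
    MemL2s s f.1 → MemL2s s g →
    ⟪g, S.H f⟫_ℂ = ∑' n, ((S.eigval n : ℝ) : ℂ) * (⟪g, S.eigvec n⟫_ℂ * ⟪S.eigvec n, f.1⟫_ℂ) +
      ∑' j, ∫ ξ : ℝ, ((S.energy j ξ : ℝ) : ℂ) *
        ((starRingEnd ℂ) (pairing g (S.psiQ (j, ξ))) * pairing f.1 (S.psiQ (j, ξ)))

/-- At each noncritical energy `e`, as `x → ±∞`, `ψ^Q_m(x, ·)` approaches `∑ₙ α^±_{mn} ψ_n(x, ·)` in
`L²(ℝ_y)`, uniformly in `x` (outside null sets of `x`).  The incoming part of `ψ^Q_m` is `ψ_m`: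
right-moving modes at `-∞` and left-moving modes at `+∞` enter with coefficient `δ_{mn}`. -/
structure HypH3 : Prop where
  plus : ∀ e ∉ S.criticalValues, ∀ m ∈ S.modes e, Tendsto
    (fun x => eLpNorm (fun y : ℝ => S.psiQ m (x, y) -
      ∑ᶠ n ∈ S.modes e, S.αplus m n • S.psi n (x, y)) 2 volume) (atTop ⊓ ae volume) (𝓝 0)
  minus : ∀ e ∉ S.criticalValues, ∀ m ∈ S.modes e, Tendsto
    (fun x => eLpNorm (fun y : ℝ => S.psiQ m (x, y) -
      ∑ᶠ n ∈ S.modes e, S.αminus m n • S.psi n (x, y)) 2 volume) (atBot ⊓ ae volume) (𝓝 0)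
  incoming_plus : ∀ e ∉ S.criticalValues, ∀ m ∈ S.modes e, ∀ n ∈ S.modes e,
    S.current n < 0 → S.αplus m n = if m = n then 1 else 0
  incoming_minus : ∀ e ∉ S.criticalValues, ∀ m ∈ S.modes e, ∀ n ∈ S.modes e,
    0 < S.current n → S.αminus m n = if m = n then 1 else 0

/-! ### The scattering matrix -/

/-- The modes at energy `e` with `J > 0`. -/
abbrev PosMode (e : ℝ) := {m : ℕ × ℝ // m ∈ S.modes e ∧ 0 < S.current m}

/-- The modes at energy `e` with `J < 0`. -/
abbrev NegMode (e : ℝ) := {m : ℕ × ℝ // m ∈ S.modes e ∧ S.current m < 0}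

/-- `n₊(e)`. -/
def nPlus (e : ℝ) : ℕ := Nat.card (S.PosMode e)

/-- `n₋(e)`. -/
def nMinus (e : ℝ) : ℕ := Nat.card (S.NegMode e)

/-- `√(|J_n| / |J_m|)`. -/
def weight (m n : ℕ × ℝ) : ℂ := (Real.sqrt (|S.current n| / |S.current m|) : ℂ)

/-- `T⁺_{mn} = √(|J_n|/|J_m|) α⁺_{mn}`, `J_m > 0`, `J_n > 0`. -/
def Tplus (e : ℝ) : Matrix (S.PosMode e) (S.PosMode e) ℂ :=
  Matrix.of fun m n => S.weight m n * S.αplus m n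

/-- `T⁻_{mn} = √(|J_n|/|J_m|) α⁻_{mn}`, `J_m < 0`, `J_n < 0`. -/
def Tminus (e : ℝ) : Matrix (S.NegMode e) (S.NegMode e) ℂ :=
  Matrix.of fun m n => S.weight m n * S.αminus m n

/-- `R⁺_{mn} = √(|J_n|/|J_m|) α⁺_{mn}`, `J_m < 0`, `J_n > 0`: the wave comes in from `+∞` and is
reflected to `+∞`. -/
def Rplus (e : ℝ) : Matrix (S.NegMode e) (S.PosMode e) ℂ :=
  Matrix.of fun m n => S.weight m n * S.αplus m n

/-- `R⁻_{mn} = √(|J_n|/|J_m|) α⁻_{mn}`, `J_m > 0`, `J_n < 0`: the wave comes in from `-∞` and is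
reflected to `-∞`. -/
def Rminus (e : ℝ) : Matrix (S.PosMode e) (S.NegMode e) ℂ :=
  Matrix.of fun m n => S.weight m n * S.αminus m n

/-- The scattering matrix `[[T₊, R₋], [R₊, T₋]]`. -/
def scatteringMatrix (e : ℝ) : Matrix (S.PosMode e ⊕ S.NegMode e) (S.PosMode e ⊕ S.NegMode e) ℂ :=
  Matrix.fromBlocks (S.Tplus e) (S.Rminus e) (S.Rplus e) (S.Tminus e)

end ScatteringSystem

end EdgeScattering

end

open MeasureTheory Filter Topology Set
open scoped ContDiff Matrix ENNReal InnerProductSpace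

noncomputable section

namespace EdgeScattering

variable {q : ℕ}

/-! ### Multiplication by bounded functions of `x` -/

/-- Measurable and bounded functions of one real variable. -/
structure BddMeas (f : ℝ → ℂ) : Prop where
  measurable : Measurable f
  bdd : ∃ C : ℝ, ∀ x, ‖f x‖ ≤ C

namespace BddMeas

variable {f g : ℝ → ℂ}

theorem bound (hf : BddMeas f) : ∃ C : ℝ, 0 ≤ C ∧ ∀ x, ‖f x‖ ≤ C :=
  let ⟨C, hC⟩ := hf.bdd
  ⟨C, (norm_nonneg _).trans (hC 0), hC⟩

theorem mul (hf : BddMeas f) (hg : BddMeas g) : BddMeas (fun x => f x * g x) := by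
  obtain ⟨C, hC0, hC⟩ := hf.bound
  obtain ⟨D, _, hD⟩ := hg.bound
  exact ⟨hf.measurable.mul hg.measurable, C * D, fun x => by
    rw [norm_mul]; exact mul_le_mul (hC x) (hD x) (norm_nonneg _) hC0⟩

theorem sub (hf : BddMeas f) (hg : BddMeas g) : BddMeas (fun x => f x - g x) := by
  obtain ⟨C, _, hC⟩ := hf.bound
  obtain ⟨D, _, hD⟩ := hg.bound
  exact ⟨hf.measurable.sub hg.measurable, C + D, fun x =>
    (norm_sub_le _ _).trans (add_le_add (hC x) (hD x))⟩

theorem const (c : ℂ) : BddMeas (fun _ => c) := ⟨measurable_const, ‖c‖, fun _ => le_rfl⟩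

theorem star (hf : BddMeas f) : BddMeas (fun x => starRingEnd ℂ (f x)) := by
  obtain ⟨C, _, hC⟩ := hf.bound
  exact ⟨Complex.continuous_conj.measurable.comp hf.measurable, C, fun x => by simpa using hC x⟩

theorem of_continuous_compact (hf : Continuous f) (h : HasCompactSupport f) : BddMeas f :=
  let ⟨C, hC⟩ := h.exists_bound_of_continuous hf
  ⟨hf.measurable, C, hC⟩

theorem memLp (hf : BddMeas f) {u : ℝ × ℝ → Fibre q} (hu : MemLp u 2 volume) :
    MemLp (fun z : ℝ × ℝ => f z.1 • u z) 2 volume := by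
  obtain ⟨C, _, hC⟩ := hf.bound
  refine hu.of_le_mul (c := C)
    ((hf.measurable.comp measurable_fst).aestronglyMeasurable.smul hu.1) (ae_of_all _ fun z => ?_)
  rw [norm_smul]
  gcongr
  exact hC _

end BddMeas

open Classical in
/-- Multiplication by a bounded measurable function of `x`; zero if `f` is not of this kind. -/
def mulX (f : ℝ → ℂ) : L2Plane q →L[ℂ] L2Plane q :=
  if hf : BddMeas f then
    LinearMap.mkContinuous
      { toFun := fun u => (hf.memLp (Lp.memLp u)).toLp
        map_add' := fun u v => by
          refine Eq.trans (MemLp.toLp_congr _ ((hf.memLp (Lp.memLp u)).add (hf.memLp (Lp.memLp v)))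
            ?_) (MemLp.toLp_add _ _)
          filter_upwards [Lp.coeFn_add u v] with z hz
          simp only [hz, Pi.add_apply, smul_add]
        map_smul' := fun c u => by
          refine Eq.trans (MemLp.toLp_congr _ ((hf.memLp (Lp.memLp u)).const_smul c)
            ?_) (MemLp.toLp_const_smul _ _)
          filter_upwards [Lp.coeFn_smul c u] with z hz
          simp only [hz, Pi.smul_apply, smul_comm c] }
      hf.bound.choose fun u => by
        refine Lp.norm_le_mul_norm_of_ae_le_mul ?_
        filter_upwards [MemLp.coeFn_toLp (hf.memLp (Lp.memLp u))] with z hz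
        simp only [LinearMap.coe_mk, AddHom.coe_mk, hz, norm_smul]
        gcongr
        exact hf.bound.choose_spec.2 _
  else 0

theorem mulX_coe {f : ℝ → ℂ} (hf : BddMeas f) (u : L2Plane q) :
    mulX f u =ᵐ[volume] fun z => f z.1 • u z := by
  rw [mulX, dif_pos hf]
  exact MemLp.coeFn_toLp (hf.memLp (Lp.memLp u))

theorem eq_mulX {f : ℝ → ℂ} (hf : BddMeas f) {u v : L2Plane q}
    (h : ∀ᵐ z : ℝ × ℝ, v z = f z.1 • u z) : v = mulX f u := by
  refine Lp.ext ?_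
  filter_upwards [h, mulX_coe hf u] with z h1 h2
  rw [h1, h2]

theorem mulX_mul {f g : ℝ → ℂ} (hf : BddMeas f) (hg : BddMeas g) (u : L2Plane q) :
    mulX (fun x => f x * g x) u = mulX f (mulX g u) := by
  refine (eq_mulX (hf.mul hg) ?_).symm
  filter_upwards [mulX_coe hf (mulX g u), mulX_coe hg u] with z h1 h2
  rw [h1, h2, mul_smul]

theorem mulX_sub {f g : ℝ → ℂ} (hf : BddMeas f) (hg : BddMeas g) (u : L2Plane q) :
    mulX (fun x => f x - g x) u = mulX f u - mulX g u := by
  refine (eq_mulX (hf.sub hg) ?_).symm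
  filter_upwards [Lp.coeFn_sub (mulX f u) (mulX g u), mulX_coe hf u, mulX_coe hg u] with z h h1 h2
  rw [h, Pi.sub_apply, h1, h2, sub_smul]

theorem mulX_const (c : ℂ) (u : L2Plane q) : mulX (fun _ => c) u = c • u :=
  (eq_mulX (BddMeas.const c) (by filter_upwards [Lp.coeFn_smul c u] with z h using h)).symm

theorem mulX_zero (u : L2Plane q) : mulX (fun _ => 0) u = 0 := by
  rw [mulX_const, zero_smul]

theorem mulX_const_mul {f : ℝ → ℂ} (hf : BddMeas f) (c : ℂ) (u : L2Plane q) :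
    mulX (fun x => c * f x) u = c • mulX f u := by
  rw [mulX_mul (BddMeas.const c) hf, mulX_const]

theorem norm_mulX_le {f : ℝ → ℂ} (hf : Measurable f) {C : ℝ} (hC : ∀ x, ‖f x‖ ≤ C)
    (u : L2Plane q) : ‖mulX f u‖ ≤ C * ‖u‖ := by
  refine Lp.norm_le_mul_norm_of_ae_le_mul ?_
  filter_upwards [mulX_coe ⟨hf, C, hC⟩ u] with z hz
  rw [hz, norm_smul]
  gcongr
  exact hC _

theorem opNorm_mulX_le {f : ℝ → ℂ} (hf : Measurable f) {C : ℝ} (hC : ∀ x, ‖f x‖ ≤ C) :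
    ‖(mulX f : L2Plane q →L[ℂ] L2Plane q)‖ ≤ C :=
  ContinuousLinearMap.opNorm_le_bound _ ((norm_nonneg _).trans (hC 0)) (norm_mulX_le hf hC)

theorem inner_mulX_left {f : ℝ → ℂ} (hf : BddMeas f) (u v : L2Plane q) :
    ⟪mulX f u, v⟫_ℂ = ⟪u, mulX (fun x => starRingEnd ℂ (f x)) v⟫_ℂ := by
  rw [L2.inner_def, L2.inner_def]
  refine integral_congr_ae ?_
  filter_upwards [mulX_coe hf u, mulX_coe hf.star v] with z h1 h2
  simp only [h1, h2, inner_smul_left, inner_smul_right]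

theorem inner_mulX_right {f : ℝ → ℂ} (hf : BddMeas f) (u v : L2Plane q) :
    ⟪u, mulX f v⟫_ℂ = ⟪mulX (fun x => starRingEnd ℂ (f x)) u, v⟫_ℂ := by
  rw [inner_mulX_left hf.star]; simp

theorem mulX_adjoint {f : ℝ → ℂ} (hf : BddMeas f) :
    ContinuousLinearMap.adjoint (mulX f : L2Plane q →L[ℂ] L2Plane q) =
      mulX (fun x => starRingEnd ℂ (f x)) := by
  refine (ContinuousLinearMap.eq_adjoint_iff _ _).2 (fun u v => ?_) |>.symm
  rw [inner_mulX_left hf.star]; simp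

theorem mulX_injective {f : ℝ → ℂ} (hf : BddMeas f) (h0 : ∀ x, f x ≠ 0) :
    Function.Injective (mulX f : L2Plane q → L2Plane q) := by
  refine (injective_iff_map_eq_zero (mulX f : L2Plane q →L[ℂ] L2Plane q)).2 fun u hu => ?_
  refine (Lp.eq_zero_iff_ae_eq_zero).2 ?_
  have := mulX_coe hf u
  rw [hu] at this
  filter_upwards [this, Lp.coeFn_zero (Fibre q) 2 (volume : Measure (ℝ × ℝ))] with z h1 h2
  rw [h2] at h1
  simpa [h0] using h1.symm

/-! ### Smooth functions with bounded derivatives -/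

/-- Smooth functions of `x` all of whose derivatives are bounded. -/
structure SmoothBdd (θ : ℝ → ℂ) : Prop where
  contDiff : ContDiff ℝ ∞ θ
  bdd : ∀ k, ∃ C : ℝ, ∀ x, ‖iteratedDeriv k θ x‖ ≤ C

theorem contDiff_iteratedDeriv {θ : ℝ → ℂ} (h : ContDiff ℝ ∞ θ) (k : ℕ) :
    ContDiff ℝ ∞ (iteratedDeriv k θ) := by
  rw [iteratedDeriv_eq_iterate]
  induction k with
  | zero => simpa using h
  | succ k ih =>
    rw [Function.iterate_succ_apply']
    exact (contDiff_infty_iff_deriv.1 ih).2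

theorem iteratedDeriv_mul_apply {f g : ℝ → ℂ} (hf : ContDiff ℝ ∞ f) (hg : ContDiff ℝ ∞ g) (n : ℕ)
    (x : ℝ) : iteratedDeriv n (fun x => f x * g x) x =
      ∑ i ∈ Finset.range (n + 1), (n.choose i : ℂ) * iteratedDeriv i f x *
        iteratedDeriv (n - i) g x :=
  iteratedDeriv_mul ((hf.of_le (by exact_mod_cast le_top)).contDiffAt)
    ((hg.of_le (by exact_mod_cast le_top)).contDiffAt)

namespace SmoothBdd

variable {θ η : ℝ → ℂ}

theorem bddMeas_iteratedDeriv (h : SmoothBdd θ) (k : ℕ) : BddMeas (iteratedDeriv k θ) :=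
  ⟨(contDiff_iteratedDeriv h.contDiff k).continuous.measurable, h.bdd k⟩

theorem bddMeas (h : SmoothBdd θ) : BddMeas θ := by
  simpa using h.bddMeas_iteratedDeriv 0

theorem of_hasCompactSupport (h : ContDiff ℝ ∞ θ) (hc : HasCompactSupport θ) : SmoothBdd θ := by
  refine ⟨h, fun k => ?_⟩
  have hk : HasCompactSupport (iteratedDeriv k θ) := by
    rw [iteratedDeriv_eq_iterate]
    induction k with
    | zero => simpa using hc
    | succ k ih => rw [Function.iterate_succ_apply']; exact ih.deriv
  exact hk.exists_bound_of_continuous (contDiff_iteratedDeriv h k).continuous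

end SmoothBdd

theorem iteratedDeriv_cexp_mul (c : ℂ) (k : ℕ) :
    iteratedDeriv k (fun x : ℝ => Complex.exp (c * x)) = fun x : ℝ => c ^ k * Complex.exp (c * x) := by
  induction k with
  | zero => simp
  | succ k ih =>
    rw [iteratedDeriv_succ, ih]
    funext x
    have h : HasDerivAt (fun x : ℝ => Complex.exp (c * x)) (Complex.exp (c * x) * (c * 1)) x :=
      ((Complex.ofRealCLM.hasDerivAt (x := x)).const_mul c).cexp
    rw [(h.const_mul (c ^ k)).deriv]
    ring

theorem smoothBdd_cexp (t : ℝ) : SmoothBdd (fun x : ℝ => Complex.exp (Complex.I * t * x)) := by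
  refine ⟨?_, fun k => ⟨|t| ^ k, fun x => ?_⟩⟩
  · exact Complex.contDiff_exp.comp (contDiff_const.mul Complex.ofRealCLM.contDiff)
  · rw [iteratedDeriv_cexp_mul]
    simp [Complex.norm_exp]

/-! ### The weights `(1 + iεx)^a` -/

/-- The weight `(1 + iεx)^a`, of modulus `⟨εx⟩^a`. -/
def wp (ε : ℝ) (a : ℤ) (x : ℝ) : ℂ := (1 + Complex.I * ε * x) ^ a

theorem wp_base_ne_zero (ε x : ℝ) : (1 + Complex.I * ε * x : ℂ) ≠ 0 := by
  intro h
  have := congrArg Complex.re h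
  simp at this

theorem wp_ne_zero (ε : ℝ) (a : ℤ) (x : ℝ) : wp ε a x ≠ 0 := zpow_ne_zero _ (wp_base_ne_zero ε x)

theorem wp_mul (ε : ℝ) (a b : ℤ) (x : ℝ) : wp ε a x * wp ε b x = wp ε (a + b) x :=
  (zpow_add₀ (wp_base_ne_zero ε x) a b).symm

theorem wp_zero (ε x : ℝ) : wp ε 0 x = 1 := zpow_zero _

theorem wp_one (ε x : ℝ) : wp ε 1 x = 1 + Complex.I * ε * x := zpow_one _

theorem conj_wp (ε : ℝ) (a : ℤ) (x : ℝ) : starRingEnd ℂ (wp ε a x) = wp (-ε) a x := by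
  simp [wp, map_zpow₀]

theorem norm_wp_one (ε x : ℝ) : ‖wp ε 1 x‖ = Real.sqrt (1 + (ε * x) ^ 2) := by
  rw [wp_one, Complex.norm_eq_sqrt_sq_add_sq]
  simp

theorem norm_wp (ε : ℝ) (a : ℤ) (x : ℝ) : ‖wp ε a x‖ = ‖wp ε 1 x‖ ^ a := by
  simp [wp, norm_zpow]

theorem one_le_norm_wp_one (ε x : ℝ) : 1 ≤ ‖wp ε 1 x‖ := by
  rw [norm_wp_one]
  exact Real.one_le_sqrt.2 (by nlinarith [sq_nonneg (ε * x)])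

theorem norm_wp_le_one (ε : ℝ) {a : ℤ} (ha : a ≤ 0) (x : ℝ) : ‖wp ε a x‖ ≤ 1 := by
  rw [norm_wp]
  exact zpow_le_one_of_nonpos₀ (one_le_norm_wp_one ε x) ha

theorem hasDerivAt_wp (ε : ℝ) (a : ℤ) (x : ℝ) :
    HasDerivAt (wp ε a) (a * (Complex.I * ε) * wp ε (a - 1) x) x := by
  have h1 : HasDerivAt (fun x : ℝ => (1 + Complex.I * ε * x : ℂ)) (Complex.I * ε) x := by
    simpa using ((Complex.ofRealCLM.hasDerivAt (x := x)).const_mul (Complex.I * ε : ℂ)).const_add 1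
  have h2 := (hasDerivAt_zpow a (1 + Complex.I * ε * x : ℂ) (Or.inl (wp_base_ne_zero ε x)))
  have := h2.comp x h1
  refine this.congr_deriv ?_
  simp only [wp]; ring

theorem iteratedDeriv_wp (ε : ℝ) (a : ℤ) (k : ℕ) :
    iteratedDeriv k (wp ε a) = fun x =>
      (∏ i ∈ Finset.range k, ((a : ℂ) - i)) * (Complex.I * ε) ^ k * wp ε (a - k) x := by
  induction k with
  | zero => simp
  | succ k ih =>
    rw [iteratedDeriv_succ, ih]
    funext x
    rw [((hasDerivAt_wp ε (a - k) x).const_mul _).deriv, Finset.prod_range_succ]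
    push_cast
    rw [show a - ((k : ℤ) + 1) = a - k - 1 by ring]
    ring

theorem contDiff_wp (ε : ℝ) (a : ℤ) : ContDiff ℝ ∞ (wp ε a) := by
  refine contDiff_of_differentiable_iteratedDeriv fun m _ => ?_
  rw [iteratedDeriv_wp]
  exact fun x => ((hasDerivAt_wp ε _ x).const_mul _).differentiableAt

theorem smoothBdd_wp (ε : ℝ) {a : ℤ} (ha : a ≤ 0) : SmoothBdd (wp ε a) := by
  refine ⟨contDiff_wp ε a, fun k => ⟨‖(∏ i ∈ Finset.range k, ((a : ℂ) - i)) *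
    (Complex.I * ε) ^ k‖, fun x => ?_⟩⟩
  rw [iteratedDeriv_wp, norm_mul]
  exact mul_le_of_le_one_right (norm_nonneg _) (norm_wp_le_one ε (by omega) x)

/-- The logarithmic derivatives of the weights are of order `ε`. -/
theorem exists_norm_iteratedDeriv_wp_le (a : ℤ) (k : ℕ) (hk : 1 ≤ k) :
    ∃ C : ℝ, 0 ≤ C ∧ ∀ ε : ℝ, |ε| ≤ 1 → ∀ x,
      ‖iteratedDeriv k (wp ε a) x * wp ε (-a) x‖ ≤ C * |ε| := by
  refine ⟨‖∏ i ∈ Finset.range k, ((a : ℂ) - i)‖, norm_nonneg _, fun ε hε x => ?_⟩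
  rw [iteratedDeriv_wp]
  simp only
  rw [mul_assoc, wp_mul, norm_mul, norm_mul, mul_assoc]
  gcongr
  have h1 : ‖(Complex.I * ε) ^ k‖ ≤ |ε| := by
    rw [norm_pow, norm_mul, Complex.norm_I, one_mul, Complex.norm_real, Real.norm_eq_abs]
    exact pow_le_of_le_one (abs_nonneg _) hε (by omega)
  calc _ ≤ |ε| * 1 := mul_le_mul h1 (norm_wp_le_one ε (by omega) x) (norm_nonneg _) (abs_nonneg _)
    _ = |ε| := mul_one _

theorem norm_wp_le_of_abs_le {ε ε' : ℝ} (h : |ε| ≤ |ε'|) (x : ℝ) : ‖wp ε 1 x‖ ≤ ‖wp ε' 1 x‖ := by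
  rw [norm_wp_one, norm_wp_one, mul_pow, mul_pow]
  have := sq_le_sq.2 h
  gcongr

theorem norm_wp_div_le (ε : ℝ) {n : ℝ} (hn : 1 ≤ n) (x : ℝ) :
    ‖wp ε 1 x‖ ≤ n * ‖wp (ε / n) 1 x‖ := by
  rw [norm_wp_one, norm_wp_one]
  rw [← Real.sqrt_sq (by linarith : 0 ≤ n), ← Real.sqrt_mul (sq_nonneg _)]
  refine Real.sqrt_le_sqrt ?_
  have hn0 : n ≠ 0 := by linarith
  rw [Real.sqrt_sq (by linarith)]
  have : n ^ 2 * (1 + (ε / n * x) ^ 2) = n ^ 2 + (ε * x) ^ 2 := by field_simp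
  rw [this]
  nlinarith

variable {q : ℕ}

/-! ### Weak derivatives -/

theorem integrable_test_smul {θ : ℝ × ℝ → ℂ} (hθ : Continuous θ) (hc : HasCompactSupport θ)
    {v : ℝ × ℝ → Fibre q} (hv : LocallyIntegrable v volume) :
    Integrable (fun z => θ z • v z) volume := by
  have h1 : IntegrableOn (fun z => θ z • v z) (tsupport θ) volume :=
    IntegrableOn.continuousOn_smul (hv.integrableOn_isCompact hc) hθ.continuousOn hc
  rw [integrableOn_iff_integrable_of_support_subset] at h1
  · exact h1
  · intro z hz
    refine subset_tsupport θ ?_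
    intro h0
    exact hz (by simp [h0])

theorem ae_eq_of_forall_test {u v : ℝ × ℝ → Fibre q} (hu : LocallyIntegrable u volume)
    (hv : LocallyIntegrable v volume)
    (h : ∀ θ : ℝ × ℝ → ℂ, ContDiff ℝ ∞ θ → HasCompactSupport θ →
      ∫ z, θ z • u z = ∫ z, θ z • v z) : u =ᵐ[volume] v := by
  refine ae_eq_of_integral_contDiff_smul_eq hu hv fun g hg hgc => ?_
  have := h (fun z => (g z : ℂ)) (Complex.ofRealCLM.contDiff.comp hg)
    (hgc.comp_left (g := fun x : ℝ => (x : ℂ)) (by simp))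
  simpa only [Complex.coe_smul] using this

/-- The derivative in a fixed direction. -/
def dirDeriv (e : ℝ × ℝ) (θ : ℝ × ℝ → ℂ) (z : ℝ × ℝ) : ℂ := fderiv ℝ θ z e

theorem contDiff_dirDeriv {θ : ℝ × ℝ → ℂ} (h : ContDiff ℝ ∞ θ) (e : ℝ × ℝ) :
    ContDiff ℝ ∞ (dirDeriv e θ) :=
  (h.fderiv_right (m := ∞) (by simp)).clm_apply contDiff_const

theorem hasCompactSupport_dirDeriv {θ : ℝ × ℝ → ℂ} (h : HasCompactSupport θ) (e : ℝ × ℝ) :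
    HasCompactSupport (dirDeriv e θ) := h.fderiv_apply ℝ e

theorem contDiff_iterate_dirDeriv {θ : ℝ × ℝ → ℂ} (h : ContDiff ℝ ∞ θ) (e : ℝ × ℝ) (n : ℕ) :
    ContDiff ℝ ∞ ((dirDeriv e)^[n] θ) := by
  induction n with
  | zero => exact h
  | succ n ih => rw [Function.iterate_succ_apply']; exact contDiff_dirDeriv ih e

theorem dirDeriv_comm {θ : ℝ × ℝ → ℂ} (h : ContDiff ℝ ∞ θ) (e f : ℝ × ℝ) :
    dirDeriv e (dirDeriv f θ) = dirDeriv f (dirDeriv e θ) := by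
  funext z
  have hd : Differentiable ℝ (fderiv ℝ θ) :=
    (h.fderiv_right (m := ∞) (by simp)).differentiable (by simp)
  have key : ∀ e f : ℝ × ℝ, dirDeriv e (dirDeriv f θ) z = fderiv ℝ (fderiv ℝ θ) z e f := by
    intro e f
    have : HasFDerivAt (dirDeriv f θ)
        ((ContinuousLinearMap.apply ℝ ℂ f).comp (fderiv ℝ (fderiv ℝ θ) z)) z :=
      (ContinuousLinearMap.apply ℝ ℂ f).hasFDerivAt.comp z (hd z).hasFDerivAt
    rw [dirDeriv, this.fderiv]; rfl
  rw [key, key]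
  exact (h.contDiffAt.isSymmSndFDerivAt (by
    rw [minSmoothness_of_isRCLikeNormedField]; exact WithTop.coe_le_coe.2 (le_top : (2 : ℕ∞) ≤ ⊤))) e f

theorem dirDeriv_iterate_comm {θ : ℝ × ℝ → ℂ} (h : ContDiff ℝ ∞ θ) (e f : ℝ × ℝ) (n : ℕ) :
    dirDeriv e ((dirDeriv f)^[n] θ) = (dirDeriv f)^[n] (dirDeriv e θ) := by
  induction n with
  | zero => rfl
  | succ n ih =>
    rw [Function.iterate_succ_apply', Function.iterate_succ_apply',
      dirDeriv_comm (contDiff_iterate_dirDeriv h f n), ih]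

theorem deriv_comp_mk_left {θ : ℝ × ℝ → ℂ} (h : ContDiff ℝ ∞ θ) (x y : ℝ) :
    deriv (fun x => θ (x, y)) x = dirDeriv (1, 0) θ (x, y) := by
  have h1 := (h.differentiable (by simp) (x, y)).hasFDerivAt
  have h2 : HasDerivAt (fun x : ℝ => (x, y)) ((1 : ℝ), (0 : ℝ)) x :=
    (hasDerivAt_id x).prodMk (hasDerivAt_const x y)
  exact (h1.comp_hasDerivAt x h2).deriv

theorem deriv_comp_mk_right {θ : ℝ × ℝ → ℂ} (h : ContDiff ℝ ∞ θ) (x y : ℝ) :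
    deriv (fun y => θ (x, y)) y = dirDeriv (0, 1) θ (x, y) := by
  have h1 := (h.differentiable (by simp) (x, y)).hasFDerivAt
  have h2 : HasDerivAt (fun y : ℝ => (x, y)) ((0 : ℝ), (1 : ℝ)) y :=
    (hasDerivAt_const y x).prodMk (hasDerivAt_id y)
  exact (h1.comp_hasDerivAt y h2).deriv

theorem partialDeriv_eq {θ : ℝ × ℝ → ℂ} (h : ContDiff ℝ ∞ θ) (a b : ℕ) :
    partialDeriv a b θ = (dirDeriv (1, 0))^[a] ((dirDeriv (0, 1))^[b] θ) := by
  have hy : ∀ (x : ℝ) (b : ℕ), iteratedDeriv b (fun y => θ (x, y)) =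
      fun y => (dirDeriv (0, 1))^[b] θ (x, y) := by
    intro x b
    induction b with
    | zero => simp
    | succ b ih =>
      rw [iteratedDeriv_succ, ih]
      funext y
      rw [deriv_comp_mk_right (contDiff_iterate_dirDeriv h _ b), Function.iterate_succ_apply']
  have hx : ∀ (η : ℝ × ℝ → ℂ), ContDiff ℝ ∞ η → ∀ (y : ℝ) (a : ℕ),
      iteratedDeriv a (fun x => η (x, y)) = fun x => (dirDeriv (1, 0))^[a] η (x, y) := by
    intro η hη y a
    induction a with
    | zero => simp
    | succ a ih =>
      rw [iteratedDeriv_succ, ih]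
      funext x
      rw [deriv_comp_mk_left (contDiff_iterate_dirDeriv hη _ a), Function.iterate_succ_apply']
  funext z
  simp only [partialDeriv, hy]
  rw [hx _ (contDiff_iterate_dirDeriv h _ b)]

theorem partialDeriv_succ_left {θ : ℝ × ℝ → ℂ} (h : ContDiff ℝ ∞ θ) (a b : ℕ) :
    partialDeriv (a + 1) b θ = partialDeriv a b (dirDeriv (1, 0) θ) := by
  rw [partialDeriv_eq h, partialDeriv_eq (contDiff_dirDeriv h _), Function.iterate_succ_apply,
    dirDeriv_iterate_comm h]

theorem partialDeriv_succ_right {θ : ℝ × ℝ → ℂ} (h : ContDiff ℝ ∞ θ) (a b : ℕ) :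
    partialDeriv a (b + 1) θ = partialDeriv a b (dirDeriv (0, 1) θ) := by
  rw [partialDeriv_eq h, partialDeriv_eq (contDiff_dirDeriv h _), Function.iterate_succ_apply]

/-- `v'` is the weak derivative of `v` in the direction `e`. -/
def WeakDir (e : ℝ × ℝ) (v v' : ℝ × ℝ → Fibre q) : Prop :=
  ∀ θ : ℝ × ℝ → ℂ, ContDiff ℝ ∞ θ → HasCompactSupport θ →
    ∫ z, dirDeriv e θ z • v z = -∫ z, θ z • v' z

theorem partialDeriv_zero (θ : ℝ × ℝ → ℂ) : partialDeriv 0 0 θ = θ := by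
  funext z; simp [partialDeriv]

theorem hasWeakDeriv_zero {u : ℝ × ℝ → Fibre q} (hu : LocallyIntegrable u volume) :
    HasWeakDeriv 0 0 u u :=
  ⟨hu, hu, fun θ _ _ => by simp [partialDeriv_zero]⟩

theorem HasWeakDeriv.unique {a b : ℕ} {u v w : ℝ × ℝ → Fibre q} (hv : HasWeakDeriv a b u v)
    (hw : HasWeakDeriv a b u w) : v =ᵐ[volume] w := by
  refine ae_eq_of_forall_test hv.2.1 hw.2.1 fun θ hθ hc => ?_
  have h := (hv.2.2 θ hθ hc).symm.trans (hw.2.2 θ hθ hc)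
  exact smul_right_injective _ (pow_ne_zero _ (by norm_num : (-1 : ℂ) ≠ 0)) h

theorem HasWeakDeriv.congr {a b : ℕ} {u u' v v' : ℝ × ℝ → Fibre q} (h : HasWeakDeriv a b u v)
    (hu : u =ᵐ[volume] u') (hv : v =ᵐ[volume] v') : HasWeakDeriv a b u' v' := by
  refine ⟨h.1.congr hu, h.2.1.congr hv, fun θ hθ hc => ?_⟩
  have h1 : ∫ z, partialDeriv a b θ z • u' z = ∫ z, partialDeriv a b θ z • u z :=
    integral_congr_ae (hu.mono fun z hz => by simp only [hz])
  have h2 : ∫ z, θ z • v' z = ∫ z, θ z • v z :=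
    integral_congr_ae (hv.mono fun z hz => by simp only [hz])
  rw [h1, h2, h.2.2 θ hθ hc]

theorem neg_one_pow_smul_eq {n : ℕ} {x y : Fibre q} (h : (-1 : ℂ) ^ n • x = (-1 : ℂ) ^ (n + 1) • y) :
    x = -y := by
  rw [pow_succ, mul_smul] at h
  have := smul_right_injective _ (pow_ne_zero n (by norm_num : (-1 : ℂ) ≠ 0)) h
  simpa using this

theorem HasWeakDeriv.weakDir_left {a b : ℕ} {u v v' : ℝ × ℝ → Fibre q} (hv : HasWeakDeriv a b u v)
    (hv' : HasWeakDeriv (a + 1) b u v') : WeakDir (1, 0) v v' := by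
  intro θ hθ hc
  have h1 := hv.2.2 _ (contDiff_dirDeriv hθ (1, 0)) (hasCompactSupport_dirDeriv hc _)
  have h2 := hv'.2.2 θ hθ hc
  rw [partialDeriv_succ_left hθ, h1, show a + 1 + b = a + b + 1 by ring] at h2
  exact neg_one_pow_smul_eq h2

theorem HasWeakDeriv.weakDir_right {a b : ℕ} {u v v' : ℝ × ℝ → Fibre q}
    (hv : HasWeakDeriv a b u v) (hv' : HasWeakDeriv a (b + 1) u v') : WeakDir (0, 1) v v' := by
  intro θ hθ hc
  have h1 := hv.2.2 _ (contDiff_dirDeriv hθ (0, 1)) (hasCompactSupport_dirDeriv hc _)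
  have h2 := hv'.2.2 θ hθ hc
  rw [partialDeriv_succ_right hθ, h1, show a + (b + 1) = a + b + 1 by ring] at h2
  exact neg_one_pow_smul_eq h2

theorem HasWeakDeriv.succ_left {a b : ℕ} {u v v' : ℝ × ℝ → Fibre q} (hv : HasWeakDeriv a b u v)
    (h : WeakDir (1, 0) v v') (hl : LocallyIntegrable v' volume) :
    HasWeakDeriv (a + 1) b u v' := by
  refine ⟨hv.1, hl, fun θ hθ hc => ?_⟩
  rw [partialDeriv_succ_left hθ, hv.2.2 _ (contDiff_dirDeriv hθ _) (hasCompactSupport_dirDeriv hc _),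
    h θ hθ hc, show a + 1 + b = a + b + 1 by ring, pow_succ, mul_smul]
  simp

theorem HasWeakDeriv.succ_right {a b : ℕ} {u v v' : ℝ × ℝ → Fibre q} (hv : HasWeakDeriv a b u v)
    (h : WeakDir (0, 1) v v') (hl : LocallyIntegrable v' volume) :
    HasWeakDeriv a (b + 1) u v' := by
  refine ⟨hv.1, hl, fun θ hθ hc => ?_⟩
  rw [partialDeriv_succ_right hθ, hv.2.2 _ (contDiff_dirDeriv hθ _) (hasCompactSupport_dirDeriv hc _),
    h θ hθ hc, show a + (b + 1) = a + b + 1 by ring, pow_succ, mul_smul]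
  simp

theorem locallyIntegrable_smul {η : ℝ × ℝ → ℂ} (hη : Continuous η) {v : ℝ × ℝ → Fibre q}
    (hv : LocallyIntegrable v volume) : LocallyIntegrable (fun z => η z • v z) volume :=
  hv.continuous_smul hη

theorem WeakDir.smul {e : ℝ × ℝ} {v v' : ℝ × ℝ → Fibre q} (h : WeakDir e v v')
    (hv : LocallyIntegrable v volume) (hv' : LocallyIntegrable v' volume) {η : ℝ × ℝ → ℂ}
    (hη : ContDiff ℝ ∞ η) :
    WeakDir e (fun z => η z • v z) (fun z => dirDeriv e η z • v z + η z • v' z) := by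
  intro θ hθ hc
  have hc' : HasCompactSupport (fun z => θ z * η z) := hc.mul_right
  have h1 := h (fun z => θ z * η z) (hθ.mul hη) hc'
  have h2 : dirDeriv e (fun z => θ z * η z) =
      fun z => dirDeriv e θ z * η z + θ z * dirDeriv e η z := by
    funext z
    have ha := (hθ.differentiable (by simp) z).hasFDerivAt
    have hb := (hη.differentiable (by simp) z).hasFDerivAt
    rw [dirDeriv, show (fun z => θ z * η z) = θ * η from rfl, (ha.mul hb).fderiv]
    simp [dirDeriv]; ring
  rw [h2] at h1
  have i1 := integrable_test_smul (contDiff_dirDeriv hθ e).continuous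
    (hasCompactSupport_dirDeriv hc e) (locallyIntegrable_smul hη.continuous hv)
  have i2 := integrable_test_smul hθ.continuous hc
    (locallyIntegrable_smul (contDiff_dirDeriv hη e).continuous hv)
  have i3 := integrable_test_smul hθ.continuous hc (locallyIntegrable_smul hη.continuous hv')
  simp only [add_smul, mul_smul, smul_add] at h1 ⊢
  rw [integral_add i1 i2] at h1
  rw [integral_add i2 i3, neg_add, ← h1]
  abel

theorem WeakDir.sum {ι : Type*} {e : ℝ × ℝ} (s : Finset ι) {v v' : ι → ℝ × ℝ → Fibre q}
    (h : ∀ i ∈ s, WeakDir e (v i) (v' i)) (hv : ∀ i ∈ s, LocallyIntegrable (v i) volume)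
    (hv' : ∀ i ∈ s, LocallyIntegrable (v' i) volume) :
    WeakDir e (fun z => ∑ i ∈ s, v i z) (fun z => ∑ i ∈ s, v' i z) := by
  intro θ hθ hc
  simp only [Finset.smul_sum]
  rw [integral_finsetSum _ fun i hi => integrable_test_smul (contDiff_dirDeriv hθ e).continuous
      (hasCompactSupport_dirDeriv hc e) (hv i hi),
    integral_finsetSum _ fun i hi => integrable_test_smul hθ.continuous hc (hv' i hi),
    ← Finset.sum_neg_distrib]
  exact Finset.sum_congr rfl fun i hi => h i hi θ hθ hc

theorem locallyIntegrable_sum {ι : Type*} (s : Finset ι) {v : ι → ℝ × ℝ → Fibre q}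
    (hv : ∀ i ∈ s, LocallyIntegrable (v i) volume) :
    LocallyIntegrable (fun z => ∑ i ∈ s, v i z) volume :=
  locallyIntegrable_finsetSum s hv

/-- The Leibniz sum for the derivative `∂_x^a ∂_y^b` of `θ(x) u`. -/
def leibniz (θ : ℝ → ℂ) (v : ℕ → ℕ → ℝ × ℝ → Fibre q) (a b : ℕ) (z : ℝ × ℝ) : Fibre q :=
  ∑ ij ∈ Finset.HasAntidiagonal.antidiagonal a, (a.choose ij.1) • (iteratedDeriv ij.1 θ z.1 • v ij.2 b z)

theorem contDiff_comp_fst {θ : ℝ → ℂ} (h : ContDiff ℝ ∞ θ) :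
    ContDiff ℝ ∞ (fun z : ℝ × ℝ => θ z.1) := h.comp contDiff_fst

theorem dirDeriv_comp_fst {θ : ℝ → ℂ} (h : ContDiff ℝ ∞ θ) (e : ℝ × ℝ) (z : ℝ × ℝ) :
    dirDeriv e (fun z => θ z.1) z = e.1 * deriv θ z.1 := by
  have h1 : HasFDerivAt θ (fderiv ℝ θ z.1) z.1 := (h.differentiable (by simp) z.1).hasFDerivAt
  have h2 := h1.comp z (hasFDerivAt_fst (𝕜 := ℝ) (E := ℝ) (F := ℝ))
  have : dirDeriv e (fun z => θ z.1) z = fderiv ℝ θ z.1 e.1 := by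
    rw [dirDeriv]; erw [h2.fderiv]; rfl
  rw [this, fderiv_eq_smul_deriv, Complex.real_smul]

theorem locallyIntegrable_leibniz {θ : ℝ → ℂ} (hθ : ContDiff ℝ ∞ θ) {v : ℕ → ℕ → ℝ × ℝ → Fibre q}
    {a b : ℕ} (hv : ∀ j ≤ a, LocallyIntegrable (v j b) volume) :
    LocallyIntegrable (leibniz θ v a b) volume := by
  refine locallyIntegrable_sum _ fun ij hij => ?_
  have : ij.2 ≤ a := by
    have := Finset.HasAntidiagonal.mem_antidiagonal.1 hij; omega
  simp only [← Nat.cast_smul_eq_nsmul ℂ]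
  exact locallyIntegrable_smul continuous_const
    (locallyIntegrable_smul ((contDiff_iteratedDeriv hθ ij.1).continuous.comp continuous_fst)
      (hv _ this))

theorem hasWeakDeriv_leibniz {p : ℕ} {θ : ℝ → ℂ} (hθ : ContDiff ℝ ∞ θ) {u : ℝ × ℝ → Fibre q}
    {v : ℕ → ℕ → ℝ × ℝ → Fibre q} (hv : ∀ a b, a + b ≤ p → HasWeakDeriv a b u (v a b)) (a b : ℕ)
    (hab : a + b ≤ p) : HasWeakDeriv a b (fun z => θ z.1 • u z) (leibniz θ v a b) := by
  induction a with
  | zero =>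
    have key : ∀ b ≤ p, HasWeakDeriv 0 b (fun z => θ z.1 • u z) (fun z => θ z.1 • v 0 b z) := by
      intro b
      induction b with
      | zero =>
        intro _
        have h0 := hv 0 0 (by omega)
        have := h0.unique (hasWeakDeriv_zero h0.1)
        refine (hasWeakDeriv_zero (locallyIntegrable_smul (hθ.continuous.comp continuous_fst)
          h0.1)).congr EventuallyEq.rfl ?_
        filter_upwards [this] with z hz
        rw [hz]
        rfl
      | succ b ih =>
        intro hb
        have h0 := hv 0 b (by omega)
        have h1 := hv 0 (b + 1) (by omega)
        refine (ih (by omega)).succ_right ?_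
          (locallyIntegrable_smul (hθ.continuous.comp continuous_fst) h1.2.1)
        have := (h0.weakDir_right h1).smul h0.2.1 h1.2.1 (contDiff_comp_fst hθ)
        simpa [dirDeriv_comp_fst hθ] using this
    refine (key b (by omega)).congr EventuallyEq.rfl ?_
    exact ae_of_all _ fun z => by simp [leibniz]
  | succ a ih =>
    have hl : ∀ j ≤ a + 1, LocallyIntegrable (v j b) volume := fun j hj =>
      (hv j b (by omega)).2.1
    refine (ih (by omega)).succ_left ?_ (locallyIntegrable_leibniz hθ hl)
    have h1 : WeakDir (1, 0) (leibniz θ v a b) fun z => ∑ ij ∈ Finset.HasAntidiagonal.antidiagonal a,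
        ((a.choose ij.1 : ℂ) • (iteratedDeriv (ij.1 + 1) θ z.1 • v ij.2 b z +
          iteratedDeriv ij.1 θ z.1 • v (ij.2 + 1) b z)) := by
      unfold leibniz
      simp only [← Nat.cast_smul_eq_nsmul ℂ]
      have hc : ∀ k, Continuous fun z : ℝ × ℝ => iteratedDeriv k θ z.1 := fun k =>
        (contDiff_iteratedDeriv hθ k).continuous.comp continuous_fst
      have hle : ∀ ij ∈ Finset.HasAntidiagonal.antidiagonal a, ij.2 ≤ a := fun ij hij => by
        have := Finset.HasAntidiagonal.mem_antidiagonal.1 hij; omega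
      refine WeakDir.sum _ (fun ij hij => ?_) (fun ij hij => ?_) (fun ij hij => ?_)
      · have hm := hle ij hij
        have h0 := hv ij.2 b (by omega)
        have h1 := hv (ij.2 + 1) b (by omega)
        have h2 := ((h0.weakDir_left h1).smul h0.2.1 h1.2.1
          (contDiff_comp_fst (contDiff_iteratedDeriv hθ ij.1)))
        have h3 := h2.smul (η := fun _ => (a.choose ij.1 : ℂ))
          (locallyIntegrable_smul (hc _) h0.2.1)
          ((locallyIntegrable_smul
            (contDiff_dirDeriv (contDiff_comp_fst (contDiff_iteratedDeriv hθ _)) _).continuous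
            h0.2.1).add (locallyIntegrable_smul (hc _) h1.2.1)) contDiff_const
        simp only [dirDeriv_comp_fst (contDiff_iteratedDeriv hθ ij.1), ← iteratedDeriv_succ] at h3
        simpa [dirDeriv] using h3
      · exact locallyIntegrable_smul continuous_const
          (locallyIntegrable_smul (hc _) (hl _ ((hle ij hij).trans (by omega))))
      · exact locallyIntegrable_smul continuous_const
          ((locallyIntegrable_smul (hc _) (hl _ ((hle ij hij).trans (by omega)))).add
            (locallyIntegrable_smul (hc _) (hl _ (by have := hle ij hij; omega))))
    convert h1 using 1
    funext z
    rw [leibniz, Finset.sum_antidiagonal_choose_succ_nsmul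
      (fun i j => iteratedDeriv i θ z.1 • v j b z)]
    simp only [smul_add, Finset.sum_add_distrib]
    rw [add_comm]
    congr 1
    · refine Finset.sum_congr rfl fun ij hij => ?_
      rw [Nat.cast_smul_eq_nsmul, ← Nat.choose_symm_of_eq_add
        (Finset.HasAntidiagonal.mem_antidiagonal.1 hij).symm]
    · exact Finset.sum_congr rfl fun ij _ => by rw [Nat.cast_smul_eq_nsmul]

variable {q : ℕ}

/-! ### Interpolation of weak derivatives along a line -/

theorem memLp_two_iff {α E : Type*} [MeasurableSpace α] {μ : Measure α} [NormedAddCommGroup E]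
    {f : α → E} : MemLp f 2 μ ↔ AEStronglyMeasurable f μ ∧ ∫⁻ x, ‖f x‖ₑ ^ 2 ∂μ < ⊤ := by
  rw [MemLp, eLpNorm_lt_top_iff_lintegral_rpow_enorm_lt_top (by norm_num) (by norm_num)]
  norm_num

theorem one_le_bracket (x : ℝ) : 1 ≤ bracket x :=
  Real.one_le_sqrt.2 (by nlinarith [sq_nonneg x])

theorem bracket_pos (x : ℝ) : 0 < bracket x := lt_of_lt_of_le one_pos (one_le_bracket x)

theorem continuous_bracket : Continuous bracket := by unfold bracket; fun_prop

theorem continuous_bracket_rpow (s : ℝ) : Continuous fun x => bracket x ^ s :=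
  continuous_bracket.rpow_const fun x => Or.inl (bracket_pos x).ne'

theorem bracket_le_two_mul {x y : ℝ} (h : |x - y| ≤ 1) : bracket x ≤ 2 * bracket y := by
  unfold bracket
  rw [show (2 : ℝ) = Real.sqrt (2 ^ 2) from (Real.sqrt_sq (by norm_num)).symm,
    ← Real.sqrt_mul (by norm_num)]
  refine Real.sqrt_le_sqrt ?_
  have := abs_le.1 h
  have h2 : (x - y) ^ 2 ≤ 1 := by nlinarith
  nlinarith [sq_nonneg (x - 2 * y)]

theorem bracket_rpow_le (s : ℝ) {x y : ℝ} (h : |x - y| ≤ 1) :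
    bracket x ^ s ≤ 2 ^ |s| * bracket y ^ s := by
  rcases le_total 0 s with hs | hs
  · rw [abs_of_nonneg hs, ← Real.mul_rpow (by norm_num) (bracket_pos y).le]
    exact Real.rpow_le_rpow (bracket_pos x).le (bracket_le_two_mul h) hs
  · rw [abs_of_nonpos hs]
    have h1 : bracket y ≤ 2 * bracket x := bracket_le_two_mul (by rwa [abs_sub_comm])
    have h2 := Real.rpow_le_rpow_of_nonpos (bracket_pos y) h1 hs
    rw [Real.mul_rpow (by norm_num) (bracket_pos x).le] at h2
    calc bracket x ^ s = 2 ^ (-s) * (2 ^ s * bracket x ^ s) := by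
          rw [← mul_assoc, ← Real.rpow_add (by norm_num)]; simp
      _ ≤ _ := by gcongr

/-- The weighted average of `v` over a segment of direction `e`. -/
def avg (ν : ℝ → ℝ) (e : ℝ × ℝ) (v : ℝ × ℝ → Fibre q) (z : ℝ × ℝ) : Fibre q :=
  ∫ t in Icc (0 : ℝ) 1, ν t • v (z + t • e)

/-- The difference of `v` along `e`. -/
def diff (e : ℝ × ℝ) (v : ℝ × ℝ → Fibre q) (z : ℝ × ℝ) : Fibre q := v (z + e) - v z

theorem measurePreserving_shear (e : ℝ × ℝ) :
    MeasurePreserving (fun p : ℝ × (ℝ × ℝ) => (p.1, p.2 + p.1 • e))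
      ((volume.restrict (Icc (0 : ℝ) 1)).prod volume)
      ((volume.restrict (Icc (0 : ℝ) 1)).prod volume) := by
  refine MeasurePreserving.skew_product (f := id) (g := fun t z => z + t • e)
    (MeasurePreserving.id _) ?_ (ae_of_all _ fun t => ?_)
  · exact (by fun_prop : Continuous fun p : ℝ × (ℝ × ℝ) => p.2 + p.1 • e).measurable
  · exact (measurePreserving_add_right volume (t • e)).map_eq

theorem measurableEmbedding_shear (e : ℝ × ℝ) :
    MeasurableEmbedding (fun p : ℝ × (ℝ × ℝ) => (p.1, p.2 + p.1 • e)) := by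
  refine Continuous.measurableEmbedding (by fun_prop) ?_
  rintro ⟨t, z⟩ ⟨t', z'⟩ h
  simp only [Prod.mk.injEq] at h
  obtain ⟨rfl, h⟩ := h
  simpa using h

theorem aestronglyMeasurable_shear {e : ℝ × ℝ} {v : ℝ × ℝ → Fibre q}
    (hv : AEStronglyMeasurable v volume) :
    AEStronglyMeasurable (fun p : ℝ × (ℝ × ℝ) => v (p.2 + p.1 • e))
      ((volume.restrict (Icc (0 : ℝ) 1)).prod volume) := by
  have h1 : AEStronglyMeasurable (fun p : ℝ × (ℝ × ℝ) => v p.2)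
      ((volume.restrict (Icc (0 : ℝ) 1)).prod volume) := hv.comp_snd
  exact h1.comp_measurePreserving (measurePreserving_shear e)

theorem memL2s_avg {s : ℝ} {ν : ℝ → ℝ} (hν : Continuous ν) {e : ℝ × ℝ} (he : |e.1| ≤ 1)
    {v : ℝ × ℝ → Fibre q} (hv : MemL2s s v) : MemL2s s (avg ν e v) := by
  obtain ⟨C, hC⟩ := (isCompact_Icc (a := (0 : ℝ)) (b := 1)).exists_bound_of_continuousOn
    hν.continuousOn
  have hC0 : 0 ≤ C := (norm_nonneg _).trans (hC 0 (by simp))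
  obtain ⟨hm, hfin⟩ := memLp_two_iff.1 hv
  have hbm : ∀ s : ℝ, Measurable fun z : ℝ × ℝ => bracket z.1 ^ s := fun s =>
    ((continuous_bracket_rpow s).comp continuous_fst).measurable
  have hvm : AEStronglyMeasurable v volume := by
    have := ((hbm (-s)).aestronglyMeasurable (μ := volume)).smul hm
    refine this.congr (ae_of_all _ fun z => ?_)
    simp only [Pi.smul_apply', smul_smul]
    rw [← Real.rpow_add (bracket_pos _)]; simp
  have hFm : AEStronglyMeasurable (fun p : ℝ × (ℝ × ℝ) => ν p.1 • v (p.2 + p.1 • e))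
      ((volume.restrict (Icc (0 : ℝ) 1)).prod volume) :=
    (hν.measurable.comp measurable_fst).aestronglyMeasurable.smul (aestronglyMeasurable_shear hvm)
  have hGm : AEStronglyMeasurable (avg ν e v) volume :=
    hFm.prod_swap.integral_prod_right'
  have hprob : IsProbabilityMeasure (volume.restrict (Icc (0 : ℝ) 1)) := ⟨by simp⟩
  refine memLp_two_iff.2 ⟨(hbm s).aestronglyMeasurable.smul hGm, ?_⟩
  set K : ℝ≥0∞ := ENNReal.ofReal (C * 2 ^ |s|) with hK
  have hJ : ∀ z : ℝ × ℝ, ‖bracket z.1 ^ s • avg ν e v z‖ₑ ^ 2 ≤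
      ∫⁻ t in Icc (0 : ℝ) 1,
        K ^ 2 * ‖bracket (z + t • e).1 ^ s • v (z + t • e)‖ₑ ^ 2 := by
    intro z
    by_cases hz : AEStronglyMeasurable (fun t => ν t • v (z + t • e)) (volume.restrict (Icc (0 : ℝ) 1))
    swap
    · rw [avg, integral_undef (fun h => hz h.1)]; simp
    have h1 : ‖bracket z.1 ^ s • avg ν e v z‖ₑ ≤
        ∫⁻ t in Icc (0 : ℝ) 1, ‖bracket z.1 ^ s • ν t • v (z + t • e)‖ₑ := by
      rw [avg, ← integral_smul]
      exact enorm_integral_le_lintegral_enorm _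
    have h2 := eLpNorm_le_eLpNorm_of_exponent_le (p := 1) (q := 2) (by norm_num)
      (hz.const_smul (bracket z.1 ^ s))
    rw [eLpNorm_one_eq_lintegral_enorm, eLpNorm_eq_lintegral_rpow_enorm_toReal (by norm_num) (by norm_num)] at h2
    have h3 := h1.trans h2
    have h4 := pow_le_pow_left' h3 2
    refine h4.trans ?_
    rw [← ENNReal.rpow_natCast, ← ENNReal.rpow_mul]
    norm_num
    refine setLIntegral_mono' measurableSet_Icc fun t ht => ?_
    rw [← mul_pow]
    gcongr
    rw [enorm_smul, enorm_smul, enorm_smul, ← mul_assoc, ← mul_assoc]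
    refine mul_le_mul' ?_ le_rfl
    rw [← ofReal_norm, ← ofReal_norm, ← ofReal_norm, hK,
      ← ENNReal.ofReal_mul (norm_nonneg _), ← ENNReal.ofReal_mul (by positivity)]
    refine ENNReal.ofReal_le_ofReal ?_
    have hb := bracket_rpow_le s (x := z.1) (y := (z + t • e).1) (by
      simp only [Prod.fst_add, Prod.smul_fst, smul_eq_mul, sub_add_cancel_left, abs_neg, abs_mul]
      rw [abs_of_nonneg ht.1]
      exact mul_le_one₀ ht.2 (abs_nonneg _) he)
    rw [Real.norm_of_nonneg (Real.rpow_nonneg (bracket_pos _).le _),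
      Real.norm_of_nonneg (Real.rpow_nonneg (bracket_pos _).le _)]
    calc _ ≤ (2 ^ |s| * bracket (z + t • e).1 ^ s) * C :=
          mul_le_mul hb (hC t ht) (norm_nonneg _)
            (by have := bracket_pos (z + t • e).1; positivity)
      _ = _ := by simp only [Prod.fst_add, Prod.smul_fst, smul_eq_mul]; ring
  refine (lintegral_mono hJ).trans_lt ?_
  have hm2 : AEMeasurable (fun p : (ℝ × ℝ) × ℝ =>
      K ^ 2 * ‖bracket (p.1 + p.2 • e).1 ^ s • v (p.1 + p.2 • e)‖ₑ ^ 2)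
      (volume.prod (volume.restrict (Icc (0 : ℝ) 1))) := by
    have := (aestronglyMeasurable_shear (e := e) hm).prod_swap
    exact ((this.enorm).pow_const 2).const_mul _
  rw [lintegral_lintegral_swap hm2]
  have : ∀ t : ℝ, ∫⁻ z : ℝ × ℝ, K ^ 2 * ‖bracket (z + t • e).1 ^ s • v (z + t • e)‖ₑ ^ 2 =
      K ^ 2 * ∫⁻ z : ℝ × ℝ, ‖bracket z.1 ^ s • v z‖ₑ ^ 2 := by
    intro t
    rw [lintegral_const_mul' _ _ (by finiteness)]
    congr 1
    exact lintegral_add_right_eq_self (fun z : ℝ × ℝ => ‖bracket z.1 ^ s • v z‖ₑ ^ 2) (t • e)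
  refine (lintegral_congr this).le.trans_lt ?_
  rw [lintegral_const]
  exact ENNReal.mul_lt_top (ENNReal.mul_lt_top (by finiteness) hfin) (by simp)

theorem integrable_shear_test {ν : ℝ → ℝ} (hν : Continuous ν) {θ : ℝ × ℝ → ℂ} (hθ : Continuous θ)
    (hc : HasCompactSupport θ) (e : ℝ × ℝ) {v : ℝ × ℝ → Fibre q}
    (hv : LocallyIntegrable v volume) :
    Integrable (fun p : ℝ × (ℝ × ℝ) => ν p.1 • θ (p.2 - p.1 • e) • v p.2)
      ((volume.restrict (Icc (0 : ℝ) 1)).prod volume) := by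
  obtain ⟨C, hC⟩ := (isCompact_Icc (a := (0 : ℝ)) (b := 1)).exists_bound_of_continuousOn
    hν.continuousOn
  obtain ⟨B, hB⟩ := hc.exists_bound_of_continuous hθ
  have hC0 : 0 ≤ C := (norm_nonneg _).trans (hC 0 (by simp))
  have hB0 : 0 ≤ B := (norm_nonneg _).trans (hB 0)
  let K : Set (ℝ × ℝ) := (fun p : ℝ × (ℝ × ℝ) => p.2 + p.1 • e) '' (Icc (0 : ℝ) 1 ×ˢ tsupport θ)
  have hK : IsCompact K := (isCompact_Icc.prod hc).image (by fun_prop)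
  have hvK : Integrable (K.indicator v) volume :=
    (hv.integrableOn_isCompact hK).integrable_indicator hK.measurableSet
  have hdom : Integrable (fun p : ℝ × (ℝ × ℝ) => (C * B) * ‖K.indicator v p.2‖)
      ((volume.restrict (Icc (0 : ℝ) 1)).prod volume) :=
    (integrable_const (C * B)).mul_prod hvK.norm
  refine hdom.mono' ?_ ?_
  · refine (hν.measurable.comp measurable_fst).aestronglyMeasurable.smul ?_
    exact (by fun_prop : Continuous fun p : ℝ × (ℝ × ℝ) =>
      θ (p.2 - p.1 • e)).aestronglyMeasurable.smul hv.aestronglyMeasurable.comp_snd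
  · have : ∀ᵐ p : ℝ × (ℝ × ℝ) ∂((volume.restrict (Icc (0 : ℝ) 1)).prod volume),
        p.1 ∈ Icc (0 : ℝ) 1 :=
      Measure.quasiMeasurePreserving_fst.ae (ae_restrict_mem measurableSet_Icc)
    filter_upwards [this] with p hp
    by_cases h0 : p.2 - p.1 • e ∈ tsupport θ
    · have : p.2 ∈ K := ⟨(p.1, p.2 - p.1 • e), ⟨hp, h0⟩, by simp⟩
      rw [indicator_of_mem this, norm_smul, norm_smul, ← mul_assoc]
      exact mul_le_mul_of_nonneg_right
        (mul_le_mul (hC _ hp) (hB _) (norm_nonneg _) hC0) (norm_nonneg _)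
    · rw [image_eq_zero_of_notMem_tsupport h0]
      simp only [zero_smul, smul_zero, norm_zero]
      positivity

theorem integrable_test_shear {ν : ℝ → ℝ} (hν : Continuous ν) {θ : ℝ × ℝ → ℂ} (hθ : Continuous θ)
    (hc : HasCompactSupport θ) (e : ℝ × ℝ) {v : ℝ × ℝ → Fibre q}
    (hv : LocallyIntegrable v volume) :
    Integrable (fun p : ℝ × (ℝ × ℝ) => ν p.1 • θ p.2 • v (p.2 + p.1 • e))
      ((volume.restrict (Icc (0 : ℝ) 1)).prod volume) := by
  have := ((measurePreserving_shear e).integrable_comp_emb (measurableEmbedding_shear e)).2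
    (integrable_shear_test hν hθ hc e hv)
  refine this.congr (ae_of_all _ fun p => ?_)
  simp

theorem smul_avg (ν : ℝ → ℝ) (e : ℝ × ℝ) (v : ℝ × ℝ → Fibre q) (c : ℂ) (z : ℝ × ℝ) :
    c • avg ν e v z = ∫ t in Icc (0 : ℝ) 1, ν t • c • v (z + t • e) := by
  rw [avg, ← integral_smul]
  exact integral_congr_ae (ae_of_all _ fun t => smul_comm _ _ _)

theorem integral_smul_avg {ν : ℝ → ℝ} (hν : Continuous ν) {θ : ℝ × ℝ → ℂ} (hθ : Continuous θ)
    (hc : HasCompactSupport θ) (e : ℝ × ℝ) {v : ℝ × ℝ → Fibre q}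
    (hv : LocallyIntegrable v volume) :
    ∫ z, θ z • avg ν e v z =
      ∫ z, (∫ t in Icc (0 : ℝ) 1, (ν t : ℂ) * θ (z - t • e)) • v z := by
  simp only [smul_avg]
  have h1 := integrable_test_shear hν hθ hc e hv
  have h2 := integrable_shear_test hν hθ hc e hv
  rw [← integral_integral_swap (f := fun t z => ν t • θ z • v (z + t • e)) h1,
    ← integral_prod _ h1]
  have h3 := (measurePreserving_shear e).integral_comp (measurableEmbedding_shear e)
    (fun p : ℝ × (ℝ × ℝ) => ν p.1 • θ (p.2 - p.1 • e) • v p.2)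
  simp only [add_sub_cancel_right] at h3
  rw [h3, integral_prod_symm _ h2]
  refine integral_congr_ae (ae_of_all _ fun z => ?_)
  simp only
  rw [← integral_smul_const]
  refine integral_congr_ae (ae_of_all _ fun t => ?_)
  simp only [mul_smul, Complex.coe_smul]

theorem locallyIntegrable_avg {ν : ℝ → ℝ} (hν : Continuous ν) (e : ℝ × ℝ) {v : ℝ × ℝ → Fibre q}
    (hv : LocallyIntegrable v volume) : LocallyIntegrable (avg ν e v) volume := by
  intro z
  let θ : ContDiffBump z := ⟨1, 2, one_pos, by norm_num⟩
  have hc : HasCompactSupport θ := θ.hasCompactSupport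
  have h1 := integrable_test_shear hν (θ := fun z => (θ z : ℂ))
    (Complex.continuous_ofReal.comp θ.continuous)
    (hc.comp_left (g := fun x : ℝ => (x : ℂ)) (by simp)) e hv
  have h2 := h1.integral_prod_right
  simp only [← smul_avg] at h2
  refine ⟨Metric.closedBall z 1, Metric.closedBall_mem_nhds z one_pos, ?_⟩
  refine (h2.integrableOn (s := Metric.closedBall z 1)).congr_fun (fun w hw => ?_)
    Metric.isClosed_closedBall.measurableSet
  simp [θ.one_of_mem_closedBall hw]

theorem locallyIntegrable_shift {v : ℝ × ℝ → Fibre q} (hv : LocallyIntegrable v volume)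
    (e : ℝ × ℝ) : LocallyIntegrable (fun z => v (z + e)) volume := by
  rw [locallyIntegrable_iff] at hv ⊢
  intro K hK
  have h1 := hv _ (hK.image (continuous_add_const e))
  have := ((measurePreserving_add_right (volume : Measure (ℝ × ℝ)) e).integrableOn_image
    (Homeomorph.addRight e).measurableEmbedding (f := v) (s := K)).1 h1
  exact this

theorem avg_weakDir {e : ℝ × ℝ} {v v' : ℝ × ℝ → Fibre q} (h : WeakDir e v v')
    (hv : LocallyIntegrable v volume) (hv' : LocallyIntegrable v' volume) {ν ν' : ℝ → ℝ}
    (hν : ∀ t, HasDerivAt ν (ν' t) t) (hν' : Continuous ν') :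
    avg ν e v' =ᵐ[volume] fun z => ν 1 • v (z + e) - ν 0 • v z - avg ν' e v z := by
  have hνc : Continuous ν := continuous_iff_continuousAt.2 fun t => (hν t).continuousAt
  have hl1 := (locallyIntegrable_shift hv e).smul (ν 1)
  have hl2 := hv.smul (ν 0)
  have hl3 := locallyIntegrable_avg hν' e hv
  refine ae_eq_of_forall_test (locallyIntegrable_avg hνc e hv') ((hl1.sub hl2).sub hl3)
    fun θ hθ hc => ?_
  have hcs : ∀ t : ℝ, HasCompactSupport fun z => θ (z - t • e) := fun t =>
    hc.comp_homeomorph (Homeomorph.subRight (t • e))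
  have hds : ∀ t : ℝ, dirDeriv e (fun z => θ (z - t • e)) = fun z => dirDeriv e θ (z - t • e) := by
    intro t; funext z
    simp only [dirDeriv]
    rw [fderiv_comp_sub]
  have e1 : ∫ z, θ z • avg ν e v' z = ∫ t in Icc (0 : ℝ) 1, ν t • ∫ z, θ (z - t • e) • v' z := by
    rw [integral_smul_avg hνc hθ.continuous hc e hv']
    have h2 := integrable_shear_test hνc hθ.continuous hc e hv'
    have h3 := integral_integral_swap (f := fun t z => ν t • θ (z - t • e) • v' z) h2
    simp only [integral_smul] at h3
    rw [h3]
    refine integral_congr_ae (ae_of_all _ fun z => ?_)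
    simp only
    rw [← integral_smul_const]
    refine integral_congr_ae (ae_of_all _ fun t => ?_)
    simp only [mul_smul, Complex.coe_smul]
  have e2 : ∀ t : ℝ, ∫ z, θ (z - t • e) • v' z = -∫ z, dirDeriv e θ (z - t • e) • v z := by
    intro t
    have := h (fun z => θ (z - t • e)) (hθ.comp (contDiff_id.sub contDiff_const)) (hcs t)
    rw [hds] at this
    rw [this, neg_neg]
  have hdc := (contDiff_dirDeriv hθ e).continuous
  have e3 : ∫ z, θ z • avg ν e v' z = -∫ z, (∫ t in Icc (0 : ℝ) 1,
      (ν t : ℂ) * dirDeriv e θ (z - t • e)) • v z := by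
    rw [e1]
    simp only [e2, smul_neg, integral_neg]
    have h2 := integrable_shear_test hνc hdc (hasCompactSupport_dirDeriv hc e) e hv
    have h3 := integral_integral_swap (f := fun t z => ν t • dirDeriv e θ (z - t • e) • v z) h2
    simp only [integral_smul] at h3
    rw [h3]
    congr 1
    refine integral_congr_ae (ae_of_all _ fun z => ?_)
    simp only
    rw [← integral_smul_const]
    refine integral_congr_ae (ae_of_all _ fun t => ?_)
    simp only [mul_smul, Complex.coe_smul]
  have e4 : ∀ z, ∫ t in Icc (0 : ℝ) 1, (ν t : ℂ) * dirDeriv e θ (z - t • e) =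
      -((ν 1 : ℂ) * θ (z - e) - (ν 0 : ℂ) * θ z -
        ∫ t in Icc (0 : ℝ) 1, (ν' t : ℂ) * θ (z - t • e)) := by
    intro z
    have hd : ∀ t : ℝ, HasDerivAt (fun t : ℝ => θ (z - t • e)) (-dirDeriv e θ (z - t • e)) t := by
      intro t
      have ha := (hθ.differentiable (by simp) (z - t • e)).hasFDerivAt
      have hb : HasDerivAt (fun t : ℝ => z - t • e) (-e) t := by
        simpa using ((hasDerivAt_id t).smul_const e).const_sub z
      exact (ha.comp_hasDerivAt t hb).congr_deriv (by simp [dirDeriv])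
    have hn : ∀ t : ℝ, HasDerivAt (fun t : ℝ => (ν t : ℂ)) (ν' t) t := fun t => (hν t).ofReal_comp
    have := intervalIntegral.integral_mul_deriv_eq_deriv_mul (a := 0) (b := 1)
      (u := fun t => (ν t : ℂ)) (v := fun t => θ (z - t • e)) (fun t _ => hn t) (fun t _ => hd t)
      (by exact Continuous.intervalIntegrable (by fun_prop) _ _)
      (by exact Continuous.intervalIntegrable (by fun_prop) _ _)
    rw [integral_Icc_eq_integral_Ioc, integral_Icc_eq_integral_Ioc,
      ← intervalIntegral.integral_of_le (by norm_num), ← intervalIntegral.integral_of_le (by norm_num)]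
    simp only [mul_neg, intervalIntegral.integral_neg, one_smul, zero_smul, sub_zero] at this
    rw [← neg_eq_iff_eq_neg, this]
  have hi1 : Integrable (fun z => θ z • ν 1 • v (z + e)) := integrable_test_smul hθ.continuous hc hl1
  have hi2 : Integrable (fun z => θ z • ν 0 • v z) := integrable_test_smul hθ.continuous hc hl2
  have hi3 := integrable_test_smul hθ.continuous hc hl3
  rw [e3]
  simp only [smul_sub]
  have hi12 : Integrable (fun z => θ z • ν 1 • v (z + e) - θ z • ν 0 • v z) := hi1.sub hi2
  change _ = ∫ z, θ z • ν 1 • v (z + e) - θ z • ν 0 • v z - θ z • avg ν' e v z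
  rw [integral_sub hi12 hi3, integral_sub hi1 hi2,
    integral_smul_avg hν' hθ.continuous hc e hv]
  have hs : ∫ z, θ z • ν 1 • v (z + e) = ∫ z, ((ν 1 : ℂ) * θ (z - e)) • v z := by
    have := integral_add_right_eq_self (μ := volume)
      (fun z => ((ν 1 : ℂ) * θ (z - e)) • v z) e
    rw [← this]
    refine integral_congr_ae (ae_of_all _ fun z => ?_)
    simp only [add_sub_cancel_right, mul_smul, Complex.coe_smul]
    exact smul_comm _ _ _
  have hs0 : ∫ z, θ z • ν 0 • v z = ∫ z, ((ν 0 : ℂ) * θ z) • v z := by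
    refine integral_congr_ae (ae_of_all _ fun z => ?_)
    simp only [mul_smul, Complex.coe_smul]
    exact smul_comm _ _ _
  rw [hs, hs0]
  have j1 : Integrable (fun z => ((ν 1 : ℂ) * θ (z - e)) • v z) := by
    refine integrable_test_smul (by fun_prop) ?_ hv
    have h1 := hcs 1
    simp only [one_smul] at h1
    exact h1.mul_left (f := fun _ => (ν 1 : ℂ))
  have j2 : Integrable (fun z => ((ν 0 : ℂ) * θ z) • v z) :=
    integrable_test_smul (by fun_prop) (hc.mul_left (f := fun _ => (ν 0 : ℂ))) hv
  have j3 : Integrable (fun z => (∫ t in Icc (0 : ℝ) 1, (ν' t : ℂ) * θ (z - t • e)) • v z) := by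
    have := (integrable_shear_test hν' hθ.continuous hc e hv).integral_prod_right
    refine this.congr (ae_of_all _ fun z => ?_)
    simp only
    rw [← integral_smul_const]
    refine integral_congr_ae (ae_of_all _ fun t => ?_)
    simp only [mul_smul, Complex.coe_smul]
  have j12 : Integrable (fun z => ((ν 1 : ℂ) * θ (z - e)) • v z - ((ν 0 : ℂ) * θ z) • v z) :=
    j1.sub j2
  rw [← integral_sub j1 j2, ← integral_sub j12 j3, ← integral_neg]
  refine integral_congr_ae (ae_of_all _ fun z => ?_)
  simp only [e4]
  rw [neg_smul, neg_neg, sub_smul, sub_smul]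

theorem MemL2s.congr {s : ℝ} {u v : ℝ × ℝ → Fibre q} (h : MemL2s s u) (huv : u =ᵐ[volume] v) :
    MemL2s s v :=
  MemLp.ae_eq (huv.mono fun z hz => by simp only [hz]) h

theorem MemL2s.sub {s : ℝ} {u v : ℝ × ℝ → Fibre q} (h : MemL2s s u) (h' : MemL2s s v) :
    MemL2s s (fun z => u z - v z) := by
  exact (MemLp.sub h h').ae_eq (ae_of_all _ fun z => by simp [smul_sub])

theorem memL2s_shift {s : ℝ} {e : ℝ × ℝ} (he : |e.1| ≤ 1) {v : ℝ × ℝ → Fibre q}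
    (hv : MemL2s s v) : MemL2s s (fun z => v (z + e)) := by
  have h1 : MemLp (fun z : ℝ × ℝ => bracket (z + e).1 ^ s • v (z + e)) 2 volume :=
    MemLp.comp_measurePreserving
      (g := fun z : ℝ × ℝ => bracket z.1 ^ s • v z) (f := fun z => z + e) hv
      (measurePreserving_add_right volume e)
  have hvm : AEStronglyMeasurable (fun z => v (z + e)) volume := by
    have := (((continuous_bracket_rpow (-s)).comp
      ((continuous_add_const e).fst)).aestronglyMeasurable (μ := volume)).smul h1.1
    refine this.congr (ae_of_all _ fun z => ?_)
    simp only [Pi.smul_apply', Function.comp, smul_smul]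
    rw [← Real.rpow_add (bracket_pos _)]; simp
  refine h1.of_le_mul (c := 2 ^ |s|)
    (((continuous_bracket_rpow s).comp continuous_fst).aestronglyMeasurable.smul hvm)
    (ae_of_all _ fun z => ?_)
  rw [norm_smul, norm_smul, ← mul_assoc]
  gcongr
  rw [Real.norm_of_nonneg (Real.rpow_nonneg (bracket_pos _).le _),
    Real.norm_of_nonneg (Real.rpow_nonneg (bracket_pos _).le _)]
  exact bracket_rpow_le s (by simpa using he)

theorem WeakDir.diff {e : ℝ × ℝ} {v v' : ℝ × ℝ → Fibre q} (h : WeakDir e v v')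
    (hv : LocallyIntegrable v volume) (hv' : LocallyIntegrable v' volume) :
    WeakDir e (diff e v) (diff e v') := by
  intro θ hθ hc
  have h1 := h (fun z => θ (z - e)) (hθ.comp (contDiff_id.sub contDiff_const))
    (hc.comp_homeomorph (Homeomorph.subRight e))
  have hds : dirDeriv e (fun z => θ (z - e)) = fun z => dirDeriv e θ (z - e) := by
    funext z
    simp only [dirDeriv]
    rw [fderiv_comp_sub]
  rw [hds] at h1
  have a1 := integral_add_right_eq_self (μ := volume) (fun z => dirDeriv e θ (z - e) • v z) e
  have a2 := integral_add_right_eq_self (μ := volume) (fun z => θ (z - e) • v' z) e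
  simp only [add_sub_cancel_right] at a1 a2
  rw [← a1, ← a2] at h1
  have hdc := (contDiff_dirDeriv hθ e).continuous
  have hdcc := hasCompactSupport_dirDeriv hc e
  simp only [EdgeScattering.diff, smul_sub]
  rw [integral_sub (integrable_test_smul hdc hdcc (locallyIntegrable_shift hv e))
      (integrable_test_smul hdc hdcc hv),
    integral_sub (integrable_test_smul hθ.continuous hc (locallyIntegrable_shift hv' e))
      (integrable_test_smul hθ.continuous hc hv'), h1, h θ hθ hc]
  abel

/-- Intermediate weak derivatives are controlled by the extreme ones. -/
theorem memL2s_of_weakDir_chain {s : ℝ} {e : ℝ × ℝ} (he : |e.1| ≤ 1) (n : ℕ) :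
    ∀ v : ℕ → ℝ × ℝ → Fibre q, (∀ k < n, WeakDir e (v k) (v (k + 1))) →
      (∀ k ≤ n, LocallyIntegrable (v k) volume) → MemL2s s (v 0) → MemL2s s (v n) →
      ∀ k ≤ n, MemL2s s (v k) := by
  induction n with
  | zero => intro v _ _ h0 _ k hk; rwa [Nat.le_zero.1 hk]
  | succ n ih =>
    intro v hw hl h0 hn
    have hd : MemL2s s (diff e (v n)) := by
      have h1 := avg_weakDir (hw n (by omega)) (hl n (by omega)) (hl (n + 1) le_rfl)
        (ν := fun _ => 1) (ν' := fun _ => 0) (fun t => hasDerivAt_const t 1) continuous_const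
      refine (memL2s_avg continuous_const he hn).congr (h1.trans (ae_of_all _ fun z => ?_))
      simp [avg, diff]
    have hdiff := ih (fun k => diff e (v k))
      (fun k hk => (hw k (by omega)).diff (hl k (by omega)) (hl (k + 1) (by omega)))
      (fun k hk => (locallyIntegrable_shift (hl k (by omega)) e).sub (hl k (by omega)))
      ((memL2s_shift he h0).sub h0) hd
    have hvn : MemL2s s (v n) := by
      rcases Nat.eq_zero_or_pos n with rfl | hpos
      · exact h0
      obtain ⟨m, rfl⟩ : ∃ m, n = m + 1 := ⟨n - 1, by omega⟩
      have h1 := avg_weakDir (hw (m + 1) (by omega)) (hl (m + 1) (by omega)) (hl (m + 2) le_rfl)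
        (ν := fun t => 1 - t) (ν' := fun _ => -1)
        (fun t => by simpa using (hasDerivAt_id t).const_sub 1) continuous_const
      have h2 := avg_weakDir (hw m (by omega)) (hl m (by omega)) (hl (m + 1) (by omega))
        (ν := fun _ => 1) (ν' := fun _ => 0) (fun t => hasDerivAt_const t 1) continuous_const
      have h3 := memL2s_avg (ν := fun t => 1 - t) (by fun_prop) he hn
      refine ((hdiff m (by omega)).sub h3).congr ?_
      filter_upwards [h1, h2] with z z1 z2
      rw [z1]
      simp only [avg, one_smul, zero_smul, integral_zero, sub_zero, neg_smul, integral_neg,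
        sub_self, sub_neg_eq_add, zero_sub] at z1 z2 ⊢
      rw [z2]
      simp [diff]
    intro k hk
    rcases Nat.lt_or_ge k (n + 1) with h | h
    · exact ih v (fun k hk => hw k (by omega)) (fun k hk => hl k (by omega)) h0 hvn k (by omega)
    · rwa [show k = n + 1 by omega]

/-! ### Symmetric operators with surjective `A ± i` -/

section Resolvent

variable {𝓗 : Type*} [NormedAddCommGroup 𝓗] [InnerProductSpace ℂ 𝓗]

/-- `i` or `-i`. -/
def imUnit (b : Bool) : ℂ := if b then Complex.I else -Complex.I

theorem conj_imUnit (b : Bool) : starRingEnd ℂ (imUnit b) = imUnit !b := by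
  cases b <;> simp [imUnit]

theorem imUnit_not (b : Bool) : imUnit (!b) = -imUnit b := by
  cases b <;> simp [imUnit]

theorem norm_imUnit (b : Bool) : ‖imUnit b‖ = 1 := by
  cases b <;> simp [imUnit]

theorem ofReal_sub_imUnit_ne_zero (t : ℝ) (b : Bool) : (t : ℂ) - imUnit b ≠ 0 := by
  intro h
  have := congrArg Complex.im h
  cases b <;> simp [imUnit] at this

/-- A symmetric operator `A` with domain `D` for which `A - i` and `A + i` are onto. -/
structure IsSelfAdjointOn {D : Submodule ℂ 𝓗} (A : D →ₗ[ℂ] 𝓗) : Prop where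
  symm : ∀ u v : D, ⟪A u, (v : 𝓗)⟫_ℂ = ⟪(u : 𝓗), A v⟫_ℂ
  surj : ∀ b f, ∃ u : D, A u - imUnit b • (u : 𝓗) = f

namespace IsSelfAdjointOn

variable {D : Submodule ℂ 𝓗} {A : D →ₗ[ℂ] 𝓗}

theorem norm_sq_of_symm (h : ∀ u v : D, ⟪A u, (v : 𝓗)⟫_ℂ = ⟪(u : 𝓗), A v⟫_ℂ) (b : Bool) (u : D) :
    ‖A u - imUnit b • (u : 𝓗)‖ ^ 2 = ‖A u‖ ^ 2 + ‖(u : 𝓗)‖ ^ 2 := by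
  have h1 := norm_sub_sq (𝕜 := ℂ) (A u) (imUnit b • (u : 𝓗))
  have h2 : (⟪A u, (u : 𝓗)⟫_ℂ).im = 0 := by
    have h3 := h u u
    rw [← inner_conj_symm] at h3
    exact Complex.conj_eq_iff_im.1 (by rw [← h u u] at h3; simpa using h3)
  rw [h1, inner_smul_right, norm_smul, norm_imUnit, one_mul]
  have h4 : RCLike.re (imUnit b * ⟪A u, (u : 𝓗)⟫_ℂ) = 0 := by
    cases b <;> simp [imUnit, h2]
  rw [h4]; ring

variable (hA : IsSelfAdjointOn A)
include hA

theorem norm_sq (b : Bool) (u : D) :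
    ‖A u - imUnit b • (u : 𝓗)‖ ^ 2 = ‖A u‖ ^ 2 + ‖(u : 𝓗)‖ ^ 2 := norm_sq_of_symm hA.symm b u

theorem norm_le (b : Bool) (u : D) : ‖(u : 𝓗)‖ ≤ ‖A u - imUnit b • (u : 𝓗)‖ := by
  refine le_of_sq_le_sq ?_ (norm_nonneg _)
  rw [hA.norm_sq]; nlinarith [sq_nonneg ‖A u‖]

theorem norm_apply_le (b : Bool) (u : D) : ‖A u‖ ≤ ‖A u - imUnit b • (u : 𝓗)‖ := by
  refine le_of_sq_le_sq ?_ (norm_nonneg _)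
  rw [hA.norm_sq]; nlinarith [sq_nonneg ‖(u : 𝓗)‖]

theorem bijective (b : Bool) :
    Function.Bijective (A - imUnit b • D.subtype) := by
  refine ⟨(injective_iff_map_eq_zero _).2 fun u hu => ?_, fun f => hA.surj b f⟩
  have h1 := hA.norm_le b u
  have h2 : A u - imUnit b • (u : 𝓗) = 0 := hu
  rw [h2, norm_zero] at h1
  exact Subtype.ext (norm_le_zero_iff.1 h1)

/-- `(A ∓ i)⁻¹` as a map into the domain. -/
def resD (b : Bool) : 𝓗 →ₗ[ℂ] D := (LinearEquiv.ofBijective _ (hA.bijective b)).symm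

theorem resD_spec (b : Bool) (f : 𝓗) : A (hA.resD b f) - imUnit b • (hA.resD b f : 𝓗) = f :=
  (LinearEquiv.ofBijective _ (hA.bijective b)).apply_symm_apply f

theorem apply_resD (b : Bool) (f : 𝓗) : A (hA.resD b f) = f + imUnit b • (hA.resD b f : 𝓗) :=
  eq_add_of_sub_eq (hA.resD_spec b f)

theorem resD_apply (b : Bool) (u : D) : hA.resD b (A u - imUnit b • (u : 𝓗)) = u :=
  (LinearEquiv.ofBijective _ (hA.bijective b)).symm_apply_apply u

theorem resD_eq {b : Bool} {u : D} {f : 𝓗} (h : A u - imUnit b • (u : 𝓗) = f) :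
    hA.resD b f = u := by rw [← h, hA.resD_apply]

theorem norm_resD_le (b : Bool) (f : 𝓗) : ‖(hA.resD b f : 𝓗)‖ ≤ ‖f‖ := by
  have := hA.norm_le b (hA.resD b f)
  rwa [hA.resD_spec] at this

theorem norm_apply_resD_le (b : Bool) (f : 𝓗) : ‖A (hA.resD b f)‖ ≤ ‖f‖ := by
  have := hA.norm_apply_le b (hA.resD b f)
  rwa [hA.resD_spec] at this

/-- `(A ∓ i)⁻¹` as a bounded operator. -/
def res (b : Bool) : 𝓗 →L[ℂ] 𝓗 :=
  LinearMap.mkContinuous (D.subtype ∘ₗ hA.resD b) 1 fun f => by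
    simpa using hA.norm_resD_le b f

theorem res_apply (b : Bool) (f : 𝓗) : hA.res b f = hA.resD b f := rfl

theorem inner_res_left (b : Bool) (f g : 𝓗) : ⟪hA.res b f, g⟫_ℂ = ⟪f, hA.res (!b) g⟫_ℂ := by
  have h1 := hA.symm (hA.resD b f) (hA.resD (!b) g)
  rw [hA.apply_resD, hA.apply_resD, inner_add_left, inner_add_right, inner_smul_left,
    inner_smul_right, conj_imUnit] at h1
  exact (add_right_cancel h1).symm

theorem res_comp_bounded {B : D →ₗ[ℂ] 𝓗} {C : ℝ}
    (hB : ∀ u : D, ‖B u‖ ≤ C * (‖A u‖ + ‖(u : 𝓗)‖)) (hC : 0 ≤ C) (b : Bool) (f : 𝓗) :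
    ‖B (hA.resD b f)‖ ≤ 2 * C * ‖f‖ := by
  refine (hB _).trans ?_
  have h1 := hA.norm_apply_resD_le b f
  have h2 := hA.norm_resD_le b f
  nlinarith

theorem dom_closed {b : Bool} {u : ℕ → D} {x y : 𝓗} (hu : Tendsto (fun n => (u n : 𝓗)) atTop (𝓝 x))
    (hAu : Tendsto (fun n => A (u n)) atTop (𝓝 y)) : ∃ hx : x ∈ D, A ⟨x, hx⟩ = y := by
  have h1 : Tendsto (fun n => hA.res b (A (u n) - imUnit b • (u n : 𝓗))) atTop
      (𝓝 (hA.res b (y - imUnit b • x))) :=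
    ((hA.res b).continuous.tendsto _).comp (hAu.sub (hu.const_smul _))
  simp only [hA.res_apply, hA.resD_apply] at h1
  have h2 := tendsto_nhds_unique hu h1
  refine ⟨h2 ▸ (hA.resD b _).2, ?_⟩
  have h3 : (⟨x, h2 ▸ (hA.resD b _).2⟩ : D) = hA.resD b (y - imUnit b • x) := Subtype.ext h2
  rw [h3, hA.apply_resD, ← h2]
  abel

end IsSelfAdjointOn

theorem isSelfAdjointOn_add [CompleteSpace 𝓗] {T : 𝓗 →ₗ.[ℂ] 𝓗} (hT : IsSelfAdjoint T)
    (K : 𝓗 →L[ℂ] 𝓗) (hK : ∀ u v, ⟪K u, v⟫_ℂ = ⟪u, K v⟫_ℂ) :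
    IsSelfAdjointOn (T.toFun + K.toLinearMap ∘ₗ T.domain.subtype) := by
  set A : T.domain →ₗ[ℂ] 𝓗 := T.toFun + K.toLinearMap ∘ₗ T.domain.subtype with hAdef
  have hAu : ∀ u : T.domain, A u = T u + K u := fun u => rfl
  have hdense : Dense (T.domain : Set 𝓗) := hT.dense_domain
  have hadj : T.adjoint = T := hT
  have hformal := LinearPMap.adjoint_isFormalAdjoint hdense (T := T)
  rw [hadj] at hformal
  have hsymm : ∀ u v : T.domain, ⟪A u, (v : 𝓗)⟫_ℂ = ⟪(u : 𝓗), A v⟫_ℂ := by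
    intro u v
    rw [hAu, hAu, inner_add_left, inner_add_right, hK, hformal]
  refine ⟨hsymm, fun b f => ?_⟩
  have hnorm := fun b u => IsSelfAdjointOn.norm_sq_of_symm hsymm b u
  have hle : ∀ b (u : T.domain), ‖(u : 𝓗)‖ ≤ ‖A u - imUnit b • (u : 𝓗)‖ := fun b u => by
    refine le_of_sq_le_sq ?_ (norm_nonneg _)
    rw [hnorm]; nlinarith [sq_nonneg ‖A u‖]
  let L : T.domain →ₗ[ℂ] 𝓗 := A - imUnit b • T.domain.subtype
  have hL : ∀ u, L u = A u - imUnit b • (u : 𝓗) := fun u => rfl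
  have hclosed : IsClosed (LinearMap.range L : Set 𝓗) := by
    refine IsSeqClosed.isClosed fun x y hx hxy => ?_
    choose u hu using hx
    have hcau : CauchySeq fun n => (u n : 𝓗) := by
      refine Metric.cauchySeq_iff'.2 fun ε hε => ?_
      obtain ⟨N, hN⟩ := Metric.cauchySeq_iff'.1 hxy.cauchySeq ε hε
      refine ⟨N, fun n hn => lt_of_le_of_lt ?_ (hN n hn)⟩
      rw [dist_eq_norm, dist_eq_norm, ← hu, ← hu, ← map_sub, hL]
      exact hle b (u n - u N)
    obtain ⟨w, hw⟩ := cauchySeq_tendsto_of_complete hcau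
    have h1 : Tendsto (fun n => T (u n)) atTop (𝓝 (y + imUnit b • w - K w)) := by
      have : ∀ n, T (u n) = x n + imUnit b • (u n : 𝓗) - K (u n) := fun n => by
        rw [← hu, hL, hAu]; abel
      simp only [this]
      exact (hxy.add (hw.const_smul _)).sub ((K.continuous.tendsto w).comp hw)
    have hg := hT.isClosed
    have h2 : (w, y + imUnit b • w - K w) ∈ T.graph :=
      hg.mem_of_tendsto (hw.prodMk_nhds h1) (Eventually.of_forall fun n => T.mem_graph (u n))
    obtain ⟨w', hw1, hw2⟩ := (LinearPMap.mem_graph_iff T).1 h2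
    refine ⟨w', ?_⟩
    simp only at hw1 hw2
    rw [hL, hAu, hw2, hw1]; abel
  have hortho : (LinearMap.range L)ᗮ = ⊥ := by
    refine (Submodule.eq_bot_iff _).2 fun w hw => ?_
    have h0 : ∀ u : T.domain, ⟪-K w + imUnit (!b) • w, (u : 𝓗)⟫_ℂ = ⟪w, T u⟫_ℂ := by
      intro u
      have h1 := (Submodule.mem_orthogonal' _ _).1 hw (L u) ⟨u, rfl⟩
      rw [hL, hAu, inner_sub_right, inner_add_right, inner_smul_right] at h1
      rw [inner_add_left, inner_neg_left, inner_smul_left, conj_imUnit, Bool.not_not, hK]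
      linear_combination -h1
    have hmem := LinearPMap.mem_adjoint_domain_of_exists (T := T) w ⟨_, h0⟩
    have h2 := LinearPMap.adjoint_apply_eq hdense ⟨w, hmem⟩ h0
    have hmem' : w ∈ T.domain := by rw [hadj] at hmem; exact hmem
    have h3 : T ⟨w, hmem'⟩ = -K w + imUnit (!b) • w := by
      rw [← h2]
      have : ∀ (T' : 𝓗 →ₗ.[ℂ] 𝓗) (h : T' = T) (hm : w ∈ T'.domain), T ⟨w, hmem'⟩ = T' ⟨w, hm⟩ := by
        rintro T' rfl hm; rfl
      exact this _ hadj hmem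
    have h4 := hle (!b) ⟨w, hmem'⟩
    rw [hAu, h3] at h4
    simpa using h4
  have : LinearMap.range L = ⊤ := by
    rw [← (hclosed.submodule_topologicalClosure_eq), Submodule.topologicalClosure_eq_top_iff, hortho]
  have hf : f ∈ LinearMap.range L := by rw [this]; trivial
  exact hf

end Resolvent

/-! ### The differential expression and its commutators with functions of `x` -/

section Expression

variable {p q : ℕ}

theorem toEuclideanLin_eq_sum (M : Matrix (Fin q) (Fin q) ℂ) (u : Fibre q) :
    Matrix.toEuclideanLin M u =
      ∑ i, ∑ j, (M i j * u j) • (EuclideanSpace.single i (1 : ℂ) : Fibre q) := by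
  ext k
  simp only [← Finset.sum_smul]
  simp [Matrix.toLpLin_apply, Matrix.mulVec, dotProduct, Finset.sum_apply, Pi.single_apply]

theorem norm_toEuclideanLin_le {M : Matrix (Fin q) (Fin q) ℂ} {C : ℝ} (hC : ∀ i j, ‖M i j‖ ≤ C)
    (u : Fibre q) : ‖Matrix.toEuclideanLin M u‖ ≤ (q * q * C) * ‖u‖ := by
  rw [toEuclideanLin_eq_sum]
  refine (norm_sum_le _ _).trans ?_
  have h1 : ∀ i ∈ Finset.univ, ‖∑ j, (M i j * u j) • (EuclideanSpace.single i (1 : ℂ) : Fibre q)‖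
      ≤ ∑ _j : Fin q, C * ‖u‖ := fun i _ => by
    refine (norm_sum_le _ _).trans (Finset.sum_le_sum fun j _ => ?_)
    rw [norm_smul, norm_mul, PiLp.norm_single, norm_one, mul_one]
    exact mul_le_mul (hC i j) (PiLp.norm_apply_le u j) (norm_nonneg _)
      ((norm_nonneg _).trans (hC i j))
  refine (Finset.sum_le_sum h1).trans (le_of_eq ?_)
  simp; ring

/-- `∑_{a,b} C(a,k) c_{ab}(y) (-i)^{a+b} v_{a-k,b}`; for `v_{ab} = ∂_x^a ∂_y^b u` this is the `k`-th
commutator coefficient of the differential expression, applied to `u`. -/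
def commExpr (p : ℕ) (c : ℕ → ℕ → ℝ → Matrix (Fin q) (Fin q) ℂ) (k : ℕ)
    (v : ℕ → ℕ → ℝ × ℝ → Fibre q) (z : ℝ × ℝ) : Fibre q :=
  ∑ a ∈ Finset.range (p + 1), ∑ b ∈ Finset.range (p + 1 - a),
    (a.choose k : ℂ) • Matrix.toEuclideanLin (c a b z.2) ((-Complex.I) ^ (a + b) • v (a - k) b z)

theorem commExpr_zero (c : ℕ → ℕ → ℝ → Matrix (Fin q) (Fin q) ℂ)
    (v : ℕ → ℕ → ℝ × ℝ → Fibre q) (z : ℝ × ℝ) :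
    commExpr p c 0 v z = ∑ a ∈ Finset.range (p + 1), ∑ b ∈ Finset.range (p + 1 - a),
      Matrix.toEuclideanLin (c a b z.2) ((-Complex.I) ^ (a + b) • v a b z) := by
  simp [commExpr]

theorem commExpr_eq_zero {c : ℕ → ℕ → ℝ → Matrix (Fin q) (Fin q) ℂ} {k : ℕ} (hk : p < k)
    (v : ℕ → ℕ → ℝ × ℝ → Fibre q) (z : ℝ × ℝ) : commExpr p c k v z = 0 := by
  refine Finset.sum_eq_zero fun a ha => Finset.sum_eq_zero fun b _ => ?_
  rw [Nat.choose_eq_zero_of_lt (by have := Finset.mem_range.1 ha; omega)]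
  simp

theorem choose_smul_leibniz {θ : ℝ → ℂ} {v : ℕ → ℕ → ℝ × ℝ → Fibre q} {a b k : ℕ} (ha : a ≤ p)
    (z : ℝ × ℝ) : (a.choose k : ℂ) • leibniz θ v (a - k) b z =
      ∑ l ∈ Finset.range (p + 1), ((((k + l).choose l : ℂ) * iteratedDeriv l θ z.1) *
        (a.choose (k + l) : ℂ)) • v (a - (k + l)) b z := by
  rcases lt_or_ge a k with h | h
  · rw [Nat.choose_eq_zero_of_lt h]
    simp only [Nat.cast_zero, zero_smul]
    refine (Finset.sum_eq_zero fun l _ => ?_).symm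
    rw [Nat.choose_eq_zero_of_lt (show a < k + l by omega)]; simp
  rw [leibniz, Finset.Nat.sum_antidiagonal_eq_sum_range_succ_mk, Finset.smul_sum]
  have hsub : Finset.range (a - k + 1) ⊆ Finset.range (p + 1) :=
    Finset.range_subset_range.2 (by omega)
  rw [← Finset.sum_subset hsub]
  · refine Finset.sum_congr rfl fun l hl => ?_
    have hl' : l ≤ a - k := by have := Finset.mem_range.1 hl; omega
    have h1 : a.choose (k + l) * (k + l).choose k = a.choose k * (a - k).choose l := by
      have := Nat.choose_mul (n := a) (k := k + l) (s := k) (Nat.le_add_right k l)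
      rw [this, Nat.add_sub_cancel_left]
    have h2 : (k + l).choose k = (k + l).choose l := by
      rw [Nat.choose_symm_add]
    rw [h2] at h1
    have h3 : (a.choose (k + l) : ℂ) * ((k + l).choose l : ℂ) =
      (a.choose k : ℂ) * ((a - k).choose l : ℂ) := by exact_mod_cast h1
    simp only [← Nat.cast_smul_eq_nsmul ℂ, smul_smul, Nat.sub_sub]
    congr 1
    linear_combination -(iteratedDeriv l θ z.1) * h3
  · intro l _ hl
    have hl' : a - k < l := by
      by_contra hcon
      exact hl (Finset.mem_range.2 (by omega))
    rw [Nat.choose_eq_zero_of_lt (show a < k + l by omega)]; simp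

theorem commExpr_leibniz (c : ℕ → ℕ → ℝ → Matrix (Fin q) (Fin q) ℂ) (k : ℕ) (θ : ℝ → ℂ)
    (v : ℕ → ℕ → ℝ × ℝ → Fibre q) (z : ℝ × ℝ) :
    commExpr p c k (leibniz θ v) z = ∑ l ∈ Finset.range (p + 1),
      (((k + l).choose l : ℂ) * iteratedDeriv l θ z.1) • commExpr p c (k + l) v z := by
  simp only [commExpr, Finset.smul_sum]
  rw [Finset.sum_comm]
  refine Finset.sum_congr rfl fun a ha => ?_
  rw [Finset.sum_comm]
  refine Finset.sum_congr rfl fun b _ => ?_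
  have ha' : a ≤ p := by have := Finset.mem_range.1 ha; omega
  rw [← map_smul, smul_comm, choose_smul_leibniz ha', Finset.smul_sum, map_sum]
  refine Finset.sum_congr rfl fun l _ => ?_
  simp only [map_smul, smul_smul]
  congr 1; ring

theorem commExpr_congr {c : ℕ → ℕ → ℝ → Matrix (Fin q) (Fin q) ℂ} {k : ℕ}
    {v w : ℕ → ℕ → ℝ × ℝ → Fibre q} (h : ∀ a b, a + b ≤ p → v a b =ᵐ[volume] w a b) :
    commExpr p c k v =ᵐ[volume] commExpr p c k w := by
  have h' : ∀ᵐ z, ∀ a b, a + b ≤ p → v a b z = w a b z := by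
    rw [ae_all_iff]; intro a; rw [ae_all_iff]; intro b
    by_cases hab : a + b ≤ p
    · filter_upwards [h a b hab] with z hz _ using hz
    · exact Eventually.of_forall fun z h => absurd h hab
  filter_upwards [h'] with z hz
  refine Finset.sum_congr rfl fun a ha => Finset.sum_congr rfl fun b hb => ?_
  rw [hz (a - k) b]
  have := Finset.mem_range.1 ha
  have := Finset.mem_range.1 hb
  omega

/-- `v` is the family of weak derivatives of order at most `p` of `u`. -/
def WeakFamily (p : ℕ) (u : ℝ × ℝ → Fibre q) (v : ℕ → ℕ → ℝ × ℝ → Fibre q) : Prop :=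
  ∀ a b, a + b ≤ p → HasWeakDeriv a b u (v a b)

theorem WeakFamily.locallyIntegrable {u : ℝ × ℝ → Fibre q} {v : ℕ → ℕ → ℝ × ℝ → Fibre q}
    (h : WeakFamily p u v) : LocallyIntegrable u volume := (h 0 0 (by omega)).1

theorem WeakFamily.leibniz {θ : ℝ → ℂ} (hθ : ContDiff ℝ ∞ θ) {u : ℝ × ℝ → Fibre q}
    {v : ℕ → ℕ → ℝ × ℝ → Fibre q} (h : WeakFamily p u v) :
    WeakFamily p (fun z => θ z.1 • u z) (leibniz θ v) :=
  fun a b hab => hasWeakDeriv_leibniz hθ h a b hab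

theorem WeakFamily.ae_eq {u u' : ℝ × ℝ → Fibre q} {v v' : ℕ → ℕ → ℝ × ℝ → Fibre q}
    (h : WeakFamily p u v) (h' : WeakFamily p u' v') (hu : u =ᵐ[volume] u') (a b : ℕ)
    (hab : a + b ≤ p) : v a b =ᵐ[volume] v' a b :=
  ((h a b hab).congr hu (ae_eq_refl _)).unique (h' a b hab)

theorem MemL2s.of_bracket_pow {s : ℝ} {u : ℝ × ℝ → Fibre q} {n : ℕ}
    (h : MemL2s s fun z => (bracket z.2 ^ n) • u z) : MemL2s s u := by
  have hb : Continuous fun z : ℝ × ℝ => (bracket z.2 ^ n)⁻¹ :=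
    ((continuous_bracket.comp continuous_snd).pow n).inv₀ fun z =>
      pow_ne_zero _ (bracket_pos z.2).ne'
  refine MemLp.of_le h (f := fun z => (bracket z.1 ^ s) • u z) ?_ (Eventually.of_forall fun z => ?_)
  · have h1 := hb.aestronglyMeasurable.smul h.1 (μ := volume)
    refine h1.congr (Eventually.of_forall fun z => ?_)
    have : (bracket z.2 ^ n) ≠ 0 := pow_ne_zero _ (bracket_pos z.2).ne'
    simp only [Pi.smul_apply', smul_smul]
    congr 1; field_simp
  · have h1 : 1 ≤ bracket z.2 ^ n := one_le_pow₀ (one_le_bracket _)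
    rw [norm_smul, norm_smul, norm_smul]
    refine mul_le_mul_of_nonneg_left ?_ (norm_nonneg _)
    exact le_mul_of_one_le_left (norm_nonneg _) (by rwa [Real.norm_of_nonneg (by linarith)])

/-- Interpolation: all the derivatives of order at most `p` of `u ∈ H^p_s` lie in `L²_s`. -/
theorem WeakFamily.memL2s {u : ℝ × ℝ → Fibre q} {v : ℕ → ℕ → ℝ × ℝ → Fibre q} {s : ℝ}
    (h : WeakFamily p u v) (hu : MemHps p s u) (a b : ℕ) (hab : a + b ≤ p) : MemL2s s (v a b) := by
  have h00 : MemL2s s (v 0 0) :=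
    hu.1.of_bracket_pow.congr ((hasWeakDeriv_zero h.locallyIntegrable).unique (h 0 0 (by omega)))
  have htop : ∀ a b, a + b = p → MemL2s s (v a b) := fun a b hab => by
    obtain ⟨w, hw, hw2⟩ := hu.2 a b hab
    exact hw2.congr (hw.unique (h a b hab.le))
  have hy : ∀ b ≤ p, MemL2s s (v 0 b) :=
    memL2s_of_weakDir_chain (e := (0, 1)) (by simp) p (fun b => v 0 b)
      (fun k hk => (h 0 k (by omega)).weakDir_right (h 0 (k + 1) (by omega)))
      (fun k hk => (h 0 k (by omega)).2.1) h00 (htop 0 p (by omega))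
  exact memL2s_of_weakDir_chain (e := (1, 0)) (by simp) (p - b) (fun a => v a b)
    (fun k hk => (h k b (by omega)).weakDir_left (h (k + 1) b (by omega)))
    (fun k hk => (h k b (by omega)).2.1) (hy b (by omega)) (htop (p - b) b (by omega)) a (by omega)

theorem MemL2s.smul_of_le {s : ℝ} {u : ℝ × ℝ → Fibre q} (hu : MemL2s (-s) u) {f : ℝ → ℂ}
    (hf : Continuous f) {C : ℝ} (hC : ∀ x, ‖f x‖ ≤ C * bracket x ^ (-s)) :
    MemLp (fun z => f z.1 • u z) 2 volume := by
  have h0 : AEStronglyMeasurable u volume := by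
    have h1 := ((continuous_bracket_rpow s).comp continuous_fst).aestronglyMeasurable.smul hu.1
      (μ := volume)
    refine h1.congr (Eventually.of_forall fun z => ?_)
    simp only [Pi.smul_apply', smul_smul, Function.comp]
    rw [← Real.rpow_add (bracket_pos _)]; simp
  refine MemLp.of_le_mul hu (c := C)
    ((hf.comp continuous_fst).aestronglyMeasurable.smul h0) (Eventually.of_forall fun z => ?_)
  rw [norm_smul, norm_smul, ← mul_assoc]
  refine mul_le_mul_of_nonneg_right ?_ (norm_nonneg _)
  rw [Real.norm_eq_abs, abs_of_pos (Real.rpow_pos_of_pos (bracket_pos _) _)]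
  exact hC z.1

theorem memL2s_zero_iff {u : ℝ × ℝ → Fibre q} : MemL2s 0 u ↔ MemLp u 2 volume := by
  simp [MemL2s]

/-- Multiplication by a symbol of order `-s` maps `H^p_{-s}` into `H^p`. -/
theorem WeakFamily.memHps_smul {u : ℝ × ℝ → Fibre q} {v : ℕ → ℕ → ℝ × ℝ → Fibre q} {s : ℝ}
    (h : WeakFamily p u v) (hu : MemHps p (-s) u) {θ : ℝ → ℂ} (hθ : ContDiff ℝ ∞ θ)
    (hb : ∀ k, ∃ C, ∀ x, ‖iteratedDeriv k θ x‖ ≤ C * bracket x ^ (-s)) :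
    MemHps p 0 (fun z => θ z.1 • u z) := by
  refine ⟨?_, fun a b hab => ⟨_, h.leibniz hθ a b hab.le, ?_⟩⟩
  · rw [memL2s_zero_iff]
    obtain ⟨C, hC⟩ := hb 0
    rw [iteratedDeriv_zero] at hC
    refine (hu.1.smul_of_le hθ.continuous hC).ae_eq (Eventually.of_forall fun z => ?_)
    exact smul_comm _ _ _
  · rw [memL2s_zero_iff]
    refine memLp_finsetSum _ fun ij hij => ?_
    have hij' := Finset.HasAntidiagonal.mem_antidiagonal.1 hij
    obtain ⟨C, hC⟩ := hb ij.1
    have := (h.memL2s hu ij.2 b (by omega)).smul_of_le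
      (contDiff_iteratedDeriv hθ _).continuous hC
    refine (this.const_smul (a.choose ij.1 : ℂ)).ae_eq (Eventually.of_forall fun z => ?_)
    simp only [Pi.smul_apply, Nat.cast_smul_eq_nsmul]

end Expression

/-! ### Multiplication by a bounded matrix function -/

section MatMul

variable {q : ℕ}

/-- A bounded measurable function with Hermitian values. -/
structure BddHermitian (Q : ℝ × ℝ → Matrix (Fin q) (Fin q) ℂ) : Prop where
  measurable : ∀ i j, Measurable fun z => Q z i j
  hermitian : ∀ z, (Q z).IsHermitian
  bdd : ∃ C : ℝ, ∀ z i j, ‖Q z i j‖ ≤ C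

theorem BddHermitian.zero : BddHermitian (fun _ => (0 : Matrix (Fin q) (Fin q) ℂ)) :=
  ⟨fun _ _ => measurable_const, fun _ => Matrix.isHermitian_zero, 0, fun _ _ _ => by simp⟩

variable {Q : ℝ × ℝ → Matrix (Fin q) (Fin q) ℂ}

theorem BddHermitian.memLp (hQ : BddHermitian Q) {u : ℝ × ℝ → Fibre q} (hu : MemLp u 2 volume) :
    MemLp (fun z => Matrix.toEuclideanLin (Q z) (u z)) 2 volume := by
  obtain ⟨C, hC⟩ := hQ.bdd
  refine MemLp.of_le_mul hu (c := q * q * C) ?_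
    (Eventually.of_forall fun z => norm_toEuclideanLin_le (hC z) (u z))
  simp only [toEuclideanLin_eq_sum]
  refine Finset.aestronglyMeasurable_fun_sum _ fun i _ =>
    Finset.aestronglyMeasurable_fun_sum _ fun j _ => ?_
  refine AEStronglyMeasurable.smul_const ?_ _
  refine (hQ.measurable i j).aestronglyMeasurable.mul ?_
  exact (EuclideanSpace.proj (𝕜 := ℂ) j).continuous.comp_aestronglyMeasurable hu.1

theorem BddHermitian.mulDomain_eq (hQ : BddHermitian Q) : mulDomain Q = ⊤ :=
  eq_top_iff.2 fun u _ => hQ.memLp (Lp.memLp u)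

theorem inner_toEuclideanLin {M : Matrix (Fin q) (Fin q) ℂ} (hM : M.IsHermitian) (u v : Fibre q) :
    ⟪Matrix.toEuclideanLin M u, v⟫_ℂ = ⟪u, Matrix.toEuclideanLin M v⟫_ℂ :=
  Matrix.isSymmetric_toEuclideanLin_iff.2 hM u v

/-- Multiplication by `Q` as a linear map. -/
def BddHermitian.lin (hQ : BddHermitian Q) : L2Plane q →ₗ[ℂ] L2Plane q :=
  (mulOp Q).toFun ∘ₗ LinearMap.codRestrict (mulDomain Q) LinearMap.id
    fun u => by rw [hQ.mulDomain_eq]; trivial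

theorem BddHermitian.lin_coe (hQ : BddHermitian Q) (u : L2Plane q) :
    hQ.lin u =ᵐ[volume] fun z => Matrix.toEuclideanLin (Q z) (u z) :=
  MemLp.coeFn_toLp (hQ.memLp (Lp.memLp u))

theorem BddHermitian.isSymmetric (hQ : BddHermitian Q) : hQ.lin.IsSymmetric := by
  intro u v
  rw [L2.inner_def, L2.inner_def]
  refine integral_congr_ae ?_
  filter_upwards [hQ.lin_coe u, hQ.lin_coe v] with z hu hv
  rw [hu, hv, inner_toEuclideanLin (hQ.hermitian z)]

/-- Multiplication by `Q` as a bounded operator. -/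
def BddHermitian.clm (hQ : BddHermitian Q) : L2Plane q →L[ℂ] L2Plane q :=
  ⟨hQ.lin, hQ.isSymmetric.continuous⟩

theorem BddHermitian.clm_coe (hQ : BddHermitian Q) (u : L2Plane q) :
    hQ.clm u =ᵐ[volume] fun z => Matrix.toEuclideanLin (Q z) (u z) := hQ.lin_coe u

end MatMul

/-! ### Operators whose commutators with functions of `x` are of finite order -/

section LocalOperator

variable {p q : ℕ}

/-- A self-adjoint operator `A = comm 0` on `L²` such that
`A (θ u) = ∑ₗ θ^{(l)} (comm l u)` for smooth functions `θ` of `x`; `comm k` is, up to the factor `k!`,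
a `k`-fold commutator of `A` with `x`. -/
structure LocalOperator (p q : ℕ) where
  dom : Submodule ℂ (L2Plane q)
  comm : ℕ → dom →ₗ[ℂ] L2Plane q
  selfAdjoint : IsSelfAdjointOn (comm 0)
  comm_bound : ∀ k, ∃ C : ℝ, 0 ≤ C ∧ ∀ u, ‖comm k u‖ ≤ C * (‖comm 0 u‖ + ‖(u : L2Plane q)‖)
  comm_eq_zero : ∀ k, p < k → comm k = 0
  mul_mem : ∀ θ, SmoothBdd θ → ∀ u ∈ dom, mulX θ u ∈ dom
  comm_mul : ∀ k (θ : ℝ → ℂ), ContDiff ℝ ∞ θ → ∀ u v : dom,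
    (∀ᵐ z : ℝ × ℝ, v.1 z = θ z.1 • u.1 z) →
    ∀ᵐ z : ℝ × ℝ, comm k v z = ∑ l ∈ Finset.range (p + 1),
      (((k + l).choose l : ℂ) * iteratedDeriv l θ z.1) • comm (k + l) u z

theorem MemHps.congr {s : ℝ} {u v : ℝ × ℝ → Fibre q} (h : MemHps p s u) (huv : u =ᵐ[volume] v) :
    MemHps p s v := by
  refine ⟨h.1.congr ?_, fun a b hab => ?_⟩
  · filter_upwards [huv] with z hz; rw [hz]
  · obtain ⟨w, hw, hw2⟩ := h.2 a b hab
    exact ⟨w, hw.congr huv (ae_eq_refl _), hw2⟩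

variable {S : ScatteringSystem p q}

theorem ScatteringSystem.HypH1.apply_ae (h1 : S.HypH1) (u : S.H₀.domain)
    {v : ℕ → ℕ → ℝ × ℝ → Fibre q} (hv : WeakFamily p u.1 v) :
    S.H₀ u =ᵐ[volume] commExpr p S.coeff 0 v := by
  obtain ⟨v', hv', h⟩ := h1.apply_eq u
  have h2 := commExpr_congr (c := S.coeff) (k := 0)
    (WeakFamily.ae_eq hv' hv (ae_eq_refl _))
  filter_upwards [h, h2] with z hz hz2
  rw [hz, ← hz2, commExpr_zero]

theorem ScatteringSystem.HypH1.mulX_mem (h1 : S.HypH1) {θ : ℝ → ℂ} (hθ : SmoothBdd θ)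
    {u : L2Plane q} (hu : u ∈ S.H₀.domain) : mulX θ u ∈ S.H₀.domain := by
  obtain ⟨v, hv, -⟩ := h1.apply_eq ⟨u, hu⟩
  have h2 : MemHps p (-0) u := by rw [neg_zero]; exact (h1.mem_domain u).1 hu
  refine (h1.mem_domain _).2 ((WeakFamily.memHps_smul hv h2 hθ.contDiff fun k => ?_).congr
    (mulX_coe hθ.bddMeas u).symm)
  obtain ⟨C, hC⟩ := hθ.bdd k
  exact ⟨C, fun x => by simpa using hC x⟩

/-- `e^{itx}`. -/
def planeWave (t : ℝ) (x : ℝ) : ℂ := Complex.exp (Complex.I * t * x)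

theorem smoothBdd_planeWave (t : ℝ) : SmoothBdd (planeWave t) := smoothBdd_cexp t

theorem planeWave_neg_mul (t x : ℝ) : planeWave (-t) x * planeWave t x = 1 := by
  rw [planeWave, planeWave, ← Complex.exp_add]; simp

theorem iteratedDeriv_planeWave (t : ℝ) (k : ℕ) (x : ℝ) :
    iteratedDeriv k (planeWave t) x = (Complex.I * t) ^ k * planeWave t x := by
  have := iteratedDeriv_cexp_mul (Complex.I * t) k
  exact congrFun this x

/-- Coefficients that recover `a_k` from the values `∑_l (it)^l a_l`, `t = 0, …, p`. -/
def interpCoeff (p : ℕ) : Matrix (Fin (p + 1)) (Fin (p + 1)) ℂ :=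
  (Matrix.vandermonde fun t : Fin (p + 1) => Complex.I * ((t : ℕ) : ℝ))⁻¹

theorem sum_interpCoeff {E : Type*} [AddCommGroup E] [Module ℂ E] (a : ℕ → E) (k : Fin (p + 1)) :
    ∑ t : Fin (p + 1), interpCoeff p k t •
      ∑ l ∈ Finset.range (p + 1), (Complex.I * ((t : ℕ) : ℝ)) ^ l • a l = a k := by
  have hdet : (Matrix.vandermonde fun t : Fin (p + 1) => Complex.I * ((t : ℕ) : ℝ)).det ≠ 0 := by
    rw [Matrix.det_vandermonde_ne_zero_iff]
    intro s t hst
    have : ((s : ℕ) : ℂ) = ((t : ℕ) : ℂ) := by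
      simpa using mul_left_cancel₀ Complex.I_ne_zero hst
    exact Fin.ext (by exact_mod_cast this)
  have hinv : interpCoeff p * (Matrix.vandermonde fun t : Fin (p + 1) => Complex.I * ((t : ℕ) : ℝ))
      = 1 := Matrix.nonsing_inv_mul _ (Ne.isUnit hdet)
  simp only [Finset.sum_range, Finset.smul_sum, smul_smul]
  rw [Finset.sum_comm]
  simp only [← Finset.sum_smul]
  have : ∀ l : Fin (p + 1), ∑ t : Fin (p + 1), interpCoeff p k t *
      (Complex.I * ((t : ℕ) : ℝ)) ^ (l : ℕ) = if k = l then 1 else 0 := fun l => by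
    have := congrFun (congrFun hinv k) l
    rw [Matrix.mul_apply, Matrix.one_apply] at this
    rw [← this]; rfl
  simp only [this, ite_smul, one_smul, zero_smul, Finset.sum_ite_eq, Finset.mem_univ, if_true]

/-- Multiplication by a smooth bounded function of `x` on the domain of `H₀`. -/
def ScatteringSystem.HypH1.mulDom (h1 : S.HypH1) {θ : ℝ → ℂ} (hθ : SmoothBdd θ) :
    S.H₀.domain →ₗ[ℂ] S.H₀.domain :=
  (mulX θ).toLinearMap.restrict fun _ hu => h1.mulX_mem hθ hu

/-- The commutator coefficients of `H₀` as operators. -/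
def ScatteringSystem.HypH1.commLin (h1 : S.HypH1) (k : ℕ) : S.H₀.domain →ₗ[ℂ] L2Plane q :=
  if h : k < p + 1 then ∑ t : Fin (p + 1), interpCoeff p ⟨k, h⟩ t •
    ((mulX (planeWave (-((t : ℕ) : ℝ)))).toLinearMap ∘ₗ S.H₀.toFun ∘ₗ
      h1.mulDom (smoothBdd_planeWave ((t : ℕ) : ℝ)))
  else 0

theorem ScatteringSystem.HypH1.commLin_ae (h1 : S.HypH1) (k : ℕ) (u : S.H₀.domain)
    {v : ℕ → ℕ → ℝ × ℝ → Fibre q} (hv : WeakFamily p u.1 v) :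
    h1.commLin k u =ᵐ[volume] commExpr p S.coeff k v := by
  rw [HypH1.commLin]
  split_ifs with hk
  swap
  · have h2 := Lp.coeFn_zero (Fibre q) 2 (volume : Measure (ℝ × ℝ))
    filter_upwards [h2] with z hz
    rw [commExpr_eq_zero (by omega), LinearMap.zero_apply, hz, Pi.zero_apply]
  have key : ∀ t : Fin (p + 1), ∀ᵐ z : ℝ × ℝ,
      mulX (planeWave (-((t : ℕ) : ℝ)))
        (S.H₀ (h1.mulDom (smoothBdd_planeWave ((t : ℕ) : ℝ)) u)) z =
      ∑ l ∈ Finset.range (p + 1), (Complex.I * ((t : ℕ) : ℝ)) ^ l • commExpr p S.coeff l v z := by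
    intro t
    have hθ := smoothBdd_planeWave ((t : ℕ) : ℝ)
    have h3 : WeakFamily p (h1.mulDom hθ u : L2Plane q) (leibniz (planeWave ((t : ℕ) : ℝ)) v) := by
      intro a b hab
      exact (hv.leibniz hθ.contDiff a b hab).congr (mulX_coe hθ.bddMeas u.1).symm (ae_eq_refl _)
    filter_upwards [h1.apply_ae _ h3, mulX_coe (smoothBdd_planeWave (-((t : ℕ) : ℝ))).bddMeas
      (S.H₀ (h1.mulDom hθ u))] with z hz hz2
    rw [hz2, hz, commExpr_leibniz, Finset.smul_sum]
    refine Finset.sum_congr rfl fun l _ => ?_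
    rw [iteratedDeriv_planeWave, smul_smul, zero_add, Nat.choose_self]
    congr 1
    have := planeWave_neg_mul ((t : ℕ) : ℝ) z.1
    linear_combination (Complex.I * ((t : ℕ) : ℝ)) ^ l * this
  have hae : ∀ᵐ z : ℝ × ℝ, ∀ t : Fin (p + 1), mulX (planeWave (-((t : ℕ) : ℝ)))
        (S.H₀ (h1.mulDom (smoothBdd_planeWave ((t : ℕ) : ℝ)) u)) z =
      ∑ l ∈ Finset.range (p + 1), (Complex.I * ((t : ℕ) : ℝ)) ^ l • commExpr p S.coeff l v z :=
    ae_all_iff.2 key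
  have hsum : (((∑ t : Fin (p + 1), interpCoeff p ⟨k, hk⟩ t •
      ((mulX (planeWave (-((t : ℕ) : ℝ)))).toLinearMap ∘ₗ S.H₀.toFun ∘ₗ
        h1.mulDom (smoothBdd_planeWave ((t : ℕ) : ℝ)))) u : L2Plane q) : ℝ × ℝ → Fibre q)
      =ᵐ[volume] fun z => ∑ t : Fin (p + 1), interpCoeff p ⟨k, hk⟩ t •
        (mulX (planeWave (-((t : ℕ) : ℝ)))
          (S.H₀ (h1.mulDom (smoothBdd_planeWave ((t : ℕ) : ℝ)) u))) z := by
    rw [LinearMap.sum_apply]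
    refine (Lp.coeFn_finsetSum _ _).trans ?_
    have : ∀ᵐ z : ℝ × ℝ, ∀ t : Fin (p + 1), (interpCoeff p ⟨k, hk⟩ t •
        mulX (planeWave (-((t : ℕ) : ℝ)))
          (S.H₀ (h1.mulDom (smoothBdd_planeWave ((t : ℕ) : ℝ)) u)) : L2Plane q) z =
        interpCoeff p ⟨k, hk⟩ t • (mulX (planeWave (-((t : ℕ) : ℝ)))
          (S.H₀ (h1.mulDom (smoothBdd_planeWave ((t : ℕ) : ℝ)) u))) z :=
      ae_all_iff.2 fun t => Lp.coeFn_smul _ _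
    filter_upwards [this] with z hz
    rw [Finset.sum_apply]
    exact Finset.sum_congr rfl fun t _ => hz t
  filter_upwards [hae, hsum] with z hz hz2
  rw [hz2]
  simp only [hz]
  exact sum_interpCoeff (fun l => commExpr p S.coeff l v z) ⟨k, hk⟩

variable {Q : ℝ × ℝ → Matrix (Fin q) (Fin q) ℂ}

/-- `H₀ + Q` and its commutator coefficients. -/
def ScatteringSystem.HypH1.commPert (h1 : S.HypH1) (hQ : BddHermitian Q) :
    ℕ → S.H₀.domain →ₗ[ℂ] L2Plane q
  | 0 => S.H₀.toFun + hQ.clm.toLinearMap ∘ₗ S.H₀.domain.subtype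
  | k + 1 => h1.commLin (k + 1)

theorem ScatteringSystem.HypH1.isSelfAdjointOn (h1 : S.HypH1) (hQ : BddHermitian Q) :
    IsSelfAdjointOn (h1.commPert hQ 0) :=
  isSelfAdjointOn_add h1.selfAdjoint hQ.clm hQ.isSymmetric

theorem IsSelfAdjointOn.exists_bound_conj {D : Submodule ℂ (L2Plane q)} {A : D →ₗ[ℂ] L2Plane q}
    (hA : IsSelfAdjointOn A) (M : L2Plane q →L[ℂ] L2Plane q) (m : D →ₗ[ℂ] D)
    (hm : ∀ u, (m u : L2Plane q) = M u) :
    ∃ C : ℝ, 0 ≤ C ∧ ∀ u : D, ‖A (m u)‖ ≤ C * (‖A u‖ + ‖(u : L2Plane q)‖) := by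
  let g : L2Plane q →ₗ[ℂ] L2Plane q := A ∘ₗ m ∘ₗ hA.resD true
  have hg : Continuous g := by
    refine LinearMap.continuous_of_seq_closed_graph (g := g) fun u x y hu hgu => ?_
    have h1 : Tendsto (fun n => (m (hA.resD true (u n)) : L2Plane q)) atTop
        (𝓝 (M (hA.res true x))) := by
      simp only [hm]
      exact (M.continuous.tendsto _).comp (((hA.res true).continuous.tendsto _).comp hu)
    obtain ⟨hx, h2⟩ := hA.dom_closed (b := true) h1 hgu
    rw [← h2]
    exact congrArg A (Subtype.ext (hm _).symm)
  let G : L2Plane q →L[ℂ] L2Plane q := ⟨g, hg⟩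
  refine ⟨‖G‖, norm_nonneg _, fun u => ?_⟩
  have h1 : A (m u) = G (A u - imUnit true • (u : L2Plane q)) :=
    congrArg (fun w => A (m w)) (hA.resD_apply true u).symm
  rw [h1]
  refine (G.le_opNorm _).trans (mul_le_mul_of_nonneg_left ?_ (norm_nonneg _))
  refine (norm_sub_le _ _).trans ?_
  rw [norm_smul, norm_imUnit, one_mul]

/-- `H₀ + Q` as a local operator. -/
def ScatteringSystem.HypH1.localOperator (h1 : S.HypH1) (hQ : BddHermitian Q) :
    LocalOperator p q where
  dom := S.H₀.domain
  comm := h1.commPert hQ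
  selfAdjoint := h1.isSelfAdjointOn hQ
  comm_bound := by
    intro k
    rcases k with _ | k
    · exact ⟨1, zero_le_one, fun u => by rw [one_mul]; exact le_add_of_nonneg_right (norm_nonneg _)⟩
    change ∃ C : ℝ, 0 ≤ C ∧ ∀ u, ‖h1.commLin (k + 1) u‖ ≤ _
    have hA := h1.isSelfAdjointOn hQ
    have key : ∀ t : Fin (p + 1), ∃ C : ℝ, 0 ≤ C ∧ ∀ u : S.H₀.domain,
        ‖S.H₀.toFun (h1.mulDom (smoothBdd_planeWave ((t : ℕ) : ℝ)) u)‖ ≤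
          C * (‖h1.commPert hQ 0 u‖ + ‖(u : L2Plane q)‖) := by
      intro t
      have hθ := smoothBdd_planeWave ((t : ℕ) : ℝ)
      obtain ⟨C, hC0, hC⟩ := hA.exists_bound_conj (mulX (planeWave ((t : ℕ) : ℝ)))
        (h1.mulDom hθ) fun u => rfl
      let M : L2Plane q →L[ℂ] L2Plane q := hQ.clm ∘L mulX (planeWave ((t : ℕ) : ℝ))
      refine ⟨C + ‖M‖, by positivity, fun u => ?_⟩
      have h2 : S.H₀.toFun (h1.mulDom hθ u) = h1.commPert hQ 0 (h1.mulDom hθ u) - M u := by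
        rw [eq_sub_iff_add_eq]; rfl
      rw [h2]
      refine (norm_sub_le _ _).trans ?_
      have h3 := M.le_opNorm u
      have h4 := hC u
      have h5 := norm_nonneg M
      have h6 := norm_nonneg (h1.commPert hQ 0 u)
      nlinarith
    choose C hC0 hC using key
    by_cases hk : k + 1 < p + 1
    swap
    · refine ⟨0, le_rfl, fun u => ?_⟩
      rw [HypH1.commLin, dif_neg hk]; simp
    refine ⟨∑ t : Fin (p + 1), ‖interpCoeff p ⟨k + 1, hk⟩ t‖ *
      (‖(mulX (planeWave (-((t : ℕ) : ℝ))) : L2Plane q →L[ℂ] L2Plane q)‖ * C t),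
      Finset.sum_nonneg fun t _ => mul_nonneg (norm_nonneg _)
        (mul_nonneg (norm_nonneg _) (hC0 t)), fun u => ?_⟩
    rw [HypH1.commLin, dif_pos hk, LinearMap.sum_apply, Finset.sum_mul]
    refine (norm_sum_le _ _).trans (Finset.sum_le_sum fun t _ => ?_)
    rw [LinearMap.smul_apply, norm_smul, mul_assoc, mul_assoc]
    refine mul_le_mul_of_nonneg_left ?_ (norm_nonneg _)
    refine (ContinuousLinearMap.le_opNorm _ _).trans ?_
    exact mul_le_mul_of_nonneg_left (hC t u) (norm_nonneg _)
  comm_eq_zero := by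
    intro k hk
    rcases k with _ | k
    · omega
    · change h1.commLin (k + 1) = 0
      rw [HypH1.commLin, dif_neg (by omega)]
  mul_mem := fun θ hθ u hu => h1.mulX_mem hθ hu
  comm_mul := by
    intro k θ hθ u v huv
    obtain ⟨f, hf, -⟩ := h1.apply_eq u
    have hfv : WeakFamily p (v : L2Plane q) (leibniz θ f) := fun a b hab =>
      (WeakFamily.leibniz hθ hf a b hab).congr (huv.mono fun z hz => hz.symm) (ae_eq_refl _)
    have hl : ∀ᵐ z : ℝ × ℝ, ∀ l, h1.commLin l u z = commExpr p S.coeff l f z :=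
      ae_all_iff.2 fun l => h1.commLin_ae l u hf
    rcases k with _ | k
    · filter_upwards [h1.apply_ae v hfv, h1.apply_ae u hf, hl, huv,
        Lp.coeFn_add (S.H₀ u) (hQ.clm u), Lp.coeFn_add (S.H₀ v) (hQ.clm v), hQ.clm_coe u,
        hQ.clm_coe v] with z h2 h3 h4 h5 h6 h7 h8 h9
      change (S.H₀ v + hQ.clm v : L2Plane q) z = _
      rw [h7, Pi.add_apply, h2, h9, commExpr_leibniz, Finset.sum_range_succ',
        Finset.sum_range_succ']
      change _ = (∑ l ∈ Finset.range p, _) + (_ : ℂ) • (S.H₀ u + hQ.clm u : L2Plane q) z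
      rw [h6, Pi.add_apply, h3, h8, h5, add_assoc]
      congr 1
      · refine Finset.sum_congr rfl fun l _ => ?_
        congr 1
        rw [← h4 (0 + (l + 1)), zero_add]; rfl
      · simp [smul_add]
    · filter_upwards [h1.commLin_ae (k + 1) v hfv, hl] with z h2 h3
      change h1.commLin (k + 1) v z = _
      rw [h2, commExpr_leibniz]
      refine Finset.sum_congr rfl fun l _ => ?_
      congr 1
      rw [← h3, show k + 1 + l = (k + l) + 1 by ring]; rfl

/-- `w ∈ D(A)` is `(1 + iεx)⁻¹ ψ` for a generalized eigenfunction `ψ` of `A` with energy `e`. -/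
def LocalOperator.GenEig (L : LocalOperator p q) (ε : ℝ) (w : L.dom) (e : ℝ) : Prop :=
  L.comm 0 w = (e : ℂ) • (w : L2Plane q) - (Complex.I * ε) • mulX (wp ε (-1)) (L.comm 1 w)

theorem exists_norm_iteratedDeriv_wp_neg_one_le {ε : ℝ} (hε : ε ≠ 0) (k : ℕ) :
    ∃ C, ∀ x, ‖iteratedDeriv k (wp ε (-1)) x‖ ≤ C * bracket x ^ (-(1 : ℝ)) := by
  set K := ‖(∏ i ∈ Finset.range k, (((-1 : ℤ) : ℂ) - i)) * (Complex.I * ε) ^ k‖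
  have hm : 0 < min 1 |ε| := lt_min one_pos (abs_pos.2 hε)
  refine ⟨K * (min 1 |ε|)⁻¹, fun x => ?_⟩
  rw [iteratedDeriv_wp, norm_mul, mul_assoc]
  refine mul_le_mul_of_nonneg_left ?_ (norm_nonneg _)
  have h1 := one_le_norm_wp_one ε x
  have h2 : ‖wp ε (-1 - (k : ℤ)) x‖ ≤ ‖wp ε 1 x‖⁻¹ := by
    rw [norm_wp, ← zpow_neg_one]
    exact zpow_le_zpow_right₀ h1 (by omega)
  refine h2.trans ?_
  rw [Real.rpow_neg_one, ← mul_inv]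
  refine inv_anti₀ (mul_pos hm (bracket_pos x)) ?_
  rw [norm_wp_one, bracket]
  refine Real.le_sqrt_of_sq_le ?_
  rw [mul_pow, Real.sq_sqrt (by positivity)]
  have h3 : min 1 |ε| ^ 2 ≤ 1 := pow_le_one₀ hm.le (min_le_left _ _)
  have h4 : min 1 |ε| ^ 2 ≤ ε ^ 2 := by
    rw [← sq_abs ε]; exact pow_le_pow_left₀ hm.le (min_le_right _ _) 2
  nlinarith [sq_nonneg x]

theorem ScatteringSystem.HypH1.exists_genEig (h1 : S.HypH1) (hQ : BddHermitian Q) {ε : ℝ}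
    (hε : ε ≠ 0) {ψ : ℝ × ℝ → Fibre q} {e : ℝ} (hψ : MemHps p (-1) ψ)
    (he : DiffExprApply p S.coeff ψ fun z => (e : ℂ) • ψ z - Matrix.toEuclideanLin (Q z) (ψ z)) :
    ∃ w : (h1.localOperator hQ).dom, (∀ᵐ z : ℝ × ℝ, w.1 z = wp ε (-1) z.1 • ψ z) ∧
      (h1.localOperator hQ).GenEig ε w e := by
  obtain ⟨v, hv, hev⟩ := he
  have hmem := WeakFamily.memHps_smul hv hψ (contDiff_wp ε (-1))
    (exists_norm_iteratedDeriv_wp_neg_one_le hε)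
  have hLp : MemLp (fun z : ℝ × ℝ => wp ε (-1) z.1 • ψ z) 2 volume :=
    memL2s_zero_iff.1 hmem.1.of_bracket_pow
  have hw0 : hLp.toLp _ =ᵐ[volume] fun z : ℝ × ℝ => wp ε (-1) z.1 • ψ z := hLp.coeFn_toLp
  let w : S.H₀.domain := ⟨hLp.toLp _, (h1.mem_domain _).2 (hmem.congr hw0.symm)⟩
  refine ⟨w, hw0, ?_⟩
  have hfw : WeakFamily p (w : L2Plane q) (leibniz (wp ε (-1)) v) := fun a b hab =>
    (WeakFamily.leibniz (contDiff_wp ε (-1)) hv a b hab).congr hw0.symm (ae_eq_refl _)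
  refine Lp.ext ?_
  have hb := (smoothBdd_wp ε (a := -1) (by norm_num)).bddMeas
  filter_upwards [h1.apply_ae w hfw, h1.commLin_ae 1 w hfw, hw0, hev,
    Lp.coeFn_add (S.H₀ w) (hQ.clm w), hQ.clm_coe w,
    Lp.coeFn_sub ((e : ℂ) • (w : L2Plane q)) ((Complex.I * ε) • mulX (wp ε (-1)) (h1.commLin 1 w)),
    Lp.coeFn_smul (e : ℂ) (w : L2Plane q),
    Lp.coeFn_smul (Complex.I * ε) (mulX (wp ε (-1)) (h1.commLin 1 w)),
    mulX_coe hb (h1.commLin 1 w)] with z h2 h3 h4 h5 h6 h7 h8 h9 h10 h11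
  change (S.H₀ w + hQ.clm w : L2Plane q) z =
    ((e : ℂ) • (w : L2Plane q) - (Complex.I * ε) • mulX (wp ε (-1)) (h1.commLin 1 w) : L2Plane q) z
  change (w : L2Plane q) z = _ at h4
  rw [← commExpr_zero] at h5
  rw [h6, Pi.add_apply, h8, Pi.sub_apply, h9, h10, Pi.smul_apply, Pi.smul_apply, h11, h7, h2, h3,
    commExpr_leibniz, commExpr_leibniz, Finset.sum_range_succ', Finset.sum_range_succ, h4,
    commExpr_eq_zero (show p < 1 + p by omega), ← h5]
  have hs : ∑ l ∈ Finset.range p, (((0 + (l + 1)).choose (l + 1) : ℂ) *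
        iteratedDeriv (l + 1) (wp ε (-1)) z.1) • commExpr p S.coeff (0 + (l + 1)) v z =
      -((Complex.I * ε) • wp ε (-1) z.1 • ∑ l ∈ Finset.range p, (((1 + l).choose l : ℂ) *
        iteratedDeriv l (wp ε (-1)) z.1) • commExpr p S.coeff (1 + l) v z) := by
    rw [Finset.smul_sum, Finset.smul_sum, ← Finset.sum_neg_distrib]
    refine Finset.sum_congr rfl fun l _ => ?_
    rw [show 0 + (l + 1) = 1 + l by ring, show l + 1 = 1 + l by ring, Nat.choose_self, smul_smul,
      smul_smul, ← neg_smul]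
    congr 1
    simp only [iteratedDeriv_wp]
    have hch : (1 + l).choose l = l + 1 := by
      rw [add_comm 1 l]; simp
    have hw : wp ε (-1) z.1 * wp ε (-1 - (l : ℤ)) z.1 = wp ε (-1 - ((1 + l : ℕ) : ℤ)) z.1 := by
      rw [wp_mul]; congr 1; push_cast; ring
    rw [hch, ← hw, add_comm 1 l, Finset.prod_range_succ, pow_succ]
    push_cast; ring
  rw [hs]
  simp only [map_smul, iteratedDeriv_zero, Nat.choose_self, Nat.cast_one, one_mul,
    smul_zero, add_zero, smul_sub, smul_comm (e : ℂ)]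
  abel

end LocalOperator

/-! ### Resolvents conjugated with powers of `1 + iεx` -/

section Conjugation

variable {p q : ℕ}

theorem mulX_denseRange {f : ℝ → ℂ} (hf : BddMeas f) (h0 : ∀ x, f x ≠ 0) :
    DenseRange (mulX f : L2Plane q → L2Plane q) := by
  have h1 : (LinearMap.range (mulX f : L2Plane q →L[ℂ] L2Plane q).toLinearMap)ᗮ = ⊥ := by
    refine (Submodule.eq_bot_iff _).2 fun u hu => ?_
    refine mulX_injective hf.star (fun x => by simpa using h0 x) ?_
    rw [map_zero, ← inner_self_eq_zero (𝕜 := ℂ), inner_mulX_left hf.star]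
    simp only [RingHomCompTriple.comp_apply, RingHom.id_apply]
    exact (Submodule.mem_orthogonal' _ _).1 hu _ ⟨_, rfl⟩
  have h2 := Submodule.topologicalClosure_eq_top_iff.2 h1
  have h3 : Dense ((LinearMap.range (mulX f : L2Plane q →L[ℂ] L2Plane q).toLinearMap :
    Submodule ℂ (L2Plane q)) : Set (L2Plane q)) := Submodule.dense_iff_topologicalClosure_eq_top.2 h2
  exact h3

theorem eq_of_mulX_comp_eq {f : ℝ → ℂ} (hf : BddMeas f) (h0 : ∀ x, f x ≠ 0) {E : Type*}
    [TopologicalSpace E] [T2Space E] {A B : L2Plane q → E} (hA : Continuous A) (hB : Continuous B)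
    (h : ∀ u, A (mulX f u) = B (mulX f u)) : A = B :=
  (mulX_denseRange hf h0).equalizer hA hB (funext h)

namespace LocalOperator

variable (L : LocalOperator p q)

/-- The operator `comm k (A ∓ i)⁻¹`. -/
def commRes (k : ℕ) (b : Bool) : L2Plane q →L[ℂ] L2Plane q :=
  LinearMap.mkContinuousOfExistsBound (L.comm k ∘ₗ L.selfAdjoint.resD b) (by
    obtain ⟨C, hC0, hC⟩ := L.comm_bound k
    exact ⟨2 * C, fun f => L.selfAdjoint.res_comp_bounded hC hC0 b f⟩)

theorem commRes_apply (k : ℕ) (b : Bool) (f : L2Plane q) :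
    L.commRes k b f = L.comm k (L.selfAdjoint.resD b f) := rfl

theorem commRes_sub (k : ℕ) (b : Bool) (u : L.dom) :
    L.commRes k b (L.comm 0 u - imUnit b • (u : L2Plane q)) = L.comm k u := by
  rw [commRes_apply, L.selfAdjoint.resD_apply]

/-- `θ^{(l)} / θ` for `θ = (1 + iεx)^a`. -/
def logDeriv (ε : ℝ) (a : ℤ) (l : ℕ) (x : ℝ) : ℂ :=
  iteratedDeriv l (wp ε a) x * wp ε (-a) x

theorem bddMeas_logDeriv (ε : ℝ) (a : ℤ) (l : ℕ) : BddMeas (logDeriv ε a l) := by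
  refine ⟨(((contDiff_iteratedDeriv (contDiff_wp ε a) l).continuous.mul
    (contDiff_wp ε (-a)).continuous)).measurable, ?_⟩
  refine ⟨‖(∏ i ∈ Finset.range l, ((a : ℂ) - i)) * (Complex.I * ε) ^ l‖, fun x => ?_⟩
  rw [logDeriv, iteratedDeriv_wp, mul_assoc, wp_mul, norm_mul]
  exact mul_le_of_le_one_right (norm_nonneg _) (norm_wp_le_one ε (by omega) x)

/-- `(1 + iεx)^{-a} (A ∓ i) (1 + iεx)^a = (1 + conjPert) (A ∓ i)`. -/
def conjPert (ε : ℝ) (a : ℤ) (b : Bool) : L2Plane q →L[ℂ] L2Plane q :=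
  ∑ l ∈ Finset.range p, mulX (logDeriv ε a (l + 1)) ∘L L.commRes (l + 1) b

theorem exists_norm_conjPert_le (a : ℤ) (b : Bool) :
    ∃ C : ℝ, 0 ≤ C ∧ ∀ ε : ℝ, |ε| ≤ 1 → ‖L.conjPert ε a b‖ ≤ C * |ε| := by
  choose! C hC0 hC using fun k (hk : 1 ≤ k) => exists_norm_iteratedDeriv_wp_le a k hk
  refine ⟨∑ l ∈ Finset.range p, C (l + 1) * ‖L.commRes (l + 1) b‖,
    Finset.sum_nonneg fun l _ => mul_nonneg (hC0 _ (by omega)) (norm_nonneg _), fun ε hε => ?_⟩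
  rw [conjPert, Finset.sum_mul]
  refine (norm_sum_le _ _).trans (Finset.sum_le_sum fun l _ => ?_)
  refine (ContinuousLinearMap.opNorm_comp_le _ _).trans ?_
  rw [mul_right_comm]
  exact mul_le_mul_of_nonneg_right (opNorm_mulX_le (bddMeas_logDeriv ε a _).1
    fun x => hC (l + 1) (by omega) ε hε x) (norm_nonneg _)

/-- The perturbations of the conjugated resolvents are small for weights `(1 + iε'x)^a`,
`|ε'| ≤ ε`, `|a| ≤ 2`. -/
structure Admissible (ε : ℝ) : Prop where
  pos : 0 < ε
  le_one : ε ≤ 1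
  small : ∀ ε' : ℝ, |ε'| ≤ ε → ∀ a : ℤ, |a| ≤ 2 → ∀ b, ‖L.conjPert ε' a b‖ ≤ 1 / 2

theorem exists_admissible : ∃ ε, L.Admissible ε := by
  choose C hC0 hC using fun a b => L.exists_norm_conjPert_le a b
  set K : ℝ := ∑ a ∈ Finset.Icc (-2 : ℤ) 2, ∑ b : Bool, C a b with hK
  have hK0 : 0 ≤ K := Finset.sum_nonneg fun a _ => Finset.sum_nonneg fun b _ => hC0 a b
  have hle : ∀ a ∈ Finset.Icc (-2 : ℤ) 2, ∀ b, C a b ≤ K := fun a ha b =>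
    (Finset.single_le_sum (fun b _ => hC0 a b) (Finset.mem_univ b)).trans
      (Finset.single_le_sum (f := fun a => ∑ b : Bool, C a b)
        (fun a _ => Finset.sum_nonneg fun b _ => hC0 a b) ha)
  have hε : (2 * (K + 1))⁻¹ ≤ 1 := inv_le_one_of_one_le₀ (by linarith)
  refine ⟨(2 * (K + 1))⁻¹, by positivity, hε, fun ε' h a ha b => ?_⟩
  refine (hC a b ε' (h.trans hε)).trans ?_
  have h1 := hle a (Finset.mem_Icc.2 (abs_le.1 ha)) b
  calc C a b * |ε'| ≤ (K + 1) * (2 * (K + 1))⁻¹ :=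
        mul_le_mul (by linarith) h (abs_nonneg _) (by linarith)
    _ = 1 / 2 := by field_simp

/-- The weighted operator identity behind the conjugation. -/
theorem sub_eq_wp_smul (ε : ℝ) (a : ℤ) (b : Bool) {u v : L.dom}
    (h : ∀ᵐ z : ℝ × ℝ, u.1 z = wp ε a z.1 • v.1 z) :
    ∀ᵐ z : ℝ × ℝ, (L.comm 0 u - imUnit b • (u : L2Plane q)) z = wp ε a z.1 •
      ((1 + L.conjPert ε a b) (L.comm 0 v - imUnit b • (v : L2Plane q))) z := by
  set g := L.comm 0 v - imUnit b • (v : L2Plane q) with hg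
  have hK : ((L.conjPert ε a b g : L2Plane q) : ℝ × ℝ → Fibre q) =ᵐ[volume]
      fun z => ∑ l ∈ Finset.range p, logDeriv ε a (l + 1) z.1 • L.comm (l + 1) v z := by
    have h1 : L.conjPert ε a b g = ∑ l ∈ Finset.range p, mulX (logDeriv ε a (l + 1))
        (L.comm (l + 1) v) := by
      rw [conjPert, sum_apply]
      refine Finset.sum_congr rfl fun l _ => ?_
      rw [ContinuousLinearMap.comp_apply, hg, commRes_sub]
    rw [h1]
    refine (Lp.coeFn_finsetSum _ _).trans ?_
    have h2 : ∀ᵐ z : ℝ × ℝ, ∀ l, mulX (logDeriv ε a (l + 1)) (L.comm (l + 1) v) z =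
        logDeriv ε a (l + 1) z.1 • L.comm (l + 1) v z :=
      ae_all_iff.2 fun l => mulX_coe (bddMeas_logDeriv ε a (l + 1)) _
    filter_upwards [h2] with z hz
    rw [Finset.sum_apply]
    exact Finset.sum_congr rfl fun l _ => hz l
  filter_upwards [hK, L.comm_mul 0 (wp ε a) (contDiff_wp ε a) v u h, h,
    Lp.coeFn_sub (L.comm 0 u) (imUnit b • (u : L2Plane q)), Lp.coeFn_smul (imUnit b) (u : L2Plane q),
    Lp.coeFn_sub (L.comm 0 v) (imUnit b • (v : L2Plane q)), Lp.coeFn_smul (imUnit b) (v : L2Plane q),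
    Lp.coeFn_add g (L.conjPert ε a b g)] with z h1 h2 h3 h4 h5 h6 h7 h8
  have h9 : ((1 + L.conjPert ε a b) g : L2Plane q) = g + L.conjPert ε a b g := by simp
  rw [h9, h8, Pi.add_apply, h1, h6, h4, Pi.sub_apply, Pi.sub_apply, h5, h7, Pi.smul_apply,
    Pi.smul_apply, h2, h3, Finset.sum_range_succ', smul_add, Finset.smul_sum]
  have h10 : ∀ l ∈ Finset.range p, (((0 + (l + 1)).choose (l + 1) : ℂ) *
      iteratedDeriv (l + 1) (wp ε a) z.1) • L.comm (0 + (l + 1)) v z =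
      wp ε a z.1 • logDeriv ε a (l + 1) z.1 • L.comm (l + 1) v z := fun l _ => by
    rw [zero_add, Nat.choose_self, smul_smul, logDeriv]
    congr 1
    have : wp ε a z.1 * wp ε (-a) z.1 = 1 := by rw [wp_mul, add_neg_cancel, wp_zero]
    push_cast
    linear_combination -(iteratedDeriv (l + 1) (wp ε a) z.1) * this
  rw [Finset.sum_congr rfl h10]
  simp only [iteratedDeriv_zero, zero_add, Nat.choose_self, Nat.cast_one, one_mul, smul_sub,
    smul_comm (wp ε a z.1) (imUnit b)]
  abel

/-- The conjugated resolvent `(1 + iεx)^{-a} (A ∓ i)⁻¹ (1 + iεx)^a`, with values in the domain. -/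
def cresD (ε : ℝ) (a : ℤ) (b : Bool) : L2Plane q →ₗ[ℂ] L.dom :=
  L.selfAdjoint.resD b ∘ₗ (Ring.inverse (1 + L.conjPert ε a b)).toLinearMap

/-- The conjugated resolvent as a bounded operator. -/
def cres (ε : ℝ) (a : ℤ) (b : Bool) : L2Plane q →L[ℂ] L2Plane q :=
  L.selfAdjoint.res b ∘L Ring.inverse (1 + L.conjPert ε a b)

theorem cres_apply (ε : ℝ) (a : ℤ) (b : Bool) (f : L2Plane q) :
    L.cres ε a b f = L.cresD ε a b f := rfl

variable {L} {ε₀ : ℝ} (hε₀ : L.Admissible ε₀) {ε : ℝ} (hε : |ε| ≤ ε₀) {a : ℤ} (ha : |a| ≤ 2)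
include hε₀ hε ha

theorem Admissible.isUnit (b : Bool) : IsUnit (1 + L.conjPert ε a b) := by
  have h := hε₀.small ε hε a ha b
  have := isUnit_one_sub_of_norm_lt_one (x := -L.conjPert ε a b) (by rw [norm_neg]; linarith)
  rwa [sub_neg_eq_add] at this

theorem Admissible.mul_inverse (b : Bool) (f : L2Plane q) :
    (1 + L.conjPert ε a b) (Ring.inverse (1 + L.conjPert ε a b) f) = f := by
  have := Ring.mul_inverse_cancel _ (hε₀.isUnit hε ha b)
  exact congrArg (fun T : L2Plane q →L[ℂ] L2Plane q => T f) this

theorem Admissible.inverse_mul (b : Bool) (f : L2Plane q) :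
    Ring.inverse (1 + L.conjPert ε a b) ((1 + L.conjPert ε a b) f) = f := by
  have := Ring.inverse_mul_cancel _ (hε₀.isUnit hε ha b)
  exact congrArg (fun T : L2Plane q →L[ℂ] L2Plane q => T f) this

theorem Admissible.norm_inverse_le (b : Bool) (f : L2Plane q) :
    ‖Ring.inverse (1 + L.conjPert ε a b) f‖ ≤ 2 * ‖f‖ := by
  set g := Ring.inverse (1 + L.conjPert ε a b) f with hg
  have h1 : g + L.conjPert ε a b g = f := hε₀.mul_inverse hε ha b f
  have h2 : ‖L.conjPert ε a b g‖ ≤ 1 / 2 * ‖g‖ := (ContinuousLinearMap.le_opNorm _ _).trans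
    (mul_le_mul_of_nonneg_right (hε₀.small ε hε a ha b) (norm_nonneg _))
  have h3 : ‖g‖ ≤ ‖f‖ + ‖L.conjPert ε a b g‖ := by
    rw [← h1]
    have := norm_sub_le (g + L.conjPert ε a b g) (L.conjPert ε a b g)
    rwa [add_sub_cancel_right] at this
  linarith

theorem Admissible.norm_cres_sub_le (b : Bool) (f : L2Plane q) :
    ‖L.cres ε a b f - L.selfAdjoint.res b f‖ ≤ 2 * ‖L.conjPert ε a b‖ * ‖f‖ := by
  set g := Ring.inverse (1 + L.conjPert ε a b) f with hg
  have h1 : g + L.conjPert ε a b g = f := hε₀.mul_inverse hε ha b f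
  have h2 : L.cres ε a b f - L.selfAdjoint.res b f =
      -L.selfAdjoint.res b (L.conjPert ε a b g) := by
    rw [show L.cres ε a b f = L.selfAdjoint.res b g from rfl, ← h1, map_add]; abel
  rw [h2, norm_neg]
  refine (L.selfAdjoint.norm_resD_le b _).trans ?_
  refine (ContinuousLinearMap.le_opNorm _ _).trans ?_
  have := hε₀.norm_inverse_le hε ha b f
  have h3 := norm_nonneg (L.conjPert ε a b)
  nlinarith

/-- `(A ∓ i)⁻¹ (1 + iεx)^a = (1 + iεx)^a cres` for `a ≤ 0`. -/
theorem Admissible.res_mulX (ha0 : a ≤ 0) (b : Bool) (f : L2Plane q) :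
    L.selfAdjoint.res b (mulX (wp ε a) f) = mulX (wp ε a) (L.cres ε a b f) := by
  have hθ := smoothBdd_wp ε ha0
  set v := L.cresD ε a b f with hv
  let u : L.dom := ⟨mulX (wp ε a) v, L.mul_mem _ hθ _ v.2⟩
  have h1 := L.sub_eq_wp_smul ε a b (u := u) (v := v) (mulX_coe hθ.bddMeas _)
  rw [hv, cresD, LinearMap.comp_apply, L.selfAdjoint.resD_spec] at h1
  have h2 : (1 + L.conjPert ε a b) ((Ring.inverse (1 + L.conjPert ε a b)).toLinearMap f) = f :=
    hε₀.mul_inverse hε ha b f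
  rw [h2] at h1
  have h3 := eq_mulX hθ.bddMeas h1
  have h4 := L.selfAdjoint.resD_eq h3
  rw [L.selfAdjoint.res_apply, h4]
  rfl

/-- `(1 + iεx)^{-a} (A ∓ i)⁻¹ = cres (1 + iεx)^{-a}` for `a ≥ 0`. -/
theorem Admissible.mulX_res (ha0 : 0 ≤ a) (b : Bool) (f : L2Plane q) :
    mulX (wp ε (-a)) (L.selfAdjoint.res b f) = L.cres ε a b (mulX (wp ε (-a)) f) := by
  have hθ := smoothBdd_wp ε (a := -a) (by omega)
  set u := L.selfAdjoint.resD b f with hu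
  let v : L.dom := ⟨mulX (wp ε (-a)) u, L.mul_mem _ hθ _ u.2⟩
  have h0 : ∀ᵐ z : ℝ × ℝ, u.1 z = wp ε a z.1 • v.1 z := by
    filter_upwards [mulX_coe hθ.bddMeas (u : L2Plane q)] with z hz
    change _ = wp ε a z.1 • (mulX (wp ε (-a)) (u : L2Plane q) z)
    rw [hz, smul_smul, wp_mul, add_neg_cancel, wp_zero, one_smul]
  have h1 := L.sub_eq_wp_smul ε a b h0
  rw [hu, L.selfAdjoint.resD_spec] at h1
  have h2 : (1 + L.conjPert ε a b) (L.comm 0 v - imUnit b • (v : L2Plane q)) =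
      mulX (wp ε (-a)) f := by
    refine eq_mulX hθ.bddMeas ?_
    filter_upwards [h1] with z hz
    rw [hz, smul_smul, wp_mul, neg_add_cancel, wp_zero, one_smul]
  rw [cres_apply, cresD, LinearMap.comp_apply]
  have h3 : (Ring.inverse (1 + L.conjPert ε a b)).toLinearMap (mulX (wp ε (-a)) f) =
      L.comm 0 v - imUnit b • (v : L2Plane q) := by
    rw [← h2]; exact hε₀.inverse_mul hε ha b _
  rw [h3, L.selfAdjoint.resD_apply]
  rfl

theorem Admissible.inner_cres_left (ha0 : a ≤ 0) (b : Bool) (f g : L2Plane q) :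
    ⟪L.cres ε a b f, g⟫_ℂ = ⟪f, L.cres (-ε) (-a) (!b) g⟫_ℂ := by
  have hθ := smoothBdd_wp ε ha0
  have hθ' := smoothBdd_wp (-ε) ha0
  have hconj : (fun x => starRingEnd ℂ (wp ε a x)) = wp (-ε) a := funext fun x => conj_wp ε a x
  refine congrFun (eq_of_mulX_comp_eq (A := fun g => ⟪L.cres ε a b f, g⟫_ℂ)
    (B := fun g => ⟪f, L.cres (-ε) (-a) (!b) g⟫_ℂ) hθ'.bddMeas (wp_ne_zero (-ε) a)
    (by fun_prop) (by fun_prop) fun u => ?_) g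
  have h1 := hε₀.mulX_res (ε := -ε) (a := -a) (by rwa [abs_neg]) (by rwa [abs_neg]) (by omega)
    (!b) u
  rw [neg_neg] at h1
  change ⟪_, _⟫_ℂ = ⟪_, _⟫_ℂ
  rw [← h1, ← hconj, ← inner_mulX_left hθ.bddMeas, ← inner_mulX_left hθ.bddMeas,
    ← hε₀.res_mulX hε ha ha0, L.selfAdjoint.inner_res_left]

omit ha in
/-- Weighted generalized eigenfunctions are eigenvectors of the conjugated resolvent. -/
theorem Admissible.cres_genEig {w : L.dom} {e : ℝ} (hw : L.GenEig ε w e) (b : Bool) :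
    L.cres ε 1 b w = ((e : ℂ) - imUnit b)⁻¹ • (w : L2Plane q) := by
  have ha : |(1 : ℤ)| ≤ 2 := by norm_num
  have h1 : (1 + L.conjPert ε 1 b) (L.comm 0 w - imUnit b • (w : L2Plane q)) =
      ((e : ℂ) - imUnit b) • (w : L2Plane q) := by
    have h2 : L.conjPert ε 1 b (L.comm 0 w - imUnit b • (w : L2Plane q)) =
        (Complex.I * ε) • mulX (wp ε (-1)) (L.comm 1 w) := by
      rw [conjPert, sum_apply]
      simp only [ContinuousLinearMap.comp_apply, commRes_sub]
      have h3 : ∀ l, logDeriv ε 1 (l + 1) = fun x => if l = 0 then (Complex.I * ε) * wp ε (-1) x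
          else 0 := fun l => by
        funext x
        rw [logDeriv, iteratedDeriv_wp]
        rcases l with _ | l
        · simp [wp_zero]
        · rw [Finset.prod_eq_zero (i := 1) (Finset.mem_range.2 (by omega)) (by simp)]; simp
      simp only [h3]
      rcases Nat.eq_zero_or_pos p with hp | hp
      · have : L.comm 1 = 0 := L.comm_eq_zero 1 (by omega)
        subst hp
        simp [this]
      · rw [Finset.sum_eq_single_of_mem 0 (Finset.mem_range.2 hp)]
        · simp only [if_true]
          exact mulX_const_mul (smoothBdd_wp ε (a := -1) (by norm_num)).bddMeas _ _
        · intro l _ hl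
          simp only [if_neg hl]
          exact mulX_zero _
    have h4 : (1 + L.conjPert ε 1 b) (L.comm 0 w - imUnit b • (w : L2Plane q)) =
      (L.comm 0 w - imUnit b • (w : L2Plane q)) +
        L.conjPert ε 1 b (L.comm 0 w - imUnit b • (w : L2Plane q)) := by simp
    rw [h4, h2, hw, sub_smul]
    abel
  have h5 := hε₀.inverse_mul hε ha b (L.comm 0 w - imUnit b • (w : L2Plane q))
  rw [h1, map_smul] at h5
  have hne := ofReal_sub_imUnit_ne_zero e b
  have h6 : Ring.inverse (1 + L.conjPert ε 1 b) (w : L2Plane q) =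
      ((e : ℂ) - imUnit b)⁻¹ • (L.comm 0 w - imUnit b • (w : L2Plane q)) := by
    rw [← h5, smul_smul, inv_mul_cancel₀ hne, one_smul]
  rw [cres, ContinuousLinearMap.comp_apply, h6, map_smul, L.selfAdjoint.res_apply,
    L.selfAdjoint.resD_apply]

omit ha in
theorem Admissible.inner_genEig_cres {w : L.dom} {e : ℝ} (hw : L.GenEig ε w e) (b : Bool)
    (f : L2Plane q) : ⟪(w : L2Plane q), L.cres (-ε) (-1) b f⟫_ℂ =
      ((e : ℂ) - imUnit b)⁻¹ * ⟪(w : L2Plane q), f⟫_ℂ := by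
  have h1 := hε₀.inner_cres_left (ε := -ε) (a := -1) (by rwa [abs_neg]) (by norm_num)
    (by norm_num) b f w
  rw [neg_neg, neg_neg, hε₀.cres_genEig hε hw, inner_smul_right] at h1
  rw [← inner_conj_symm, h1, map_mul, inner_conj_symm, map_inv₀, map_sub, conj_imUnit,
    Bool.not_not, Complex.conj_ofReal]

end LocalOperator

end Conjugation

/-! ### Powers of conjugated Cayley transforms -/

section Cayley

variable {p q : ℕ}

theorem opNorm_pow_le {E : Type*} [NormedAddCommGroup E] [NormedSpace ℂ E] {T : E →L[ℂ] E} {K : ℝ}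
    (h : ‖T‖ ≤ K) (n : ℕ) : ‖T ^ n‖ ≤ K ^ n := by
  induction n with
  | zero => rw [pow_zero, pow_zero]; exact ContinuousLinearMap.norm_id_le (𝕜 := ℂ) (E := E)
  | succ n ih =>
    rw [pow_succ, pow_succ]
    exact (ContinuousLinearMap.opNorm_comp_le _ _).trans
      (mul_le_mul ih h (norm_nonneg _) ((norm_nonneg _).trans ih))

namespace LocalOperator

variable (L : LocalOperator p q)

/-- The Cayley transform `(A ± i)(A ∓ i)⁻¹`. -/
def cay (b : Bool) : L2Plane q →L[ℂ] L2Plane q := 1 + (2 * imUnit b) • L.selfAdjoint.res b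

/-- The conjugated Cayley transform. -/
def ccay (ε : ℝ) (a : ℤ) (b : Bool) : L2Plane q →L[ℂ] L2Plane q :=
  1 + (2 * imUnit b) • L.cres ε a b

/-- Integral powers of the Cayley transform. -/
def cayPow (n : ℤ) : L2Plane q →L[ℂ] L2Plane q := L.cay (decide (0 ≤ n)) ^ n.natAbs

/-- Integral powers of the conjugated Cayley transform. -/
def ccayPow (ε : ℝ) (a : ℤ) (n : ℤ) : L2Plane q →L[ℂ] L2Plane q :=
  L.ccay ε a (decide (0 ≤ n)) ^ n.natAbs

theorem cay_apply (b : Bool) (f : L2Plane q) :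
    L.cay b f = f + (2 * imUnit b) • L.selfAdjoint.res b f := by
  simp [cay]

theorem ccay_apply (ε : ℝ) (a : ℤ) (b : Bool) (f : L2Plane q) :
    L.ccay ε a b f = f + (2 * imUnit b) • L.cres ε a b f := by
  simp [ccay]

theorem norm_cay (b : Bool) (f : L2Plane q) : ‖L.cay b f‖ = ‖f‖ := by
  set u := L.selfAdjoint.resD b f with hu
  have h1 := L.selfAdjoint.resD_spec b f
  have h2 : L.cay b f = L.comm 0 u - imUnit (!b) • (u : L2Plane q) := by
    rw [cay_apply, L.selfAdjoint.res_apply, ← hu]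
    nth_rw 1 [← h1]
    rw [imUnit_not, two_mul, add_smul, neg_smul]
    abel
  have h3 := L.selfAdjoint.norm_sq b u
  have h4 := L.selfAdjoint.norm_sq (!b) u
  rw [h1] at h3
  rw [← h2, ← h3] at h4
  exact (pow_left_inj₀ (norm_nonneg _) (norm_nonneg _) two_ne_zero).1 h4

variable {L} {ε₀ : ℝ} (hε₀ : L.Admissible ε₀) {ε : ℝ} (hε : |ε| ≤ ε₀) {a : ℤ} (ha : |a| ≤ 2)
include hε₀ hε ha

theorem Admissible.cay_mulX (ha0 : a ≤ 0) (b : Bool) (f : L2Plane q) :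
    L.cay b (mulX (wp ε a) f) = mulX (wp ε a) (L.ccay ε a b f) := by
  rw [cay_apply, ccay_apply, hε₀.res_mulX hε ha ha0, map_add, map_smul]

theorem Admissible.cay_pow_mulX (ha0 : a ≤ 0) (b : Bool) (n : ℕ) (f : L2Plane q) :
    (L.cay b ^ n) (mulX (wp ε a) f) = mulX (wp ε a) ((L.ccay ε a b ^ n) f) := by
  induction n with
  | zero => simp
  | succ n ih =>
    rw [pow_succ', pow_succ', mul_apply_eq_comp, ih, hε₀.cay_mulX hε ha ha0]; rfl

theorem Admissible.cayPow_mulX (ha0 : a ≤ 0) (n : ℤ) (f : L2Plane q) :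
    L.cayPow n (mulX (wp ε a) f) = mulX (wp ε a) (L.ccayPow ε a n f) :=
  hε₀.cay_pow_mulX hε ha ha0 _ _ f

theorem Admissible.norm_ccay_le (b : Bool) :
    ‖L.ccay ε a b‖ ≤ 1 + 4 * ‖L.conjPert ε a b‖ := by
  refine ContinuousLinearMap.opNorm_le_bound _ (by positivity) fun f => ?_
  have h1 : L.ccay ε a b f = L.cay b f +
      (2 * imUnit b) • (L.cres ε a b f - L.selfAdjoint.res b f) := by
    rw [ccay_apply, cay_apply, smul_sub]; abel
  have h2 := hε₀.norm_cres_sub_le hε ha b f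
  rw [h1]
  refine (norm_add_le _ _).trans ?_
  rw [norm_cay, norm_smul, norm_mul, norm_imUnit]
  simp only [Complex.norm_ofNat, mul_one]
  linarith

omit hε ha in
theorem Admissible.exists_norm_ccay_pow_le (hε : |ε| ≤ ε₀) (ha : |a| ≤ 2) (ha0 : a ≤ 0) (b : Bool) :
    ∃ C : ℝ, 0 ≤ C ∧ ∀ n : ℕ, ‖L.ccay ε a b ^ n‖ ≤ C * (1 + (n : ℝ)) ^ (-a) := by
  obtain ⟨C, hC0, hC⟩ := L.exists_norm_conjPert_le a b
  refine ⟨Real.exp (4 * C), (Real.exp_pos _).le, fun n => ?_⟩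
  set ε' : ℝ := ε / (1 + n) with hε'def
  have hn1 : (1 : ℝ) ≤ 1 + n := by linarith [Nat.cast_nonneg (α := ℝ) n]
  have hn0 : (0 : ℝ) < 1 + n := by linarith
  have habs : |ε'| = |ε| / (1 + n) := by rw [hε'def, abs_div, abs_of_pos hn0]
  have hle : |ε'| ≤ |ε| := by rw [habs]; exact div_le_self (abs_nonneg _) hn1
  have hε' : |ε'| ≤ ε₀ := hle.trans hε
  have hpow : ‖L.ccay ε' a b ^ n‖ ≤ Real.exp (4 * C) := by
    have h1 : ‖L.ccay ε' a b‖ ≤ Real.exp (4 * C / (1 + n)) := by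
      refine (hε₀.norm_ccay_le hε' ha b).trans ?_
      have h2 := hC ε' (hε'.trans hε₀.le_one)
      have h3 : C * |ε'| ≤ C / (1 + n) := by
        rw [habs, ← mul_div_assoc]
        exact div_le_div_of_nonneg_right
          (mul_le_of_le_one_right hC0 (hε.trans hε₀.le_one)) hn0.le
      have h4 := Real.add_one_le_exp (4 * C / (1 + n))
      have h5 : 4 * C / (1 + (n : ℝ)) = 4 * (C / (1 + n)) := by ring
      linarith
    refine (opNorm_pow_le h1 n).trans ?_
    rw [← Real.exp_nat_mul]
    refine Real.exp_le_exp.2 ?_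
    rw [← mul_div_assoc, div_le_iff₀ hn0]
    nlinarith
  have hB : BddMeas fun x => wp ε a x * wp ε' (-a) x := by
    refine ⟨((contDiff_wp ε a).continuous.mul (contDiff_wp ε' (-a)).continuous).measurable,
      1, fun x => ?_⟩
    rw [norm_mul, norm_wp ε a, norm_wp ε' (-a)]
    have h0 : 0 < ‖wp ε 1 x‖ := zero_lt_one.trans_le (one_le_norm_wp_one _ _)
    have h1 : ‖wp ε' 1 x‖ ^ (-a) ≤ ‖wp ε 1 x‖ ^ (-a) :=
      zpow_le_zpow_left₀ (by omega) (norm_nonneg _) (norm_wp_le_of_abs_le hle x)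
    calc ‖wp ε 1 x‖ ^ a * ‖wp ε' 1 x‖ ^ (-a) ≤ ‖wp ε 1 x‖ ^ a * ‖wp ε 1 x‖ ^ (-a) :=
          mul_le_mul_of_nonneg_left h1 (by positivity)
      _ = 1 := by rw [zpow_neg, mul_inv_cancel₀ (by positivity)]
  have hB1 : ∀ x, ‖wp ε a x * wp ε' (-a) x‖ ≤ 1 := by
    intro x
    rw [norm_mul, norm_wp ε a, norm_wp ε' (-a)]
    have h0 : 0 < ‖wp ε 1 x‖ := zero_lt_one.trans_le (one_le_norm_wp_one _ _)
    have h1 : ‖wp ε' 1 x‖ ^ (-a) ≤ ‖wp ε 1 x‖ ^ (-a) :=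
      zpow_le_zpow_left₀ (by omega) (norm_nonneg _) (norm_wp_le_of_abs_le hle x)
    calc ‖wp ε 1 x‖ ^ a * ‖wp ε' 1 x‖ ^ (-a) ≤ ‖wp ε 1 x‖ ^ a * ‖wp ε 1 x‖ ^ (-a) :=
          mul_le_mul_of_nonneg_left h1 (by positivity)
      _ = 1 := by rw [zpow_neg, mul_inv_cancel₀ (by positivity)]
  have hB'1 : ∀ x, ‖wp ε (-a) x * wp ε' a x‖ ≤ (1 + (n : ℝ)) ^ (-a) := by
    intro x
    rw [norm_mul, norm_wp ε (-a), norm_wp ε' a]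
    have h0 : 0 < ‖wp ε' 1 x‖ := zero_lt_one.trans_le (one_le_norm_wp_one _ _)
    have h1 : ‖wp ε 1 x‖ ^ (-a) ≤ ((1 + n) * ‖wp ε' 1 x‖) ^ (-a) :=
      zpow_le_zpow_left₀ (by omega) (norm_nonneg _) (norm_wp_div_le ε hn1 x)
    calc ‖wp ε 1 x‖ ^ (-a) * ‖wp ε' 1 x‖ ^ a
        ≤ ((1 + n) * ‖wp ε' 1 x‖) ^ (-a) * ‖wp ε' 1 x‖ ^ a :=
          mul_le_mul_of_nonneg_right h1 (by positivity)
      _ = (1 + (n : ℝ)) ^ (-a) := by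
          rw [mul_zpow, mul_assoc, zpow_neg ‖wp ε' 1 x‖, inv_mul_cancel₀ (by positivity), mul_one]
  have hB' : BddMeas fun x => wp ε (-a) x * wp ε' a x :=
    ⟨((contDiff_wp ε (-a)).continuous.mul (contDiff_wp ε' a).continuous).measurable, _, hB'1⟩
  have hθ := (smoothBdd_wp ε ha0).bddMeas
  have hθ' := (smoothBdd_wp ε' ha0).bddMeas
  refine ContinuousLinearMap.opNorm_le_bound _ (by positivity) fun f => ?_
  have key : (L.ccay ε a b ^ n) f = mulX (fun x => wp ε (-a) x * wp ε' a x)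
      ((L.ccay ε' a b ^ n) (mulX (fun x => wp ε a x * wp ε' (-a) x) f)) := by
    refine mulX_injective hθ (wp_ne_zero ε a) ?_
    rw [← hε₀.cay_pow_mulX hε ha ha0, ← mulX_mul hθ hB']
    have h1 : (fun x => wp ε a x * (wp ε (-a) x * wp ε' a x)) = wp ε' a := by
      funext x; rw [← mul_assoc, wp_mul, add_neg_cancel, wp_zero, one_mul]
    rw [h1, ← hε₀.cay_pow_mulX hε' ha ha0, ← mulX_mul hθ' hB]
    congr 2
    congr 1
    funext x
    rw [mul_left_comm, wp_mul, add_neg_cancel, wp_zero, mul_one]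
  rw [key]
  refine (norm_mulX_le hB'.1 hB'1 _).trans ?_
  rw [mul_comm (Real.exp _), mul_assoc]
  refine mul_le_mul_of_nonneg_left ?_ (by positivity)
  refine (ContinuousLinearMap.le_opNorm _ _).trans ?_
  refine mul_le_mul hpow ?_ (norm_nonneg _) (Real.exp_pos _).le
  simpa using norm_mulX_le hB.1 hB1 f

theorem Admissible.exists_norm_ccayPow_le (ha0 : a ≤ 0) :
    ∃ C : ℝ, 0 ≤ C ∧ ∀ n : ℤ, ‖L.ccayPow ε a n‖ ≤ C * (1 + |(n : ℝ)|) ^ 2 := by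
  obtain ⟨C, hC0, hC⟩ := hε₀.exists_norm_ccay_pow_le hε ha ha0 true
  obtain ⟨C', hC0', hC'⟩ := hε₀.exists_norm_ccay_pow_le hε ha ha0 false
  have hle : ∀ m : ℕ, (1 + (m : ℝ)) ^ (-a) ≤ (1 + (m : ℝ)) ^ 2 := fun m => by
    have h1 : (1 : ℝ) ≤ 1 + m := by linarith [Nat.cast_nonneg (α := ℝ) m]
    have := zpow_le_zpow_right₀ h1 (show -a ≤ 2 by rw [abs_le] at ha; omega)
    exact_mod_cast this
  refine ⟨C + C', by positivity, fun n => ?_⟩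
  have habs : |(n : ℝ)| = (n.natAbs : ℝ) := by rw [Nat.cast_natAbs]; simp
  rw [habs, ccayPow, add_mul]
  have h3 : 0 ≤ (1 + (n.natAbs : ℝ)) ^ 2 := by positivity
  cases decide (0 ≤ n)
  · refine (hC' _).trans ?_
    have := mul_le_mul_of_nonneg_left (hle n.natAbs) hC0'
    nlinarith [mul_nonneg hC0 h3]
  · refine (hC _).trans ?_
    have := mul_le_mul_of_nonneg_left (hle n.natAbs) hC0
    nlinarith [mul_nonneg hC0' h3]

omit ha in
theorem Admissible.inner_genEig_ccayPow {w : L.dom} {e : ℝ} (hw : L.GenEig ε w e) (n : ℤ)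
    (f : L2Plane q) : ⟪(w : L2Plane q), L.ccayPow (-ε) (-1) n f⟫_ℂ =
      (((e : ℂ) + Complex.I) / (e - Complex.I)) ^ n * ⟪(w : L2Plane q), f⟫_ℂ := by
  have h1 : ∀ b f, ⟪(w : L2Plane q), L.ccay (-ε) (-1) b f⟫_ℂ =
      (((e : ℂ) + imUnit b) / (e - imUnit b)) * ⟪(w : L2Plane q), f⟫_ℂ := fun b f => by
    rw [ccay_apply, inner_add_right, inner_smul_right, hε₀.inner_genEig_cres hε hw]
    have := ofReal_sub_imUnit_ne_zero e b
    field_simp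
    ring
  have h2 : ∀ b (m : ℕ), ⟪(w : L2Plane q), (L.ccay (-ε) (-1) b ^ m) f⟫_ℂ =
      (((e : ℂ) + imUnit b) / (e - imUnit b)) ^ m * ⟪(w : L2Plane q), f⟫_ℂ := fun b m => by
    induction m with
    | zero => simp
    | succ m ih => rw [pow_succ', mul_apply_eq_comp, h1, ih, pow_succ']; ring
  rw [ccayPow, h2]
  congr 1
  rcases le_or_gt 0 n with hn | hn
  · rw [decide_eq_true hn]
    obtain ⟨m, rfl⟩ := Int.eq_ofNat_of_zero_le hn
    simp [imUnit]
  · rw [decide_eq_false (not_le.2 hn)]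
    obtain ⟨m, rfl⟩ : ∃ m : ℕ, n = -m := ⟨n.natAbs, by omega⟩
    rw [zpow_neg, zpow_natCast, ← inv_pow, inv_div]
    simp [imUnit, sub_eq_add_neg]

end LocalOperator

end Cayley

/-! ### Fourier expansion in the Cayley variable -/

section CayleyFourier

/-- `k(cot πx)` on `(0,1)`, extended by zero. -/
def cotComp (k : ℝ → ℂ) (x : ℝ) : ℂ :=
  if x ∈ Ioo (0 : ℝ) 1 then k (Real.cos (Real.pi * x) / Real.sin (Real.pi * x)) else 0

variable {k : ℝ → ℂ}

theorem sin_pi_pos {x : ℝ} (hx : x ∈ Ioo (0 : ℝ) 1) : 0 < Real.sin (Real.pi * x) :=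
  Real.sin_pos_of_pos_of_lt_pi (mul_pos Real.pi_pos hx.1)
    (by nlinarith [Real.pi_pos, hx.2])

theorem contDiff_cotComp (hk : ContDiff ℝ ∞ k) (hc : HasCompactSupport k) :
    ContDiff ℝ ∞ (cotComp k) := by
  obtain ⟨B, hB⟩ := hc.isCompact.isBounded.exists_norm_le
  have hzero : ∀ t, B < |t| → k t = 0 := fun t ht => by
    by_contra h
    exact absurd (hB t (subset_tsupport k h)) (not_le.2 ht)
  refine contDiff_iff_contDiffAt.2 fun x => ?_
  by_cases hx : x ∈ Ioo (0 : ℝ) 1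
  · have h1 : ContDiffAt ℝ ∞ (fun x => k (Real.cos (Real.pi * x) / Real.sin (Real.pi * x))) x := by
      refine hk.contDiffAt.comp x ?_
      refine ContDiffAt.div ?_ ?_ (sin_pi_pos hx).ne'
      · exact (Real.contDiff_cos.comp (contDiff_const.mul contDiff_id)).contDiffAt
      · exact (Real.contDiff_sin.comp (contDiff_const.mul contDiff_id)).contDiffAt
    refine h1.congr_of_eventuallyEq ?_
    filter_upwards [isOpen_Ioo.mem_nhds hx] with y hy
    rw [cotComp, if_pos hy]
  · refine (contDiffAt_const (c := (0 : ℂ))).congr_of_eventuallyEq ?_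
    have hO : ∀ᶠ y in 𝓝 x, y ∉ Ioo (0 : ℝ) 1 ∨
        max B 0 * |Real.sin (Real.pi * y)| < |Real.cos (Real.pi * y)| := by
      by_cases h0 : Real.sin (Real.pi * x) = 0
      · have hcos : 0 < |Real.cos (Real.pi * x)| := by
          rw [abs_pos]; intro h
          have := Real.sin_sq_add_cos_sq (Real.pi * x)
          rw [h0, h] at this; norm_num at this
        have hcont1 : Continuous fun y => max B 0 * |Real.sin (Real.pi * y)| := by fun_prop
        have hcont2 : Continuous fun y => |Real.cos (Real.pi * y)| := by fun_prop
        have : max B 0 * |Real.sin (Real.pi * x)| < |Real.cos (Real.pi * x)| := by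
          rw [h0]; simpa using hcos
        filter_upwards [(isOpen_lt hcont1 hcont2).mem_nhds this] with y hy using Or.inr hy
      · have hx' : x ∉ Icc (0 : ℝ) 1 := by
          rintro ⟨ha, hb⟩
          rcases eq_or_lt_of_le ha with h | h
          · rw [← h] at h0; simp at h0
          · rcases eq_or_lt_of_le hb with h' | h'
            · rw [h'] at h0; simp at h0
            · exact hx ⟨h, h'⟩
        filter_upwards [isClosed_Icc.isOpen_compl.mem_nhds hx'] with y hy
        exact Or.inl fun h => hy (Ioo_subset_Icc_self h)
    filter_upwards [hO] with y hy
    rw [cotComp]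
    split_ifs with h
    · refine hzero _ ?_
      have hs := sin_pi_pos h
      rcases hy with hy | hy
      · exact absurd h hy
      · rw [abs_div, lt_div_iff₀ (abs_pos.2 hs.ne')]
        refine lt_of_le_of_lt ?_ hy
        exact mul_le_mul_of_nonneg_right (le_max_left _ _) (abs_nonneg _)
    · rfl

theorem iteratedDeriv_cotComp_zero_one (n : ℕ) (hk : ContDiff ℝ ∞ k) (hc : HasCompactSupport k) :
    iteratedDeriv n (cotComp k) 0 = 0 ∧ iteratedDeriv n (cotComp k) 1 = 0 := by
  have hcont := (contDiff_iteratedDeriv (contDiff_cotComp hk hc) n).continuous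
  have hout : ∀ x, x ∉ Icc (0 : ℝ) 1 → iteratedDeriv n (cotComp k) x = 0 := by
    intro x hx
    have h1 : cotComp k =ᶠ[𝓝 x] fun _ => 0 := by
      filter_upwards [isClosed_Icc.isOpen_compl.mem_nhds hx] with y hy
      rw [cotComp, if_neg fun h => hy (Ioo_subset_Icc_self h)]
    rw [h1.iteratedDeriv_eq]
    simp
  have hcl : IsClosed {x | iteratedDeriv n (cotComp k) x = 0} := isClosed_eq hcont continuous_const
  constructor
  · have : (0 : ℝ) ∈ closure (Iio (0 : ℝ)) := by rw [closure_Iio]; simp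
    exact hcl.closure_subset_iff.2 (fun x hx => hout x fun h => not_le.2 hx h.1) this
  · have : (1 : ℝ) ∈ closure (Ioi (1 : ℝ)) := by rw [closure_Ioi]; simp
    exact hcl.closure_subset_iff.2 (fun x hx => hout x fun h => not_le.2 hx h.2) this

theorem norm_fourierCoeffOn_le {f : ℝ → ℂ} (hf : Continuous f) :
    ∃ C : ℝ, ∀ n : ℤ, ‖fourierCoeffOn (zero_lt_one (α := ℝ)) f n‖ ≤ C := by
  obtain ⟨C, hC⟩ := (isCompact_Icc (a := (0 : ℝ)) (b := 1)).exists_bound_of_continuousOn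
    hf.continuousOn
  refine ⟨C, fun n => ?_⟩
  rw [fourierCoeffOn_eq_integral]
  have h1 : ‖∫ x in (0 : ℝ)..1, fourier (-n) (x : AddCircle ((1 : ℝ) - 0)) • f x‖ ≤
      C * |(1 : ℝ) - 0| := by
    refine intervalIntegral.norm_integral_le_of_norm_le_const fun x hx => ?_
    rw [uIoc_of_le zero_le_one] at hx
    rw [norm_smul, fourier_apply, Circle.norm_coe, one_mul]
    exact hC x (Ioc_subset_Icc_self hx)
  simpa using h1

theorem fourierCoeffOn_deriv {f : ℝ → ℂ} (hf : ContDiff ℝ ∞ f) (h0 : f 0 = 0) (h1 : f 1 = 0)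
    {n : ℤ} (hn : n ≠ 0) : ‖fourierCoeffOn (zero_lt_one (α := ℝ)) f n‖ ≤
      |(n : ℝ)|⁻¹ * ‖fourierCoeffOn (zero_lt_one (α := ℝ)) (deriv f) n‖ := by
  rw [fourierCoeffOn_of_hasDerivAt (zero_lt_one (α := ℝ)) hn
    (fun x _ => (hf.differentiable (by simp) x).hasDerivAt)
    ((hf.continuous_deriv (by simp)).intervalIntegrable _ _), h0, h1]
  have hpos : 0 < |(n : ℝ)| := abs_pos.2 (by exact_mod_cast hn)
  have h2 : ‖(1 : ℂ) / (-2 * Real.pi * Complex.I * n)‖ ≤ |(n : ℝ)|⁻¹ := by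
    have h3 : ‖(-2 * Real.pi * Complex.I * n : ℂ)‖ = 2 * Real.pi * |(n : ℝ)| := by
      simp [abs_of_pos Real.pi_pos]
    rw [norm_div, norm_one, h3, one_div]
    refine inv_anti₀ hpos ?_
    nlinarith [Real.pi_gt_three]
  rw [norm_mul]
  refine mul_le_mul h2 (le_of_eq ?_) (norm_nonneg _) (by positivity)
  simp

theorem summable_fourierCoeffOn_cotComp (hk : ContDiff ℝ ∞ k) (hc : HasCompactSupport k) :
    Summable fun n : ℤ => ‖fourierCoeffOn (zero_lt_one (α := ℝ)) (cotComp k) n‖ *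
      (1 + |(n : ℝ)|) ^ 2 := by
  have hs := contDiff_cotComp hk hc
  obtain ⟨C, hC⟩ := norm_fourierCoeffOn_le (contDiff_iteratedDeriv hs 4).continuous
  have hstep : ∀ (j : ℕ) (n : ℤ), n ≠ 0 →
      ‖fourierCoeffOn (zero_lt_one (α := ℝ)) (iteratedDeriv j (cotComp k)) n‖ ≤
      |(n : ℝ)|⁻¹ * ‖fourierCoeffOn (zero_lt_one (α := ℝ)) (iteratedDeriv (j + 1) (cotComp k)) n‖ := by
    intro j n hn
    obtain ⟨h0, h1⟩ := iteratedDeriv_cotComp_zero_one j hk hc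
    have := fourierCoeffOn_deriv (contDiff_iteratedDeriv hs j) h0 h1 hn
    rwa [← iteratedDeriv_succ] at this
  have hbd : ∀ n : ℤ, n ≠ 0 → ‖fourierCoeffOn (zero_lt_one (α := ℝ)) (cotComp k) n‖ ≤
      (|(n : ℝ)|⁻¹) ^ 4 * C := by
    intro n hn
    have hp : 0 ≤ |(n : ℝ)|⁻¹ := by positivity
    have e0 := hstep 0 n hn
    have e1 := mul_le_mul_of_nonneg_left (hstep 1 n hn) hp
    have e2 := mul_le_mul_of_nonneg_left (mul_le_mul_of_nonneg_left (hstep 2 n hn) hp) hp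
    have e3 := mul_le_mul_of_nonneg_left (mul_le_mul_of_nonneg_left
      (mul_le_mul_of_nonneg_left (hstep 3 n hn) hp) hp) hp
    have e4 := mul_le_mul_of_nonneg_left (hC n) (pow_nonneg hp 4)
    rw [iteratedDeriv_zero] at e0
    norm_num only at e0 e1 e2 e3
    calc _ ≤ _ := e0
      _ ≤ _ := e1
      _ ≤ _ := e2
      _ ≤ _ := e3
      _ ≤ _ := by rw [← mul_assoc, ← mul_assoc, ← mul_assoc]; simpa [pow_succ] using e4
  have h2 : Summable fun n : ℤ => (4 * C) * (1 / (n : ℝ) ^ 2) :=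
    (Real.summable_one_div_int_pow.2 (by norm_num)).mul_left _
  refine (summable_of_hasFiniteSupport (f := fun n : ℤ => if n = 0 then
    ‖fourierCoeffOn (zero_lt_one (α := ℝ)) (cotComp k) 0‖ else 0) ?_ |>.add h2).of_nonneg_of_le
      (fun n => by positivity) fun n => ?_
  · refine (Set.finite_singleton (0 : ℤ)).subset fun n hn => ?_
    by_contra h
    exact hn (if_neg h)
  · by_cases hn : n = 0
    · subst hn; simp
    · rw [if_neg hn, zero_add]
      have h1 : 1 ≤ |(n : ℝ)| := by
        have := Int.one_le_abs hn
        exact_mod_cast this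
      have hpos : 0 < |(n : ℝ)| := by linarith
      have hC0 : 0 ≤ C := (norm_nonneg _).trans (hC 0)
      calc _ ≤ (|(n : ℝ)|⁻¹) ^ 4 * C * (2 * |(n : ℝ)|) ^ 2 :=
            mul_le_mul (hbd n hn) (pow_le_pow_left₀ (by positivity) (by linarith) 2)
              (by positivity) (by positivity)
        _ = 4 * C * (1 / (n : ℝ) ^ 2) := by
            rw [← sq_abs (n : ℝ)]; field_simp; norm_num

theorem exp_two_pi_sub_one (x : ℝ) : Complex.exp (2 * Real.pi * Complex.I * x) - 1 =
    2 * Complex.I * (Complex.exp (Real.pi * x * Complex.I) * (Real.sin (Real.pi * x) : ℝ)) := by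
  have h1 : Complex.exp (2 * Real.pi * Complex.I * x) =
      Complex.exp (Real.pi * x * Complex.I) * Complex.exp (Real.pi * x * Complex.I) := by
    rw [← Complex.exp_add]; congr 1; ring
  rw [h1]
  have h2 : Complex.exp (Real.pi * x * Complex.I) =
      (Real.cos (Real.pi * x) : ℝ) + (Real.sin (Real.pi * x) : ℝ) * Complex.I := by
    rw [Complex.exp_mul_I]; push_cast; ring
  rw [h2]
  have h3 : ((Real.cos (Real.pi * x) : ℝ) : ℂ) ^ 2 + ((Real.sin (Real.pi * x) : ℝ) : ℂ) ^ 2 = 1 := by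
    exact_mod_cast Real.cos_sq_add_sin_sq (Real.pi * x)
  linear_combination h3 - ((Real.sin (Real.pi * x) : ℝ) : ℂ) ^ 2 * Complex.I_sq

/-- A smooth function with compact support, expanded in powers of `v = (t + i)/(t - i)`. -/
theorem exists_cayley_series (hk : ContDiff ℝ ∞ k) (hc : HasCompactSupport k) :
    ∃ c : ℤ → ℂ, Summable (fun n => ‖c n‖ * (1 + |(n : ℝ)|) ^ 2) ∧
      ∀ v : ℂ, ‖v‖ = 1 → HasSum (fun n => c n * v ^ n)
        (if v = 1 then 0 else k (2 * Complex.I / (v - 1)).re) := by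
  set c : ℤ → ℂ := fun n => fourierCoeffOn (zero_lt_one (α := ℝ)) (cotComp k) n with hcdef
  have hsum := summable_fourierCoeffOn_cotComp hk hc
  refine ⟨c, hsum, fun v hv => ?_⟩
  have hcc : Continuous (cotComp k) := (contDiff_cotComp hk hc).continuous
  have h01 : cotComp k 0 = cotComp k (0 + 1) := by simp [cotComp]
  have : Fact ((0 : ℝ) < 1) := ⟨one_pos⟩
  let F : C(AddCircle (1 : ℝ), ℂ) :=
    ⟨AddCircle.liftIco 1 0 (cotComp k), AddCircle.liftIco_continuous h01 hcc.continuousOn⟩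
  have hcoef : ∀ n, fourierCoeff F n = c n := fun n => by
    have := fourierCoeff_liftIco_eq (T := (1 : ℝ)) (a := 0) (cotComp k) n
    change fourierCoeff (AddCircle.liftIco 1 0 (cotComp k)) n = _
    rw [this, hcdef]
    simp only [fourierCoeffOn_eq_integral]
    simp
  have hs1 : Summable (fourierCoeff F) := by
    refine Summable.of_norm ?_
    refine hsum.of_nonneg_of_le (fun n => norm_nonneg _) fun n => ?_
    rw [hcoef]
    refine le_mul_of_one_le_right (norm_nonneg _) ?_
    exact one_le_pow₀ (by linarith [abs_nonneg (n : ℝ)])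
  obtain ⟨x, hx, rfl⟩ : ∃ x ∈ Ico (0 : ℝ) 1, Complex.exp (2 * Real.pi * Complex.I * x) = v := by
    have h1 : Complex.exp (Complex.arg v * Complex.I) = v := by
      have := Complex.norm_mul_exp_arg_mul_I v
      rwa [hv, Complex.ofReal_one, one_mul] at this
    refine ⟨Int.fract (Complex.arg v / (2 * Real.pi)), ⟨Int.fract_nonneg _, Int.fract_lt_one _⟩, ?_⟩
    refine Eq.trans ?_ h1
    refine Complex.exp_eq_exp_iff_exists_int.2 ⟨-⌊Complex.arg v / (2 * Real.pi)⌋, ?_⟩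
    rw [Int.fract]
    have : (Real.pi : ℂ) ≠ 0 := by exact_mod_cast Real.pi_ne_zero
    push_cast
    field_simp
    ring
  have h2 := has_pointwise_sum_fourier_series_of_summable hs1 (x : AddCircle (1 : ℝ))
  have h3 : F (x : AddCircle (1 : ℝ)) = cotComp k x :=
    AddCircle.liftIco_coe_apply (p := (1 : ℝ)) (a := 0) (f := cotComp k) (by simpa using hx)
  rw [h3] at h2
  convert h2 using 1
  · funext n
    rw [hcoef, smul_eq_mul, fourier_coe_apply, ← Complex.exp_int_mul]
    congr 2
    push_cast; ring
  · rcases eq_or_lt_of_le hx.1 with h | h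
    · rw [← h]; simp [cotComp]
    · have hs := sin_pi_pos ⟨h, hx.2⟩
      have hsub := exp_two_pi_sub_one x
      have hne : Complex.exp (2 * Real.pi * Complex.I * x) ≠ 1 := by
        intro he
        rw [he, sub_self] at hsub
        have := (mul_eq_zero.1 hsub.symm).resolve_left (by simp)
        rcases mul_eq_zero.1 this with h' | h'
        · exact Complex.exp_ne_zero _ h'
        · exact hs.ne' (by exact_mod_cast h')
      rw [if_neg hne, cotComp, if_pos ⟨h, hx.2⟩, hsub]
      congr 1
      have h4 : 2 * Complex.I / (2 * Complex.I * (Complex.exp (Real.pi * x * Complex.I) *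
          (Real.sin (Real.pi * x) : ℝ))) =
          Complex.exp (-(Real.pi * x * Complex.I)) / (Real.sin (Real.pi * x) : ℝ) := by
        rw [Complex.exp_neg]
        have : ((Real.sin (Real.pi * x) : ℝ) : ℂ) ≠ 0 := by exact_mod_cast hs.ne'
        have := Complex.exp_ne_zero (Real.pi * x * Complex.I)
        have := Complex.I_ne_zero
        field_simp
      rw [h4, Complex.div_ofReal_re, ← neg_mul, Complex.exp_mul_I]
      have h5 : (-((Real.pi : ℂ) * x)) = ((-(Real.pi * x) : ℝ) : ℂ) := by push_cast; ring
      rw [h5, ← Complex.ofReal_cos, ← Complex.ofReal_sin, Complex.add_re, Complex.re_ofReal_mul,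
        Complex.I_re, Complex.ofReal_re, mul_zero, add_zero, Real.cos_neg]

end CayleyFourier

/-! ### Functions of a local operator -/

section Functional

variable {p q : ℕ}

theorem hasSum_clm_apply {E : Type*} [NormedAddCommGroup E] [NormedSpace ℂ E] {ι : Type*}
    {T : ι → E →L[ℂ] E} {S : E →L[ℂ] E} (h : HasSum T S) (x : E) : HasSum (fun i => T i x) (S x) :=
  (ContinuousLinearMap.apply ℂ E x).hasSum h

/-- Smooth functions with compact support. -/
structure IsTest (k : ℝ → ℂ) : Prop where
  contDiff : ContDiff ℝ ∞ k
  compact : HasCompactSupport k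

namespace IsTest

variable {k l : ℝ → ℂ}

theorem mul_left (hk : IsTest k) {f : ℝ → ℂ} (hf : ContDiff ℝ ∞ f) : IsTest fun t => f t * k t :=
  ⟨hf.mul hk.contDiff, hk.compact.mul_left⟩

theorem mul (hk : IsTest k) (hl : IsTest l) : IsTest fun t => k t * l t :=
  hl.mul_left hk.contDiff

theorem star (hk : IsTest k) : IsTest fun t => starRingEnd ℂ (k t) :=
  ⟨Complex.conjCLE.contDiff.comp hk.contDiff, hk.compact.comp_left (map_zero _)⟩

theorem sub_imUnit_mul (hk : IsTest k) (b : Bool) : IsTest fun t : ℝ => ((t : ℂ) - imUnit b) * k t :=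
  hk.mul_left (Complex.ofRealCLM.contDiff.sub contDiff_const)

end IsTest

/-- The function of the resolvent `w = (t - i)⁻¹` that corresponds to `k(t)`. -/
def resFun (k : ℝ → ℂ) (w : ℂ) : ℂ := if w = 0 then 0 else k (w⁻¹).re

/-- Coefficients of the expansion of `k` in powers of `(t + i)/(t - i)`. -/
def cayCoeff (k : ℝ → ℂ) : ℤ → ℂ :=
  open Classical in
  if h : ∃ c : ℤ → ℂ, Summable (fun n => ‖c n‖ * (1 + |(n : ℝ)|) ^ 2) ∧
      ∀ v : ℂ, ‖v‖ = 1 → HasSum (fun n => c n * v ^ n)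
        (if v = 1 then 0 else k (2 * Complex.I / (v - 1)).re) then h.choose else 0

namespace IsTest

variable {k : ℝ → ℂ}

theorem cayCoeff_spec (hk : IsTest k) :
    Summable (fun n => ‖cayCoeff k n‖ * (1 + |(n : ℝ)|) ^ 2) ∧
      ∀ v : ℂ, ‖v‖ = 1 → HasSum (fun n => cayCoeff k n * v ^ n)
        (if v = 1 then 0 else k (2 * Complex.I / (v - 1)).re) := by
  have h := exists_cayley_series hk.contDiff hk.compact
  rw [cayCoeff, dif_pos h]
  exact h.choose_spec

theorem hasSum_cayCoeff (hk : IsTest k) (t : ℝ) :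
    HasSum (fun n => cayCoeff k n * (((t : ℂ) + Complex.I) / (t - Complex.I)) ^ n) (k t) := by
  have h1 : (t : ℂ) - Complex.I ≠ 0 := ofReal_sub_imUnit_ne_zero t true
  have hv : ‖((t : ℂ) + Complex.I) / (t - Complex.I)‖ = 1 := by
    have : (t : ℂ) + Complex.I = starRingEnd ℂ (t - Complex.I) := by simp
    rw [norm_div, this, RCLike.norm_conj, div_self (norm_ne_zero_iff.2 h1)]
  have h2 : ((t : ℂ) + Complex.I) / (t - Complex.I) - 1 = 2 * Complex.I / (t - Complex.I) := by
    field_simp; ring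
  have h3 := hk.cayCoeff_spec.2 _ hv
  rw [if_neg, h2] at h3
  · convert h3 using 2
    have : 2 * Complex.I / (2 * Complex.I / ((t : ℂ) - Complex.I)) = t - Complex.I := by
      have := Complex.I_ne_zero
      field_simp
    rw [this]; simp
  · intro h
    rw [h, sub_self] at h2
    have := div_ne_zero (mul_ne_zero two_ne_zero Complex.I_ne_zero) h1
    exact this h2.symm

end IsTest

namespace LocalOperator

variable (L : LocalOperator p q)

theorem star_res (b : Bool) : star (L.selfAdjoint.res b) = L.selfAdjoint.res (!b) := by
  rw [ContinuousLinearMap.star_eq_adjoint]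
  refine ((ContinuousLinearMap.eq_adjoint_iff _ _).2 fun x y => ?_).symm
  rw [L.selfAdjoint.inner_res_left, Bool.not_not]

theorem star_cay (b : Bool) : star (L.cay b) = L.cay (!b) := by
  rw [cay, star_add, star_one, star_smul, star_res, cay]
  simp [conj_imUnit]

theorem star_cay_mul (b : Bool) : star (L.cay b) * L.cay b = 1 := by
  rw [ContinuousLinearMap.star_eq_adjoint]
  exact (ContinuousLinearMap.norm_map_iff_adjoint_comp_self _).1 (L.norm_cay b)

theorem cay_mem_unitary (b : Bool) : L.cay b ∈ unitary (L2Plane q →L[ℂ] L2Plane q) := by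
  refine Unitary.mem_iff.2 ⟨L.star_cay_mul b, ?_⟩
  have := L.star_cay_mul (!b)
  rwa [star_cay, Bool.not_not, ← L.star_cay b] at this

instance isStarNormal_res (b : Bool) : IsStarNormal (L.selfAdjoint.res b) := by
  refine ⟨?_⟩
  have h1 := (Unitary.mem_iff.1 (L.cay_mem_unitary b)).1
  have h2 := (Unitary.mem_iff.1 (L.cay_mem_unitary b)).2
  have h3 := h1.trans h2.symm
  rw [star_cay, cay, cay, imUnit_not] at h3
  rw [star_res]
  have h4 : (2 * imUnit b * (2 * -imUnit b)) • (L.selfAdjoint.res (!b) * L.selfAdjoint.res b) =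
      (2 * imUnit b * (2 * -imUnit b)) • (L.selfAdjoint.res b * L.selfAdjoint.res (!b)) := by
    simp only [add_mul, mul_add, one_mul, mul_one, smul_mul_smul_comm] at h3
    have h5 : (2 * -imUnit b * (2 * imUnit b)) = (2 * imUnit b * (2 * -imUnit b)) := by ring
    rw [h5] at h3
    have h6 := sub_eq_zero.2 h3
    rw [← sub_eq_zero, ← h6]
    abel
  have h7 : (2 * imUnit b * (2 * -imUnit b)) ≠ 0 := by
    cases b <;> simp [imUnit]
  exact smul_right_injective _ h7 h4

theorem norm_one_add_of_mem_spectrum {w : ℂ} (hw : w ∈ spectrum ℂ (L.selfAdjoint.res true)) :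
    ‖1 + 2 * Complex.I * w‖ = 1 := by
  have h1 : 1 + 2 * Complex.I * w ∈ spectrum ℂ (L.cay true) := by
    rw [spectrum.mem_iff] at hw ⊢
    intro h
    refine hw ?_
    have h2 : (algebraMap ℂ (L2Plane q →L[ℂ] L2Plane q)) (1 + 2 * Complex.I * w) - L.cay true =
        (2 * Complex.I) • ((algebraMap ℂ (L2Plane q →L[ℂ] L2Plane q)) w -
          L.selfAdjoint.res true) := by
      rw [cay, map_add, map_one, Algebra.algebraMap_eq_smul_one, Algebra.algebraMap_eq_smul_one,
        smul_sub, smul_smul]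
      simp [imUnit]
    rw [h2] at h
    have h3 : (2 * Complex.I) ≠ 0 := mul_ne_zero two_ne_zero Complex.I_ne_zero
    have := h.smul (Units.mk0 _ h3)⁻¹
    rwa [Units.smul_def, Units.val_inv_eq_inv_val, Units.val_mk0, smul_smul,
      inv_mul_cancel₀ h3, one_smul] at this
  have := spectrum.subset_circle_of_unitary (L.cay_mem_unitary true) h1
  simpa using this

/-- `k(A)`. -/
def fn (k : ℝ → ℂ) : L2Plane q →L[ℂ] L2Plane q := cfc (resFun k) (L.selfAdjoint.res true)

/-- `(1 + iεx)^{-a} k(A) (1 + iεx)^a`. -/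
def cfn (ε : ℝ) (a : ℤ) (k : ℝ → ℂ) : L2Plane q →L[ℂ] L2Plane q :=
  ∑' n, cayCoeff k n • L.ccayPow ε a n

theorem cfc_cayPow (n : ℤ) :
    cfc (fun w : ℂ => (1 + 2 * Complex.I * w) ^ n) (L.selfAdjoint.res true) = L.cayPow n := by
  have hb : cfc (fun w : ℂ => 1 + 2 * Complex.I * w) (L.selfAdjoint.res true) = L.cay true := by
    rw [cfc_const_add (1 : ℂ) (fun w : ℂ => 2 * Complex.I * w) (L.selfAdjoint.res true)
      (by fun_prop) (L.isStarNormal_res true),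
      cfc_const_mul_id (2 * Complex.I) (L.selfAdjoint.res true) (L.isStarNormal_res true), map_one]; rfl
  rcases le_or_gt 0 n with hn | hn
  · obtain ⟨m, rfl⟩ := Int.eq_ofNat_of_zero_le hn
    simp only [zpow_natCast]
    rw [cfc_pow (fun w : ℂ => 1 + 2 * Complex.I * w) m (L.selfAdjoint.res true) (by fun_prop)
      (L.isStarNormal_res true), hb, cayPow, decide_eq_true hn]
    simp
  · obtain ⟨m, rfl⟩ : ∃ m : ℕ, n = -m := ⟨n.natAbs, by omega⟩
    have h1 : (spectrum ℂ (L.selfAdjoint.res true)).EqOn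
        (fun w : ℂ => (1 + 2 * Complex.I * w) ^ (-(m : ℤ)))
        (fun w : ℂ => (star (1 + 2 * Complex.I * w)) ^ m) := fun w hw => by
      have h2 := L.norm_one_add_of_mem_spectrum hw
      have h3 : (1 + 2 * Complex.I * w)⁻¹ = star (1 + 2 * Complex.I * w) := by
        rw [Complex.inv_def, Complex.normSq_eq_norm_sq, h2, one_pow, inv_one, Complex.ofReal_one, mul_one]; rfl
      simp only [zpow_neg, zpow_natCast]
      rw [← inv_pow, h3]
    rw [cfc_congr h1, cfc_pow (fun w : ℂ => star (1 + 2 * Complex.I * w)) m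
      (L.selfAdjoint.res true) (by fun_prop) (L.isStarNormal_res true), cfc_star, hb, star_cay, cayPow, decide_eq_false (not_le.2 hn)]
    simp

variable {L} {k l : ℝ → ℂ}

theorem resFun_eqOn (hk : IsTest k) {w : ℂ} (hw : ‖1 + 2 * Complex.I * w‖ = 1) :
    HasSum (fun n => cayCoeff k n * (1 + 2 * Complex.I * w) ^ n) (resFun k w) := by
  have h := hk.cayCoeff_spec.2 _ hw
  rw [resFun]
  by_cases h0 : w = 0
  · rw [if_pos h0]; rwa [if_pos (by simp [h0])] at h
  · rw [if_neg h0]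
    rw [if_neg (by simp [h0, Complex.I_ne_zero])] at h
    convert h using 3
    rw [add_sub_cancel_left]
    have := Complex.I_ne_zero
    field_simp

theorem hasSum_fn (hk : IsTest k) : HasSum (fun n => cayCoeff k n • L.cayPow n) (L.fn k) := by
  have hcont : ∀ n : ℤ, ContinuousOn (fun w : ℂ => (1 + 2 * Complex.I * w) ^ n)
      (spectrum ℂ (L.selfAdjoint.res true)) := fun n => by
    refine ContinuousOn.zpow₀ (by fun_prop) n fun w hw => Or.inl fun h => ?_
    have := L.norm_one_add_of_mem_spectrum hw
    rw [h] at this; simp at this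
  have hsummable : Summable fun n => ‖cayCoeff k n‖ := by
    refine hk.cayCoeff_spec.1.of_nonneg_of_le (fun n => norm_nonneg _) fun n => ?_
    exact le_mul_of_one_le_right (norm_nonneg _) (one_le_pow₀ (by linarith [abs_nonneg (n : ℝ)]))
  have hunif : TendstoUniformlyOn (fun (s : Finset ℤ) (w : ℂ) =>
      ∑ n ∈ s, cayCoeff k n * (1 + 2 * Complex.I * w) ^ n) (resFun k) atTop
      (spectrum ℂ (L.selfAdjoint.res true)) := by
    refine (tendstoUniformlyOn_tsum hsummable (fun n w hw => ?_)).congr_right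
      fun w hw => (resFun_eqOn hk (L.norm_one_add_of_mem_spectrum hw)).tsum_eq
    rw [norm_mul, norm_zpow, L.norm_one_add_of_mem_spectrum hw, one_zpow, mul_one]
  have h1 := tendsto_cfc_fun hunif (Eventually.of_forall fun s =>
    continuousOn_finsetSum s fun n _ => (hcont n).const_mul (cayCoeff k n))
  rw [HasSum, SummationFilter.unconditional_filter]
  refine h1.congr fun s => ?_
  have h2 := cfc_sum (fun (n : ℤ) (w : ℂ) => cayCoeff k n * (1 + 2 * Complex.I * w) ^ n)
    (L.selfAdjoint.res true) s fun n _ => (hcont n).const_mul (cayCoeff k n)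
  have h3 : (∑ n ∈ s, fun w : ℂ => cayCoeff k n * (1 + 2 * Complex.I * w) ^ n) =
      fun w : ℂ => ∑ n ∈ s, cayCoeff k n * (1 + 2 * Complex.I * w) ^ n := by
    funext w; rw [Finset.sum_apply]
  rw [h3] at h2
  rw [h2]
  refine Finset.sum_congr rfl fun n _ => ?_
  rw [cfc_const_mul _ _ _ (hcont n), cfc_cayPow]

theorem continuousOn_resFun (hk : IsTest k) :
    ContinuousOn (resFun k) (spectrum ℂ (L.selfAdjoint.res true)) := by
  have hcont : ∀ n : ℤ, ContinuousOn (fun w : ℂ => cayCoeff k n * (1 + 2 * Complex.I * w) ^ n)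
      (spectrum ℂ (L.selfAdjoint.res true)) := fun n => by
    refine (ContinuousOn.zpow₀ (by fun_prop) n fun w hw => Or.inl fun h => ?_).const_mul _
    have := L.norm_one_add_of_mem_spectrum hw
    rw [h] at this; simp at this
  have hsummable : Summable fun n => ‖cayCoeff k n‖ := by
    refine hk.cayCoeff_spec.1.of_nonneg_of_le (fun n => norm_nonneg _) fun n => ?_
    exact le_mul_of_one_le_right (norm_nonneg _) (one_le_pow₀ (by linarith [abs_nonneg (n : ℝ)]))
  refine (continuousOn_tsum hcont hsummable fun n w hw => ?_).congr
    fun w hw => (resFun_eqOn hk (L.norm_one_add_of_mem_spectrum hw)).tsum_eq.symm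
  rw [norm_mul, norm_zpow, L.norm_one_add_of_mem_spectrum hw, one_zpow, mul_one]

theorem fn_mul (hk : IsTest k) (hl : IsTest l) : L.fn (fun t => k t * l t) = L.fn k * L.fn l := by
  rw [fn, fn, fn, ← cfc_mul _ _ _ (continuousOn_resFun hk) (continuousOn_resFun hl)]
  congr 1
  funext w
  by_cases h : w = 0 <;> simp [resFun, h]

theorem star_fn (k : ℝ → ℂ) : star (L.fn k) = L.fn fun t => starRingEnd ℂ (k t) := by
  rw [fn, fn, ← cfc_star]
  congr 1
  funext w
  by_cases h : w = 0 <;> simp [resFun, h]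

theorem fn_eq_res_mul (hk : IsTest k) :
    L.fn k = L.selfAdjoint.res true * L.fn fun t : ℝ => ((t : ℂ) - imUnit true) * k t := by
  have h1 := continuousOn_resFun (L := L) (hk.sub_imUnit_mul true)
  have h2 := cfc_mul (fun w : ℂ => w) _ (L.selfAdjoint.res true) continuousOn_id h1
  rw [cfc_id' ℂ (L.selfAdjoint.res true) (L.isStarNormal_res true)] at h2
  rw [fn, fn, ← h2]
  refine cfc_congr fun w hw => ?_
  have hn := L.norm_one_add_of_mem_spectrum hw
  by_cases h : w = 0
  · simp [resFun, h]
  · simp only [resFun, if_neg h]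
    have h3 : ((w⁻¹).re : ℂ) - imUnit true = w⁻¹ := by
      refine Complex.ext (by simp [imUnit]) ?_
      have h4 : (w⁻¹).im = -1 := by
        have h5 : Complex.normSq (1 + 2 * Complex.I * w) = 1 := by
          rw [Complex.normSq_eq_norm_sq, hn]; norm_num
        rw [Complex.normSq_apply] at h5
        simp at h5
        have h6 : Complex.normSq w = w.im := by rw [Complex.normSq_apply]; nlinarith
        have h7 : Complex.normSq w ≠ 0 := fun h' => h (Complex.normSq_eq_zero.1 h')
        rw [Complex.inv_im, h6, neg_div, div_self (h6 ▸ h7)]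
      rw [h4]; simp [imUnit]
    rw [h3, ← mul_assoc, mul_inv_cancel₀ h, one_mul]

theorem fn_apply (hk : IsTest k) (f : L2Plane q) : L.fn k f =
    L.selfAdjoint.resD true (L.fn (fun t : ℝ => ((t : ℂ) - imUnit true) * k t) f) :=
  congrArg (fun T : L2Plane q →L[ℂ] L2Plane q => T f) (fn_eq_res_mul hk)

variable {ε₀ : ℝ} (hε₀ : L.Admissible ε₀) {ε : ℝ} (hε : |ε| ≤ ε₀)
include hε₀ hε

theorem Admissible.hasSum_cfn {a : ℤ} (ha : |a| ≤ 2) (ha0 : a ≤ 0) (hk : IsTest k) :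
    HasSum (fun n => cayCoeff k n • L.ccayPow ε a n) (L.cfn ε a k) := by
  obtain ⟨C, hC0, hC⟩ := hε₀.exists_norm_ccayPow_le hε ha ha0
  refine Summable.hasSum (Summable.of_norm ((hk.cayCoeff_spec.1.mul_left C).of_nonneg_of_le
    (fun n => norm_nonneg _) fun n => ?_))
  rw [norm_smul, mul_left_comm]
  exact mul_le_mul_of_nonneg_left (hC n) (norm_nonneg _)

theorem Admissible.fn_mulX {a : ℤ} (ha : |a| ≤ 2) (ha0 : a ≤ 0) (hk : IsTest k) (f : L2Plane q) :
    L.fn k (mulX (wp ε a) f) = mulX (wp ε a) (L.cfn ε a k f) := by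
  have h1 := hasSum_clm_apply (hasSum_fn (L := L) hk) (mulX (wp ε a) f)
  have h2 := (mulX (wp ε a)).hasSum (hasSum_clm_apply (hε₀.hasSum_cfn hε ha ha0 hk) f)
  refine h1.unique ?_
  convert h2 using 2 with n
  simp only [FunLike.coe_smul, Pi.smul_apply, map_smul]
  rw [hε₀.cayPow_mulX hε ha ha0]

theorem Admissible.cfn_eq_cres_mul {a : ℤ} (ha : |a| ≤ 2) (ha0 : a ≤ 0) (hk : IsTest k)
    (f : L2Plane q) : L.cfn ε a k f =
      L.cres ε a true (L.cfn ε a (fun t : ℝ => ((t : ℂ) - imUnit true) * k t) f) := by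
  refine mulX_injective (smoothBdd_wp ε ha0).bddMeas (wp_ne_zero ε a) ?_
  rw [← hε₀.fn_mulX hε ha ha0 hk, ← hε₀.res_mulX hε ha ha0,
    ← hε₀.fn_mulX hε ha ha0 (hk.sub_imUnit_mul true), fn_apply hk, L.selfAdjoint.res_apply]

theorem Admissible.inner_genEig_cfn {w : L.dom} {e : ℝ} (hw : L.GenEig ε w e) (hk : IsTest k)
    (f : L2Plane q) :
    ⟪(w : L2Plane q), L.cfn (-ε) (-1) k f⟫_ℂ = k e * ⟪(w : L2Plane q), f⟫_ℂ := by
  have h1 := hasSum_clm_apply (hε₀.hasSum_cfn (ε := -ε) (a := -1) (by rwa [abs_neg]) (by norm_num)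
    (by norm_num) hk) f
  have h2 := (innerSL ℂ (w : L2Plane q)).hasSum h1
  refine h2.unique (((hk.hasSum_cayCoeff e).mul_right ⟪(w : L2Plane q), f⟫_ℂ).congr_fun fun n => ?_)
  change ⟪(w : L2Plane q), cayCoeff k n • L.ccayPow (-ε) (-1) n f⟫_ℂ = _
  rw [inner_smul_right, hε₀.inner_genEig_ccayPow hε hw, mul_assoc]

end LocalOperator

end Functional

/-! ### Hilbert–Schmidt and trace class operators -/

section HilbertSchmidt

variable {𝓗 : Type} [NormedAddCommGroup 𝓗] [InnerProductSpace ℂ 𝓗]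

/-- Hilbert–Schmidt operators. -/
def IsHS (T : 𝓗 →L[ℂ] 𝓗) : Prop :=
  ∃ C : ℝ, ∀ (ι : Type) (e : ι → 𝓗), Orthonormal ℂ e → ∀ s : Finset ι, ∑ i ∈ s, ‖T (e i)‖ ^ 2 ≤ C

theorem IsHS.summable {T : 𝓗 →L[ℂ] 𝓗} (h : IsHS T) {ι : Type} {e : ι → 𝓗} (he : Orthonormal ℂ e) :
    Summable fun i => ‖T (e i)‖ ^ 2 := by
  obtain ⟨C, hC⟩ := h
  exact summable_of_sum_le (fun i => by positivity) (hC ι e he)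

theorem IsHS.comp_left {T : 𝓗 →L[ℂ] 𝓗} (h : IsHS T) (S : 𝓗 →L[ℂ] 𝓗) : IsHS (S ∘L T) := by
  obtain ⟨C, hC⟩ := h
  refine ⟨‖S‖ ^ 2 * C, fun ι e he s => ?_⟩
  refine (Finset.sum_le_sum fun i _ => ?_).trans
    ((Finset.mul_sum s (fun i => ‖T (e i)‖ ^ 2) _).symm.le.trans
      (mul_le_mul_of_nonneg_left (hC ι e he s) (by positivity)))
  rw [← mul_pow]
  exact pow_le_pow_left₀ (norm_nonneg _) (S.le_opNorm _) 2

theorem hasSum_norm_inner_sq {ι : Type*} (b : HilbertBasis ι ℂ 𝓗) (x : 𝓗) :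
    HasSum (fun i => ‖⟪b i, x⟫_ℂ‖ ^ 2) (‖x‖ ^ 2) := by
  have h := b.hasSum_inner_mul_inner x x
  have h2 := Complex.reCLM.hasSum h
  convert h2 using 1
  · funext i
    rw [← inner_conj_symm x (b i)]
    simp only [Complex.reCLM_apply, ← Complex.normSq_eq_conj_mul_self, Complex.ofReal_re,
      Complex.normSq_eq_norm_sq]
  · rw [Complex.reCLM_apply, norm_sq_eq_re_inner (𝕜 := ℂ) x]; rfl

variable [CompleteSpace 𝓗]

theorem IsHS.adjoint {T : 𝓗 →L[ℂ] 𝓗} (h : IsHS T) : IsHS (ContinuousLinearMap.adjoint T) := by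
  obtain ⟨w, b, -⟩ := exists_hilbertBasis ℂ 𝓗
  have hs := h.summable b.orthonormal
  refine ⟨∑' i, ‖T (b i)‖ ^ 2, fun ι e he s => ?_⟩
  have h1 : HasSum (fun k => ∑ i ∈ s, ‖⟪b k, ContinuousLinearMap.adjoint T (e i)⟫_ℂ‖ ^ 2)
      (∑ i ∈ s, ‖ContinuousLinearMap.adjoint T (e i)‖ ^ 2) :=
    hasSum_sum fun i _ => hasSum_norm_inner_sq b _
  refine hasSum_le (fun k => ?_) h1 hs.hasSum
  simp only [ContinuousLinearMap.adjoint_inner_right]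
  refine le_trans (le_of_eq (Finset.sum_congr rfl fun i _ => ?_)) (he.sum_inner_products_le (T (b k)))
  rw [← inner_conj_symm, RCLike.norm_conj]

theorem Summable.mul_of_sq {ι : Type*} {f g : ι → ℝ} (hf : Summable fun i => f i ^ 2)
    (hg : Summable fun i => g i ^ 2) : Summable fun i => |f i| * |g i| := by
  refine ((hf.add hg)).of_nonneg_of_le (fun i => by positivity) fun i => ?_
  nlinarith [sq_nonneg (|f i| - |g i|), sq_abs (f i), sq_abs (g i), sq_nonneg (f i), sq_nonneg (g i)]

omit [CompleteSpace 𝓗] in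
theorem exists_nat_family {T : 𝓗 →L[ℂ] 𝓗} {ι : Type} {f g : ι → 𝓗}
    (hs : Summable fun i => ‖f i‖ * ‖g i‖) (h : ∀ x, HasSum (fun i => ⟪f i, x⟫_ℂ • g i) (T x)) :
    ∃ f g : ℕ → 𝓗, Summable (fun n => ‖f n‖ * ‖g n‖) ∧
      ∀ x, HasSum (fun n => ⟪f n, x⟫_ℂ • g n) (T x) := by
  set U := Function.support fun i => ‖f i‖ * ‖g i‖ with hU
  have hcount : U.Countable := hs.countable_support
  have := hcount.to_subtype
  obtain ⟨enc, henc⟩ := exists_injective_nat U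
  have hoff : ∀ i ∉ U, f i = 0 ∨ g i = 0 := fun i hi => by
    have : ‖f i‖ * ‖g i‖ = 0 := Function.notMem_support.1 hi
    rcases mul_eq_zero.1 this with h | h
    · exact Or.inl (norm_eq_zero.1 h)
    · exact Or.inr (norm_eq_zero.1 h)
  refine ⟨Function.extend enc (fun i => f i) 0, Function.extend enc (fun i => g i) 0, ?_, fun x => ?_⟩
  · refine (henc.summable_iff fun n hn => ?_).1 ?_
    · rw [Function.extend_apply' _ _ _ (by simpa using hn)]; simp
    · simp only [Function.comp_def, henc.extend_apply]
      exact hs.subtype U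
  · refine (henc.hasSum_iff fun n hn => ?_).1 ?_
    · rw [Function.extend_apply' _ _ _ (by simpa using hn)]; simp
    · simp only [Function.comp_def, henc.extend_apply]
      refine (hasSum_subtype_iff_of_support_subset (f := fun i => ⟪f i, x⟫_ℂ • g i) ?_).2 (h x)
      intro i hi
      by_contra hcon
      rcases hoff i hcon with h0 | h0 <;> simp [h0] at hi

/-- The product of two Hilbert–Schmidt operators is trace class, and its trace is that of the
product in the other order. -/
theorem hasTrace_comp {A B : 𝓗 →L[ℂ] 𝓗} (hA : IsHS A) (hB : IsHS B) {κ : Type}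
    (b : HilbertBasis κ ℂ 𝓗) {t : ℂ} (ht : HasSum (fun k => ⟪b k, B (A (b k))⟫_ℂ) t) :
    HasTrace (A ∘L B) t := by
  have hBa := hB.adjoint
  have hsA := hA.summable b.orthonormal
  have hsB := hBa.summable b.orthonormal
  refine ⟨exists_nat_family (f := fun k => ContinuousLinearMap.adjoint B (b k))
    (g := fun k => A (b k)) ?_ fun x => ?_, fun ι e => ?_⟩
  · simpa using Summable.mul_of_sq hsB hsA
  · have h1 := A.hasSum (b.hasSum_repr (B x))
    simp only [map_smul, b.repr_apply_apply] at h1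
    simpa only [ContinuousLinearMap.adjoint_inner_left, ContinuousLinearMap.comp_apply] using h1
  · have hdouble : ∀ T : 𝓗 →L[ℂ] 𝓗, (Summable fun k => ‖T (b k)‖ ^ 2) →
        Summable fun p : κ × ι => ‖⟪e p.2, T (b p.1)⟫_ℂ‖ ^ 2 := fun T hT => by
      refine (summable_prod_of_nonneg fun p => by positivity).2 ⟨fun k =>
        (hasSum_norm_inner_sq e (T (b k))).summable, ?_⟩
      simpa only [(hasSum_norm_inner_sq e (T (b _))).tsum_eq] using hT
    have hs : Summable fun p : κ × ι =>
        ⟪ContinuousLinearMap.adjoint B (b p.1), e p.2⟫_ℂ * ⟪e p.2, A (b p.1)⟫_ℂ := by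
      refine Summable.of_norm ?_
      have h2 := Summable.mul_of_sq (hdouble _ hsB) (hdouble _ hsA)
      refine h2.congr fun p => ?_
      rw [norm_mul, abs_norm, abs_norm, ← inner_conj_symm, RCLike.norm_conj]
    have h3 : HasSum (fun p : κ × ι =>
        ⟪ContinuousLinearMap.adjoint B (b p.1), e p.2⟫_ℂ * ⟪e p.2, A (b p.1)⟫_ℂ) t := by
      have h4 := hs.hasSum
      have h5 := h4.prod_fiberwise fun k => e.hasSum_inner_mul_inner
        (ContinuousLinearMap.adjoint B (b k)) (A (b k))
      have h6 := h5.unique (by simpa only [ContinuousLinearMap.adjoint_inner_left] using ht)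
      rwa [h6] at h4
    have h6 := ((Equiv.prodComm ι κ).hasSum_iff).2 h3
    refine h6.prod_fiberwise fun i => ?_
    have h7 := b.hasSum_inner_mul_inner (ContinuousLinearMap.adjoint A (e i)) (B (e i))
    simp only [ContinuousLinearMap.adjoint_inner_left] at h7
    refine h7.congr_fun fun k => ?_
    simp only [Function.comp, Equiv.prodComm_apply, Prod.swap]
    rw [ContinuousLinearMap.adjoint_inner_left, mul_comm]

end HilbertSchmidt

/-! ### Plancherel's formula and slices -/

section Slices

variable {q : ℕ}

theorem separableSpace_L2Plane : TopologicalSpace.SeparableSpace (L2Plane q) := by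
  have : Fact ((2 : ℝ≥0∞) ≠ ⊤) := ⟨by simp⟩
  infer_instance

theorem countable_of_orthonormal {𝓗 : Type*} [NormedAddCommGroup 𝓗] [InnerProductSpace ℂ 𝓗]
    [TopologicalSpace.SeparableSpace 𝓗] {ι : Type*} {e : ι → 𝓗} (he : Orthonormal ℂ e) :
    Countable ι := by
  rcases isEmpty_or_nonempty ι with h | h
  · infer_instance
  obtain ⟨i₀⟩ := h
  have : Nonempty 𝓗 := ⟨e i₀⟩
  have hd := TopologicalSpace.denseRange_denseSeq 𝓗
  choose n hn using fun i => hd.exists_dist_lt (e i) (show (0 : ℝ) < 1 / 2 by norm_num)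
  refine Function.Injective.countable (f := n) fun i j hij => ?_
  by_contra hne
  have h1 : dist (e i) (e j) < 1 := by
    have h2 := hn i
    have h3 := hn j
    rw [← hij] at h3
    rw [dist_comm] at h3
    exact lt_of_le_of_lt (dist_triangle _ _ _) (by linarith)
  have h4 : dist (e i) (e j) ^ 2 = 2 := by
    rw [dist_eq_norm, norm_sub_sq (𝕜 := ℂ), he.2 hne, he.1 i, he.1 j]; norm_num
  nlinarith [dist_nonneg (x := e i) (y := e j)]

/-- Plancherel's formula on `L¹ ∩ L²`. -/
theorem lintegral_fourier_sq {F : ℝ → ℂ} (h1 : Integrable F) (h2 : MemLp F 2 volume) :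
    ∫⁻ ξ : ℝ, ‖∫ x : ℝ, Complex.exp (-(Complex.I * ξ * x)) * F x‖ₑ ^ 2 =
      ENNReal.ofReal (2 * Real.pi) * ∫⁻ x, ‖F x‖ₑ ^ 2 := by
  open FourierTransform SchwartzMap in
  have hFcont : Continuous (𝓕 F) :=
    VectorFourier.fourierIntegral_continuous Real.continuous_fourierChar
      (L := innerₗ ℝ) (by exact continuous_inner) h1
  set f : Lp ℂ 2 (volume : Measure ℝ) := h2.toLp F with hf
  have hae : (𝓕 f : Lp ℂ 2 (volume : Measure ℝ)) =ᵐ[volume] 𝓕 F := by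
    refine ae_eq_of_integral_contDiff_smul_eq
      (((Lp.memLp (𝓕 f : Lp ℂ 2 (volume : Measure ℝ))).locallyIntegrable (by norm_num)))
      hFcont.locallyIntegrable fun g hg hgc => ?_
    have hgC : ContDiff ℝ ∞ fun x => (g x : ℂ) := Complex.ofRealCLM.contDiff.comp hg
    have hgcC : HasCompactSupport fun x => (g x : ℂ) := hgc.comp_left Complex.ofReal_zero
    set G := hgcC.toSchwartzMap hgC with hG
    have hGx : ∀ x, G x = (g x : ℂ) := fun x => rfl
    have e1 := congrArg (fun T => T G) (Lp.fourier_toTemperedDistribution_eq f)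
    simp only [TemperedDistribution.fourier_apply, Lp.toTemperedDistribution_apply] at e1
    have e2 : ∫ x, (𝓕 G) x • f x = ∫ x, (𝓕 G) x • F x := by
      refine integral_congr_ae ?_
      filter_upwards [h2.coeFn_toLp] with x hx
      rw [hf, hx]
    have e3 : ∫ x, (𝓕 G) x • F x = ∫ x, G x • 𝓕 F x := by
      have := VectorFourier.integral_fourierIntegral_smul_eq_flip (μ := (volume : Measure ℝ))
        (ν := (volume : Measure ℝ)) (L := innerₗ ℝ) Real.continuous_fourierChar
        (by exact continuous_inner) (f := G) (g := F) G.integrable h1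
      rw [SchwartzMap.fourier_coe]
      rw [flip_innerₗ] at this
      exact this
    have e4 : ∀ (u : ℝ → ℂ), ∫ x, g x • u x = ∫ x, G x • u x := fun u =>
      integral_congr_ae (Eventually.of_forall fun x => by simp only [hGx]; simp)
    rw [e4, e4, ← e1, e2, e3]
  have hnorm : ∫⁻ ξ, ‖𝓕 F ξ‖ₑ ^ 2 = ∫⁻ x, ‖F x‖ₑ ^ 2 := by
    have h3 : ∀ g : Lp ℂ 2 (volume : Measure ℝ), ∫⁻ x, ‖g x‖ₑ ^ 2 = ‖g‖ₑ ^ 2 := fun g => by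
      rw [Lp.enorm_def, eLpNorm_eq_lintegral_rpow_enorm_toReal (by norm_num) (by norm_num),
        ← ENNReal.rpow_natCast, ← ENNReal.rpow_mul]
      simp
    have h4 : ‖(𝓕 f : Lp ℂ 2 (volume : Measure ℝ))‖ₑ = ‖f‖ₑ := by
      rw [enorm_eq_nnnorm, enorm_eq_nnnorm]
      congr 1
      exact NNReal.eq (Lp.norm_fourier_eq f)
    calc ∫⁻ ξ, ‖𝓕 F ξ‖ₑ ^ 2 = ∫⁻ ξ, ‖(𝓕 f : Lp ℂ 2 (volume : Measure ℝ)) ξ‖ₑ ^ 2 :=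
          lintegral_congr_ae (hae.mono fun x hx => by simp only [hx])
      _ = ∫⁻ x, ‖f x‖ₑ ^ 2 := by rw [h3, h3, h4]
      _ = ∫⁻ x, ‖F x‖ₑ ^ 2 := lintegral_congr_ae (h2.coeFn_toLp.mono fun x hx => by
          simp only [hf, hx])
  have h2pi : (2 * Real.pi)⁻¹ ≠ 0 := by positivity
  have hscale : ∀ ξ : ℝ, ∫ x : ℝ, Complex.exp (-(Complex.I * ξ * x)) * F x =
      𝓕 F ((2 * Real.pi)⁻¹ * ξ) := fun ξ => by
    rw [Real.fourier_real_eq_integral_exp_smul]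
    refine integral_congr_ae (Eventually.of_forall fun x => ?_)
    simp only [smul_eq_mul]
    congr 2
    have : (Real.pi : ℂ) ≠ 0 := by exact_mod_cast Real.pi_ne_zero
    push_cast
    field_simp
  simp only [hscale]
  have hmap := Real.map_volume_mul_left h2pi
  have hm : Measurable fun ξ => ‖𝓕 F ξ‖ₑ ^ 2 := (hFcont.measurable.enorm).pow_const 2
  have h5 := lintegral_map (μ := volume) hm (measurable_const_mul (2 * Real.pi)⁻¹)
  rw [hmap, lintegral_smul_measure, hnorm, inv_inv, abs_of_pos (by positivity)] at h5
  rw [← h5]; rfl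

theorem volume_plane : (volume : Measure (ℝ × ℝ)) = (volume : Measure ℝ).prod volume := rfl

theorem L2Plane_enorm_sq (f : L2Plane q) : ‖f‖ₑ ^ 2 = ∫⁻ z, ‖f z‖ₑ ^ 2 := by
  rw [Lp.enorm_def, eLpNorm_eq_lintegral_rpow_enorm_toReal (by norm_num) (by norm_num),
    ← ENNReal.rpow_natCast, ← ENNReal.rpow_mul]
  simp

theorem L2Line_enorm_sq (f : L2Line q) : ‖f‖ₑ ^ 2 = ∫⁻ z, ‖f z‖ₑ ^ 2 := by
  rw [Lp.enorm_def, eLpNorm_eq_lintegral_rpow_enorm_toReal (by norm_num) (by norm_num),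
    ← ENNReal.rpow_natCast, ← ENNReal.rpow_mul]
  simp

theorem enorm_sq_eq_lintegral_slices {f : ℝ × ℝ → Fibre q} (hf : AEStronglyMeasurable f volume) :
    ∫⁻ z, ‖f z‖ₑ ^ 2 = ∫⁻ x, ∫⁻ y, ‖f (x, y)‖ₑ ^ 2 := by
  rw [volume_plane, lintegral_prod]
  exact (hf.enorm.pow_const 2)

theorem ae_slice_memLp {f : ℝ × ℝ → Fibre q} (hf : MemLp f 2 volume) :
    ∀ᵐ x : ℝ, MemLp (fun y => f (x, y)) 2 volume := by
  have h1 := (memLp_two_iff.1 hf).2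
  rw [enorm_sq_eq_lintegral_slices hf.1] at h1
  have hm : AEMeasurable (fun x => ∫⁻ y, ‖f (x, y)‖ₑ ^ 2) volume :=
    AEMeasurable.lintegral_prod_right' (f := fun z : ℝ × ℝ => ‖f z‖ₑ ^ 2) (hf.1.enorm.pow_const 2)
  filter_upwards [ae_lt_top' hm h1.ne, hf.1.prodMk_left] with x hx hx2
  exact memLp_two_iff.2 ⟨hx2, hx⟩

/-- `∫ ⟨b(y), f(x,y)⟩ dy`. -/
def sliceInner (b : ℝ → Fibre q) (f : ℝ × ℝ → Fibre q) (x : ℝ) : ℂ := ∫ y, ⟪b y, f (x, y)⟫_ℂ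

theorem aestronglyMeasurable_inner_snd {b : ℝ → Fibre q} {f : ℝ × ℝ → Fibre q}
    (hb : AEStronglyMeasurable b volume) (hf : AEStronglyMeasurable f volume) :
    AEStronglyMeasurable (fun z : ℝ × ℝ => ⟪b z.2, f z⟫_ℂ) volume :=
  AEStronglyMeasurable.inner hb.comp_snd hf

theorem aestronglyMeasurable_sliceInner {b : ℝ → Fibre q} {f : ℝ × ℝ → Fibre q}
    (hb : AEStronglyMeasurable b volume) (hf : AEStronglyMeasurable f volume) :
    AEStronglyMeasurable (sliceInner b f) volume :=
  (aestronglyMeasurable_inner_snd hb hf).integral_prod_right'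

theorem sliceInner_eq {f : ℝ × ℝ → Fibre q} {x : ℝ} (hx : MemLp (fun y => f (x, y)) 2 volume)
    (b : L2Line q) : sliceInner b f x = ⟪b, hx.toLp _⟫_ℂ := by
  rw [L2.inner_def]
  refine integral_congr_ae ?_
  filter_upwards [hx.coeFn_toLp] with y hy
  rw [hy]

theorem toLp_enorm_sq {f : ℝ → Fibre q} (hf : MemLp f 2 volume) :
    ‖hf.toLp f‖ₑ ^ 2 = ∫⁻ y, ‖f y‖ₑ ^ 2 := by
  rw [L2Line_enorm_sq]
  exact lintegral_congr_ae (hf.coeFn_toLp.mono fun y hy => by simp only [hy])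

theorem enorm_sliceInner_sq_le {f : ℝ × ℝ → Fibre q} (hf : MemLp f 2 volume) (b : L2Line q) :
    ∀ᵐ x : ℝ, ‖sliceInner b f x‖ₑ ^ 2 ≤ ‖b‖ₑ ^ 2 * ∫⁻ y, ‖f (x, y)‖ₑ ^ 2 := by
  filter_upwards [ae_slice_memLp hf] with x hx
  rw [sliceInner_eq hx, ← toLp_enorm_sq hx, ← mul_pow]
  gcongr
  rw [enorm_eq_nnnorm, enorm_eq_nnnorm, enorm_eq_nnnorm, ← ENNReal.coe_mul]
  exact_mod_cast nnnorm_inner_le_nnnorm (𝕜 := ℂ) b (hx.toLp _)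

theorem memLp_sliceInner {f : ℝ × ℝ → Fibre q} (hf : MemLp f 2 volume) (b : L2Line q) :
    MemLp (sliceInner b f) 2 volume := by
  refine memLp_two_iff.2 ⟨aestronglyMeasurable_sliceInner (Lp.aestronglyMeasurable b) hf.1, ?_⟩
  refine lt_of_le_of_lt (lintegral_mono_ae (enorm_sliceInner_sq_le hf b)) ?_
  rw [lintegral_const_mul' _ _ (by simp), ← enorm_sq_eq_lintegral_slices hf.1]
  exact ENNReal.mul_lt_top (by simp) (memLp_two_iff.1 hf).2

theorem tsum_enorm_inner_sq {𝓗 : Type*} [NormedAddCommGroup 𝓗] [InnerProductSpace ℂ 𝓗] {ι : Type*}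
    (b : HilbertBasis ι ℂ 𝓗) (x : 𝓗) : ∑' i, ‖⟪b i, x⟫_ℂ‖ₑ ^ 2 = ‖x‖ₑ ^ 2 := by
  have h1 : HasSum (fun i => ‖⟪b i, x⟫_ℂ‖ ^ 2) (‖x‖ ^ 2) := by
    have h2 := Complex.reCLM.hasSum (b.hasSum_inner_mul_inner x x)
    convert h2 using 1
    · funext i
      rw [← inner_conj_symm x (b i)]
      simp only [Complex.reCLM_apply, ← Complex.normSq_eq_conj_mul_self, Complex.ofReal_re,
        Complex.normSq_eq_norm_sq]
    · rw [Complex.reCLM_apply, norm_sq_eq_re_inner (𝕜 := ℂ) x]; rfl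
  have h3 := ENNReal.ofReal_tsum_of_nonneg (fun i => by positivity) h1.summable
  rw [h1.tsum_eq] at h3
  simp only [ENNReal.ofReal_pow (norm_nonneg _), ofReal_norm] at h3
  exact h3.symm

theorem tsum_enorm_sliceInner_sq {f : ℝ × ℝ → Fibre q} (hf : MemLp f 2 volume) {ι : Type*}
    (b : HilbertBasis ι ℂ (L2Line q)) :
    ∀ᵐ x : ℝ, ∑' k, ‖sliceInner (b k) f x‖ₑ ^ 2 = ∫⁻ y, ‖f (x, y)‖ₑ ^ 2 := by
  filter_upwards [ae_slice_memLp hf] with x hx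
  simp only [sliceInner_eq hx, tsum_enorm_inner_sq, toLp_enorm_sq]

/-- `a(x) b(y)` is square integrable. -/
theorem lintegral_tens_sq {a : ℝ → ℂ} (ha : MemLp a 2 volume) {b : ℝ → Fibre q}
    (hb : MemLp b 2 volume) : ∫⁻ z : ℝ × ℝ, ‖a z.1 • b z.2‖ₑ ^ 2 =
      (∫⁻ x, ‖a x‖ₑ ^ 2) * ∫⁻ y, ‖b y‖ₑ ^ 2 := by
  rw [volume_plane, ← lintegral_prod_mul (ha.1.enorm.pow_const 2) (hb.1.enorm.pow_const 2)]
  simp only [enorm_smul, mul_pow]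

theorem memLp_tens {a : ℝ → ℂ} (ha : MemLp a 2 volume) {b : ℝ → Fibre q}
    (hb : MemLp b 2 volume) : MemLp (fun z : ℝ × ℝ => a z.1 • b z.2) 2 volume := by
  refine memLp_two_iff.2 ⟨ha.1.comp_fst.smul hb.1.comp_snd, ?_⟩
  rw [lintegral_tens_sq ha hb]
  exact ENNReal.mul_lt_top (memLp_two_iff.1 ha).2 (memLp_two_iff.1 hb).2

/-- The operator `b ↦ a(x) b(y)`. -/
def tens {a : ℝ → ℂ} (ha : MemLp a 2 volume) : L2Line q →L[ℂ] L2Plane q :=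
  LinearMap.mkContinuousOfExistsBound
    { toFun := fun b => (memLp_tens ha (Lp.memLp b)).toLp _
      map_add' := fun b c => by
        rw [← MemLp.toLp_add]
        refine MemLp.toLp_congr _ _ ?_
        have h := (Measure.quasiMeasurePreserving_snd (μ := (volume : Measure ℝ))
          (ν := (volume : Measure ℝ))).ae_eq (Lp.coeFn_add b c)
        filter_upwards [h] with z hz
        simp only [Function.comp] at hz
        rw [hz]; simp
      map_smul' := fun r b => by
        rw [RingHom.id_apply, ← MemLp.toLp_const_smul]
        refine MemLp.toLp_congr _ _ ?_
        have h := (Measure.quasiMeasurePreserving_snd (μ := (volume : Measure ℝ))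
          (ν := (volume : Measure ℝ))).ae_eq (Lp.coeFn_smul r b)
        filter_upwards [h] with z hz
        simp only [Function.comp] at hz
        rw [hz]; exact smul_comm (a z.1) r (b z.2) }
    ⟨Real.sqrt (∫⁻ x, ‖a x‖ₑ ^ 2).toReal, fun b => by
      have h2 : ‖(memLp_tens ha (Lp.memLp b)).toLp _‖ₑ ^ 2 = (∫⁻ x, ‖a x‖ₑ ^ 2) * ‖b‖ₑ ^ 2 := by
        rw [L2Plane_enorm_sq, L2Line_enorm_sq, ← lintegral_tens_sq ha (Lp.memLp b)]
        exact lintegral_congr_ae ((memLp_tens ha (Lp.memLp b)).coeFn_toLp.mono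
          fun y hy => by simp only [hy])
      have h3 := congrArg ENNReal.toReal h2
      rw [ENNReal.toReal_mul, ENNReal.toReal_pow, ENNReal.toReal_pow, toReal_enorm, toReal_enorm] at h3
      refine le_of_sq_le_sq ?_ (by positivity)
      change ‖(memLp_tens ha (Lp.memLp b)).toLp _‖ ^ 2 ≤ _
      rw [h3, mul_pow, Real.sq_sqrt ENNReal.toReal_nonneg]⟩

theorem tens_coe {a : ℝ → ℂ} (ha : MemLp a 2 volume) (b : L2Line q) :
    tens ha b =ᵐ[volume] fun z => a z.1 • b z.2 :=
  (memLp_tens ha (Lp.memLp b)).coeFn_toLp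

theorem enorm_tens_sq {a : ℝ → ℂ} (ha : MemLp a 2 volume) (b : L2Line q) :
    ‖tens ha b‖ₑ ^ 2 = (∫⁻ x, ‖a x‖ₑ ^ 2) * ‖b‖ₑ ^ 2 := by
  rw [L2Plane_enorm_sq, L2Line_enorm_sq, ← lintegral_tens_sq ha (Lp.memLp b)]
  exact lintegral_congr_ae ((tens_coe ha b).mono fun y hy => by simp only [hy])

theorem inner_tens {a : ℝ → ℂ} (ha : MemLp a 2 volume) (b : L2Line q) (f : L2Plane q) :
    ⟪tens ha b, f⟫_ℂ = ∫ x, starRingEnd ℂ (a x) * sliceInner b f x := by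
  have hint : Integrable (fun z : ℝ × ℝ => starRingEnd ℂ (a z.1) * ⟪b z.2, f z⟫_ℂ)
      ((volume : Measure ℝ).prod volume) := by
    refine (L2.integrable_inner (𝕜 := ℂ) (tens ha b) f).congr ?_
    filter_upwards [tens_coe ha b] with z hz
    rw [hz, inner_smul_left]
  rw [L2.inner_def]
  have h1 : ∫ z : ℝ × ℝ, ⟪tens ha b z, f z⟫_ℂ =
      ∫ z : ℝ × ℝ, starRingEnd ℂ (a z.1) * ⟪b z.2, f z⟫_ℂ := by
    refine integral_congr_ae ?_
    filter_upwards [tens_coe ha b] with z hz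
    rw [hz, inner_smul_left]
  refine h1.trans ((integral_prod _ hint).trans ?_)
  refine integral_congr_ae (Eventually.of_forall fun x => ?_)
  exact MeasureTheory.integral_const_mul (starRingEnd ℂ (a x)) fun y => ⟪b y, f (x, y)⟫_ℂ

end Slices

/-! ### The free resolution of the identity and a Hilbert–Schmidt criterion -/

section FreeParseval

variable {p q : ℕ}

theorem memLp_wp_neg_one {ε : ℝ} (hε : ε ≠ 0) : MemLp (wp ε (-1)) 2 volume := by
  refine (memLp_two_iff_integrable_sq_norm
    (contDiff_wp ε (-1)).continuous.aestronglyMeasurable).2 ?_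
  have h := (integrable_inv_one_add_sq).comp_mul_left' hε
  refine h.congr (Eventually.of_forall fun x => ?_)
  simp only
  rw [norm_wp, norm_wp_one, zpow_neg_one, inv_pow, Real.sq_sqrt (by positivity)]

/-- The profile `(2π)^{-1/2} (1 + iεx)^{-1} e^{iξx}`. -/
def profile (ε ξ x : ℝ) : ℂ :=
  wp ε (-1) x * (((Real.sqrt (2 * Real.pi))⁻¹ : ℂ) * Complex.exp (Complex.I * ξ * x))

theorem norm_exp_I_mul_mul (ξ x : ℝ) : ‖Complex.exp (Complex.I * ξ * x)‖ = 1 := by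
  have : Complex.I * ξ * x = ((ξ * x : ℝ) : ℂ) * Complex.I := by push_cast; ring
  rw [this, Complex.norm_exp_ofReal_mul_I]

theorem norm_profile (ε ξ x : ℝ) :
    ‖profile ε ξ x‖ = (Real.sqrt (2 * Real.pi))⁻¹ * ‖wp ε (-1) x‖ := by
  rw [profile, norm_mul, norm_mul, norm_exp_I_mul_mul, mul_one, mul_comm, norm_inv,
    Complex.norm_real, Real.norm_of_nonneg (Real.sqrt_nonneg _)]

theorem memLp_profile {ε : ℝ} (hε : ε ≠ 0) (ξ : ℝ) : MemLp (profile ε ξ) 2 volume := by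
  refine (memLp_wp_neg_one hε).of_le_mul (c := (Real.sqrt (2 * Real.pi))⁻¹) ?_
    (Eventually.of_forall fun x => (norm_profile ε ξ x).le)
  refine Continuous.aestronglyMeasurable ?_
  exact (contDiff_wp ε (-1)).continuous.mul (by fun_prop)

/-- The pairing with a plane wave is a Fourier transform. -/
theorem inner_tens_profile {ε : ℝ} (hε : ε ≠ 0) (ξ : ℝ) (b : L2Line q) (f : L2Plane q) :
    ⟪tens (memLp_profile hε ξ) b, f⟫_ℂ = ((Real.sqrt (2 * Real.pi))⁻¹ : ℂ) *
      ∫ x : ℝ, Complex.exp (-(Complex.I * ξ * x)) * (wp (-ε) (-1) x * sliceInner b f x) := by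
  rw [inner_tens, ← MeasureTheory.integral_const_mul]
  refine integral_congr_ae (Eventually.of_forall fun x => ?_)
  simp only [profile, map_mul, conj_wp, map_inv₀, Complex.conj_ofReal, ← Complex.exp_conj,
    Complex.conj_I]
  rw [show -Complex.I * ξ * x = -(Complex.I * ξ * x) by ring]
  ring

theorem integrable_wp_mul_sliceInner {ε : ℝ} (hε : ε ≠ 0) (b : L2Line q) (f : L2Plane q) :
    Integrable fun x => wp (-ε) (-1) x * sliceInner b f x :=
  MemLp.integrable_mul (memLp_wp_neg_one (neg_ne_zero.2 hε)) (memLp_sliceInner (Lp.memLp f) b)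

theorem memLp_wp_mul_sliceInner (ε : ℝ) (b : L2Line q) (f : L2Plane q) :
    MemLp (fun x => wp (-ε) (-1) x * sliceInner b f x) 2 volume := by
  refine (memLp_sliceInner (Lp.memLp f) b).of_le_mul (c := 1)
    ((contDiff_wp (-ε) (-1)).continuous.aestronglyMeasurable.mul
      (memLp_sliceInner (Lp.memLp f) b).1) (Eventually.of_forall fun x => ?_)
  rw [norm_mul]
  exact mul_le_mul_of_nonneg_right (norm_wp_le_one _ (by norm_num) x) (norm_nonneg _)

theorem continuous_inner_tens_profile {ε : ℝ} (hε : ε ≠ 0) (b : L2Line q) (f : L2Plane q) :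
    Continuous fun ξ : ℝ => ⟪tens (memLp_profile hε ξ) b, f⟫_ℂ := by
  simp only [inner_tens_profile hε]
  refine continuous_const.mul ?_
  have hF := integrable_wp_mul_sliceInner hε b f
  refine continuous_of_dominated (F := fun (ξ x : ℝ) => Complex.exp (-(Complex.I * ξ * x)) *
    (wp (-ε) (-1) x * sliceInner b f x)) (fun ξ => ?_) (fun ξ => Eventually.of_forall fun x => ?_)
    hF.norm (Eventually.of_forall fun x => by fun_prop)
  · exact (Continuous.aestronglyMeasurable (by fun_prop)).mul hF.1
  · rw [norm_mul, Complex.exp_neg, norm_inv, norm_exp_I_mul_mul, inv_one, one_mul]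

theorem lintegral_inner_tens_profile {ε : ℝ} (hε : ε ≠ 0) (b : L2Line q) (f : L2Plane q) :
    ∫⁻ ξ : ℝ, ‖⟪tens (memLp_profile hε ξ) b, f⟫_ℂ‖ₑ ^ 2 =
      ∫⁻ x, ‖wp (-ε) (-1) x‖ₑ ^ 2 * ‖sliceInner b f x‖ₑ ^ 2 := by
  simp only [inner_tens_profile hε, enorm_mul, mul_pow]
  rw [lintegral_const_mul' _ _ (ENNReal.pow_ne_top enorm_ne_top), lintegral_fourier_sq
    (integrable_wp_mul_sliceInner hε b f) (memLp_wp_mul_sliceInner ε b f), ← mul_assoc]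
  have h : ‖((Real.sqrt (2 * Real.pi))⁻¹ : ℂ)‖ₑ ^ 2 * ENNReal.ofReal (2 * Real.pi) = 1 := by
    rw [← ofReal_norm, ← ENNReal.ofReal_pow (norm_nonneg _), ← ENNReal.ofReal_mul (by positivity),
      norm_inv, Complex.norm_real, Real.norm_of_nonneg (Real.sqrt_nonneg _), inv_pow,
      Real.sq_sqrt (by positivity), inv_mul_cancel₀ (by positivity), ENNReal.ofReal_one]
  rw [h, one_mul]
  simp only [enorm_mul, mul_pow]

/-- The functions `(1 + iεx)^{-1} ψ_j(·; ξ)`. -/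
def wave (S : ScatteringSystem p q) {ε : ℝ} (hε : ε ≠ 0) (m : ℕ × ℝ) : L2Plane q :=
  tens (memLp_profile hε m.2) (S.mode m.2 m.1)

variable (S : ScatteringSystem p q) {ε : ℝ} (hε : ε ≠ 0)

theorem wave_coe (m : ℕ × ℝ) :
    ∀ᵐ z : ℝ × ℝ, wave S hε m z = wp ε (-1) z.1 • S.psi m z := by
  filter_upwards [tens_coe (memLp_profile hε m.2) (S.mode m.2 m.1)] with z hz
  rw [wave, hz, profile, ScatteringSystem.psi, smul_smul]

theorem tsum_enorm_wave (f : L2Plane q) (ξ : ℝ) :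
    ∑' j, ‖⟪wave S hε (j, ξ), f⟫_ℂ‖ₑ ^ 2 =
      ∑' k, ‖⟪tens (memLp_profile hε ξ) (S.mode 0 k), f⟫_ℂ‖ₑ ^ 2 := by
  have h : ∀ b : HilbertBasis ℕ ℂ (L2Line q), ∑' j, ‖⟪tens (memLp_profile hε ξ) (b j), f⟫_ℂ‖ₑ ^ 2 =
      ‖ContinuousLinearMap.adjoint (tens (memLp_profile hε ξ)) f‖ₑ ^ 2 := fun b => by
    simpa only [ContinuousLinearMap.adjoint_inner_right] using
      tsum_enorm_inner_sq b (ContinuousLinearMap.adjoint (tens (memLp_profile hε ξ)) f)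
  exact (h (S.mode ξ)).trans (h (S.mode 0)).symm

theorem measurable_tsum_enorm_wave (f : L2Plane q) :
    Measurable fun ξ => ∑' j, ‖⟪wave S hε (j, ξ), f⟫_ℂ‖ₑ ^ 2 := by
  simp only [tsum_enorm_wave]
  exact Measurable.tsum fun k =>
    (continuous_inner_tens_profile hε _ f).measurable.enorm.pow_const 2

theorem lintegral_wave (f : L2Plane q) :
    ∫⁻ ξ, ∑' j, ‖⟪wave S hε (j, ξ), f⟫_ℂ‖ₑ ^ 2 = ‖mulX (wp (-ε) (-1)) f‖ₑ ^ 2 := by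
  simp only [tsum_enorm_wave]
  have hb := (smoothBdd_wp (-ε) (a := -1) (by norm_num)).bddMeas
  rw [lintegral_tsum fun k =>
    ((continuous_inner_tens_profile hε _ f).measurable.enorm.pow_const 2).aemeasurable]
  simp only [lintegral_inner_tens_profile hε]
  have h0 : ∀ k, AEMeasurable (fun x => ‖wp (-ε) (-1) x‖ₑ ^ 2 * ‖sliceInner (S.mode 0 k) f x‖ₑ ^ 2)
      volume := fun k => (hb.measurable.enorm.pow_const 2).aemeasurable.mul
    ((memLp_sliceInner (Lp.memLp f) _).1.enorm.pow_const 2)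
  rw [← lintegral_tsum h0]
  rw [L2Plane_enorm_sq, enorm_sq_eq_lintegral_slices (Lp.aestronglyMeasurable _)]
  refine lintegral_congr_ae ?_
  have h2 : ∀ᵐ x : ℝ, ∀ᵐ y : ℝ, mulX (wp (-ε) (-1)) f (x, y) = wp (-ε) (-1) x • f (x, y) :=
    Measure.ae_ae_of_ae_prod (mulX_coe hb f)
  filter_upwards [tsum_enorm_sliceInner_sq (Lp.memLp f) (S.mode 0), h2] with x hx hx2
  rw [ENNReal.tsum_mul_left, hx, ← lintegral_const_mul' _ _ (by simp)]
  exact lintegral_congr_ae (hx2.mono fun y hy => by simp only [hy, enorm_smul, mul_pow])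

theorem enorm_wave_sq (m : ℕ × ℝ) : ‖wave S hε m‖ₑ ^ 2 = ∫⁻ x, ‖profile ε 0 x‖ₑ ^ 2 := by
  have h1 : ‖S.mode m.2 m.1‖ₑ = 1 := by
    rw [← ofReal_norm, (S.mode m.2).orthonormal.1, ENNReal.ofReal_one]
  rw [wave, enorm_tens_sq, h1, one_pow, mul_one]
  refine lintegral_congr fun x => ?_
  rw [← ofReal_norm, ← ofReal_norm, norm_profile, norm_profile]

include hε in
theorem lintegral_profile_lt_top : ∫⁻ x, ‖profile ε 0 x‖ₑ ^ 2 < ⊤ :=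
  (memLp_two_iff.1 (memLp_profile hε 0)).2

variable {S}

namespace ScatteringSystem.HypH1

theorem genEig_wave (h1 : S.HypH1) (m : ℕ × ℝ) :
    ∃ w : (h1.localOperator BddHermitian.zero).dom, (w : L2Plane q) = wave S hε m ∧
      (h1.localOperator BddHermitian.zero).GenEig ε w (S.energy m.1 m.2) := by
  obtain ⟨w, hw, hg⟩ := h1.exists_genEig BddHermitian.zero hε
    (by simpa using h1.psi_mem 1 (by norm_num) m) (e := S.energy m.1 m.2) (ψ := S.psi m)
    (by simpa using h1.psi_eq m)
  refine ⟨w, ?_, hg⟩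
  refine Lp.ext ?_
  filter_upwards [hw, wave_coe S hε m] with z h1 h2
  rw [h1, h2]

/-- The set of wave numbers at which one of the branches has a bounded energy has finite measure,
counted with multiplicity. -/
theorem tsum_volume_energy_lt_top (h1 : S.HypH1) (Λ : ℝ) :
    ∑' j, volume {ξ | |S.energy j ξ| ≤ Λ} < ⊤ := by
  have hfin := h1.finite_branches (-Λ) Λ
  have hz : ∀ j ∉ hfin.toFinset, volume {ξ | |S.energy j ξ| ≤ Λ} = 0 := fun j hj => by
    have : {ξ | |S.energy j ξ| ≤ Λ} = ∅ := by
      refine Set.eq_empty_of_forall_notMem fun ξ hξ => hj ?_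
      exact hfin.mem_toFinset.2 ⟨ξ, abs_le.1 hξ⟩
    rw [this, measure_empty]
  rw [tsum_eq_sum hz]
  refine ENNReal.sum_lt_top.2 fun j _ => ?_
  have h2 := (h1.energy_tendsto j).eventually_gt_atTop Λ
  obtain ⟨K, hK, hKs⟩ := Filter.mem_cocompact.1 h2
  refine lt_of_le_of_lt (measure_mono fun ξ hξ => ?_) hK.measure_lt_top
  by_contra hcon
  exact absurd (show Λ < |S.energy j ξ| from hKs hcon) (not_lt.2 hξ)

end ScatteringSystem.HypH1

theorem sum_lintegral_le {ι α : Type*} [MeasurableSpace α] (μ : Measure α) (s : Finset ι)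
    (f : ι → α → ℝ≥0∞) : ∑ i ∈ s, ∫⁻ x, f i x ∂μ ≤ ∫⁻ x, ∑ i ∈ s, f i x ∂μ := by
  classical
  induction s using Finset.induction_on with
  | empty => simp
  | insert a s ha ih =>
    simp only [Finset.sum_insert ha]
    exact (add_le_add le_rfl ih).trans (le_lintegral_add _ _)

theorem sum_enorm_inner_le {𝓗 : Type*} [NormedAddCommGroup 𝓗] [InnerProductSpace ℂ 𝓗]
    [CompleteSpace 𝓗] {ι : Type*} {e : ι → 𝓗} (he : Orthonormal ℂ e) (T : 𝓗 →L[ℂ] 𝓗) (w : 𝓗)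
    (s : Finset ι) : ∑ i ∈ s, ‖⟪w, T (e i)⟫_ℂ‖ₑ ^ 2 ≤ ‖T‖ₑ ^ 2 * ‖w‖ₑ ^ 2 := by
  have h1 := he.sum_inner_products_le (ContinuousLinearMap.adjoint T w) (s := s)
  have h2 : ‖ContinuousLinearMap.adjoint T w‖ ≤ ‖T‖ * ‖w‖ := by
    refine ((ContinuousLinearMap.adjoint T).le_opNorm w).trans ?_
    rw [LinearIsometryEquiv.norm_map]
  have h3 : ∑ i ∈ s, ‖⟪w, T (e i)⟫_ℂ‖ ^ 2 ≤ (‖T‖ * ‖w‖) ^ 2 := by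
    refine le_trans (le_of_eq (Finset.sum_congr rfl fun i _ => ?_))
      (h1.trans (pow_le_pow_left₀ (norm_nonneg _) h2 2))
    rw [← ContinuousLinearMap.adjoint_inner_left, ← inner_conj_symm, RCLike.norm_conj]
  have h4 := ENNReal.ofReal_le_ofReal h3
  rw [ENNReal.ofReal_sum_of_nonneg fun i _ => by positivity, mul_pow,
    ENNReal.ofReal_mul (by positivity)] at h4
  simpa only [ENNReal.ofReal_pow (norm_nonneg _), ofReal_norm] using h4

/-- The resolvent equation turns an energy bound into a bound weighted by the generalized energies. -/
theorem LocalOperator.Admissible.exists_weighted {L : LocalOperator p q} {ε₀ : ℝ}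
    (hε₀ : L.Admissible ε₀) (hle : |ε| ≤ ε₀) {u v : L.dom}
    (huv : (v : L2Plane q) = mulX (wp (-ε) (-1)) (u : L2Plane q)) {C : ℝ}
    (hC : ‖L.comm 0 v‖ ≤ C * ‖(v : L2Plane q)‖) :
    ∃ f : L2Plane q, ‖mulX (wp (-ε) (-1)) f‖ ^ 2 ≤ (C ^ 2 + 1) * ‖(v : L2Plane q)‖ ^ 2 ∧
      ∀ (w : L.dom) (e : ℝ), L.GenEig ε w e →
        ⟪(w : L2Plane q), f⟫_ℂ = ((e : ℂ) - imUnit true) * ⟪(w : L2Plane q), (u : L2Plane q)⟫_ℂ := by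
  have hb := (smoothBdd_wp (-ε) (a := -1) (by norm_num)).bddMeas
  have hle' : |-ε| ≤ ε₀ := by rwa [abs_neg]
  refine ⟨(1 + L.conjPert (-ε) (-1) true)
    (L.comm 0 u - imUnit true • (u : L2Plane q)), ?_, fun w e hg => ?_⟩
  · have h2 := L.sub_eq_wp_smul (-ε) (-1) true (u := v) (v := u) (by
      filter_upwards [mulX_coe hb (u : L2Plane q)] with z hz
      rw [huv, hz])
    rw [← eq_mulX hb h2, L.selfAdjoint.norm_sq, add_mul, one_mul, ← mul_pow]
    gcongr
  · have h3 := hε₀.inner_genEig_cres hle hg true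
      ((1 + L.conjPert (-ε) (-1) true) (L.comm 0 u - imUnit true • (u : L2Plane q)))
    rw [L.cres_apply, LocalOperator.cresD, LinearMap.comp_apply, ContinuousLinearMap.coe_coe,
      hε₀.inverse_mul hle' (by norm_num), L.selfAdjoint.resD_apply] at h3
    rw [h3, mul_inv_cancel_left₀ (ofReal_sub_imUnit_ne_zero _ _)]

theorem norm_ofReal_sub_imUnit_sq (t : ℝ) (b : Bool) : ‖(t : ℂ) - imUnit b‖ ^ 2 = t ^ 2 + 1 := by
  rw [← Complex.normSq_eq_norm_sq, Complex.normSq_apply]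
  cases b <;> simp [imUnit] <;> ring

/-- An operator localised in space and in energy is Hilbert–Schmidt. -/
theorem ScatteringSystem.HypH1.isHS (h1 : S.HypH1) {L : LocalOperator p q}
    (hL : L = h1.localOperator BddHermitian.zero) {ε₀ : ℝ}
    (hε₀ : L.Admissible ε₀) (hle : |ε| ≤ ε₀) (hε : ε ≠ 0)
    {T : L2Plane q →L[ℂ] L2Plane q} {T₁ T₂ : L2Plane q → L.dom}
    (hT₁ : ∀ f, (T₁ f : L2Plane q) = T f)
    (hT₂ : ∀ f, (T₂ f : L2Plane q) = mulX (wp (-ε) (-1)) (T f)) {C : ℝ}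
    (hC : ∀ f, ‖L.comm 0 (T₂ f)‖ ≤ C * ‖(T₂ f : L2Plane q)‖) :
    IsHS (mulX (wp (-ε) (-1)) ∘L T) := by
  -- the energy weighted Parseval formula
  have key : ∀ f, ∃ f₁ : L2Plane q, ‖mulX (wp (-ε) (-1)) f₁‖ ^ 2 ≤
      (C ^ 2 + 1) * ‖mulX (wp (-ε) (-1)) (T f)‖ ^ 2 ∧ ∀ m : ℕ × ℝ,
        ⟪wave S hε m, f₁⟫_ℂ = ((S.energy m.1 m.2 : ℂ) - imUnit true) * ⟪wave S hε m, T f⟫_ℂ := by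
    intro f
    obtain ⟨f₁, h2, h3⟩ := hε₀.exists_weighted hle (u := T₁ f) (v := T₂ f)
      (by rw [hT₁, hT₂]) (hC f)
    rw [hT₂] at h2
    refine ⟨f₁, h2, fun m => ?_⟩
    subst hL
    obtain ⟨w, hw, hg⟩ := h1.genEig_wave hε m
    rw [← hw, ← hT₁]
    exact h3 w _ hg
  clear hC hT₁ hT₂ hε₀ T₁ T₂ hL
  set Λ : ℝ := Real.sqrt (2 * (C ^ 2 + 1)) with hΛ
  have hΛ2 : Λ ^ 2 = 2 * (C ^ 2 + 1) := Real.sq_sqrt (by positivity)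
  set low : L2Plane q → ℝ → ℝ≥0∞ := fun f ξ =>
    ∑' j, {ξ | |S.energy j ξ| ≤ Λ}.indicator (fun ξ => ‖⟪wave S hε (j, ξ), T f⟫_ℂ‖ₑ ^ 2) ξ with hlow
  have hmain : ∀ f, ‖mulX (wp (-ε) (-1)) (T f)‖ₑ ^ 2 ≤ 2 * ∫⁻ ξ, low f ξ := by
    intro f
    obtain ⟨f₁, hf₁, hin⟩ := key f
    set A := ‖mulX (wp (-ε) (-1)) (T f)‖ₑ ^ 2 with hA
    have hAtop : A ≠ ⊤ := by simp [hA]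
    have h5 : A ≤ ∫⁻ ξ, (low f ξ + ENNReal.ofReal (Λ ^ 2)⁻¹ *
        ∑' j, ‖⟪wave S hε (j, ξ), f₁⟫_ℂ‖ₑ ^ 2) := by
      rw [hA, ← lintegral_wave S hε]
      refine lintegral_mono fun ξ => ?_
      rw [hlow, ← ENNReal.tsum_mul_left, ← ENNReal.tsum_add]
      refine ENNReal.tsum_le_tsum fun j => ?_
      by_cases hj : |S.energy j ξ| ≤ Λ
      · rw [Set.indicator_of_mem (by exact hj)]
        exact le_self_add
      · refine le_add_left ?_
        rw [hin, enorm_mul, mul_pow, ← mul_assoc]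
        refine le_mul_of_one_le_left' ?_
        rw [← ofReal_norm, ← ENNReal.ofReal_pow (norm_nonneg _),
          ← ENNReal.ofReal_mul (by positivity), ENNReal.one_le_ofReal]
        rw [norm_ofReal_sub_imUnit_sq, ← div_eq_inv_mul, one_le_div (by rw [hΛ2]; positivity), ← sq_abs (S.energy j ξ)]
        nlinarith [not_le.1 hj, Real.sqrt_nonneg (2 * (C ^ 2 + 1))]
    rw [lintegral_add_right _ ((measurable_tsum_enorm_wave S hε f₁).const_mul _),
      lintegral_const_mul _ (measurable_tsum_enorm_wave S hε f₁), lintegral_wave S hε] at h5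
    have h7 : ENNReal.ofReal (Λ ^ 2)⁻¹ * ‖mulX (wp (-ε) (-1)) f₁‖ₑ ^ 2 ≤ A / 2 := by
      have h8 : (Λ ^ 2)⁻¹ * ‖mulX (wp (-ε) (-1)) f₁‖ ^ 2 ≤
          ‖mulX (wp (-ε) (-1)) (T f)‖ ^ 2 / 2 := by
        rw [hΛ2, inv_mul_le_iff₀ (by positivity)]
        linarith
      have h9 := ENNReal.ofReal_le_ofReal h8
      rw [ENNReal.ofReal_mul (by positivity), ENNReal.ofReal_div_of_pos (by norm_num)] at h9
      simpa [hA, ENNReal.ofReal_pow, ofReal_norm] using h9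
    have h11 : A / 2 ≤ ∫⁻ ξ, low f ξ := by
      have h12 : A / 2 ≠ ⊤ := ENNReal.div_ne_top hAtop (by norm_num)
      refine (ENNReal.add_le_add_iff_right h12).1 ?_
      rw [ENNReal.add_halves]
      exact h5.trans (by gcongr)
    calc A = 2 * (A / 2) := (ENNReal.mul_div_cancel (by norm_num) (by norm_num)).symm
      _ ≤ _ := by gcongr
  set K := ‖T‖ₑ ^ 2 * ∫⁻ x, ‖profile ε 0 x‖ₑ ^ 2 with hK
  have hKtop : K < ⊤ := ENNReal.mul_lt_top (by simp) (lintegral_profile_lt_top hε)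
  have hfin : 2 * (K * ∑' j, volume {ξ | |S.energy j ξ| ≤ Λ}) < ⊤ :=
    ENNReal.mul_lt_top (by simp) (ENNReal.mul_lt_top hKtop (h1.tsum_volume_energy_lt_top Λ))
  refine ⟨(2 * (K * ∑' j, volume {ξ | |S.energy j ξ| ≤ Λ})).toReal, fun ι e he s => ?_⟩
  have h20 : ∑ i ∈ s, ‖mulX (wp (-ε) (-1)) (T (e i))‖ₑ ^ 2 ≤
      2 * (K * ∑' j, volume {ξ | |S.energy j ξ| ≤ Λ}) := by
    refine (Finset.sum_le_sum fun i _ => hmain (e i)).trans ?_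
    rw [← Finset.mul_sum]
    gcongr
    refine (sum_lintegral_le _ _ _).trans ?_
    have h21 : ∀ ξ, ∑ i ∈ s, low (e i) ξ ≤
        ∑' j, {ξ | |S.energy j ξ| ≤ Λ}.indicator (fun _ => K) ξ := by
      intro ξ
      rw [hlow, ← Summable.tsum_finsetSum fun i _ => ENNReal.summable]
      refine ENNReal.tsum_le_tsum fun j => ?_
      by_cases hj : ξ ∈ {ξ | |S.energy j ξ| ≤ Λ}
      · simp only [Set.indicator_of_mem hj]
        refine (sum_enorm_inner_le he T _ s).trans ?_
        rw [enorm_wave_sq]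
      · simp only [Set.indicator_of_notMem hj, Finset.sum_const_zero, le_refl]
    have hms : ∀ j, MeasurableSet {ξ | |S.energy j ξ| ≤ Λ} := fun j =>
      measurableSet_le (h1.energy_smooth j).continuous.abs.measurable measurable_const
    refine (lintegral_mono h21).trans ?_
    rw [lintegral_tsum fun j => (measurable_const.indicator (hms j)).aemeasurable,
      ← ENNReal.tsum_mul_left]
    refine ENNReal.tsum_le_tsum fun j => ?_
    rw [lintegral_indicator (hms j), lintegral_const, Measure.restrict_apply_univ]
  have h30 := ENNReal.toReal_mono hfin.ne h20
  rw [ENNReal.toReal_sum fun i _ => by simp] at h30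
  simpa using h30

end FreeParseval

/-! ### Localised functions of the perturbed operator are Hilbert–Schmidt -/

section Localised

variable {p q : ℕ}

theorem exists_cutoff (R : ℝ) : ∃ χ : ℝ → ℝ, ContDiff ℝ ∞ χ ∧ HasCompactSupport χ ∧
    ∀ x, |x| ≤ R → χ x = 1 := by
  let f : ContDiffBump (0 : ℝ) := ⟨max R 1, max R 1 + 1, by positivity, by linarith⟩
  refine ⟨f, f.contDiff, f.hasCompactSupport, fun x hx => f.one_of_mem_closedBall ?_⟩
  rw [mem_closedBall_zero_iff, Real.norm_eq_abs]
  exact hx.trans (le_max_left _ _)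

theorem HasCompactSupport.exists_abs_le {E : Type*} [Zero E] {f : ℝ → E}
    (hf : HasCompactSupport f) : ∃ R : ℝ, ∀ x, x ∈ tsupport f → |x| ≤ R := by
  obtain ⟨R, hR⟩ := hf.isBounded.exists_norm_le
  exact ⟨R, fun x hx => hR x hx⟩

theorem IsTest.exists_one {k : ℝ → ℂ} (hk : IsTest k) :
    ∃ k₁ : ℝ → ℂ, IsTest k₁ ∧ ∀ t, k₁ t * k t = k t := by
  obtain ⟨R, hR⟩ := HasCompactSupport.exists_abs_le hk.compact
  obtain ⟨χ, h1, h2, h3⟩ := exists_cutoff R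
  refine ⟨fun x => (χ x : ℂ), ⟨Complex.ofRealCLM.contDiff.comp h1,
    h2.comp_left Complex.ofReal_zero⟩, fun t => ?_⟩
  by_cases ht : t ∈ tsupport k
  · simp only [h3 t (hR t ht), Complex.ofReal_one, one_mul]
  · rw [image_eq_zero_of_notMem_tsupport ht, mul_zero]

namespace LocalOperator

variable {L : LocalOperator p q}

theorem Admissible.mono {ε₀ ε₁ : ℝ} (h : L.Admissible ε₀) (h0 : 0 < ε₁) (h1 : ε₁ ≤ ε₀) :
    L.Admissible ε₁ :=
  ⟨h0, h1.trans h.le_one, fun ε' hε' => h.small ε' (hε'.trans h1)⟩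

variable {ε₀ : ℝ} (hε₀ : L.Admissible ε₀) {ε : ℝ} (hε : |ε| ≤ ε₀) {k l : ℝ → ℂ}
include hε₀ hε

theorem Admissible.cfn_mul {a : ℤ} (ha : |a| ≤ 2) (ha0 : a ≤ 0) (hk : IsTest k) (hl : IsTest l)
    (f : L2Plane q) : L.cfn ε a (fun t => k t * l t) f = L.cfn ε a k (L.cfn ε a l f) := by
  refine mulX_injective (smoothBdd_wp ε ha0).bddMeas (wp_ne_zero ε a) ?_
  rw [← hε₀.fn_mulX hε ha ha0 (hk.mul hl), ← hε₀.fn_mulX hε ha ha0 hk,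
    ← hε₀.fn_mulX hε ha ha0 hl, fn_mul hk hl]
  rfl

theorem Admissible.cfn_mulX (hk : IsTest k) (f : L2Plane q) :
    L.cfn ε (-1) k (mulX (wp ε (-1)) f) = mulX (wp ε (-1)) (L.cfn ε (-2) k f) := by
  have hb := (smoothBdd_wp ε (a := -1) (by norm_num)).bddMeas
  have hsq : ∀ g : L2Plane q, mulX (wp ε (-1)) (mulX (wp ε (-1)) g) = mulX (wp ε (-2)) g :=
    fun g => by
      rw [← mulX_mul hb hb]
      simp only [wp_mul]; norm_num
  refine mulX_injective hb (wp_ne_zero ε (-1)) ?_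
  rw [← hε₀.fn_mulX hε (by norm_num) (by norm_num) hk, hsq, hsq,
    hε₀.fn_mulX hε (by norm_num) (by norm_num) hk]

theorem Admissible.norm_comm_zero_cresD_le {a : ℤ} (ha : |a| ≤ 2) (b : Bool) (f : L2Plane q) :
    ‖L.comm 0 (L.cresD ε a b f)‖ ≤ 2 * ‖f‖ :=
  (L.selfAdjoint.norm_apply_resD_le b _).trans (hε₀.norm_inverse_le hε ha b f)

omit hε₀ hε in
/-- On spectrally localised vectors the operator is bounded. -/
theorem exists_bound_fn (L : LocalOperator p q) (hk : IsTest k) : ∃ C : ℝ, ∀ f,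
    ‖L.comm 0 (L.selfAdjoint.resD true (L.fn (fun t : ℝ => ((t : ℂ) - imUnit true) * k t) f))‖ ≤
      C * ‖L.fn k f‖ := by
  obtain ⟨k₁, hk₁, h⟩ := hk.exists_one
  refine ⟨‖L.fn (fun t : ℝ => ((t : ℂ) - imUnit true) * k₁ t)‖, fun f => ?_⟩
  have h2 : L.fn (fun t : ℝ => ((t : ℂ) - imUnit true) * k t) f =
      L.fn (fun t : ℝ => ((t : ℂ) - imUnit true) * k₁ t) (L.fn k f) := by
    rw [← mul_apply_eq_comp, ← fn_mul (hk₁.sub_imUnit_mul true) hk]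
    simp only [mul_assoc, h]
  rw [h2]
  exact (L.selfAdjoint.norm_apply_resD_le true _).trans (ContinuousLinearMap.le_opNorm _ _)

theorem Admissible.exists_bound_cfn {a : ℤ} (ha : |a| ≤ 2) (ha0 : a ≤ 0) (hk : IsTest k) :
    ∃ C : ℝ, ∀ f, ‖L.comm 0 (L.cresD ε a true
      (L.cfn ε a (fun t : ℝ => ((t : ℂ) - imUnit true) * k t) f))‖ ≤ C * ‖L.cfn ε a k f‖ := by
  obtain ⟨k₁, hk₁, h⟩ := hk.exists_one
  refine ⟨2 * ‖L.cfn ε a (fun t : ℝ => ((t : ℂ) - imUnit true) * k₁ t)‖, fun f => ?_⟩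
  have h2 : L.cfn ε a (fun t : ℝ => ((t : ℂ) - imUnit true) * k t) f =
      L.cfn ε a (fun t : ℝ => ((t : ℂ) - imUnit true) * k₁ t) (L.cfn ε a k f) := by
    rw [← hε₀.cfn_mul hε ha ha0 (hk₁.sub_imUnit_mul true) hk]
    simp only [mul_assoc, h]
  rw [h2, mul_assoc]
  exact (hε₀.norm_comm_zero_cresD_le hε ha true _).trans
    (mul_le_mul_of_nonneg_left (ContinuousLinearMap.le_opNorm _ _) (by norm_num))

end LocalOperator

variable {S : ScatteringSystem p q} {Q : ℝ × ℝ → Matrix (Fin q) (Fin q) ℂ}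

namespace ScatteringSystem.HypH1

theorem norm_comm_zero_le (h1 : S.HypH1) (hQ : BddHermitian Q)
    (u : S.H₀.domain) : ‖(h1.localOperator BddHermitian.zero).comm 0 u‖ ≤
      ‖(h1.localOperator hQ).comm 0 u‖ + ‖hQ.clm‖ * ‖(u : L2Plane q)‖ := by
  have h2 : (h1.localOperator BddHermitian.zero).comm 0 u = S.H₀ u := by
    change S.H₀ u + BddHermitian.zero.clm (u : L2Plane q) = S.H₀ u
    have : BddHermitian.zero.clm (u : L2Plane q) = 0 := by
      refine Lp.ext ?_
      filter_upwards [BddHermitian.zero.clm_coe (u : L2Plane q),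
        Lp.coeFn_zero (Fibre q) 2 (volume : Measure (ℝ × ℝ))] with z h3 h4
      rw [h3, h4]; simp
    rw [this, add_zero]
  have h3 : (h1.localOperator hQ).comm 0 u = S.H₀ u + hQ.clm (u : L2Plane q) := rfl
  rw [h2, h3]
  calc ‖S.H₀ u‖ = ‖(S.H₀ u + hQ.clm (u : L2Plane q)) - hQ.clm (u : L2Plane q)‖ := by
        rw [add_sub_cancel_right]
    _ ≤ _ := norm_sub_le _ _
    _ ≤ _ := by gcongr; exact hQ.clm.le_opNorm _

variable {ε₀ : ℝ} {ε : ℝ} {k : ℝ → ℂ}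

theorem isHS_fn (h1 : S.HypH1) (hQ : BddHermitian Q)
    (h0 : (h1.localOperator BddHermitian.zero).Admissible ε₀)
    (hε₀ : (h1.localOperator hQ).Admissible ε₀) (hle : |ε| ≤ ε₀) (hε : ε ≠ 0) (hk : IsTest k) :
    IsHS ((h1.localOperator hQ).fn k ∘L mulX (wp (-ε) (-1))) := by
  have hle' : |-ε| ≤ ε₀ := by rwa [abs_neg]
  obtain ⟨C, hC⟩ := (h1.localOperator hQ).exists_bound_fn hk
  have heq : (h1.localOperator hQ).fn k ∘L mulX (wp (-ε) (-1)) =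
      mulX (wp (-ε) (-1)) ∘L (h1.localOperator hQ).cfn (-ε) (-1) k := by
    ext1 f
    exact hε₀.fn_mulX hle' (by norm_num) (by norm_num) hk f
  rw [heq]
  refine h1.isHS rfl h0 hle hε (C := C + ‖hQ.clm‖)
    (T₁ := fun f => (h1.localOperator hQ).cresD (-ε) (-1) true
      ((h1.localOperator hQ).cfn (-ε) (-1) (fun t : ℝ => ((t : ℂ) - imUnit true) * k t) f))
    (T₂ := fun f => (h1.localOperator hQ).selfAdjoint.resD true
      ((h1.localOperator hQ).fn (fun t : ℝ => ((t : ℂ) - imUnit true) * k t)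
        (mulX (wp (-ε) (-1)) f)))
    (fun f => ?_) (fun f => ?_) fun f => ?_
  · rw [hε₀.cfn_eq_cres_mul hle' (by norm_num) (by norm_num) hk, LocalOperator.cres_apply]
  · rw [← hε₀.fn_mulX hle' (by norm_num) (by norm_num) hk, LocalOperator.fn_apply hk]
  · refine (h1.norm_comm_zero_le hQ _).trans ?_
    rw [add_mul]
    gcongr
    refine (hC _).trans (le_of_eq ?_)
    rw [← LocalOperator.fn_apply hk]

theorem isHS_cfn (h1 : S.HypH1) (hQ : BddHermitian Q)
    (h0 : (h1.localOperator BddHermitian.zero).Admissible ε₀)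
    (hε₀ : (h1.localOperator hQ).Admissible ε₀) (hle : |ε| ≤ ε₀) (hε : ε ≠ 0) (hk : IsTest k) :
    IsHS ((h1.localOperator hQ).cfn (-ε) (-1) k ∘L mulX (wp (-ε) (-1))) := by
  have hle' : |-ε| ≤ ε₀ := by rwa [abs_neg]
  obtain ⟨C, hC⟩ := hε₀.exists_bound_cfn hle' (a := -1) (by norm_num) (by norm_num) hk
  have heq : (h1.localOperator hQ).cfn (-ε) (-1) k ∘L mulX (wp (-ε) (-1)) =
      mulX (wp (-ε) (-1)) ∘L (h1.localOperator hQ).cfn (-ε) (-2) k := by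
    ext1 f
    exact hε₀.cfn_mulX hle' hk f
  rw [heq]
  refine h1.isHS rfl h0 hle hε (C := C + ‖hQ.clm‖)
    (T₁ := fun f => (h1.localOperator hQ).cresD (-ε) (-2) true
      ((h1.localOperator hQ).cfn (-ε) (-2) (fun t : ℝ => ((t : ℂ) - imUnit true) * k t) f))
    (T₂ := fun f => (h1.localOperator hQ).cresD (-ε) (-1) true
      ((h1.localOperator hQ).cfn (-ε) (-1) (fun t : ℝ => ((t : ℂ) - imUnit true) * k t)
        (mulX (wp (-ε) (-1)) f)))
    (fun f => ?_) (fun f => ?_) fun f => ?_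
  · rw [hε₀.cfn_eq_cres_mul hle' (by norm_num) (by norm_num) hk, LocalOperator.cres_apply]
  · rw [← hε₀.cfn_mulX hle' hk, hε₀.cfn_eq_cres_mul hle' (by norm_num) (by norm_num) hk,
      LocalOperator.cres_apply]
  · refine (h1.norm_comm_zero_le hQ _).trans ?_
    rw [add_mul]
    gcongr
    refine (hC _).trans (le_of_eq ?_)
    rw [← LocalOperator.cres_apply, ← hε₀.cfn_eq_cres_mul hle' (by norm_num) (by norm_num) hk]

end ScatteringSystem.HypH1

end Localised

/-! ### The current form -/

section Current

variable {p q : ℕ}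

/-- Smooth bounded cut-off functions that are locally constant near infinity. -/
structure IsCut (P : ℝ → ℝ) : Prop where
  smoothBdd : SmoothBdd fun x => (P x : ℂ)
  compact : HasCompactSupport (deriv fun x => (P x : ℂ))

theorem IsCut.of_compact {P : ℝ → ℝ} (h : ContDiff ℝ ∞ P) (hc : HasCompactSupport P) : IsCut P :=
  ⟨.of_hasCompactSupport (Complex.ofRealCLM.contDiff.comp h) (hc.comp_left Complex.ofReal_zero),
    (hc.comp_left Complex.ofReal_zero).deriv⟩

/-- The coefficients of `[H, P] θ`. -/
def curCoeff (θ : ℝ → ℂ) (P : ℝ → ℝ) (n : ℕ) (x : ℝ) : ℂ :=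
  iteratedDeriv n (fun x => (P x : ℂ) * θ x) x - P x * iteratedDeriv n θ x

section Coeff

variable {θ η : ℝ → ℂ} {P : ℝ → ℝ} (hθ : ContDiff ℝ ∞ θ) (hP : IsCut P)

include hθ hP in
theorem curCoeff_eq_sum (n : ℕ) (x : ℝ) : curCoeff θ P n x = ∑ i ∈ Finset.range n,
    (n.choose (i + 1) : ℂ) * iteratedDeriv i (deriv fun x => (P x : ℂ)) x *
      iteratedDeriv (n - (i + 1)) θ x := by
  rw [curCoeff, iteratedDeriv_mul_apply hP.smoothBdd.contDiff hθ, Finset.sum_range_succ']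
  simp [iteratedDeriv_succ', iteratedDeriv_zero]

include hθ hP in
theorem continuous_curCoeff (n : ℕ) : Continuous (curCoeff θ P n) :=
  (contDiff_iteratedDeriv (hP.smoothBdd.contDiff.mul hθ) n).continuous.sub
    (hP.smoothBdd.contDiff.continuous.mul (contDiff_iteratedDeriv hθ n).continuous)

include hθ hP in
theorem curCoeff_eq_zero (n : ℕ) {x : ℝ} (hx : x ∉ tsupport (deriv fun x => (P x : ℂ))) :
    curCoeff θ P n x = 0 := by
  rw [curCoeff_eq_sum hθ hP]
  refine Finset.sum_eq_zero fun i _ => ?_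
  have : iteratedDeriv i (deriv fun x => (P x : ℂ)) x = 0 := by
    have h : (deriv fun x => (P x : ℂ)) =ᶠ[𝓝 x] fun _ => 0 :=
      notMem_tsupport_iff_eventuallyEq.1 hx
    rw [h.iteratedDeriv_eq i, iteratedDeriv_const]; simp
  rw [this]; simp

theorem curCoeff_zero (x : ℝ) : curCoeff θ P 0 x = 0 := by
  simp [curCoeff, iteratedDeriv_zero]

theorem curCoeff_congr {θ' : ℝ → ℂ} {x : ℝ} (h : θ =ᶠ[𝓝 x] θ') (n : ℕ) :
    curCoeff θ P n x = curCoeff θ' P n x := by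
  have h2 : (fun x => (P x : ℂ) * θ x) =ᶠ[𝓝 x] fun x => (P x : ℂ) * θ' x :=
    h.mono fun y hy => by simp only [hy]
  rw [curCoeff, curCoeff, h.iteratedDeriv_eq n, h2.iteratedDeriv_eq n]

include hθ in
theorem curCoeff_sub {P' : ℝ → ℝ} (hP : IsCut P) (hP' : IsCut P') (n : ℕ) (x : ℝ) :
    curCoeff θ (fun x => P x - P' x) n x = curCoeff θ P n x - curCoeff θ P' n x := by
  have hf : ContDiff ℝ n fun x => (P x : ℂ) * θ x :=
    (hP.smoothBdd.contDiff.mul hθ).of_le (mod_cast le_top)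
  have hg : ContDiff ℝ n fun x => (P' x : ℂ) * θ x :=
    (hP'.smoothBdd.contDiff.mul hθ).of_le (mod_cast le_top)
  simp only [curCoeff, Complex.ofReal_sub, sub_mul]
  rw [iteratedDeriv_fun_sub hf.contDiffAt hg.contDiffAt]
  ring

include hθ hP in
theorem bddMeas_mul_curCoeff (hη : Continuous η) (n : ℕ) :
    BddMeas fun x => η x * curCoeff θ P n x := by
  refine .of_continuous_compact (hη.mul (continuous_curCoeff hθ hP n)) ?_
  refine HasCompactSupport.of_support_subset_isCompact (K := tsupport (deriv fun x => (P x : ℂ)))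
    hP.compact fun x hx => ?_
  by_contra hcon
  exact hx (by simp only [curCoeff_eq_zero hθ hP n hcon, mul_zero])

end Coeff

namespace LocalOperator

variable (L : LocalOperator p q)

/-- Multiplication by a smooth bounded function, on the domain. -/
def mulD {θ : ℝ → ℂ} (hθ : SmoothBdd θ) : L.dom →ₗ[ℂ] L.dom :=
  (mulX θ).toLinearMap.restrict (L.mul_mem θ hθ)

theorem mulD_coe {θ : ℝ → ℂ} (hθ : SmoothBdd θ) (u : L.dom) :
    (L.mulD hθ u : L2Plane q) = mulX θ (u : L2Plane q) := rfl

/-- The commutator `i[H, P]`. -/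
def brk {P : ℝ → ℝ} (hP : IsCut P) : L.dom →ₗ[ℂ] L2Plane q :=
  Complex.I • (L.comm 0 ∘ₗ L.mulD hP.smoothBdd - (mulX fun x => (P x : ℂ)).toLinearMap ∘ₗ L.comm 0)

theorem brk_apply {P : ℝ → ℝ} (hP : IsCut P) (u : L.dom) : L.brk hP u =
    Complex.I • (L.comm 0 (L.mulD hP.smoothBdd u) - mulX (fun x => (P x : ℂ)) (L.comm 0 u)) := rfl

/-- The operator `η i[H, P] θ`, which only involves the derivative of `P`. -/
def cur (η θ : ℝ → ℂ) (P : ℝ → ℝ) : L.dom →ₗ[ℂ] L2Plane q :=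
  Complex.I • ∑ n ∈ Finset.range (p + 1),
    (mulX fun x => η x * curCoeff θ P n x).toLinearMap ∘ₗ L.comm n

theorem cur_apply (η θ : ℝ → ℂ) (P : ℝ → ℝ) (v : L.dom) : L.cur η θ P v =
    Complex.I • ∑ n ∈ Finset.range (p + 1), mulX (fun x => η x * curCoeff θ P n x) (L.comm n v) := by
  simp [cur, LinearMap.sum_apply]

variable {L} {θ η : ℝ → ℂ} {P : ℝ → ℝ}

theorem cur_coe (hη : Continuous η) (hθ : ContDiff ℝ ∞ θ) (hP : IsCut P) (v : L.dom) :
    ∀ᵐ z : ℝ × ℝ, L.cur η θ P v z = Complex.I • η z.1 •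
      ∑ n ∈ Finset.range (p + 1), curCoeff θ P n z.1 • L.comm n v z := by
  have h1 : ∀ n ∈ Finset.range (p + 1), ∀ᵐ z : ℝ × ℝ,
      mulX (fun x => η x * curCoeff θ P n x) (L.comm n v) z =
        (η z.1 * curCoeff θ P n z.1) • L.comm n v z := fun n _ =>
    mulX_coe (bddMeas_mul_curCoeff hθ hP hη n) _
  rw [cur_apply]
  filter_upwards [(Finset.eventually_all _).2 h1, Lp.coeFn_smul Complex.I (∑ n ∈ Finset.range (p + 1),
    mulX (fun x => η x * curCoeff θ P n x) (L.comm n v)),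
    Lp.coeFn_finsetSum (Finset.range (p + 1)) fun n => mulX (fun x => η x * curCoeff θ P n x)
      (L.comm n v)] with z h2 h3 h4
  rw [h3, Pi.smul_apply, h4, Finset.smul_sum]
  simp only [Finset.sum_apply]
  rw [Finset.sum_congr rfl h2]
  simp only [mul_smul]

theorem mulX_cur {f : ℝ → ℂ} (hf : BddMeas f) (hη : Continuous η) (hθ : ContDiff ℝ ∞ θ)
    (hP : IsCut P) (v : L.dom) :
    mulX f (L.cur η θ P v) = L.cur (fun x => f x * η x) θ P v := by
  rw [cur_apply, cur_apply, map_smul, map_sum]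
  simp only [mul_assoc]
  congr 1
  refine Finset.sum_congr rfl fun n _ => ?_
  rw [mulX_mul hf (bddMeas_mul_curCoeff hθ hP hη n)]

theorem comm_zero_mul (hθ : ContDiff ℝ ∞ θ) {u v : L.dom}
    (h : ∀ᵐ z : ℝ × ℝ, v.1 z = θ z.1 • u.1 z) : ∀ᵐ z : ℝ × ℝ,
      L.comm 0 v z = ∑ l ∈ Finset.range (p + 1), iteratedDeriv l θ z.1 • L.comm l u z := by
  filter_upwards [L.comm_mul 0 θ hθ u v h] with z hz
  rw [hz]
  refine Finset.sum_congr rfl fun l _ => ?_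
  rw [zero_add, Nat.choose_self, Nat.cast_one, one_mul]

theorem brk_eq_cur (hθ : ContDiff ℝ ∞ θ) (hP : IsCut P) {u v : L.dom}
    (h : ∀ᵐ z : ℝ × ℝ, u.1 z = θ z.1 • v.1 z) : L.brk hP u = L.cur (fun _ => 1) θ P v := by
  refine Lp.ext ?_
  have h1 : ∀ᵐ z : ℝ × ℝ, (L.mulD hP.smoothBdd u).1 z = ((P z.1 : ℂ) * θ z.1) • v.1 z := by
    filter_upwards [h, mulX_coe hP.smoothBdd.bddMeas (u : L2Plane q)] with z h2 h3
    rw [L.mulD_coe, h3, h2, smul_smul]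
  rw [brk_apply]
  filter_upwards [cur_coe continuous_const hθ hP v, comm_zero_mul hθ h,
    comm_zero_mul (hP.smoothBdd.contDiff.mul hθ) h1, mulX_coe hP.smoothBdd.bddMeas (L.comm 0 u),
    Lp.coeFn_smul Complex.I (L.comm 0 (L.mulD hP.smoothBdd u) -
      mulX (fun x => (P x : ℂ)) (L.comm 0 u)),
    Lp.coeFn_sub (L.comm 0 (L.mulD hP.smoothBdd u)) (mulX (fun x => (P x : ℂ)) (L.comm 0 u))]
    with z h2 h3 h4 h5 h6 h7
  rw [h2, h6, Pi.smul_apply, h7, Pi.sub_apply, h5, h4, h3, one_smul, Finset.smul_sum,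
    ← Finset.sum_sub_distrib]
  simp only [curCoeff, sub_smul, mul_smul]

theorem brk_symm (hP : IsCut P) (u v : L.dom) :
    ⟪(u : L2Plane q), L.brk hP v⟫_ℂ = ⟪L.brk hP u, (v : L2Plane q)⟫_ℂ := by
  have hb := hP.smoothBdd.bddMeas
  have hc : (fun x => starRingEnd ℂ ((P x : ℂ))) = fun x => (P x : ℂ) := by
    funext x; exact Complex.conj_ofReal _
  rw [brk_apply, brk_apply, inner_smul_right, inner_smul_left, inner_sub_right, inner_sub_left,
    inner_mulX_right hb, inner_mulX_left hb, hc, ← L.mulD_coe hP.smoothBdd,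
    ← L.mulD_coe hP.smoothBdd, ← L.selfAdjoint.symm, L.mulD_coe, inner_mulX_right hb, hc,
    ← L.selfAdjoint.symm, Complex.conj_I]
  ring

theorem smoothBdd_cutoff_mul {χ : ℝ → ℝ} (hχ : ContDiff ℝ ∞ χ) (hχc : HasCompactSupport χ)
    (hθ : ContDiff ℝ ∞ θ) : SmoothBdd fun x => (χ x : ℂ) * θ x :=
  .of_hasCompactSupport ((Complex.ofRealCLM.contDiff.comp hχ).mul hθ)
    ((hχc.comp_left Complex.ofReal_zero).mul_right)

/-- The current form of a smooth weight `θ` only depends on the functions near the support of the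
derivative of the cut-off. -/
theorem inner_cur_eq (hθ : ContDiff ℝ ∞ θ) (hP : IsCut P) {χ : ℝ → ℝ} (hχ : ContDiff ℝ ∞ χ)
    (hχc : HasCompactSupport χ)
    (h1 : ∀ x ∈ tsupport (deriv fun x => (P x : ℂ)), χ =ᶠ[𝓝 x] fun _ => 1) (a b : L.dom) :
    ⟪(a : L2Plane q), L.cur (fun x => starRingEnd ℂ (θ x)) θ P b⟫_ℂ =
      ⟪(L.mulD (smoothBdd_cutoff_mul hχ hχc hθ) a : L2Plane q),
        L.brk hP (L.mulD (smoothBdd_cutoff_mul hχ hχc hθ) b)⟫_ℂ := by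
  have hs := smoothBdd_cutoff_mul hχ hχc hθ
  have hcs : Continuous fun x => starRingEnd ℂ (θ x) :=
    Complex.continuous_conj.comp hθ.continuous
  rw [L.mulD_coe, inner_mulX_left hs.bddMeas,
    brk_eq_cur (θ := fun x => (χ x : ℂ) * θ x) hs.contDiff hP (v := b)
      (by rw [L.mulD_coe]; exact mulX_coe hs.bddMeas _),
    mulX_cur hs.bddMeas.star continuous_const hs.contDiff hP]
  congr 1
  rw [cur_apply, cur_apply]
  congr 1
  refine Finset.sum_congr rfl fun n _ => ?_
  congr 2
  funext x
  by_cases hx : x ∈ tsupport (deriv fun x => (P x : ℂ))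
  · have h2 : (fun x => (χ x : ℂ) * θ x) =ᶠ[𝓝 x] θ := (h1 x hx).mono fun y hy => by
      simp only [hy, Complex.ofReal_one, one_mul]
    rw [curCoeff_congr h2, (h1 x hx).self_of_nhds]
    simp
  · rw [curCoeff_eq_zero hθ hP n hx, curCoeff_eq_zero hs.contDiff hP n hx, mul_zero, mul_zero]

theorem _root_.EdgeScattering.exists_cutoff_nhds {K : Set ℝ} {R : ℝ} (hR : ∀ x ∈ K, |x| ≤ R) :
    ∃ χ : ℝ → ℝ, ContDiff ℝ ∞ χ ∧ HasCompactSupport χ ∧ ∀ x ∈ K, χ =ᶠ[𝓝 x] fun _ => 1 := by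
  obtain ⟨χ, h1, h2, h3⟩ := exists_cutoff (R + 1)
  refine ⟨χ, h1, h2, fun x hx => ?_⟩
  have : ∀ᶠ y in 𝓝 x, |y| < R + 1 :=
    continuous_abs.continuousAt.eventually_lt continuousAt_const (by linarith [hR x hx])
  exact this.mono fun y hy => h3 y hy.le

theorem inner_cur_symm (hθ : ContDiff ℝ ∞ θ) (hP : IsCut P) (a b : L.dom) :
    ⟪(a : L2Plane q), L.cur (fun x => starRingEnd ℂ (θ x)) θ P b⟫_ℂ =
      ⟪L.cur (fun x => starRingEnd ℂ (θ x)) θ P a, (b : L2Plane q)⟫_ℂ := by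
  obtain ⟨R, hR⟩ := HasCompactSupport.exists_abs_le hP.compact
  obtain ⟨χ, h1, h2, h3⟩ := exists_cutoff_nhds hR
  rw [inner_cur_eq hθ hP h1 h2 h3, brk_symm, ← inner_conj_symm, ← inner_cur_eq hθ hP h1 h2 h3,
    inner_conj_symm]

theorem sum_iteratedDeriv_wp_one {E : Type*} [AddCommGroup E] [Module ℂ E] (ε x : ℝ) (G : ℕ → E)
    (hG : ∀ n, p < n → G n = 0) : ∑ l ∈ Finset.range (p + 1), iteratedDeriv l (wp ε 1) x • G l =
      wp ε 1 x • G 0 + (Complex.I * ε) • G 1 := by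
  have h0 : ∀ l, 2 ≤ l → iteratedDeriv l (wp ε 1) x = 0 := fun l hl => by
    rw [iteratedDeriv_wp]
    simp only
    rw [Finset.prod_eq_zero (Finset.mem_range.2 hl) (by simp)]; simp
  have h1 : iteratedDeriv 1 (wp ε 1) x = Complex.I * ε := by
    rw [iteratedDeriv_wp]; simp [wp_zero]
  rcases p with _ | p
  · simp [iteratedDeriv_zero, hG 1 one_pos]
  · rw [Finset.sum_range_succ', Finset.sum_range_succ',
      Finset.sum_eq_zero fun l _ => by rw [h0 _ (by omega), zero_smul]]
    simp [iteratedDeriv_zero, h1, add_comm]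

/-- Cutting off a generalized eigenfunction gives an eigenfunction where the cut-off is `1`. -/
theorem GenEig.apply_mulD {ε : ℝ} {w : L.dom} {e : ℝ} (hw : L.GenEig ε w e) {χ : ℝ → ℝ}
    (hχ : ContDiff ℝ ∞ χ) (hχc : HasCompactSupport χ) {f : ℝ → ℂ} (hf : BddMeas f)
    (h1 : ∀ x, f x ≠ 0 → χ =ᶠ[𝓝 x] fun _ => 1) :
    mulX f (L.comm 0 (L.mulD (smoothBdd_cutoff_mul hχ hχc (contDiff_wp ε 1)) w)) =
      (e : ℂ) • mulX f (L.mulD (smoothBdd_cutoff_mul hχ hχc (contDiff_wp ε 1)) w : L2Plane q) := by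
  have hs := smoothBdd_cutoff_mul hχ hχc (contDiff_wp ε 1)
  have hb := (smoothBdd_wp ε (a := -1) (by norm_num)).bddMeas
  have h2 : ∀ᵐ z : ℝ × ℝ, L.comm 0 w z = (e : ℂ) • w.1 z -
      (Complex.I * ε) • wp ε (-1) z.1 • L.comm 1 w z := by
    rw [show L.comm 0 w = _ from hw]
    filter_upwards [Lp.coeFn_sub ((e : ℂ) • (w : L2Plane q))
      ((Complex.I * ε) • mulX (wp ε (-1)) (L.comm 1 w)), Lp.coeFn_smul (e : ℂ) (w : L2Plane q),
      Lp.coeFn_smul (Complex.I * ε : ℂ) (mulX (wp ε (-1)) (L.comm 1 w)),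
      mulX_coe hb (L.comm 1 w)] with z h3 h4 h5 h6
    rw [h3, Pi.sub_apply, h4, h5, Pi.smul_apply, Pi.smul_apply, h6]
  have h9 : ∀ᵐ z : ℝ × ℝ, ∀ n, p < n → L.comm n w z = 0 := by
    refine ae_all_iff.2 fun n => ?_
    by_cases hn : p < n
    · filter_upwards [Lp.coeFn_zero (Fibre q) 2 (volume : Measure (ℝ × ℝ))] with z hz _
      rw [L.comm_eq_zero n hn, LinearMap.zero_apply, hz]; rfl
    · exact Eventually.of_forall fun z h => absurd h hn
  have hm := mulX_coe hs.bddMeas (w : L2Plane q)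
  have h7 := comm_zero_mul (u := w) (v := L.mulD hs w) hs.contDiff hm
  refine Lp.ext ?_
  filter_upwards [h2, h7, hm, h9, mulX_coe hf (L.comm 0 (L.mulD hs w)),
    mulX_coe hf (L.mulD hs w : L2Plane q),
    Lp.coeFn_smul (e : ℂ) (mulX f (L.mulD hs w : L2Plane q))] with z h2 h7 hm h9 h10 h11 h12
  rw [h10, h12, Pi.smul_apply, h11, smul_comm]
  by_cases hz : f z.1 = 0
  · rw [hz, zero_smul, zero_smul]
  congr 1
  have h3 : (fun x => (χ x : ℂ) * wp ε 1 x) =ᶠ[𝓝 z.1] wp ε 1 := (h1 _ hz).mono fun y hy => by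
    simp only [hy, Complex.ofReal_one, one_mul]
  rw [h7, Finset.sum_congr rfl fun l _ => by rw [h3.iteratedDeriv_eq l],
    sum_iteratedDeriv_wp_one ε z.1 (fun n => L.comm n w z) h9, h2, L.mulD_coe, hm,
    show (χ z.1 : ℂ) * wp ε 1 z.1 = wp ε 1 z.1 from h3.self_of_nhds]
  have h13 : wp ε 1 z.1 * wp ε (-1) z.1 = 1 := by rw [wp_mul]; exact wp_zero ε _
  rw [smul_sub, smul_comm (wp ε 1 z.1) (e : ℂ), smul_comm (wp ε 1 z.1) (Complex.I * ε : ℂ),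
    smul_smul (wp ε 1 z.1) (wp ε (-1) z.1), h13, one_smul, sub_add_cancel]

theorem _root_.EdgeScattering.conj_wp_fun (ε : ℝ) (a : ℤ) :
    (fun x => starRingEnd ℂ (wp ε a x)) = wp (-ε) a := funext (conj_wp ε a)

variable (L) in
/-- The current form `i[H, P]` of the functions `(1 + iεx) a`, `(1 + iεx) b`. -/
def form (ε : ℝ) (P : ℝ → ℝ) (a b : L.dom) : ℂ :=
  ⟪(a : L2Plane q), L.cur (wp (-ε) 1) (wp ε 1) P b⟫_ℂ

theorem form_eq {ε : ℝ} (hP : IsCut P) {χ : ℝ → ℝ} (hχ : ContDiff ℝ ∞ χ)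
    (hχc : HasCompactSupport χ)
    (h1 : ∀ x ∈ tsupport (deriv fun x => (P x : ℂ)), χ =ᶠ[𝓝 x] fun _ => 1) (a b : L.dom) :
    L.form ε P a b =
      ⟪(L.mulD (smoothBdd_cutoff_mul hχ hχc (contDiff_wp ε 1)) a : L2Plane q),
        L.brk hP (L.mulD (smoothBdd_cutoff_mul hχ hχc (contDiff_wp ε 1)) b)⟫_ℂ := by
  rw [form, ← conj_wp_fun]
  exact inner_cur_eq (contDiff_wp ε 1) hP hχ hχc h1 a b

theorem form_sub {ε : ℝ} {P' : ℝ → ℝ} (hP : IsCut P) (hP' : IsCut P') (a b : L.dom) :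
    L.form ε (fun x => P x - P' x) a b = L.form ε P a b - L.form ε P' a b := by
  rw [form, form, form, ← inner_sub_right]
  congr 1
  rw [cur_apply, cur_apply, cur_apply, ← smul_sub, ← Finset.sum_sub_distrib]
  congr 1
  refine Finset.sum_congr rfl fun n _ => ?_
  rw [← mulX_sub (bddMeas_mul_curCoeff (contDiff_wp ε 1) hP (contDiff_wp (-ε) 1).continuous n)
    (bddMeas_mul_curCoeff (contDiff_wp ε 1) hP' (contDiff_wp (-ε) 1).continuous n)]
  simp only [curCoeff_sub (contDiff_wp ε 1) hP hP', mul_sub]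

/-- The current form of two generalized eigenfunctions for a compactly supported cut-off. -/
theorem form_genEig {ε : ℝ} {w₁ w₂ : L.dom} {e₁ e₂ : ℝ} (h₁ : L.GenEig ε w₁ e₁)
    (h₂ : L.GenEig ε w₂ e₂) (hP : ContDiff ℝ ∞ P) (hPc : HasCompactSupport P) :
    L.form ε P w₁ w₂ = Complex.I * ((e₁ : ℂ) - e₂) *
      ⟪(w₁ : L2Plane q), mulX (fun x => wp (-ε) 1 x * ((P x : ℂ) * wp ε 1 x)) (w₂ : L2Plane q)⟫_ℂ := by
  obtain ⟨R, hR⟩ := HasCompactSupport.exists_abs_le hPc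
  obtain ⟨χ, h1, h2, h3⟩ := exists_cutoff_nhds hR
  have hcut := IsCut.of_compact hP hPc
  have hb := hcut.smoothBdd.bddMeas
  have hs := smoothBdd_cutoff_mul h1 h2 (contDiff_wp ε 1)
  have hss := smoothBdd_cutoff_mul hP hPc (contDiff_wp ε 1)
  have hne : ∀ x, (P x : ℂ) ≠ 0 → χ =ᶠ[𝓝 x] fun _ => 1 := fun x hx =>
    h3 x (subset_tsupport _ fun h => hx (by rw [h]; simp))
  have hc : (fun x => starRingEnd ℂ ((P x : ℂ))) = fun x => (P x : ℂ) := by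
    funext x; exact Complex.conj_ofReal _
  have hsub : tsupport (deriv fun x => (P x : ℂ)) ⊆ tsupport P :=
    (tsupport_deriv_subset (f := fun x => (P x : ℂ))).trans
      (closure_mono fun x hx h => hx (by simp only [h, Complex.ofReal_zero]))
  rw [form_eq hcut h1 h2 fun x hx => h3 x (hsub hx)]
  rw [brk_apply, inner_smul_right, inner_sub_right, ← L.selfAdjoint.symm, L.mulD_coe hcut.smoothBdd,
    inner_mulX_right hb, hc, h₁.apply_mulD h1 h2 hb hne, h₂.apply_mulD h1 h2 hb hne,
    inner_smul_left, inner_smul_right, Complex.conj_ofReal, inner_mulX_left hb, hc, ← sub_mul,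
    mul_assoc]
  congr 2
  rw [L.mulD_coe, L.mulD_coe, inner_mulX_left hs.bddMeas, ← mulX_mul hb hs.bddMeas,
    ← mulX_mul hs.bddMeas.star (hb.mul hs.bddMeas)]
  congr 3
  funext x
  rw [map_mul, conj_wp, Complex.conj_ofReal]
  by_cases hx : (P x : ℂ) = 0
  · rw [hx]; ring
  · rw [(hne x hx).self_of_nhds]; simp

end LocalOperator

end Current

/-! ### The trace formula -/

section TraceFormula

variable {p q : ℕ}

theorem integrable_of_hasSum {ι Ω : Type*} [Countable ι] [MeasurableSpace Ω] {μ : Measure Ω}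
    {F : ι → Ω → ℂ} {f : Ω → ℂ} (hF : ∀ i, Integrable (F i) μ)
    (hs : Summable fun i => ∫ o, ‖F i o‖ ∂μ) (h : ∀ o, HasSum (fun i => F i o) (f o)) :
    Integrable f μ := by
  refine ⟨aestronglyMeasurable_of_tendsto_ae (atTop : Filter (Finset ι))
    (f := fun s o => ∑ i ∈ s, F i o)
    (fun s => Finset.aestronglyMeasurable_fun_sum s fun i _ => (hF i).1)
    (Eventually.of_forall fun o => h o), ?_⟩
  have h1 : ∀ o, ‖f o‖ₑ ≤ ∑' i, ‖F i o‖ₑ := fun o => by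
    rw [← (h o).tsum_eq]; exact enorm_tsum_le_tsum_enorm
  refine lt_of_le_of_lt (lintegral_mono h1) ?_
  rw [lintegral_tsum fun i => (hF i).1.enorm]
  have h2 : ∀ i, ∫⁻ o, ‖F i o‖ₑ ∂μ = ENNReal.ofReal (∫ o, ‖F i o‖ ∂μ) := fun i => by
    rw [ofReal_integral_eq_lintegral_ofReal (hF i).norm (ae_of_all _ fun _ => norm_nonneg _)]
    simp only [ofReal_norm]
  simp only [h2]
  exact hs.tsum_ofReal_lt_top

namespace LocalOperator

variable {L : LocalOperator p q} {η θ : ℝ → ℂ} {P : ℝ → ℝ}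

variable (L) in
/-- The bounded operator `η i[H, P] θ` composed with the conjugated resolvent. -/
def curRes (η θ : ℝ → ℂ) (P : ℝ → ℝ) (ε : ℝ) (a : ℤ) : L2Plane q →L[ℂ] L2Plane q :=
  Complex.I • ∑ n ∈ Finset.range (p + 1), (mulX fun x => η x * curCoeff θ P n x) ∘L
    L.commRes n true ∘L Ring.inverse (1 + L.conjPert ε a true)

theorem curRes_apply (ε : ℝ) (a : ℤ) (f : L2Plane q) :
    L.curRes η θ P ε a f = L.cur η θ P (L.cresD ε a true f) := by
  rw [cur_apply, curRes, FunLike.coe_smul, Pi.smul_apply, sum_apply]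
  rfl

variable {ε₀ : ℝ} (hε₀ : L.Admissible ε₀) {ε : ℝ} (hε : |ε| ≤ ε₀)
include hε₀ hε

theorem Admissible.brk_resD (hP : IsCut P) {a : ℤ} (ha : |a| ≤ 2) (ha0 : 0 ≤ a) (f : L2Plane q) :
    L.brk hP (L.selfAdjoint.resD true f) =
      L.curRes (fun _ => 1) (wp ε a) P ε a (mulX (wp ε (-a)) f) := by
  rw [curRes_apply]
  refine brk_eq_cur (contDiff_wp ε a) hP ?_
  have h1 := hε₀.mulX_res hε ha ha0 true f
  rw [L.cres_apply, L.selfAdjoint.res_apply] at h1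
  have hb := (smoothBdd_wp ε (a := -a) (by omega)).bddMeas
  filter_upwards [mulX_coe hb (L.selfAdjoint.resD true f : L2Plane q)] with z hz
  rw [h1] at hz
  rw [hz, smul_smul, wp_mul, add_neg_cancel, wp_zero, one_smul]

theorem Admissible.curRes_comp_mulX (hP : IsCut P) (f : L2Plane q) :
    L.curRes (fun _ => 1) (wp ε 1) P ε 1 f =
      L.curRes (fun _ => 1) (wp ε 2) P ε 2 (mulX (wp ε (-1)) f) := by
  have hb := (smoothBdd_wp ε (a := -1) (by norm_num)).bddMeas
  refine congrFun (eq_of_mulX_comp_eq hb (wp_ne_zero ε (-1))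
    (A := fun f => L.curRes (fun _ => 1) (wp ε 1) P ε 1 f)
    (B := fun f => L.curRes (fun _ => 1) (wp ε 2) P ε 2 (mulX (wp ε (-1)) f))
    (by fun_prop) (by fun_prop) fun u => ?_) f
  change L.curRes (fun _ => 1) (wp ε 1) P ε 1 (mulX (wp ε (-1)) u) =
    L.curRes (fun _ => 1) (wp ε 2) P ε 2 (mulX (wp ε (-1)) (mulX (wp ε (-1)) u))
  rw [← hε₀.brk_resD hε hP (by norm_num) (by norm_num), ← mulX_mul hb hb,
    hε₀.brk_resD hε hP (a := 2) (by norm_num) (by norm_num)]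
  simp only [wp_mul]; norm_num

omit hε₀ hε in
theorem mulX_curRes (hP : IsCut P) (f : L2Plane q) :
    mulX (wp (-ε) (-1)) (L.curRes (wp (-ε) 1) (wp ε 1) P ε 1 f) =
      L.curRes (fun _ => 1) (wp ε 1) P ε 1 f := by
  rw [curRes_apply, curRes_apply, mulX_cur (smoothBdd_wp (-ε) (by norm_num)).bddMeas
    (contDiff_wp (-ε) 1).continuous (contDiff_wp ε 1) hP]
  simp only [wp_mul]
  rfl

theorem Admissible.inner_curRes_genEig {w : L.dom} {e : ℝ} (hw : L.GenEig ε w e) :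
    ⟪(w : L2Plane q), L.curRes (wp (-ε) 1) (wp ε 1) P ε 1 (w : L2Plane q)⟫_ℂ =
      ((e : ℂ) - imUnit true)⁻¹ * L.form ε P w w := by
  have h : L.cresD ε 1 true (w : L2Plane q) = ((e : ℂ) - imUnit true)⁻¹ • w := by
    refine Subtype.ext ?_
    rw [← L.cres_apply, hε₀.cres_genEig hε hw true]; rfl
  rw [curRes_apply, h, map_smul, inner_smul_right, form]

variable {Ω : Type} [MeasurableSpace Ω] {μ : Measure Ω} {W : Ω → L.dom} {e : Ω → ℝ}

omit hε₀ hε in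
theorem inner_eq_integral (hm : ∀ f : L2Plane q, AEStronglyMeasurable
      (fun o => ⟪(W o : L2Plane q), f⟫_ℂ) μ)
    {A : L2Plane q →L[ℂ] L2Plane q}
    (hpars : ∀ f : L2Plane q, ∫⁻ o, ‖⟪(W o : L2Plane q), f⟫_ℂ‖ₑ ^ 2 ∂μ = ‖A f‖ₑ ^ 2)
    (f g : L2Plane q) : Integrable (fun o =>
        starRingEnd ℂ ⟪(W o : L2Plane q), f⟫_ℂ * ⟪(W o : L2Plane q), g⟫_ℂ) μ ∧
      ∫ o, starRingEnd ℂ ⟪(W o : L2Plane q), f⟫_ℂ * ⟪(W o : L2Plane q), g⟫_ℂ ∂μ =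
        ⟪A f, A g⟫_ℂ := by
  have hmem : ∀ f, MemLp (fun o => ⟪(W o : L2Plane q), f⟫_ℂ) 2 μ := fun f => by
    refine memLp_two_iff.2 ⟨hm f, ?_⟩
    rw [hpars]
    exact ENNReal.pow_lt_top enorm_lt_top
  let F : L2Plane q →ₗ[ℂ] Lp ℂ 2 μ :=
    { toFun := fun f => (hmem f).toLp _
      map_add' := fun f g => by
        rw [← MemLp.toLp_add]
        exact MemLp.toLp_congr _ _ (Eventually.of_forall fun o => inner_add_right _ _ _)
      map_smul' := fun c f => by
        rw [RingHom.id_apply, ← MemLp.toLp_const_smul]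
        exact MemLp.toLp_congr _ _ (Eventually.of_forall fun o => inner_smul_right _ _ _) }
  have hF : ∀ f, ‖F f‖ = ‖A f‖ := fun f => by
    have h1 : ‖F f‖ₑ ^ 2 = ‖A f‖ₑ ^ 2 := by
      rw [← hpars, Lp.enorm_def, eLpNorm_eq_lintegral_rpow_enorm_toReal (by norm_num) (by norm_num),
        ← ENNReal.rpow_natCast, ← ENNReal.rpow_mul]
      simp only [ENNReal.toReal_ofNat, Nat.cast_ofNat, one_div, ne_eq, OfNat.ofNat_ne_zero,
        not_false_eq_true, inv_mul_cancel₀, ENNReal.rpow_one, ENNReal.rpow_ofNat]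
      exact lintegral_congr_ae ((hmem f).coeFn_toLp.mono fun o ho => by
        simp only [F, LinearMap.coe_mk, AddHom.coe_mk, ho])
    have h2 := congrArg ENNReal.toReal h1
    rw [ENNReal.toReal_pow, ENNReal.toReal_pow, toReal_enorm, toReal_enorm] at h2
    exact (pow_left_inj₀ (norm_nonneg _) (norm_nonneg _) two_ne_zero).1 h2
  have hinner : ⟪F f, F g⟫_ℂ = ⟪A f, A g⟫_ℂ := by
    rw [inner_eq_sum_norm_sq_div_four, inner_eq_sum_norm_sq_div_four (A f)]
    simp only [← map_add, ← map_sub, ← map_smul, hF]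
  have hae : (fun o => ⟪F f o, F g o⟫_ℂ) =ᵐ[μ] fun o =>
      starRingEnd ℂ ⟪(W o : L2Plane q), f⟫_ℂ * ⟪(W o : L2Plane q), g⟫_ℂ := by
    filter_upwards [(hmem f).coeFn_toLp, (hmem g).coeFn_toLp] with o h1 h2
    simp only [F, LinearMap.coe_mk, AddHom.coe_mk, h1, h2]
    rw [RCLike.inner_apply, mul_comm]
  refine ⟨(L2.integrable_inner (F f) (F g)).congr hae, ?_⟩
  rw [← hinner, L2.inner_def]
  exact integral_congr_ae hae.symm

set_option maxHeartbeats 1000000 in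
/-- The trace of the current operator in terms of generalized eigenfunctions. -/
theorem Admissible.hasTrace
    (hHS₁ : ∀ k, IsTest k → IsHS (L.fn k ∘L mulX (wp (-ε) (-1))))
    (hHS₂ : ∀ k, IsTest k → IsHS (L.cfn (-ε) (-1) k ∘L mulX (wp (-ε) (-1))))
    (hW : ∀ o, L.GenEig ε (W o) (e o))
    (hm : ∀ f : L2Plane q, AEStronglyMeasurable (fun o => ⟪(W o : L2Plane q), f⟫_ℂ) μ)
    (hpars : ∀ f : L2Plane q, ∫⁻ o, ‖⟪(W o : L2Plane q), f⟫_ℂ‖ₑ ^ 2 ∂μ =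
      ‖mulX (wp (-ε) (-1)) f‖ₑ ^ 2)
    (hP : IsCut P) {g : ℝ → ℂ} (hg : IsTest g) :
    ∃ C : L2Plane q →L[ℂ] L2Plane q,
      (∀ f, C f = L.brk hP (L.selfAdjoint.resD true
        (L.fn (fun t : ℝ => ((t : ℂ) - imUnit true) * g t) f))) ∧
      Integrable (fun o => g (e o) * L.form ε P (W o) (W o)) μ ∧
      HasTrace C (∫ o, g (e o) * L.form ε P (W o) (W o) ∂μ) := by
  have hε' : |-ε| ≤ ε₀ := by rwa [abs_neg]
  set k : ℝ → ℂ := fun t : ℝ => ((t : ℂ) - imUnit true) * g t with hkdef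
  have hk : IsTest k := hg.sub_imUnit_mul true
  obtain ⟨k₁, hk₁, hkk⟩ := hk.exists_one
  have hks := hk.star
  have hk₁s := hk₁.star
  have hb := (smoothBdd_wp ε (a := -1) (by norm_num)).bddMeas
  have hbs := (smoothBdd_wp (-ε) (a := -1) (by norm_num)).bddMeas
  set M : L2Plane q →L[ℂ] L2Plane q := mulX (wp ε (-1)) with hM
  set Ms : L2Plane q →L[ℂ] L2Plane q := mulX (wp (-ε) (-1)) with hMs
  have hMadj : ContinuousLinearMap.adjoint Ms = M := by
    rw [hMs, mulX_adjoint hbs]; simp only [conj_wp, neg_neg, hM]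
  set Φs := L.cfn (-ε) (-1) (fun t => starRingEnd ℂ (k t)) with hΦs
  set D := L.curRes (wp (-ε) 1) (wp ε 1) P ε 1 with hD
  set Y₁ := L.curRes (fun _ => 1) (wp ε 1) P ε 1 with hY₁
  set Y₂ := L.curRes (fun _ => 1) (wp ε 2) P ε 2 with hY₂
  set X := ContinuousLinearMap.adjoint (Φs ∘L Ms) with hX
  set B := ContinuousLinearMap.adjoint (L.fn (fun t => starRingEnd ℂ (k₁ t)) ∘L Ms) with hB
  have hA : IsHS (Y₂ ∘L X) := (hHS₂ _ hks).adjoint.comp_left Y₂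
  have hBHS : IsHS B := (hHS₁ _ hk₁s).adjoint
  have hadj : ∀ k : ℝ → ℂ, ContinuousLinearMap.adjoint (L.fn fun t => starRingEnd ℂ (k t)) =
      L.fn k := fun k => by
    rw [← ContinuousLinearMap.star_eq_adjoint, star_fn]; simp only [Complex.conj_conj]
  have hBapp : ∀ f, B f = M (L.fn k₁ f) := fun f => by
    rw [hB, ContinuousLinearMap.adjoint_comp, hadj, hMadj]; rfl
  have hAapp : ∀ f, (Y₂ ∘L X) f = Ms (D (ContinuousLinearMap.adjoint Φs f)) := fun f => by
    rw [hX, ContinuousLinearMap.adjoint_comp, hMadj, hMs, hD, mulX_curRes hP,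
      hε₀.curRes_comp_mulX hε hP]
    rfl
  -- the two factorizations of the commuted functions
  have hΦ : ∀ f, L.fn (fun t => starRingEnd ℂ (k t)) (Ms f) = Ms (Φs f) := fun f =>
    hε₀.fn_mulX hε' (by norm_num) (by norm_num) hks f
  have hMΦ : M ∘L L.fn k = ContinuousLinearMap.adjoint Φs ∘L M := by
    have h1 : L.fn (fun t => starRingEnd ℂ (k t)) ∘L Ms = Ms ∘L Φs := by ext1 f; exact hΦ f
    have h2 := congrArg ContinuousLinearMap.adjoint h1
    rwa [ContinuousLinearMap.adjoint_comp, ContinuousLinearMap.adjoint_comp, hadj, hMadj] at h2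
  have hC : ∀ f, ((Y₂ ∘L X) ∘L B) f = L.brk hP (L.selfAdjoint.resD true (L.fn k f)) := fun f => by
    have h1 : L.fn k f = L.fn k (L.fn k₁ f) := by
      rw [← mul_apply_eq_comp, ← fn_mul hk hk₁]
      congr 2; funext t; rw [mul_comm, hkk]
    have h2 : ContinuousLinearMap.adjoint Φs (M (L.fn k₁ f)) = M (L.fn k (L.fn k₁ f)) :=
      (congrArg (fun T : L2Plane q →L[ℂ] L2Plane q => T (L.fn k₁ f)) hMΦ).symm
    rw [ContinuousLinearMap.comp_apply, hBapp, hAapp, h2, ← h1, hMs, hD, mulX_curRes hP,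
      hε₀.brk_resD hε hP (a := 1) (by norm_num) (by norm_num)]
  have hsep := separableSpace_L2Plane (q := q)
  obtain ⟨s, b, -⟩ := exists_hilbertBasis ℂ (L2Plane q)
  have hcount : Countable s := countable_of_orthonormal b.orthonormal
  -- the matrix elements
  set Φ₁ := L.cfn (-ε) (-1) (fun t => starRingEnd ℂ (k₁ t)) with hΦ₁
  have hterm := fun i => inner_eq_integral hm hpars (Φ₁ (b i))
    (D (ContinuousLinearMap.adjoint Φs (b i)))
  set F : s → Ω → ℂ := fun i o => starRingEnd ℂ ⟪(W o : L2Plane q), Φ₁ (b i)⟫_ℂ *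
    ⟪(W o : L2Plane q), D (ContinuousLinearMap.adjoint Φs (b i))⟫_ℂ with hF
  have hMsΦ₁ : ∀ i, Ms (Φ₁ (b i)) = (L.fn (fun t => starRingEnd ℂ (k₁ t)) ∘L Ms) (b i) := fun i =>
    (hε₀.fn_mulX hε' (by norm_num) (by norm_num) hk₁s (b i)).symm
  have hel : ∀ i, ⟪b i, B ((Y₂ ∘L X) (b i))⟫_ℂ = ∫ o, F i o ∂μ := fun i => by
    rw [(hterm i).2, hB, ContinuousLinearMap.adjoint_inner_right, ← hMsΦ₁, hAapp]
  have hFint : ∀ i, Integrable (F i) μ := fun i => (hterm i).1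
  have hsum : Summable fun i => ∫ o, ‖F i o‖ ∂μ := by
    have hs1 := (hHS₁ _ hk₁s).summable b.orthonormal
    have hs2 := hA.summable b.orthonormal
    refine (hs1.add hs2).of_nonneg_of_le (fun i => integral_nonneg fun o => norm_nonneg _)
      fun i => ?_
    have h3 := fun f => inner_eq_integral hm hpars f f
    have h4 : ∀ f : L2Plane q, ∀ o, starRingEnd ℂ ⟪(W o : L2Plane q), f⟫_ℂ *
        ⟪(W o : L2Plane q), f⟫_ℂ = ((‖⟪(W o : L2Plane q), f⟫_ℂ‖ ^ 2 : ℝ) : ℂ) := fun f o => by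
      rw [← Complex.normSq_eq_conj_mul_self, Complex.normSq_eq_norm_sq]
    simp only [h4] at h3
    have h5 : ∀ f : L2Plane q, Integrable (fun o => ‖⟪(W o : L2Plane q), f⟫_ℂ‖ ^ 2) μ ∧
        ∫ o, ‖⟪(W o : L2Plane q), f⟫_ℂ‖ ^ 2 ∂μ = ‖Ms f‖ ^ 2 := fun f => by
      obtain ⟨h6, h7⟩ := h3 f
      have h8 := h6.re
      simp only [RCLike.re_to_complex, Complex.ofReal_re] at h8
      refine ⟨h8, ?_⟩
      rw [integral_complex_ofReal, inner_self_eq_norm_sq_to_K] at h7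
      exact Complex.ofReal_injective (h7.trans (by push_cast; rfl))
    rw [← hMsΦ₁, hAapp, ← (h5 _).2, ← (h5 _).2, ← integral_add (h5 _).1 (h5 _).1]
    refine integral_mono (hFint i).norm ((h5 _).1.add (h5 _).1) fun o => ?_
    simp only [hF, norm_mul, RCLike.norm_conj]
    nlinarith [sq_nonneg (‖⟪(W o : L2Plane q), Φ₁ (b i)⟫_ℂ‖ -
      ‖⟪(W o : L2Plane q), D (ContinuousLinearMap.adjoint Φs (b i))⟫_ℂ‖),
      sq_nonneg ‖⟪(W o : L2Plane q), Φ₁ (b i)⟫_ℂ‖,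
      sq_nonneg ‖⟪(W o : L2Plane q), D (ContinuousLinearMap.adjoint Φs (b i))⟫_ℂ‖]
  have hres := hasSum_integral_of_summable_integral_norm hFint hsum
  have hpt : ∀ o, HasSum (fun i => F i o) (g (e o) * L.form ε P (W o) (W o)) := fun o => by
    set V := Φs (ContinuousLinearMap.adjoint D (W o : L2Plane q)) with hV
    have h1 : ∀ i, F i o = k₁ (e o) * (⟪V, b i⟫_ℂ * ⟪b i, (W o : L2Plane q)⟫_ℂ) := fun i => by
      simp only [hF, hΦ₁]
      rw [hε₀.inner_genEig_cfn hε (hW o) hk₁s, ← ContinuousLinearMap.adjoint_inner_left,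
        ← ContinuousLinearMap.adjoint_inner_left, ContinuousLinearMap.adjoint_adjoint, map_mul,
        Complex.conj_conj, inner_conj_symm, hV]
      ring
    simp only [h1]
    have h2 := ofReal_sub_imUnit_ne_zero (e o) true
    have h3 : g (e o) * L.form ε P (W o) (W o) = k₁ (e o) * ⟪V, (W o : L2Plane q)⟫_ℂ := by
      rw [← inner_conj_symm, hV, hΦs, hε₀.inner_genEig_cfn hε (hW o) hks, map_mul,
        Complex.conj_conj, inner_conj_symm, ContinuousLinearMap.adjoint_inner_left, hD,
        hε₀.inner_curRes_genEig hε (hW o), ← mul_assoc, hkk, hkdef]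
      field_simp
    rw [h3]
    exact (b.hasSum_inner_mul_inner V (W o : L2Plane q)).mul_left _
  refine ⟨(Y₂ ∘L X) ∘L B, hC, integrable_of_hasSum hFint hsum hpt, hasTrace_comp hA hBHS b ?_⟩
  simp only [fun o => (hpt o).tsum_eq] at hres
  exact hres.congr_fun hel

end LocalOperator

end TraceFormula

/-! ### The trace formula for the perturbed system -/

section PerturbedTrace

variable {p q : ℕ} {S : ScatteringSystem p q}

theorem MemHps.of_le {s t : ℝ} (hst : s ≤ t) {u : ℝ × ℝ → Fibre q} (h : MemHps p t u) :
    MemHps p s u := by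
  have key : ∀ {v : ℝ × ℝ → Fibre q}, MemL2s t v → MemL2s s v := fun {v} hv => by
    have hb : Continuous fun z : ℝ × ℝ => bracket z.1 ^ (s - t) :=
      (continuous_bracket_rpow _).comp continuous_fst
    have h2 : (fun z : ℝ × ℝ => (bracket z.1 ^ s) • v z) =
        fun z => bracket z.1 ^ (s - t) • (bracket z.1 ^ t) • v z := by
      funext z
      rw [smul_smul, ← Real.rpow_add (bracket_pos _), sub_add_cancel]
    rw [MemL2s, h2]
    refine MemLp.of_le_mul (c := 1) hv (hb.aestronglyMeasurable.smul hv.1)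
      (Eventually.of_forall fun z => ?_)
    rw [norm_smul]
    refine mul_le_mul_of_nonneg_right ?_ (norm_nonneg _)
    rw [Real.norm_of_nonneg (Real.rpow_nonneg (bracket_pos _).le _)]
    exact Real.rpow_le_one_of_one_le_of_nonpos (one_le_bracket _) (by linarith)
  exact ⟨key h.1, fun a b hab => (h.2 a b hab).imp fun v hv => ⟨hv.1, key hv.2⟩⟩

namespace ScatteringSystem.HypH1

variable (h1 : S.HypH1) (hQ : BddHermitian S.Q)

theorem H_apply {u : L2Plane q} (h : u ∈ S.H.domain) :
    S.H ⟨u, h⟩ = (h1.localOperator hQ).comm 0 ⟨u, h.1⟩ := by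
  rfl

theorem exists_waveQ (h2 : S.HypH2) {ε : ℝ} (hε : ε ≠ 0) (m : ℕ × ℝ) :
    ∃ w : (h1.localOperator hQ).dom, (∀ᵐ z : ℝ × ℝ, w.1 z = wp ε (-1) z.1 • S.psiQ m z) ∧
      (h1.localOperator hQ).GenEig ε w (S.energy m.1 m.2) :=
  h1.exists_genEig hQ hε (by simpa using h2.psiQ_mem 1 (by norm_num) m) (h2.psiQ_eq m)

/-- The functions `(1 + iεx)^{-1} ψ^Q_j(·; ξ)`. -/
def waveQ (h2 : S.HypH2) {ε : ℝ} (hε : ε ≠ 0) (m : ℕ × ℝ) : (h1.localOperator hQ).dom :=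
  (h1.exists_waveQ hQ h2 hε m).choose

theorem waveQ_coe (h2 : S.HypH2) {ε : ℝ} (hε : ε ≠ 0) (m : ℕ × ℝ) :
    ∀ᵐ z : ℝ × ℝ, (h1.waveQ hQ h2 hε m).1 z = wp ε (-1) z.1 • S.psiQ m z :=
  (h1.exists_waveQ hQ h2 hε m).choose_spec.1

theorem genEig_waveQ (h2 : S.HypH2) {ε : ℝ} (hε : ε ≠ 0) (m : ℕ × ℝ) :
    (h1.localOperator hQ).GenEig ε (h1.waveQ hQ h2 hε m) (S.energy m.1 m.2) :=
  (h1.exists_waveQ hQ h2 hε m).choose_spec.2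

theorem exists_waveEig (h2 : S.HypH2) {ε : ℝ} (hε : ε ≠ 0) (n : S.PointIndex) :
    ∃ w : (h1.localOperator hQ).dom, (w : L2Plane q) = mulX (wp ε (-1)) (S.eigvec n) ∧
      (h1.localOperator hQ).GenEig ε w (S.eigval n) := by
  obtain ⟨h, he⟩ := h2.eigvec_eq n
  have hmem : S.eigvec n ∈ S.H₀.domain := h.1
  have hb := (smoothBdd_wp ε (a := -1) (by norm_num)).bddMeas
  obtain ⟨w, hw, hg⟩ := h1.exists_genEig hQ hε (ψ := S.eigvec n) (e := S.eigval n)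
    (((h1.mem_domain _).1 hmem).of_le (by norm_num)) (by
      obtain ⟨v, hv, hv2⟩ := h1.apply_eq ⟨S.eigvec n, hmem⟩
      refine ⟨v, hv, ?_⟩
      have h3 : S.H₀ ⟨S.eigvec n, hmem⟩ =
          ((S.eigval n : ℝ) : ℂ) • S.eigvec n - hQ.clm (S.eigvec n) := by
        rw [← he]
        exact (add_sub_cancel_right _ _).symm
      filter_upwards [hv2, Lp.coeFn_sub (((S.eigval n : ℝ) : ℂ) • S.eigvec n)
        (hQ.clm (S.eigvec n)), Lp.coeFn_smul ((S.eigval n : ℝ) : ℂ) (S.eigvec n),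
        hQ.clm_coe (S.eigvec n)] with z h4 h5 h6 h7
      rw [← h4, h3, h5, Pi.sub_apply, h6, h7, Pi.smul_apply])
  exact ⟨w, eq_mulX hb hw, hg⟩

/-- Bound states carry no current. -/
theorem form_waveEig (h2 : S.HypH2) {ε : ℝ} (n : S.PointIndex)
    {w : (h1.localOperator hQ).dom} (hw : (w : L2Plane q) = mulX (wp ε (-1)) (S.eigvec n)) {P : ℝ → ℝ}
    (hP : IsCut P) : (h1.localOperator hQ).form ε P w w = 0 := by
  obtain ⟨h, he⟩ := h2.eigvec_eq n
  set φ : (h1.localOperator hQ).dom := ⟨S.eigvec n, h.1⟩ with hφ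
  have hb := (smoothBdd_wp ε (a := -1) (by norm_num)).bddMeas
  have he' : (h1.localOperator hQ).comm 0 φ = ((S.eigval n : ℝ) : ℂ) • (φ : L2Plane q) := by
    rw [hφ, ← h1.H_apply hQ h, he]
  have h3 : ∀ᵐ z : ℝ × ℝ, φ.1 z = wp ε 1 z.1 • w.1 z := by
    filter_upwards [mulX_coe hb (S.eigvec n)] with z hz
    rw [hw, hz, smul_smul, wp_mul, add_neg_cancel, wp_zero, one_smul]
  have h4 : (h1.localOperator hQ).form ε P w w = ⟪(φ : L2Plane q), (h1.localOperator hQ).brk hP φ⟫_ℂ := by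
    rw [LocalOperator.form, hw, inner_mulX_left hb, conj_wp_fun,
      LocalOperator.mulX_cur (smoothBdd_wp (-ε) (by norm_num)).bddMeas
      (contDiff_wp (-ε) 1).continuous (contDiff_wp ε 1) hP,
      LocalOperator.brk_eq_cur (contDiff_wp ε 1) hP h3]
    simp only [wp_mul]
    rfl
  rw [h4, LocalOperator.brk_apply, inner_smul_right, inner_sub_right,
    ← (h1.localOperator hQ).selfAdjoint.symm, he', map_smul, inner_smul_left, inner_smul_right,
    Complex.conj_ofReal, LocalOperator.mulD_coe, sub_self, mul_zero]

theorem inner_waveQ (h2 : S.HypH2) {ε : ℝ} (hε : ε ≠ 0) (m : ℕ × ℝ) (f : L2Plane q) :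
    ⟪(h1.waveQ hQ h2 hε m : L2Plane q), f⟫_ℂ =
      pairing (mulX (wp (-ε) (-1)) f : L2Plane q) (S.psiQ m) := by
  have hb := (smoothBdd_wp (-ε) (a := -1) (by norm_num)).bddMeas
  rw [L2.inner_def, pairing]
  refine integral_congr_ae ?_
  filter_upwards [h1.waveQ_coe hQ h2 hε m, mulX_coe hb f] with z h3 h4
  rw [h3, h4, inner_smul_left, inner_smul_right, conj_wp]

end ScatteringSystem.HypH1

theorem memL2s_mulX_wp {ε : ℝ} (hε : ε ≠ 0) (f : L2Plane q) :
    MemL2s 1 (mulX (wp ε (-1)) f : L2Plane q) := by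
  have hb := (smoothBdd_wp ε (a := -1) (by norm_num)).bddMeas
  obtain ⟨C, hC⟩ := exists_norm_iteratedDeriv_wp_neg_one_le hε 0
  have hcont : Continuous fun z : ℝ × ℝ => bracket z.1 ^ (1 : ℝ) :=
    (continuous_bracket_rpow 1).comp continuous_fst
  refine MemLp.of_le_mul (c := C) (Lp.memLp f)
    (hcont.aestronglyMeasurable.smul (Lp.aestronglyMeasurable _)) ?_
  filter_upwards [mulX_coe hb f] with z hz
  rw [hz, norm_smul, norm_smul, ← mul_assoc]
  refine mul_le_mul_of_nonneg_right ?_ (norm_nonneg _)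
  have h1 := hC z.1
  rw [iteratedDeriv_zero, Real.rpow_neg_one] at h1
  rw [Real.rpow_one, Real.norm_of_nonneg (bracket_pos _).le, mul_comm,
    ← le_div_iff₀ (bracket_pos _)]
  exact h1

/-- The index set of branches and bound states. -/
abbrev ScatteringSystem.BranchIndex (S : ScatteringSystem p q) := S.PointIndex ⊕ ℕ

/-- The spectral measure class of the perturbed operator. -/
def ScatteringSystem.branchMeasure (S : ScatteringSystem p q) : S.BranchIndex → Measure ℝ
  | .inl _ => Measure.dirac 0
  | .inr _ => volume

theorem ScatteringSystem.HypH1.hasTrace (h1 : S.HypH1) (hQ : BddHermitian S.Q) (h2 : S.HypH2) :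
    ∃ (ε : ℝ) (hε : ε ≠ 0), ∀ {P : ℝ → ℝ} (hP : IsCut P) {g : ℝ → ℂ}, IsTest g →
      ∃ C : L2Plane q →L[ℂ] L2Plane q,
        (∀ f, C f = (h1.localOperator hQ).brk hP ((h1.localOperator hQ).selfAdjoint.resD true
          ((h1.localOperator hQ).fn (fun t : ℝ => ((t : ℂ) - imUnit true) * g t) f))) ∧
        (∀ j, Integrable fun ξ => g (S.energy j ξ) * (h1.localOperator hQ).form ε P
          (h1.waveQ hQ h2 hε (j, ξ)) (h1.waveQ hQ h2 hε (j, ξ))) ∧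
        HasTrace C (∑' j, ∫ ξ, g (S.energy j ξ) * (h1.localOperator hQ).form ε P
          (h1.waveQ hQ h2 hε (j, ξ)) (h1.waveQ hQ h2 hε (j, ξ))) := by
  set L := h1.localOperator hQ with hL
  set L₀ := h1.localOperator BddHermitian.zero with hL₀
  obtain ⟨ε₁, hε₁⟩ := L.exists_admissible
  obtain ⟨ε₂, hε₂⟩ := L₀.exists_admissible
  set ε := min ε₁ ε₂ with hεdef
  have hpos : 0 < ε := lt_min hε₁.pos hε₂.pos
  have had := hε₁.mono hpos (min_le_left _ _)
  have had₀ := hε₂.mono hpos (min_le_right _ _)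
  have hle : |ε| ≤ ε := (abs_of_pos hpos).le
  have hε : ε ≠ 0 := hpos.ne'
  refine ⟨ε, hε, fun {P} hP {g} hg => ?_⟩
  have hsep := separableSpace_L2Plane (q := q)
  have hcount : Countable S.PointIndex := countable_of_orthonormal h2.orthonormal
  choose V hV hVg using h1.exists_waveEig hQ h2 hε
  let _ : MeasurableSpace S.BranchIndex := ⊤
  have _ : MeasurableSingletonClass S.BranchIndex := ⟨fun _ => trivial⟩
  let μ : Measure (S.BranchIndex × ℝ) :=
    Measure.sum fun i => (S.branchMeasure i).map (Prod.mk i)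
  let W : S.BranchIndex × ℝ → L.dom := fun o =>
    Sum.elim (fun n => V n) (fun j => h1.waveQ hQ h2 hε (j, o.2)) o.1
  let e : S.BranchIndex × ℝ → ℝ := fun o =>
    Sum.elim (fun n => S.eigval n) (fun j => S.energy j o.2) o.1
  have hemb : ∀ i : S.BranchIndex, MeasurableEmbedding (Prod.mk i : ℝ → S.BranchIndex × ℝ) :=
    fun i => measurableEmbedding_prodMk_left i
  have hW : ∀ o, L.GenEig ε (W o) (e o) := by
    rintro ⟨n | j, ξ⟩
    · exact hVg n
    · exact h1.genEig_waveQ hQ h2 hε (j, ξ)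
  have hm : ∀ f : L2Plane q, AEStronglyMeasurable (fun o => ⟪(W o : L2Plane q), f⟫_ℂ) μ := by
    intro f
    refine aestronglyMeasurable_sum_measure_iff.2 fun i => ?_
    rw [(hemb i).aestronglyMeasurable_map_iff]
    rcases i with n | j
    · exact aestronglyMeasurable_const (b := ⟪(V n : L2Plane q), f⟫_ℂ)
    · refine (h2.measurable 1 (by norm_num) (mulX (wp (-ε) (-1)) f)
        (memL2s_mulX_wp (neg_ne_zero.2 hε) f) j).congr (Eventually.of_forall fun ξ => ?_)
      exact (h1.inner_waveQ hQ h2 hε (j, ξ) f).symm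
  have hpars : ∀ f : L2Plane q, ∫⁻ o, ‖⟪(W o : L2Plane q), f⟫_ℂ‖ₑ ^ 2 ∂μ =
      ‖mulX (wp (-ε) (-1)) f‖ₑ ^ 2 := by
    intro f
    rw [h2.parseval 1 (by norm_num) (mulX (wp (-ε) (-1)) f)
      (memL2s_mulX_wp (neg_ne_zero.2 hε) f), lintegral_sum_measure]
    have h3 : ∀ i : S.BranchIndex, ∫⁻ o, ‖⟪(W o : L2Plane q), f⟫_ℂ‖ₑ ^ 2
        ∂((S.branchMeasure i).map (Prod.mk i)) =
        ∫⁻ ξ, ‖⟪(W (i, ξ) : L2Plane q), f⟫_ℂ‖ₑ ^ 2 ∂(S.branchMeasure i) := fun i =>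
      (hemb i).lintegral_map _
    simp only [h3]
    rw [Summable.tsum_sum ENNReal.summable ENNReal.summable]
    congr 1
    · refine tsum_congr fun n => ?_
      have hb := (smoothBdd_wp ε (a := -1) (by norm_num)).bddMeas
      change ∫⁻ _, ‖⟪(V n : L2Plane q), f⟫_ℂ‖ₑ ^ 2 ∂(Measure.dirac (0 : ℝ)) = _
      rw [lintegral_const, measure_univ, mul_one, hV, inner_mulX_left hb, conj_wp_fun]
    · refine tsum_congr fun j => ?_
      change ∫⁻ ξ, ‖⟪(h1.waveQ hQ h2 hε (j, ξ) : L2Plane q), f⟫_ℂ‖ₑ ^ 2 = _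
      simp only [h1.inner_waveQ hQ h2 hε]
  obtain ⟨C, hC, hint, htr⟩ := had.hasTrace hle
    (fun k hk => h1.isHS_fn hQ had₀ had hle hε hk)
    (fun k hk => h1.isHS_cfn hQ had₀ had hle hε hk) hW hm hpars hP hg
  refine ⟨C, hC, fun j => ?_, ?_⟩
  · have h3 := hint.mono_measure (Measure.le_sum _ (Sum.inr j : S.BranchIndex))
    exact (hemb (Sum.inr j)).integrable_map_iff.1 h3
  · have h3 : ∫ o, g (e o) * L.form ε P (W o) (W o) ∂μ = ∑' j, ∫ ξ, g (S.energy j ξ) *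
        L.form ε P (h1.waveQ hQ h2 hε (j, ξ)) (h1.waveQ hQ h2 hε (j, ξ)) := by
      have h4 := hasSum_integral_measure hint
      simp only [(hemb _).integral_map] at h4
      have h5 := (Sum.inr_injective (α := S.PointIndex) (β := ℕ)).hasSum_iff
        (a := ∫ o, g (e o) * L.form ε P (W o) (W o) ∂μ) (f := fun i : S.BranchIndex =>
          ∫ ξ, g (e (i, ξ)) * L.form ε P (W (i, ξ)) (W (i, ξ)) ∂(S.branchMeasure i))
        fun i hi => by
          rcases i with n | j
          · have h6 : L.form ε P (V n) (V n) = 0 := h1.form_waveEig hQ h2 n (hV n) hP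
            change ∫ ξ, g (S.eigval n) * L.form ε P (V n) (V n) ∂_ = 0
            simp [h6]
          · exact absurd ⟨j, rfl⟩ hi
      exact (h5.2 h4).tsum_eq.symm
    rw [← h3]; exact htr

end PerturbedTrace

/-! ### Translations along the first axis -/

section Translation

variable {p q : ℕ}

/-- Translation by `s` in the first variable. -/
def trans (s : ℝ) : L2Plane q →ₗᵢ[ℂ] L2Plane q :=
  Lp.compMeasurePreservingₗᵢ ℂ (fun z : ℝ × ℝ => z + (s, 0)) (measurePreserving_add_right volume (s, 0))

theorem trans_coe (s : ℝ) (f : L2Plane q) :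
    ∀ᵐ z : ℝ × ℝ, trans s f z = f (z + (s, 0)) :=
  Lp.coeFn_compMeasurePreserving f (measurePreserving_add_right volume (s, 0))

theorem ae_shift {r : ℝ × ℝ → Prop} (h : ∀ᵐ z, r z) (e : ℝ × ℝ) : ∀ᵐ z : ℝ × ℝ, r (z + e) :=
  (measurePreserving_add_right (volume : Measure (ℝ × ℝ)) e).quasiMeasurePreserving.ae h

theorem partialDeriv_shift (a b : ℕ) (θ : ℝ × ℝ → ℂ) (s : ℝ) (z : ℝ × ℝ) :
    partialDeriv a b (fun z => θ (z - (s, 0))) z = partialDeriv a b θ (z - (s, 0)) := by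
  simp only [partialDeriv, Prod.mk_sub_mk, sub_zero, Prod.fst_sub, Prod.snd_sub]
  exact congrFun (iteratedDeriv_comp_sub_const a
    (fun x => iteratedDeriv b (fun y => θ (x, y)) z.2) s) z.1

theorem HasWeakDeriv.shift {a b : ℕ} {u v : ℝ × ℝ → Fibre q} (h : HasWeakDeriv a b u v) (s : ℝ) :
    HasWeakDeriv a b (fun z => u (z + (s, 0))) fun z => v (z + (s, 0)) := by
  refine ⟨locallyIntegrable_shift h.1 _, locallyIntegrable_shift h.2.1 _, fun θ hθ hc => ?_⟩
  have a1 := integral_add_right_eq_self (μ := volume)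
    (fun z => partialDeriv a b θ (z - (s, 0)) • u z) ((s, 0) : ℝ × ℝ)
  have a2 := integral_add_right_eq_self (μ := volume)
    (fun z => θ (z - (s, 0)) • v z) ((s, 0) : ℝ × ℝ)
  simp only [add_sub_cancel_right] at a1 a2
  rw [a1, a2]
  have h3 := h.2.2 (fun z => θ (z - (s, 0))) (hθ.comp (contDiff_id.sub contDiff_const))
    (hc.comp_homeomorph (Homeomorph.subRight ((s, 0) : ℝ × ℝ)))
  simpa only [partialDeriv_shift] using h3

theorem memL2s_zero_shift {v : ℝ × ℝ → Fibre q} (h : MemL2s 0 v) (s : ℝ) :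
    MemL2s 0 fun z => v (z + (s, 0)) := by
  rw [memL2s_zero_iff] at h ⊢
  exact h.comp_measurePreserving (measurePreserving_add_right volume (s, 0))

variable {S : ScatteringSystem p q}

namespace ScatteringSystem.HypH1

variable (h1 : S.HypH1)

/-- The unperturbed operator, as a local operator. -/
abbrev free : LocalOperator p q := h1.localOperator BddHermitian.zero

theorem free_comm_zero (u : h1.free.dom) : h1.free.comm 0 u = S.H₀ u := by
  change S.H₀ u + BddHermitian.zero.clm (u : L2Plane q) = S.H₀ u
  have : BddHermitian.zero.clm (u : L2Plane q) = 0 := by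
    refine Lp.ext ?_
    filter_upwards [BddHermitian.zero.clm_coe (u : L2Plane q),
      Lp.coeFn_zero (Fibre q) 2 (volume : Measure (ℝ × ℝ))] with z h3 h4
    rw [h3, h4]; simp
  rw [this, add_zero]

/-- The unperturbed operator commutes with translations. -/
theorem exists_trans (s : ℝ) (u : h1.free.dom) : ∃ v : h1.free.dom,
    (v : L2Plane q) = trans s (u : L2Plane q) ∧
      h1.free.comm 0 v = trans s (h1.free.comm 0 u) := by
  have hu := (h1.mem_domain _).1 u.2
  have hts := trans_coe s (u : L2Plane q)
  have hmem : MemHps p 0 (trans s (u : L2Plane q)) := by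
    refine MemHps.congr (u := fun z => (u : L2Plane q) (z + (s, 0))) ⟨?_, fun a b hab => ?_⟩
      (hts.mono fun z hz => hz.symm)
    · have h3 := memL2s_zero_shift hu.1 s
      simpa using h3
    · obtain ⟨v, hv, hv2⟩ := hu.2 a b hab
      exact ⟨_, hv.shift s, memL2s_zero_shift hv2 s⟩
  refine ⟨⟨_, (h1.mem_domain _).2 hmem⟩, rfl, ?_⟩
  rw [free_comm_zero, free_comm_zero]
  obtain ⟨v, hv, hv2⟩ := h1.apply_eq u
  have hfam : WeakFamily p (trans s (u : L2Plane q)) fun a b z => v a b (z + (s, 0)) :=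
    fun a b hab => ((hv a b hab).shift s).congr (hts.mono fun z hz => hz.symm) ae_eq_rfl
  have h3 := h1.apply_ae ⟨_, (h1.mem_domain _).2 hmem⟩ hfam
  refine Lp.ext ?_
  filter_upwards [h3, ae_shift hv2 (s, 0), trans_coe s (S.H₀ u)] with z h4 h5 h6
  refine Eq.trans h4 ?_
  rw [h6, h5, commExpr_zero]
  simp

/-- Translation, on the domain of the unperturbed operator. -/
def transD (s : ℝ) (u : h1.free.dom) : h1.free.dom := (h1.exists_trans s u).choose

theorem transD_coe (s : ℝ) (u : h1.free.dom) :
    (h1.transD s u : L2Plane q) = trans s (u : L2Plane q) := (h1.exists_trans s u).choose_spec.1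

theorem comm_zero_transD (s : ℝ) (u : h1.free.dom) :
    h1.free.comm 0 (h1.transD s u) = trans s (h1.free.comm 0 u) :=
  (h1.exists_trans s u).choose_spec.2

end ScatteringSystem.HypH1

theorem BddMeas.shift {f : ℝ → ℂ} (hf : BddMeas f) (s : ℝ) : BddMeas fun x => f (x + s) :=
  ⟨hf.measurable.comp (measurable_add_const s), hf.bdd.imp fun _ h _ => h _⟩

theorem mulX_trans {f : ℝ → ℂ} (hf : BddMeas f) (s : ℝ) (u : L2Plane q) :
    mulX (fun x => f (x + s)) (trans s u) = trans s (mulX f u) := by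
  refine (eq_mulX (hf.shift s) ?_).symm
  filter_upwards [trans_coe s (mulX f u), trans_coe s u, ae_shift (mulX_coe hf u) (s, 0)]
    with z h1 h2 h3
  rw [h1, h2, h3]; rfl

theorem IsCut.shift {P : ℝ → ℝ} (hP : IsCut P) (s : ℝ) : IsCut fun x => P (x + s) := by
  have hd : (deriv fun x => ((P (x + s) : ℝ) : ℂ)) = fun x => deriv (fun x => (P x : ℂ)) (x + s) := by
    funext x
    exact deriv_comp_add_const (fun x => (P x : ℂ)) s x
  refine ⟨⟨hP.smoothBdd.contDiff.comp (contDiff_id.add contDiff_const), fun k => ?_⟩, ?_⟩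
  · obtain ⟨C, hC⟩ := hP.smoothBdd.bdd k
    refine ⟨C, fun x => ?_⟩
    rw [iteratedDeriv_comp_add_const k (fun x => (P x : ℂ)) s]
    exact hC _
  · rw [hd]
    exact hP.compact.comp_homeomorph (Homeomorph.addRight s)

theorem ScatteringSystem.HypH1.brk_transD (h1 : S.HypH1) {P : ℝ → ℝ} (hP : IsCut P) (s : ℝ)
    (u : h1.free.dom) : h1.free.brk (hP.shift s) (h1.transD s u) = trans s (h1.free.brk hP u) := by
  have h2 : h1.free.mulD (hP.shift s).smoothBdd (h1.transD s u) =
      h1.transD s (h1.free.mulD hP.smoothBdd u) := by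
    refine Subtype.ext ?_
    rw [LocalOperator.mulD_coe, h1.transD_coe, h1.transD_coe, LocalOperator.mulD_coe,
      mulX_trans hP.smoothBdd.bddMeas]
  rw [LocalOperator.brk_apply, LocalOperator.brk_apply, h2, h1.comm_zero_transD,
    h1.comm_zero_transD, mulX_trans hP.smoothBdd.bddMeas, map_smul, map_sub]

end Translation

/-! ### The current of plane waves -/

section FreeCurrent

variable {p q : ℕ} {S : ScatteringSystem p q}

theorem IsSmoothSwitch.isCut {c d : ℝ} {P : ℝ → ℝ} (h : IsSmoothSwitch c d P) : IsCut P := by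
  have hC : ContDiff ℝ ∞ fun x => (P x : ℂ) := Complex.ofRealCLM.contDiff.comp h.1
  have hcs : HasCompactSupport (deriv fun x => (P x : ℂ)) := by
    refine HasCompactSupport.of_support_subset_isCompact (K := Icc c d) isCompact_Icc
      fun x hx => ?_
    by_contra hcon
    refine hx ?_
    rw [mem_Icc, not_and_or, not_le, not_le] at hcon
    rcases hcon with hx | hx
    · have : (fun x => (P x : ℂ)) =ᶠ[𝓝 x] fun _ => 0 := by
        filter_upwards [Iio_mem_nhds hx] with y hy
        rw [h.2.1 y hy, Complex.ofReal_zero]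
      rw [this.deriv_eq, deriv_const]
    · have : (fun x => (P x : ℂ)) =ᶠ[𝓝 x] fun _ => 1 := by
        filter_upwards [Ioi_mem_nhds hx] with y hy
        rw [h.2.2 y hy, Complex.ofReal_one]
      rw [this.deriv_eq, deriv_const]
  refine ⟨⟨hC, fun k => ?_⟩, hcs⟩
  rcases k with _ | k
  · obtain ⟨C, hC⟩ := (isCompact_Icc (a := c) (b := d)).exists_bound_of_continuousOn
      h.1.continuous.continuousOn
    refine ⟨max C 1, fun x => ?_⟩
    rw [iteratedDeriv_zero, Complex.norm_real]
    by_cases hx : x ∈ Icc c d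
    · exact (hC x hx).trans (le_max_left _ _)
    · rw [mem_Icc, not_and_or, not_le, not_le] at hx
      rcases hx with hx | hx
      · rw [h.2.1 x hx]; simp
      · rw [h.2.2 x hx]; simp
  · have h2 := SmoothBdd.of_hasCompactSupport (θ := deriv fun x => (P x : ℂ))
      (by simpa [iteratedDeriv_one] using contDiff_iteratedDeriv hC 1) hcs
    rw [iteratedDeriv_succ']
    exact h2.bdd k

theorem IsSmoothSwitch.hasCompactSupport_sub {c d c' d' : ℝ} {P P' : ℝ → ℝ}
    (h : IsSmoothSwitch c d P) (h' : IsSmoothSwitch c' d' P') :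
    HasCompactSupport fun x => P x - P' x := by
  refine HasCompactSupport.of_support_subset_isCompact (K := Icc (min c c') (max d d'))
    isCompact_Icc fun x hx => ?_
  by_contra hcon
  refine hx ?_
  rw [mem_Icc, not_and_or, not_le, not_le] at hcon
  rcases hcon with hx | hx
  · simp only [h.2.1 x (hx.trans_le (min_le_left _ _)), h'.2.1 x (hx.trans_le (min_le_right _ _)),
      sub_self]
  · simp only [h.2.2 x ((le_max_left _ _).trans_lt hx), h'.2.2 x ((le_max_right _ _).trans_lt hx),
      sub_self]

theorem IsSmoothSwitch.shift {c d : ℝ} {P : ℝ → ℝ} (h : IsSmoothSwitch c d P) (s : ℝ) :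
    IsSmoothSwitch (c - s) (d - s) fun x => P (x + s) :=
  ⟨h.1.comp (contDiff_id.add contDiff_const), fun x hx => h.2.1 _ (by linarith),
    fun x hx => h.2.2 _ (by linarith)⟩

theorem IsSmoothSwitch.integral_sub_shift {c d : ℝ} {P : ℝ → ℝ} (h : IsSmoothSwitch c d P) :
    ∫ x, (P x - P (x + 1)) = -1 := by
  have hcont := h.1.continuous
  have hi : ∀ a b, IntervalIntegrable P volume a b := fun a b => hcont.intervalIntegrable a b
  have hi' : ∀ a b, IntervalIntegrable (fun x => P (x + 1)) volume a b := fun a b =>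
    (hcont.comp (continuous_add_const 1)).intervalIntegrable a b
  set N := max (|c|) (|d|) + 2 with hN
  have hc : -N < c - 1 := by
    have := neg_abs_le c; have := le_max_left |c| |d|; linarith
  have hd : d < N := by
    have := le_abs_self d; have := le_max_right |c| |d|; linarith
  have hN0 : 0 < N := by have := le_max_left |c| |d|; have := abs_nonneg c; linarith
  have h1 : ∫ x, (P x - P (x + 1)) = ∫ x in (-N)..N, (P x - P (x + 1)) := by
    refine (intervalIntegral.integral_eq_integral_of_support_subset fun x hx => ?_).symm
    by_contra hcon
    refine hx ?_
    rw [mem_Ioc, not_and_or, not_lt, not_le] at hcon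
    rcases hcon with hx | hx
    · simp only [h.2.1 x (by linarith), h.2.1 (x + 1) (by linarith), sub_self]
    · simp only [h.2.2 x (by linarith), h.2.2 (x + 1) (by linarith), sub_self]
  rw [h1, intervalIntegral.integral_sub (hi _ _) (hi' _ _),
    intervalIntegral.integral_comp_add_right, intervalIntegral.integral_interval_sub_interval_comm
      (hi _ _) (hi _ _) (hi _ _)]
  have h2 : ∫ x in (-N)..(-N + 1), P x = ∫ x in (-N)..(-N + 1), (0 : ℝ) := by
    refine intervalIntegral.integral_congr_ae (Eventually.of_forall fun x hx => ?_)
    rw [uIoc_of_le (by linarith)] at hx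
    exact h.2.1 x (by linarith [hx.2])
  have h3 : ∫ x in N..(N + 1), P x = ∫ x in N..(N + 1), (1 : ℝ) := by
    refine intervalIntegral.integral_congr_ae (Eventually.of_forall fun x hx => ?_)
    rw [uIoc_of_le (by linarith)] at hx
    exact h.2.2 x (by linarith [hx.1])
  rw [h2, h3]; simp

namespace ScatteringSystem.HypH1

variable (h1 : S.HypH1) {ε : ℝ} (hε : ε ≠ 0)

/-- The functions `(1 + iεx)^{-1} ψ_j(·; ξ)` in the domain of the unperturbed operator. -/
def waveD (m : ℕ × ℝ) : h1.free.dom := (h1.genEig_wave hε m).choose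

theorem waveD_coe (m : ℕ × ℝ) : (h1.waveD hε m : L2Plane q) = wave S hε m :=
  (h1.genEig_wave hε m).choose_spec.1

theorem genEig_waveD (m : ℕ × ℝ) :
    h1.free.GenEig ε (h1.waveD hε m) (S.energy m.1 m.2) :=
  (h1.genEig_wave hε m).choose_spec.2

theorem psi_shift (m : ℕ × ℝ) (s : ℝ) (z : ℝ × ℝ) :
    S.psi m (z + (s, 0)) = Complex.exp (Complex.I * m.2 * s) • S.psi m z := by
  simp only [ScatteringSystem.psi, smul_smul, Prod.fst_add, Prod.snd_add, add_zero]
  congr 1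
  rw [mul_left_comm, ← Complex.exp_add]
  push_cast
  ring_nf

theorem transD_waveD {χ : ℝ → ℝ} (hχ : ContDiff ℝ ∞ χ) (hχc : HasCompactSupport χ)
    {χ' : ℝ → ℝ} (hχ' : ContDiff ℝ ∞ χ') (hχc' : HasCompactSupport χ') (s : ℝ)
    (hs : ∀ x, χ' x = χ (x + s)) (m : ℕ × ℝ) :
    h1.transD s (h1.free.mulD (LocalOperator.smoothBdd_cutoff_mul hχ hχc (contDiff_wp ε 1))
      (h1.waveD hε m)) = Complex.exp (Complex.I * m.2 * s) • h1.free.mulD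
        (LocalOperator.smoothBdd_cutoff_mul hχ' hχc' (contDiff_wp ε 1)) (h1.waveD hε m) := by
  have hb := (LocalOperator.smoothBdd_cutoff_mul hχ hχc (contDiff_wp ε 1)).bddMeas
  have hb' := (LocalOperator.smoothBdd_cutoff_mul hχ' hχc' (contDiff_wp ε 1)).bddMeas
  refine Subtype.ext ?_
  rw [transD_coe, Submodule.coe_smul, LocalOperator.mulD_coe, LocalOperator.mulD_coe, waveD_coe]
  refine Lp.ext ?_
  filter_upwards [trans_coe s (mulX (fun x => (χ x : ℂ) * wp ε 1 x) (wave S hε m)),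
    ae_shift (mulX_coe hb (wave S hε m)) (s, 0), mulX_coe hb' (wave S hε m),
    Lp.coeFn_smul (Complex.exp (Complex.I * m.2 * s))
      (mulX (fun x => (χ' x : ℂ) * wp ε 1 x) (wave S hε m)),
    wave_coe S hε m, ae_shift (wave_coe S hε m) (s, 0)] with z h2 h3 h4 h5 h6 h7
  have hw : ∀ x, wp ε 1 x * wp ε (-1) x = 1 := fun x => by rw [wp_mul]; exact wp_zero _ _
  rw [h2, h3, h5, Pi.smul_apply, h4, h6, h7, psi_shift, hs]
  simp only [Prod.fst_add, smul_smul]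
  congr 1
  linear_combination (χ (z.1 + s) * Complex.exp (Complex.I * m.2 * s)) * hw (z.1 + s) -
    (χ (z.1 + s) * Complex.exp (Complex.I * m.2 * s)) * hw z.1

theorem form_shift {P : ℝ → ℝ} (hP : IsCut P) (s : ℝ) (m n : ℕ × ℝ) :
    h1.free.form ε (fun x => P (x + s)) (h1.waveD hε m) (h1.waveD hε n) =
      Complex.exp (Complex.I * (m.2 - n.2) * s) *
        h1.free.form ε P (h1.waveD hε m) (h1.waveD hε n) := by
  obtain ⟨R, hR⟩ := HasCompactSupport.exists_abs_le hP.compact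
  obtain ⟨χ, hχ, hχc, hχ1⟩ := exists_cutoff_nhds hR
  have hd : (deriv fun x => ((P (x + s) : ℝ) : ℂ)) = fun x => deriv (fun x => (P x : ℂ)) (x + s) := by
    funext x
    exact deriv_comp_add_const (fun x => (P x : ℂ)) s x
  have hχ' : ContDiff ℝ ∞ fun x => χ (x + s) := hχ.comp (contDiff_id.add contDiff_const)
  have hχc' : HasCompactSupport fun x => χ (x + s) := hχc.comp_homeomorph (Homeomorph.addRight s)
  have hχ1' : ∀ x ∈ tsupport (deriv fun x => ((P (x + s) : ℝ) : ℂ)),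
      (fun x => χ (x + s)) =ᶠ[𝓝 x] fun _ => 1 := fun x hx => by
    have h3 : x + s ∈ tsupport (deriv fun x => (P x : ℂ)) := by
      rw [hd] at hx
      have := tsupport_comp_subset_preimage (deriv fun x => (P x : ℂ)) (continuous_add_const s) hx
      exact this
    exact (continuous_add_const s).continuousAt.tendsto.eventually (hχ1 _ h3)
  rw [LocalOperator.form_eq hP hχ hχc hχ1, LocalOperator.form_eq (hP.shift s) hχ' hχc' hχ1']
  have key := h1.brk_transD hP s (h1.free.mulD
    (LocalOperator.smoothBdd_cutoff_mul hχ hχc (contDiff_wp ε 1)) (h1.waveD hε n))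
  have htr : ∀ a b : L2Plane q, ⟪a, b⟫_ℂ = ⟪trans s a, trans s b⟫_ℂ := fun a b =>
    ((trans s).inner_map_map a b).symm
  rw [htr (h1.free.mulD (LocalOperator.smoothBdd_cutoff_mul hχ hχc (contDiff_wp ε 1))
    (h1.waveD hε m) : L2Plane q), ← key, ← h1.transD_coe,
    h1.transD_waveD hε hχ hχc hχ' hχc' s (fun _ => rfl),
    h1.transD_waveD hε hχ hχc hχ' hχc' s (fun _ => rfl), map_smul, Submodule.coe_smul,
    inner_smul_left, inner_smul_right, ← Complex.exp_conj, ← mul_assoc, ← mul_assoc,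
    ← Complex.exp_add, ← Complex.exp_add]
  refine Eq.trans (one_mul _).symm (congrArg₂ (· * ·) ?_ rfl)
  simp only [map_mul, Complex.conj_I, Complex.conj_ofReal]
  rw [← Complex.exp_zero]
  ring_nf

/-- Overlaps of plane waves. -/
theorem inner_wave_mulX {G : ℝ → ℂ} (hG : Continuous G) (hGc : HasCompactSupport G) (m n : ℕ × ℝ) :
    ⟪wave S hε m, mulX (fun x => wp (-ε) 1 x * (G x * wp ε 1 x)) (wave S hε n)⟫_ℂ =
      (2 * Real.pi : ℂ)⁻¹ * (∫ x : ℝ, G x * Complex.exp (Complex.I * (n.2 - m.2) * x)) *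
        ⟪S.mode m.2 m.1, S.mode n.2 n.1⟫_ℂ := by
  have hb : BddMeas fun x => wp (-ε) 1 x * (G x * wp ε 1 x) :=
    .of_continuous_compact ((contDiff_wp _ _).continuous.mul (hG.mul (contDiff_wp _ _).continuous))
      (hGc.mul_right.mul_left)
  rw [L2.inner_def, L2.inner_def, mul_assoc, ← integral_prod_mul, ← volume_plane,
    ← MeasureTheory.integral_const_mul]
  refine integral_congr_ae ?_
  filter_upwards [wave_coe S hε m, wave_coe S hε n, mulX_coe hb (wave S hε n)] with z h2 h3 h4
  rw [h4, h2, h3, inner_smul_left, inner_smul_right, inner_smul_right, ScatteringSystem.psi,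
    ScatteringSystem.psi, inner_smul_left, inner_smul_right, conj_wp]
  have hw : ∀ ε x : ℝ, wp ε 1 x * wp ε (-1) x = 1 := fun ε x => by rw [wp_mul]; exact wp_zero _ _
  have h5 : Complex.exp (Complex.I * (n.2 - m.2) * z.1) =
      Complex.exp (-(Complex.I * m.2 * z.1)) * Complex.exp (Complex.I * n.2 * z.1) := by
    rw [← Complex.exp_add]; ring_nf
  have h6 : starRingEnd ℂ (((Real.sqrt (2 * Real.pi))⁻¹ : ℂ) * Complex.exp (Complex.I * m.2 * z.1)) =
      ((Real.sqrt (2 * Real.pi))⁻¹ : ℂ) * Complex.exp (-(Complex.I * m.2 * z.1)) := by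
    rw [map_mul, map_inv₀, Complex.conj_ofReal, ← Complex.exp_conj]
    simp [neg_mul]
  have h7 : ((Real.sqrt (2 * Real.pi))⁻¹ : ℂ) * ((Real.sqrt (2 * Real.pi))⁻¹ : ℂ) =
      (2 * Real.pi : ℂ)⁻¹ := by
    rw [← mul_inv, ← Complex.ofReal_mul, Real.mul_self_sqrt (by positivity)]; push_cast; rfl
  rw [h5, h6, ← h7]
  linear_combination ((Real.sqrt (2 * Real.pi))⁻¹ : ℂ) * Complex.exp (-(Complex.I * m.2 * z.1)) *
    ((Real.sqrt (2 * Real.pi))⁻¹ : ℂ) * Complex.exp (Complex.I * n.2 * z.1) * G z.1 *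
    ⟪S.mode m.2 m.1 z.2, S.mode n.2 n.1 z.2⟫_ℂ *
    (wp (-ε) 1 z.1 * wp (-ε) (-1) z.1 * hw ε z.1 + hw (-ε) z.1)

end ScatteringSystem.HypH1

end FreeCurrent

section FreeCurrentValue

variable {p q : ℕ} {S : ScatteringSystem p q}

theorem norm_tens_profile {ε : ℝ} (hε : ε ≠ 0) (ξ : ℝ) (v : L2Line q) :
    ‖tens (memLp_profile hε ξ) v‖ =
      Real.sqrt (∫⁻ x, ‖profile ε 0 x‖ₑ ^ 2).toReal * ‖v‖ := by
  have h6 := enorm_tens_sq (memLp_profile hε ξ) v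
  have h7 : (∫⁻ x, ‖profile ε ξ x‖ₑ ^ 2) = ∫⁻ x, ‖profile ε 0 x‖ₑ ^ 2 :=
    lintegral_congr fun x => by rw [← ofReal_norm, ← ofReal_norm, norm_profile, norm_profile]
  have h8 := congrArg ENNReal.toReal h6
  rw [h7, ENNReal.toReal_mul, ENNReal.toReal_pow, ENNReal.toReal_pow, toReal_enorm,
    toReal_enorm] at h8
  rw [← Real.sqrt_sq (norm_nonneg (tens _ v)), h8, Real.sqrt_mul ENNReal.toReal_nonneg,
    Real.sqrt_sq (norm_nonneg _)]

namespace ScatteringSystem.HypH1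

variable (h1 : S.HypH1) {ε : ℝ} (hε : ε ≠ 0)

theorem sub_shift_form {c d : ℝ} {P : ℝ → ℝ} (h : IsSmoothSwitch c d P) (s : ℝ) (m n : ℕ × ℝ) :
    (1 - Complex.exp (Complex.I * (m.2 - n.2) * s)) *
        h1.free.form ε P (h1.waveD hε m) (h1.waveD hε n) =
      Complex.I * ((S.energy m.1 m.2 : ℂ) - S.energy n.1 n.2) * ((2 * Real.pi : ℂ)⁻¹ *
        (∫ x : ℝ, ((P x - P (x + s) : ℝ) : ℂ) * Complex.exp (Complex.I * (n.2 - m.2) * x)) *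
          ⟪S.mode m.2 m.1, S.mode n.2 n.1⟫_ℂ) := by
  have hc := h.hasCompactSupport_sub (h.shift s)
  have hsm : ContDiff ℝ ∞ fun x => P x - P (x + s) := h.1.sub (h.shift s).1
  have hG : Continuous fun x => ((P x - P (x + s) : ℝ) : ℂ) :=
    Complex.continuous_ofReal.comp hsm.continuous
  have hGc : HasCompactSupport fun x => ((P x - P (x + s) : ℝ) : ℂ) :=
    hc.comp_left Complex.ofReal_zero
  rw [← inner_wave_mulX hε hG hGc, ← h1.waveD_coe hε m, ← h1.waveD_coe hε n,
    ← LocalOperator.form_genEig (h1.genEig_waveD hε m) (h1.genEig_waveD hε n) hsm hc,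
    LocalOperator.form_sub h.isCut (h.shift s).isCut, h1.form_shift hε h.isCut]
  ring

theorem form_wave_of_ne {c d : ℝ} {P : ℝ → ℝ} (h : IsSmoothSwitch c d P) {m n : ℕ × ℝ}
    (he : S.energy m.1 m.2 = S.energy n.1 n.2) (hne : m.2 ≠ n.2) :
    h1.free.form ε P (h1.waveD hε m) (h1.waveD hε n) = 0 := by
  have h2 := h1.sub_shift_form hε h (Real.pi / (m.2 - n.2)) m n
  have h3 : Complex.I * (m.2 - n.2) * ((Real.pi / (m.2 - n.2) : ℝ) : ℂ) = Real.pi * Complex.I := by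
    have : ((m.2 : ℂ) - n.2) ≠ 0 := by
      rw [← Complex.ofReal_sub]; exact_mod_cast sub_ne_zero.2 hne
    push_cast
    field_simp
  rw [h3, Complex.exp_pi_mul_I, he, sub_self, mul_zero, zero_mul] at h2
  simpa using h2

theorem tendsto_form_wave {P : ℝ → ℝ} (n : ℕ × ℝ) (k : ℕ) (ξ : ℝ) :
    Tendsto (fun ξ' => ⟪S.mode ξ k, S.mode ξ' k⟫_ℂ *
        h1.free.form ε P (h1.waveD hε (k, ξ')) (h1.waveD hε n)) (𝓝 ξ)
      (𝓝 (h1.free.form ε P (h1.waveD hε (k, ξ)) (h1.waveD hε n))) := by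
  set ζ := h1.free.cur (wp (-ε) 1) (wp ε 1) P (h1.waveD hε n) with hζ
  set b := S.mode ξ k with hb
  let Pr : ℝ → L2Line q →L[ℂ] L2Line q := fun ξ' =>
    InnerProductSpace.rankOne ℂ (S.mode ξ' k) (S.mode ξ' k)
  have hPr : Continuous Pr := (h1.projector_smooth k).continuous
  have hbn : ‖b‖ = 1 := (S.mode ξ).orthonormal.1 k
  have hPb : Pr ξ b = b := by
    simp only [Pr, InnerProductSpace.rankOne_apply, hb, inner_self_eq_norm_sq_to_K]
    rw [← hb, hbn]; simp
  have e1 : ∀ ξ', ⟪b, S.mode ξ' k⟫_ℂ *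
      h1.free.form ε P (h1.waveD hε (k, ξ')) (h1.waveD hε n) =
        ⟪tens (memLp_profile hε ξ') (Pr ξ' b), ζ⟫_ℂ := fun ξ' => by
    simp only [Pr, InnerProductSpace.rankOne_apply, map_smul, inner_smul_left, inner_conj_symm]
    rw [LocalOperator.form, waveD_coe]
    rfl
  have e2 : h1.free.form ε P (h1.waveD hε (k, ξ)) (h1.waveD hε n) =
      ⟪tens (memLp_profile hε ξ) b, ζ⟫_ℂ := by
    rw [LocalOperator.form, waveD_coe]; rfl
  simp only [e1, e2]
  have h3 : Tendsto (fun ξ' => ⟪tens (memLp_profile hε ξ') (Pr ξ' b - b), ζ⟫_ℂ) (𝓝 ξ) (𝓝 0) := by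
    have h4 : Tendsto (fun ξ' => Pr ξ' b - b) (𝓝 ξ) (𝓝 0) := by
      have : Continuous fun ξ' => Pr ξ' b - b := (hPr.clm_apply continuous_const).sub continuous_const
      have h5 := this.tendsto ξ
      rwa [hPb, sub_self] at h5
    have hK := norm_tens_profile (q := q) hε
    set K := (∫⁻ x, ‖profile ε 0 x‖ₑ ^ 2).toReal
    refine squeeze_zero_norm (a := fun ξ' => Real.sqrt K * ‖Pr ξ' b - b‖ * ‖ζ‖) (fun ξ' => ?_) ?_
    · rw [← hK ξ']
      exact norm_inner_le_norm _ _
    · simpa using ((h4.norm.const_mul (Real.sqrt K)).mul_const ‖ζ‖)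
  have h9 := h3.add ((continuous_inner_tens_profile hε b ζ).tendsto ξ)
  rw [zero_add] at h9
  refine h9.congr fun ξ' => ?_
  rw [← inner_add_left, ← map_add, sub_add_cancel]

theorem form_wave_of_eq {c d : ℝ} {P : ℝ → ℝ} (h : IsSmoothSwitch c d P) (k l : ℕ) (ξ : ℝ)
    (he : S.energy k ξ = S.energy l ξ) :
    h1.free.form ε P (h1.waveD hε (k, ξ)) (h1.waveD hε (l, ξ)) =
      if k = l then (S.current (k, ξ) : ℂ) / (2 * Real.pi) else 0 := by
  have hB := h1.tendsto_form_wave hε (P := P) (l, ξ) k ξ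
  have hexp : HasDerivAt (fun ξ' : ℝ => 1 - Complex.exp (Complex.I * (ξ' - ξ) * (1 : ℝ)))
      (-Complex.I) ξ := by
    have h2 : HasDerivAt (fun ξ' : ℝ => Complex.I * ((ξ' : ℂ) - ξ) * (1 : ℝ)) Complex.I ξ := by
      simpa using (((hasDerivAt_id ξ).ofReal_comp.sub_const (ξ : ℂ)).const_mul Complex.I)
    simpa using h2.cexp.const_sub 1
  have hE : HasDerivAt (fun ξ' : ℝ => ((S.energy k ξ' : ℂ))) (S.current (k, ξ) : ℂ) ξ :=
    ((h1.energy_smooth k).differentiable (by simp) ξ).hasDerivAt.ofReal_comp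
  rw [hasDerivAt_iff_tendsto_slope] at hexp hE
  set G : ℝ → ℝ := fun x => P x - P (x + 1) with hGd
  have hGc : HasCompactSupport G := h.hasCompactSupport_sub (h.shift 1)
  have hGcont : Continuous G := (h.1.sub (h.shift 1).1).continuous
  have hc : Tendsto (fun ξ' : ℝ => ∫ x : ℝ, (G x : ℂ) * Complex.exp (Complex.I * (ξ - ξ') * x)) (𝓝 ξ)
      (𝓝 (-1)) := by
    have h3 : Continuous fun ξ' : ℝ => ∫ x : ℝ, (G x : ℂ) * Complex.exp (Complex.I * (ξ - ξ') * x) := by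
      refine continuous_of_dominated (bound := fun x => ‖G x‖) (fun ξ' => ?_)
        (fun ξ' => Eventually.of_forall fun x => ?_)
        (hGcont.integrable_of_hasCompactSupport hGc).norm (Eventually.of_forall fun x => by fun_prop)
      · exact Continuous.aestronglyMeasurable (by fun_prop)
      · rw [norm_mul, ← Complex.ofReal_sub, norm_exp_I_mul_mul, mul_one, Complex.norm_real]
    have h4 := h3.tendsto ξ
    have h5 : ∫ x : ℝ, (G x : ℂ) * Complex.exp (Complex.I * (ξ - ξ) * x) = -1 := by
      simp only [sub_self, mul_zero, zero_mul, Complex.exp_zero, mul_one]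
      rw [integral_complex_ofReal, h.integral_sub_shift]
      simp
    rwa [h5] at h4
  have hD : Tendsto (fun ξ' => ⟪S.mode ξ k, S.mode ξ' k⟫_ℂ * ⟪S.mode ξ' k, S.mode ξ l⟫_ℂ) (𝓝 ξ)
      (𝓝 (if k = l then 1 else 0)) := by
    have h5 : Continuous fun ξ' => ⟪S.mode ξ k,
        (InnerProductSpace.rankOne ℂ (S.mode ξ' k) (S.mode ξ' k) :
          L2Line q →L[ℂ] L2Line q) (S.mode ξ l)⟫_ℂ :=
      continuous_const.inner ((h1.projector_smooth k).continuous.clm_apply continuous_const)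
    have h6 := h5.tendsto ξ
    simp only [InnerProductSpace.rankOne_apply, inner_smul_right] at h6
    rw [orthonormal_iff_ite.1 (S.mode ξ).orthonormal, orthonormal_iff_ite.1 (S.mode ξ).orthonormal]
      at h6
    simp only [if_true, mul_one] at h6
    exact h6.congr fun ξ' => mul_comm _ _
  have hL := hexp.mul (hB.mono_left nhdsWithin_le_nhds)
  have hR := (((hE.mul (hc.mono_left nhdsWithin_le_nhds)).mul
    (hD.mono_left nhdsWithin_le_nhds)).const_mul (Complex.I * (2 * Real.pi : ℂ)⁻¹))
  have heq := tendsto_nhds_unique (hL.congr fun ξ' => ?_) hR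
  · have h7 : ∀ z w : ℂ, -Complex.I * z = w → z = Complex.I * w := fun z w hz => by
      rw [← hz]; linear_combination z * Complex.I_mul_I
    rw [h7 _ _ heq]
    split_ifs
    · linear_combination (-((S.current (k, ξ) : ℂ) * (2 * Real.pi : ℂ)⁻¹)) * Complex.I_mul_I
    · simp
  · have h8 := h1.sub_shift_form hε h 1 (k, ξ') (l, ξ)
    simp only [slope_def_module, sub_self, mul_zero, zero_mul, Complex.exp_zero, sub_zero] at h8 ⊢
    simp only [Complex.real_smul]
    rw [← he] at h8
    linear_combination (((ξ' - ξ)⁻¹ : ℝ) : ℂ) * ⟪S.mode ξ k, S.mode ξ' k⟫_ℂ * h8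

/-- The current form of the plane waves at a fixed energy is diagonal. -/
theorem form_wave {c d : ℝ} {P : ℝ → ℝ} (h : IsSmoothSwitch c d P) {m n : ℕ × ℝ}
    (he : S.energy m.1 m.2 = S.energy n.1 n.2) :
    h1.free.form ε P (h1.waveD hε m) (h1.waveD hε n) =
      if m = n then (S.current m : ℂ) / (2 * Real.pi) else 0 := by
  by_cases hne : m.2 = n.2
  · obtain ⟨k, ξ⟩ := m
    obtain ⟨l, ξ'⟩ := n
    obtain rfl : ξ = ξ' := hne
    rw [h1.form_wave_of_eq hε h k l ξ he]
    simp
  · rw [h1.form_wave_of_ne hε h he hne, if_neg (fun h => hne (by rw [h]))]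

end ScatteringSystem.HypH1

end FreeCurrentValue

/-! ### Currents at large distances -/

section Scaling

variable {p q : ℕ}

theorem wp_scale (ε : ℝ) (a : ℤ) (x : ℝ) : wp ε a x = wp 1 a (ε * x) := by
  simp [wp, mul_assoc]

theorem IsSmoothSwitch.scale {c d : ℝ} {P : ℝ → ℝ} (h : IsSmoothSwitch c d P) {ε : ℝ} (hε : 0 < ε) :
    IsSmoothSwitch (c / ε) (d / ε) fun x => P (ε * x) :=
  ⟨h.1.comp (contDiff_const.mul contDiff_id), fun x hx => h.2.1 _ (by
    rw [lt_div_iff₀ hε] at hx; linarith), fun x hx => h.2.2 _ (by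
    rw [gt_iff_lt, div_lt_iff₀ hε] at hx; linarith)⟩

theorem iteratedDeriv_comp_mul_complex {f : ℝ → ℂ} (hf : ContDiff ℝ ∞ f) (ε : ℝ) (n : ℕ) (x : ℝ) :
    iteratedDeriv n (fun x => f (ε * x)) x = (ε : ℂ) ^ n * iteratedDeriv n f (ε * x) := by
  rw [iteratedDeriv_comp_const_smul (hf.of_le (mod_cast le_top))]
  simp

theorem curCoeff_scale {P : ℝ → ℝ} (hP : IsCut P) (ε : ℝ) (n : ℕ) (x : ℝ) :
    curCoeff (wp ε 1) (fun x => P (ε * x)) n x =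
      (ε : ℂ) ^ n * curCoeff (wp 1 1) P n (ε * x) := by
  have h1 : wp ε 1 = fun x => wp 1 1 (ε * x) := funext (wp_scale ε 1)
  rw [curCoeff, curCoeff, h1, iteratedDeriv_comp_mul_complex (contDiff_wp 1 1),
    iteratedDeriv_comp_mul_complex (f := fun x => (P x : ℂ) * wp 1 1 x)
      (hP.smoothBdd.contDiff.mul (contDiff_wp 1 1))]
  ring

theorem IsSmoothSwitch.tsupport_subset {c d : ℝ} {P : ℝ → ℝ} (h : IsSmoothSwitch c d P) :
    tsupport (deriv fun x => (P x : ℂ)) ⊆ Icc c d := by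
  refine closure_minimal (fun x hx => ?_) isClosed_Icc
  by_contra hcon
  refine hx ?_
  rw [mem_Icc, not_and_or, not_le, not_le] at hcon
  rcases hcon with hx | hx
  · have : (fun x => (P x : ℂ)) =ᶠ[𝓝 x] fun _ => 0 := by
      filter_upwards [Iio_mem_nhds hx] with y hy
      rw [h.2.1 y hy, Complex.ofReal_zero]
    rw [this.deriv_eq, deriv_const]
  · have : (fun x => (P x : ℂ)) =ᶠ[𝓝 x] fun _ => 1 := by
      filter_upwards [Ioi_mem_nhds hx] with y hy
      rw [h.2.2 y hy, Complex.ofReal_one]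
    rw [this.deriv_eq, deriv_const]

namespace LocalOperator

variable (L : LocalOperator p q)

theorem exists_norm_cur_le {P : ℝ → ℝ} (hP : IsCut P) : ∃ C : ℝ, 0 ≤ C ∧ ∀ ε : ℝ, 0 < ε → ε ≤ 1 →
    ∀ v : L.dom, ‖L.cur (wp (-ε) 1) (wp ε 1) (fun x => P (ε * x)) v‖ ≤
      C * ε * (‖L.comm 0 v‖ + ‖(v : L2Plane q)‖) := by
  choose K hK0 hK using L.comm_bound
  choose B hB0 hB using fun n => (bddMeas_mul_curCoeff (contDiff_wp 1 1) hP
    (contDiff_wp (-1) 1).continuous n).bound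
  refine ⟨∑ n ∈ Finset.range (p + 1), B n * K n, Finset.sum_nonneg fun n _ =>
    mul_nonneg (hB0 n) (hK0 n), fun ε hε hε1 v => ?_⟩
  have hmeas : ∀ n, Measurable fun x => wp (-ε) 1 x * curCoeff (wp ε 1) (fun x => P (ε * x)) n x :=
    fun n => by
      simp only [curCoeff_scale hP]
      have h1 := (continuous_curCoeff (contDiff_wp 1 1) hP n).comp (continuous_const_mul ε)
      exact ((contDiff_wp (-ε) 1).continuous.mul (continuous_const.mul h1)).measurable
  rw [cur_apply, norm_smul, Complex.norm_I, one_mul, Finset.sum_mul, Finset.sum_mul]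
  refine (norm_sum_le _ _).trans (Finset.sum_le_sum fun n _ => ?_)
  have h2 : ∀ x, ‖wp (-ε) 1 x * curCoeff (wp ε 1) (fun x => P (ε * x)) n x‖ ≤ ε * B n := fun x => by
    rcases n with _ | n
    · rw [curCoeff_zero, mul_zero, norm_zero]
      exact mul_nonneg hε.le (hB0 0)
    rw [curCoeff_scale hP, show wp (-ε) 1 x = wp (-1) 1 (ε * x) by simp [wp_one, mul_assoc],
      mul_left_comm, norm_mul]
    refine mul_le_mul ?_ (hB _ _) (norm_nonneg _) hε.le
    rw [norm_pow, Complex.norm_real, Real.norm_of_nonneg hε.le]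
    exact pow_le_of_le_one hε.le hε1 (by omega)
  refine (norm_mulX_le (hmeas n) h2 _).trans ?_
  calc ε * B n * ‖L.comm n v‖ ≤ ε * B n * (K n * (‖L.comm 0 v‖ + ‖(v : L2Plane q)‖)) :=
        mul_le_mul_of_nonneg_left (hK n v) (mul_nonneg hε.le (hB0 n))
    _ = _ := by ring

theorem exists_norm_comm_zero_le (e : ℝ) : ∃ ε₁ : ℝ, 0 < ε₁ ∧ ∀ ε : ℝ, 0 < ε → ε ≤ ε₁ →
    ∀ v : L.dom, L.GenEig ε v e → ‖L.comm 0 v‖ ≤ (2 * |e| + 1) * ‖(v : L2Plane q)‖ := by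
  obtain ⟨K, hK0, hK⟩ := L.comm_bound 1
  refine ⟨(2 * (K + 1))⁻¹, by positivity, fun ε hε hε1 v hv => ?_⟩
  have h1 : ε * K ≤ 1 / 2 := by
    have : ε * (2 * (K + 1)) ≤ 1 := by
      calc ε * (2 * (K + 1)) ≤ (2 * (K + 1))⁻¹ * (2 * (K + 1)) := by gcongr
        _ = 1 := inv_mul_cancel₀ (by positivity)
    nlinarith
  have h2 : ‖L.comm 0 v‖ ≤ |e| * ‖(v : L2Plane q)‖ + ε * ‖L.comm 1 v‖ := by
    rw [show L.comm 0 v = _ from hv]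
    refine (norm_sub_le _ _).trans (add_le_add ?_ ?_)
    · rw [norm_smul, Complex.norm_real, Real.norm_eq_abs]
    · rw [norm_smul, norm_mul, Complex.norm_I, one_mul, Complex.norm_real,
        Real.norm_of_nonneg hε.le]
      refine mul_le_mul_of_nonneg_left ?_ hε.le
      simpa using norm_mulX_le (contDiff_wp ε (-1)).continuous.measurable
        (norm_wp_le_one ε (by norm_num)) (L.comm 1 v)
  have h3 := mul_le_mul_of_nonneg_left (hK v) hε.le
  have h4 := norm_nonneg (L.comm 0 v)
  have h5 := norm_nonneg (v : L2Plane q)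
  nlinarith [abs_nonneg e]

theorem exists_norm_cur_genEig_le {P : ℝ → ℝ} (hP : IsCut P) (e : ℝ) :
    ∃ C ε₁ : ℝ, 0 ≤ C ∧ 0 < ε₁ ∧ ∀ ε : ℝ, 0 < ε → ε ≤ ε₁ → ∀ v : L.dom, L.GenEig ε v e →
      ‖L.cur (wp (-ε) 1) (wp ε 1) (fun x => P (ε * x)) v‖ ≤ C * ε * ‖(v : L2Plane q)‖ := by
  obtain ⟨C, hC0, hC⟩ := L.exists_norm_cur_le hP
  obtain ⟨ε₁, h1, h2⟩ := L.exists_norm_comm_zero_le e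
  refine ⟨C * (2 * |e| + 2), min 1 ε₁, by positivity, lt_min one_pos h1, fun ε hε hε1 v hv => ?_⟩
  refine (hC ε hε (hε1.trans (min_le_left _ _)) v).trans ?_
  have h3 := h2 ε hε (hε1.trans (min_le_right _ _)) v hv
  calc C * ε * (‖L.comm 0 v‖ + ‖(v : L2Plane q)‖) ≤
        C * ε * ((2 * |e| + 1) * ‖(v : L2Plane q)‖ + ‖(v : L2Plane q)‖) := by gcongr
    _ = _ := by ring

theorem mulX_indicator_cur {c d ε : ℝ} {P : ℝ → ℝ} (h : IsSmoothSwitch c d P) (v : L.dom) :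
    mulX ((Icc c d).indicator fun _ => 1) (L.cur (wp (-ε) 1) (wp ε 1) P v) =
      L.cur (wp (-ε) 1) (wp ε 1) P v := by
  have hb : BddMeas ((Icc c d).indicator fun _ => (1 : ℂ)) :=
    ⟨measurable_const.indicator measurableSet_Icc, 1, fun x => by
      by_cases hx : x ∈ Icc c d <;> simp [hx]⟩
  rw [mulX_cur hb (contDiff_wp _ _).continuous (contDiff_wp _ _) h.isCut, cur_apply, cur_apply]
  congr 1
  refine Finset.sum_congr rfl fun n _ => ?_
  congr 2
  funext x
  by_cases hx : x ∈ Icc c d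
  · simp [hx]
  · rw [curCoeff_eq_zero (contDiff_wp _ _) h.isCut n fun h2 => hx (h.tsupport_subset h2), mul_zero,
      mul_zero]

end LocalOperator

theorem lintegral_wp_neg_one {ε : ℝ} (hε : 0 < ε) :
    ∫⁻ x, ‖wp ε (-1) x‖ₑ ^ 2 = ENNReal.ofReal (Real.pi / ε) := by
  have h1 : ∀ x, ‖wp ε (-1) x‖ₑ ^ 2 = ENNReal.ofReal ((1 + (ε * x) ^ 2)⁻¹) := fun x => by
    rw [← ofReal_norm, ← ENNReal.ofReal_pow (norm_nonneg _), norm_wp, norm_wp_one, zpow_neg_one,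
      inv_pow, Real.sq_sqrt (by positivity)]
  simp only [h1]
  rw [← ofReal_integral_eq_lintegral_ofReal (integrable_inv_one_add_sq.comp_mul_left' hε.ne')
    (Eventually.of_forall fun x => by positivity),
    Measure.integral_comp_mul_left (fun x => (1 + x ^ 2)⁻¹), integral_univ_inv_one_add_sq,
    abs_of_pos (inv_pos.2 hε), smul_eq_mul, inv_mul_eq_div]

/-- Functions with bounded slices have norm `O(ε^{-1/2})` after multiplication by
`(1 + iεx)^{-1}`. -/
theorem exists_mul_norm_sq_le {ψ : ℝ × ℝ → Fibre q} {w₁ : L2Plane q}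
    (hw₁ : ∀ᵐ z : ℝ × ℝ, w₁ z = wp 1 (-1) z.1 • ψ z) {X B : ℝ} (hB : 0 ≤ B)
    (hψ : ∀ᵐ x : ℝ, X ≤ |x| → ∫⁻ y, ‖ψ (x, y)‖ₑ ^ 2 ≤ ENNReal.ofReal B) :
    ∃ K : ℝ, ∀ ε : ℝ, 0 < ε → ε ≤ 1 → ∀ w : L2Plane q,
      (∀ᵐ z : ℝ × ℝ, w z = wp ε (-1) z.1 • ψ z) → ε * ‖w‖ ^ 2 ≤ K := by
  have hn : ∀ ε : ℝ, ∀ w : L2Plane q, (∀ᵐ z : ℝ × ℝ, w z = wp ε (-1) z.1 • ψ z) →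
      ‖w‖ₑ ^ 2 = ∫⁻ x, ‖wp ε (-1) x‖ₑ ^ 2 * ∫⁻ y, ‖ψ (x, y)‖ₑ ^ 2 := fun ε w hw => by
    have h2 : ∀ᵐ x : ℝ, ∀ᵐ y : ℝ, w (x, y) = wp ε (-1) x • ψ (x, y) :=
      Measure.ae_ae_of_ae_prod hw
    rw [L2Plane_enorm_sq, enorm_sq_eq_lintegral_slices (Lp.aestronglyMeasurable _)]
    refine lintegral_congr_ae (h2.mono fun x hx => ?_)
    simp only
    rw [← lintegral_const_mul' _ _ (by simp)]
    exact lintegral_congr_ae (hx.mono fun y hy => by simp only [hy, enorm_smul, mul_pow])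
  refine ⟨(1 + X ^ 2) * ‖w₁‖ ^ 2 + B * Real.pi, fun ε hε hε1 w hw => ?_⟩
  have key : ‖w‖ₑ ^ 2 ≤ ENNReal.ofReal (1 + X ^ 2) * ‖w₁‖ₑ ^ 2 +
      ENNReal.ofReal B * ENNReal.ofReal (Real.pi / ε) := by
    rw [hn ε w hw, hn 1 w₁ hw₁, ← lintegral_wp_neg_one hε, ← lintegral_const_mul' _ _ (by simp),
      ← lintegral_const_mul' _ _ (by simp), ← lintegral_add_right _
        (((contDiff_wp ε (-1)).continuous.measurable.enorm.pow_const 2).const_mul _)]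
    refine lintegral_mono_ae (hψ.mono fun x hx => ?_)
    by_cases hX : X ≤ |x|
    · refine le_add_left ?_
      rw [mul_comm]
      gcongr
      exact hx hX
    · refine le_add_right ?_
      rw [← mul_assoc]
      gcongr
      have h3 : ∀ a : ℝ, ‖wp a (-1) x‖ₑ ^ 2 = ENNReal.ofReal ((1 + (a * x) ^ 2)⁻¹) := fun a => by
        rw [← ofReal_norm, ← ENNReal.ofReal_pow (norm_nonneg _), norm_wp, norm_wp_one, zpow_neg_one,
          inv_pow, Real.sq_sqrt (by positivity)]
      rw [h3, h3, ← ENNReal.ofReal_mul (by positivity), one_mul]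
      refine ENNReal.ofReal_le_ofReal ?_
      have h4 : x ^ 2 ≤ X ^ 2 := by
        rw [← sq_abs x]; exact pow_le_pow_left₀ (abs_nonneg _) (not_le.1 hX).le 2
      calc (1 + (ε * x) ^ 2)⁻¹ ≤ 1 := inv_le_one_of_one_le₀ (by nlinarith [sq_nonneg (ε * x)])
        _ ≤ (1 + X ^ 2) * (1 + x ^ 2)⁻¹ := by
          rw [← div_eq_mul_inv, one_le_div (by positivity)]; linarith
  have h5 := ENNReal.toReal_mono (by finiteness) key
  rw [ENNReal.toReal_add (by finiteness) (by finiteness), ENNReal.toReal_mul, ENNReal.toReal_mul,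
    ENNReal.toReal_pow, ENNReal.toReal_pow, toReal_enorm, toReal_enorm,
    ENNReal.toReal_ofReal (by positivity), ENNReal.toReal_ofReal hB,
    ENNReal.toReal_ofReal (by positivity)] at h5
  have h6 := mul_le_mul_of_nonneg_left h5 hε.le
  have h7 : ε * (B * (Real.pi / ε)) = B * Real.pi := by field_simp
  have h8 : ε * ((1 + X ^ 2) * ‖w₁‖ ^ 2) ≤ (1 + X ^ 2) * ‖w₁‖ ^ 2 :=
    mul_le_of_le_one_left (by positivity) hε1
  linarith

/-- The norm of a remainder with small slices, over a region of length `O(ε^{-1})`. -/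
theorem mul_norm_sq_indicator_le {c d ε δ : ℝ} (hcd : c ≤ d) (hε : 0 < ε) (hδ : 0 ≤ δ)
    {r : ℝ × ℝ → Fibre q} {w : L2Plane q} (hw : ∀ᵐ z : ℝ × ℝ, w z = wp ε (-1) z.1 • r z)
    (hr : ∀ᵐ x : ℝ, ε * x ∈ Icc c d → ∫⁻ y, ‖r (x, y)‖ₑ ^ 2 ≤ ENNReal.ofReal δ) :
    ε * ‖mulX ((Icc (c / ε) (d / ε)).indicator fun _ => 1) w‖ ^ 2 ≤ δ * (d - c) := by
  have hb : BddMeas ((Icc (c / ε) (d / ε)).indicator fun _ => (1 : ℂ)) :=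
    ⟨measurable_const.indicator measurableSet_Icc, 1, fun x => by
      by_cases hx : x ∈ Icc (c / ε) (d / ε) <;> simp [hx]⟩
  have key : ‖mulX ((Icc (c / ε) (d / ε)).indicator fun _ => 1) w‖ₑ ^ 2 ≤
      ENNReal.ofReal δ * ENNReal.ofReal (d / ε - c / ε) := by
    rw [L2Plane_enorm_sq, enorm_sq_eq_lintegral_slices (Lp.aestronglyMeasurable _),
      ← Real.volume_Icc, ← lintegral_indicator_const measurableSet_Icc]
    have h1 : ∀ᵐ x : ℝ, ∀ᵐ y : ℝ, mulX ((Icc (c / ε) (d / ε)).indicator fun _ => 1) w (x, y) =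
        ((Icc (c / ε) (d / ε)).indicator (fun _ => (1 : ℂ)) x) • w (x, y) :=
      Measure.ae_ae_of_ae_prod (mulX_coe hb w)
    have h2 : ∀ᵐ x : ℝ, ∀ᵐ y : ℝ, w (x, y) = wp ε (-1) x • r (x, y) :=
      Measure.ae_ae_of_ae_prod hw
    refine lintegral_mono_ae ?_
    filter_upwards [h1, h2, hr] with x h1 h2 h3
    by_cases hx : x ∈ Icc (c / ε) (d / ε)
    · rw [indicator_of_mem hx]
      refine le_trans (lintegral_mono_ae ?_) (h3 ?_)
      · filter_upwards [h1, h2] with y h1 h2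
        rw [h1, h2, indicator_of_mem hx, one_smul, enorm_smul, mul_pow]
        refine mul_le_of_le_one_left zero_le (pow_le_one₀ zero_le ?_)
        rw [← ofReal_norm, ← ENNReal.ofReal_one]
        exact ENNReal.ofReal_le_ofReal (norm_wp_le_one ε (by norm_num) x)
      · rw [mem_Icc, div_le_iff₀ hε, le_div_iff₀ hε] at hx
        exact ⟨by linarith, by linarith⟩
    · rw [indicator_of_notMem hx, lintegral_congr_ae (g := fun _ => 0)]
      · simp
      · filter_upwards [h1] with y h1
        rw [h1, indicator_of_notMem hx, zero_smul]; simp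
  have h5 := ENNReal.toReal_mono (by finiteness) key
  rw [ENNReal.toReal_mul, ENNReal.toReal_pow, toReal_enorm, ENNReal.toReal_ofReal hδ,
    ENNReal.toReal_ofReal (by rw [← sub_div]; exact div_nonneg (by linarith) hε.le)] at h5
  have h6 := mul_le_mul_of_nonneg_left h5 hε.le
  have h7 : ε * (δ * (d / ε - c / ε)) = δ * (d - c) := by field_simp
  linarith

end Scaling

/-! ### Comparison of the perturbed and the unperturbed currents -/

section Comparison

variable {p q : ℕ}

/-- The scales `(N + 1)⁻¹`. -/
def scl (N : ℕ) : ℝ := ((N : ℝ) + 1)⁻¹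

theorem scl_pos (N : ℕ) : 0 < scl N := by unfold scl; positivity

theorem scl_le_one (N : ℕ) : scl N ≤ 1 := inv_le_one_of_one_le₀ (by linarith [N.cast_nonneg (α := ℝ)])

theorem scl_zero : scl 0 = 1 := by simp [scl]

theorem tendsto_scl : Tendsto scl atTop (𝓝 0) := by
  have h := tendsto_one_div_add_atTop_nhds_zero_nat (𝕜 := ℝ)
  simp only [one_div] at h
  exact h

namespace LocalOperator

variable {L : LocalOperator p q}

variable (L) in
/-- `w N = (1 + ix/(N+1))^{-1} ψ` for a generalized eigenfunction `ψ` with energy `e`. -/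
def IsWaveFamily (e : ℝ) (ψ : ℝ × ℝ → Fibre q) (w : ℕ → L.dom) : Prop :=
  ∀ N, (∀ᵐ z : ℝ × ℝ, (w N : L2Plane q) z = wp (scl N) (-1) z.1 • ψ z) ∧ L.GenEig (scl N) (w N) e

theorem GenEig.smul {ε e : ℝ} {w : L.dom} (h : L.GenEig ε w e) (c : ℂ) : L.GenEig ε (c • w) e := by
  rw [GenEig] at h ⊢
  rw [map_smul, map_smul, h, Submodule.coe_smul, map_smul, smul_sub, smul_comm c, smul_comm c]

theorem GenEig.sum {ι : Type*} {s : Finset ι} {ε e : ℝ} {w : ι → L.dom}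
    (h : ∀ i ∈ s, L.GenEig ε (w i) e) : L.GenEig ε (∑ i ∈ s, w i) e := by
  simp only [GenEig] at h ⊢
  rw [map_sum, map_sum, Submodule.coe_sum, map_sum, Finset.smul_sum, Finset.smul_sum,
    ← Finset.sum_sub_distrib]
  exact Finset.sum_congr rfl h

/-- The current form only depends on the functions `(1 + iεx) a` and `(1 + iεx) b`. -/
theorem form_congr {ε ε' : ℝ} {P : ℝ → ℝ} (hP : IsCut P) {a b a' b' : L.dom}
    {ψ₁ ψ₂ : ℝ × ℝ → Fibre q}
    (ha : ∀ᵐ z : ℝ × ℝ, (a : L2Plane q) z = wp ε (-1) z.1 • ψ₁ z)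
    (hb : ∀ᵐ z : ℝ × ℝ, (b : L2Plane q) z = wp ε (-1) z.1 • ψ₂ z)
    (ha' : ∀ᵐ z : ℝ × ℝ, (a' : L2Plane q) z = wp ε' (-1) z.1 • ψ₁ z)
    (hb' : ∀ᵐ z : ℝ × ℝ, (b' : L2Plane q) z = wp ε' (-1) z.1 • ψ₂ z) :
    L.form ε P a b = L.form ε' P a' b' := by
  obtain ⟨R, hR⟩ := HasCompactSupport.exists_abs_le hP.compact
  obtain ⟨χ, h1, h2, h3⟩ := exists_cutoff_nhds hR
  rw [form_eq hP h1 h2 h3, form_eq hP h1 h2 h3]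
  have key : ∀ {c c' : L.dom} {ψ : ℝ × ℝ → Fibre q},
      (∀ᵐ z : ℝ × ℝ, (c : L2Plane q) z = wp ε (-1) z.1 • ψ z) →
      (∀ᵐ z : ℝ × ℝ, (c' : L2Plane q) z = wp ε' (-1) z.1 • ψ z) →
      L.mulD (smoothBdd_cutoff_mul h1 h2 (contDiff_wp ε 1)) c =
        L.mulD (smoothBdd_cutoff_mul h1 h2 (contDiff_wp ε' 1)) c' := fun {c c' ψ} hc hc' => by
    refine Subtype.ext (Lp.ext ?_)
    rw [mulD_coe, mulD_coe]
    filter_upwards [hc, hc', mulX_coe (smoothBdd_cutoff_mul h1 h2 (contDiff_wp ε 1)).bddMeas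
      (c : L2Plane q), mulX_coe (smoothBdd_cutoff_mul h1 h2 (contDiff_wp ε' 1)).bddMeas
      (c' : L2Plane q)] with z h4 h5 h6 h7
    rw [h6, h7, h4, h5, smul_smul, smul_smul, mul_assoc, mul_assoc, wp_mul, wp_mul,
      add_neg_cancel, wp_zero, wp_zero]
  rw [key ha ha', key hb hb']

/-- At equal energies, the current form does not depend on the switch function. -/
theorem form_switch {ε e c d c' d' : ℝ} {P P' : ℝ → ℝ} (hP : IsSmoothSwitch c d P)
    (hP' : IsSmoothSwitch c' d' P') {a b : L.dom} (ha : L.GenEig ε a e) (hb : L.GenEig ε b e) :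
    L.form ε P a b = L.form ε P' a b := by
  rw [← sub_eq_zero, ← form_sub hP.isCut hP'.isCut,
    form_genEig ha hb (hP.1.sub hP'.1) (hP.hasCompactSupport_sub hP')]
  simp

theorem form_sum_smul {ι κ : Type*} (s : Finset ι) (t : Finset κ) {ε : ℝ} {P : ℝ → ℝ}
    (x : ι → ℂ) (y : κ → ℂ) (a : ι → L.dom) (b : κ → L.dom) :
    L.form ε P (∑ i ∈ s, x i • a i) (∑ j ∈ t, y j • b j) =
      ∑ i ∈ s, ∑ j ∈ t, starRingEnd ℂ (x i) * y j * L.form ε P (a i) (b j) := by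
  simp only [form, map_sum, map_smul, Submodule.coe_sum, Submodule.coe_smul, sum_inner, inner_sum,
    inner_smul_left, inner_smul_right]
  rw [Finset.sum_comm]
  simp only [Finset.mul_sum]
  refine Finset.sum_congr rfl fun i _ => Finset.sum_congr rfl fun j _ => by ring

variable {L' : LocalOperator p q} (T : L.dom →ₗ[ℂ] L'.dom) (hT : ∀ v, (T v : L2Plane q) = v)
  (hcomm : ∀ n v, L.comm (n + 1) v = L'.comm (n + 1) (T v))

include hcomm in
theorem cur_map {ε : ℝ} {P : ℝ → ℝ} (v : L.dom) :
    L.cur (wp (-ε) 1) (wp ε 1) P v = L'.cur (wp (-ε) 1) (wp ε 1) P (T v) := by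
  rw [LocalOperator.cur_apply, LocalOperator.cur_apply]
  congr 1
  refine Finset.sum_congr rfl fun n _ => ?_
  rcases n with _ | n
  · simp only [curCoeff_zero, mul_zero, mulX_zero]
  · rw [hcomm]

include hT hcomm in
theorem form_sub_form {ε : ℝ} {c d : ℝ} {P : ℝ → ℝ} (h : IsSmoothSwitch c d P)
    (w₁ w₂ : L.dom) (u₁ u₂ : L'.dom) :
    ‖L.form ε P w₁ w₂ - L'.form ε P u₁ u₂‖ ≤
      ‖mulX ((Icc c d).indicator fun _ => 1) ((T w₁ - u₁ : L'.dom) : L2Plane q)‖ *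
        ‖L.cur (wp (-ε) 1) (wp ε 1) P w₂‖ +
      ‖L'.cur (wp (-ε) 1) (wp ε 1) P u₁‖ *
        ‖mulX ((Icc c d).indicator fun _ => 1) ((T w₂ - u₂ : L'.dom) : L2Plane q)‖ := by
  have hb : BddMeas ((Icc c d).indicator fun _ => (1 : ℂ)) :=
    ⟨measurable_const.indicator measurableSet_Icc, 1, fun x => by
      by_cases hx : x ∈ Icc c d <;> simp [hx]⟩
  have hbc : (fun x => starRingEnd ℂ ((Icc c d).indicator (fun _ => (1 : ℂ)) x)) =
      (Icc c d).indicator fun _ => (1 : ℂ) := by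
    funext x; by_cases hx : x ∈ Icc c d <;> simp [hx]
  have e1 : L.form ε P w₁ w₂ - L'.form ε P u₁ u₂ =
      ⟪((T w₁ - u₁ : L'.dom) : L2Plane q),
        L.cur (wp (-ε) 1) (wp ε 1) P w₂⟫_ℂ +
      ⟪(u₁ : L2Plane q), L'.cur (wp (-ε) 1) (wp ε 1) P (T w₂ - u₂)⟫_ℂ := by
    rw [LocalOperator.form, LocalOperator.form, map_sub, inner_sub_right, Submodule.coe_sub,
      inner_sub_left, hT, cur_map T hcomm]
    ring
  have e2 : ⟪(u₁ : L2Plane q), L'.cur (wp (-ε) 1) (wp ε 1) P (T w₂ - u₂)⟫_ℂ =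
      ⟪L'.cur (wp (-ε) 1) (wp ε 1) P u₁, ((T w₂ - u₂ : L'.dom) : L2Plane q)⟫_ℂ := by
    rw [← conj_wp_fun]
    exact LocalOperator.inner_cur_symm (contDiff_wp ε 1) h.isCut u₁ (T w₂ - u₂)
  rw [e1, e2]
  refine (norm_add_le _ _).trans (add_le_add ?_ ?_)
  · conv_lhs => rw [← LocalOperator.mulX_indicator_cur _ h]
    rw [inner_mulX_right hb, hbc]
    exact norm_inner_le_norm (𝕜 := ℂ) _ _
  · conv_lhs => rw [← LocalOperator.mulX_indicator_cur _ h]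
    rw [inner_mulX_left hb, hbc]
    exact norm_inner_le_norm (𝕜 := ℂ) _ _

theorem tendsto_mul_of_sq {ε f g : ℕ → ℝ} (hε : ∀ N, 0 < ε N) (hf : ∀ N, 0 ≤ f N)
    (hg : ∀ N, 0 ≤ g N) {K : ℝ} (hgK : ∀ N, ε N * g N ^ 2 ≤ K)
    (hf0 : Tendsto (fun N => ε N * f N ^ 2) atTop (𝓝 0)) :
    Tendsto (fun N => f N * (ε N * g N)) atTop (𝓝 0) := by
  have h1 : Tendsto (fun N => Real.sqrt (ε N * f N ^ 2 * K)) atTop (𝓝 0) := by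
    have := (hf0.mul_const K).sqrt
    simpa using this
  refine squeeze_zero (fun N => mul_nonneg (hf N) (mul_nonneg (hε N).le (hg N))) (fun N => ?_) h1
  refine Real.le_sqrt_of_sq_le ?_
  have h2 := mul_le_mul_of_nonneg_left (hgK N) (mul_nonneg (hε N).le (sq_nonneg (f N)))
  calc (f N * (ε N * g N)) ^ 2 = ε N * f N ^ 2 * (ε N * g N ^ 2) := by ring
    _ ≤ _ := h2

include hT hcomm in
/-- The current of the perturbed waves is the current of their asymptotics. -/
theorem tendsto_form_sub_form {e c d : ℝ} (hcd : c ≤ d) {P : ℝ → ℝ} (h : IsSmoothSwitch c d P)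
    {ψ₁ ψ₂ χ₁ χ₂ : ℝ × ℝ → Fibre q} {w₁ w₂ : ℕ → L.dom} {u₁ u₂ : ℕ → L'.dom}
    (hw₁ : L.IsWaveFamily e ψ₁ w₁)
    (hw₂ : L.IsWaveFamily e ψ₂ w₂)
    (hu₁ : L'.IsWaveFamily e χ₁ u₁) (hu₂ : L'.IsWaveFamily e χ₂ u₂)
    {X B : ℝ} (hB : 0 ≤ B)
    (hψ₂ : ∀ᵐ x : ℝ, X ≤ |x| → ∫⁻ y, ‖ψ₂ (x, y)‖ₑ ^ 2 ≤ ENNReal.ofReal B)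
    (hχ₁ : ∀ᵐ x : ℝ, X ≤ |x| → ∫⁻ y, ‖χ₁ (x, y)‖ₑ ^ 2 ≤ ENNReal.ofReal B)
    (hr₁ : ∀ δ > 0, ∀ᶠ N in atTop, ∀ᵐ x : ℝ, scl N * x ∈ Icc c d →
      ∫⁻ y, ‖ψ₁ (x, y) - χ₁ (x, y)‖ₑ ^ 2 ≤ ENNReal.ofReal δ)
    (hr₂ : ∀ δ > 0, ∀ᶠ N in atTop, ∀ᵐ x : ℝ, scl N * x ∈ Icc c d →
      ∫⁻ y, ‖ψ₂ (x, y) - χ₂ (x, y)‖ₑ ^ 2 ≤ ENNReal.ofReal δ) :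
    Tendsto (fun N => L.form (scl N) (fun x => P (scl N * x)) (w₁ N) (w₂ N) -
      L'.form (scl N) (fun x => P (scl N * x)) (u₁ N) (u₂ N)) atTop (𝓝 0) := by
  have hdiff : ∀ {ψ χ : ℝ × ℝ → Fibre q} {w : ℕ → L.dom} {u : ℕ → L'.dom},
      L.IsWaveFamily e ψ w → L'.IsWaveFamily e χ u →
      (∀ δ > 0, ∀ᶠ N in atTop, ∀ᵐ x : ℝ, scl N * x ∈ Icc c d →
        ∫⁻ y, ‖ψ (x, y) - χ (x, y)‖ₑ ^ 2 ≤ ENNReal.ofReal δ) →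
      Tendsto (fun N => scl N * ‖mulX ((Icc (c / scl N) (d / scl N)).indicator fun _ => 1)
        ((T (w N) - u N : L'.dom) : L2Plane q)‖ ^ 2) atTop (𝓝 0) := by
    intro ψ χ w u hw hu hr
    refine tendsto_order.2 ⟨fun a ha => Eventually.of_forall fun N =>
      ha.trans_le (mul_nonneg (scl_pos N).le (sq_nonneg _)), fun a ha => ?_⟩
    have hδ : 0 < a / (2 * (d - c + 1)) := div_pos ha (by linarith)
    filter_upwards [hr _ hδ] with N hN
    refine (mul_norm_sq_indicator_le hcd (scl_pos N) hδ.le (r := fun z => ψ z - χ z) ?_ hN).trans_lt ?_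
    · filter_upwards [(hw N).1, (hu N).1,
        Lp.coeFn_sub (w N : L2Plane q) (u N : L2Plane q)] with z h2 h3 h4
      rw [Submodule.coe_sub, hT, h4, Pi.sub_apply, smul_sub]
      exact congrArg₂ (· - ·) h2 h3
    · rw [div_mul_eq_mul_div, div_lt_iff₀ (by linarith)]
      nlinarith
  obtain ⟨C₁, ε₁, hC₁, hε₁, hb₁⟩ := L.exists_norm_cur_genEig_le h.isCut e
  obtain ⟨C₂, ε₂, hC₂, hε₂, hb₂⟩ := L'.exists_norm_cur_genEig_le h.isCut e
  obtain ⟨K₁, hK₁⟩ := exists_mul_norm_sq_le (by simpa [scl_zero] using (hw₂ 0).1) hB hψ₂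
  obtain ⟨K₂, hK₂⟩ := exists_mul_norm_sq_le (by simpa [scl_zero] using (hu₁ 0).1) hB hχ₁
  have t1 := (tendsto_mul_of_sq scl_pos (fun _ => norm_nonneg _)
    (fun N => norm_nonneg (w₂ N : L2Plane q))
    (fun N => hK₁ _ (scl_pos N) (scl_le_one N) _ (hw₂ N).1) (hdiff hw₁ hu₁ hr₁)).const_mul C₁
  have t2 := (tendsto_mul_of_sq scl_pos (fun _ => norm_nonneg _)
    (fun N => norm_nonneg (u₁ N : L2Plane q))
    (fun N => hK₂ _ (scl_pos N) (scl_le_one N) _ (hu₁ N).1) (hdiff hw₂ hu₂ hr₂)).const_mul C₂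
  have t3 := t1.add t2
  rw [mul_zero, mul_zero, add_zero] at t3
  refine squeeze_zero_norm' ?_ t3
  filter_upwards [tendsto_scl.eventually_lt_const hε₁, tendsto_scl.eventually_lt_const hε₂]
    with N h3 h4
  refine (form_sub_form T hT hcomm (h.scale (scl_pos N)) _ _ _ _).trans ?_
  have h5 := mul_le_mul_of_nonneg_left (hb₁ _ (scl_pos N) h3.le _ (hw₂ N).2)
    (norm_nonneg (mulX ((Icc (c / scl N) (d / scl N)).indicator fun _ => 1)
        ((T (w₁ N) - u₁ N : L'.dom) : L2Plane q)))
  have h6 := mul_le_mul_of_nonneg_right (hb₂ _ (scl_pos N) h4.le _ (hu₁ N).2)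
    (norm_nonneg (mulX ((Icc (c / scl N) (d / scl N)).indicator fun _ => 1)
        ((T (w₂ N) - u₂ N : L'.dom) : L2Plane q)))
  refine (add_le_add h5 h6).trans (le_of_eq ?_)
  ring

include hT hcomm in
/-- The perturbed current form in terms of the unperturbed current form of the asymptotics. -/
theorem form_eq_form_asymptotic {e c d : ℝ} (hcd : c ≤ d) {P : ℝ → ℝ} (h : IsSmoothSwitch c d P)
    {ψ₁ ψ₂ χ₁ χ₂ : ℝ × ℝ → Fibre q} {w₁ w₂ : ℕ → L.dom} {u₁ u₂ : ℕ → L'.dom}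
    (hw₁ : L.IsWaveFamily e ψ₁ w₁)
    (hw₂ : L.IsWaveFamily e ψ₂ w₂)
    (hu₁ : L'.IsWaveFamily e χ₁ u₁) (hu₂ : L'.IsWaveFamily e χ₂ u₂)
    {X B : ℝ} (hB : 0 ≤ B)
    (hψ₂ : ∀ᵐ x : ℝ, X ≤ |x| → ∫⁻ y, ‖ψ₂ (x, y)‖ₑ ^ 2 ≤ ENNReal.ofReal B)
    (hχ₁ : ∀ᵐ x : ℝ, X ≤ |x| → ∫⁻ y, ‖χ₁ (x, y)‖ₑ ^ 2 ≤ ENNReal.ofReal B)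
    (hr₁ : ∀ δ > 0, ∀ᶠ N in atTop, ∀ᵐ x : ℝ, scl N * x ∈ Icc c d →
      ∫⁻ y, ‖ψ₁ (x, y) - χ₁ (x, y)‖ₑ ^ 2 ≤ ENNReal.ofReal δ)
    (hr₂ : ∀ δ > 0, ∀ᶠ N in atTop, ∀ᵐ x : ℝ, scl N * x ∈ Icc c d →
      ∫⁻ y, ‖ψ₂ (x, y) - χ₂ (x, y)‖ₑ ^ 2 ≤ ENNReal.ofReal δ) :
    L.form (scl 0) P (w₁ 0) (w₂ 0) = L'.form (scl 0) P (u₁ 0) (u₂ 0) := by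
  have hcst : ∀ (L : LocalOperator p q) {ψ₁ ψ₂ : ℝ × ℝ → Fibre q} {w₁ w₂ : ℕ → L.dom},
      L.IsWaveFamily e ψ₁ w₁ → L.IsWaveFamily e ψ₂ w₂ → ∀ N,
      L.form (scl N) (fun x => P (scl N * x)) (w₁ N) (w₂ N) = L.form (scl 0) P (w₁ 0) (w₂ 0) :=
    fun L ψ₁ ψ₂ w₁ w₂ h₁ h₂ N =>
      (LocalOperator.form_switch (h.scale (scl_pos N)) h (h₁ N).2 (h₂ N).2).trans
        (LocalOperator.form_congr h.isCut (h₁ N).1 (h₂ N).1 (h₁ 0).1 (h₂ 0).1)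
  have h2 := tendsto_form_sub_form T hT hcomm hcd h hw₁ hw₂ hu₁ hu₂ hB hψ₂ hχ₁ hr₁ hr₂
  rw [← sub_eq_zero]
  refine tendsto_nhds_unique (tendsto_const_nhds.congr fun N => ?_) h2
  exact congrArg₂ (· - ·) (hcst L hw₁ hw₂ N).symm (hcst L' hu₁ hu₂ N).symm

end LocalOperator

end Comparison

/-! ### The current form of the perturbed waves -/

section PerturbedCurrent

variable {p q : ℕ} {S : ScatteringSystem p q}

theorem ScatteringSystem.HypH1.finite_level (h1 : S.HypH1) {e : ℝ} (he : e ∉ S.criticalValues)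
    (j : ℕ) : {ξ | S.energy j ξ = e}.Finite := by
  by_contra hinf
  have hcpt : ∃ K : Set ℝ, IsCompact K ∧ {ξ | S.energy j ξ = e} ⊆ K := by
    have h2 := (h1.energy_tendsto j).eventually (eventually_gt_atTop |e|)
    obtain ⟨K, hK, hKs⟩ := mem_cocompact.1 h2
    refine ⟨K, hK, fun ξ hξ => ?_⟩
    by_contra hcon
    have h3 : |e| < |S.energy j ξ| := hKs hcon
    rw [show S.energy j ξ = e from hξ] at h3
    exact lt_irrefl _ h3
  obtain ⟨K, hK, hKs⟩ := hcpt
  obtain ⟨ξ, -, hξ⟩ := Set.Infinite.exists_accPt_of_subset_isCompact hinf hK hKs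
  have hcl : IsClosed {ξ | S.energy j ξ = e} :=
    isClosed_singleton.preimage (h1.energy_smooth j).continuous
  have hmem : S.energy j ξ = e := hcl.closure_subset (mem_closure_iff_clusterPt.2 hξ.clusterPt)
  have hd : HasDerivAt (S.energy j) (deriv (S.energy j) ξ) ξ :=
    ((h1.energy_smooth j).differentiable (by simp) ξ).hasDerivAt
  have hne : deriv (S.energy j) ξ ≠ 0 := fun h0 => he ⟨j, ξ, hmem, h0⟩
  exact (accPt_iff_frequently_nhdsNE.1 hξ) ((hd.eventually_ne hne (c := e)).mono fun x hx h => hx h)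

theorem ScatteringSystem.HypH1.finite_modes (h1 : S.HypH1) {e : ℝ} (he : e ∉ S.criticalValues) :
    (S.modes e).Finite := by
  have h2 := h1.finite_branches e e
  refine (h2.biUnion (t := fun j => Prod.mk j '' {ξ | S.energy j ξ = e})
    fun j _ => (h1.finite_level he j).image _).subset fun m hm => ?_
  refine mem_biUnion (x := m.1) ⟨m.2, ?_⟩ ⟨m.2, hm, rfl⟩
  rw [show S.energy m.1 m.2 = e from hm]
  exact ⟨le_rfl, le_rfl⟩

/-- A superposition of the plane waves at energy `e`. -/
def ScatteringSystem.comb (S : ScatteringSystem p q) (e : ℝ) (α : ℕ × ℝ → ℂ) (z : ℝ × ℝ) : Fibre q :=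
  ∑ᶠ n ∈ S.modes e, α n • S.psi n z

theorem lintegral_enorm_sq (f : ℝ → Fibre q) :
    ∫⁻ y, ‖f y‖ₑ ^ 2 = eLpNorm f 2 volume ^ 2 := by
  rw [eLpNorm_eq_lintegral_rpow_enorm_toReal (by norm_num) (by norm_num),
    ← ENNReal.rpow_natCast, ← ENNReal.rpow_mul]
  simp

theorem memLp_psi_slice (n : ℕ × ℝ) (x : ℝ) : MemLp (fun y => S.psi n (x, y)) 2 volume :=
  (Lp.memLp (S.mode n.2 n.1)).const_smul
    (((Real.sqrt (2 * Real.pi))⁻¹ : ℂ) * Complex.exp (Complex.I * n.2 * x))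

theorem eLpNorm_psi_slice_le (n : ℕ × ℝ) (x : ℝ) :
    eLpNorm (fun y => S.psi n (x, y)) 2 volume ≤ ENNReal.ofReal (Real.sqrt (2 * Real.pi))⁻¹ := by
  have h : (fun y => S.psi n (x, y)) = (((Real.sqrt (2 * Real.pi))⁻¹ : ℂ) *
      Complex.exp (Complex.I * n.2 * x)) • (S.mode n.2 n.1 : ℝ → Fibre q) := rfl
  rw [h, eLpNorm_const_smul, ← Lp.enorm_def, ← ofReal_norm, ← ofReal_norm,
    (S.mode n.2).orthonormal.1, ENNReal.ofReal_one, mul_one, norm_mul, norm_exp_I_mul_mul, mul_one,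
    norm_inv, Complex.norm_real, Real.norm_of_nonneg (Real.sqrt_nonneg _)]

theorem ScatteringSystem.comb_eq_sum {e : ℝ} (hfin : (S.modes e).Finite) (α : ℕ × ℝ → ℂ) (z : ℝ × ℝ) :
    S.comb e α z = ∑ n ∈ hfin.toFinset, α n • S.psi n z :=
  finsum_mem_eq_finite_toFinset_sum _ hfin

theorem memLp_comb_slice {e : ℝ} (hfin : (S.modes e).Finite) (α : ℕ × ℝ → ℂ) (x : ℝ) :
    MemLp (fun y => S.comb e α (x, y)) 2 volume := by
  simp only [ScatteringSystem.comb_eq_sum hfin]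
  exact memLp_finsetSum _ fun n _ => (memLp_psi_slice n x).const_smul (α n)

theorem exists_eLpNorm_comb_le {e : ℝ} (hfin : (S.modes e).Finite) (α : ℕ × ℝ → ℂ) :
    ∃ B : ℝ, 0 ≤ B ∧ ∀ x, eLpNorm (fun y => S.comb e α (x, y)) 2 volume ≤ ENNReal.ofReal B := by
  refine ⟨∑ n ∈ hfin.toFinset, ‖α n‖ * (Real.sqrt (2 * Real.pi))⁻¹,
    Finset.sum_nonneg fun n _ => by positivity, fun x => ?_⟩
  have h : (fun y => S.comb e α (x, y)) =
      ∑ n ∈ hfin.toFinset, fun y => α n • S.psi n (x, y) := by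
    funext y
    rw [ScatteringSystem.comb_eq_sum hfin, Finset.sum_apply]
  rw [h, ENNReal.ofReal_sum_of_nonneg fun n _ => by positivity]
  refine (eLpNorm_sum_le (fun n _ => ((memLp_psi_slice n x).const_smul (α n)).1)
    (by norm_num)).trans (Finset.sum_le_sum fun n _ => ?_)
  rw [eLpNorm_const_smul, ENNReal.ofReal_mul (norm_nonneg _), ofReal_norm]
  exact mul_le_mul_right (eLpNorm_psi_slice_le n x) _

namespace ScatteringSystem.HypH1

variable (h1 : S.HypH1)

theorem isWaveFamily_comb {e : ℝ} (hfin : (S.modes e).Finite) (α : ℕ × ℝ → ℂ) :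
    h1.free.IsWaveFamily e (S.comb e α) fun N =>
      ∑ n ∈ hfin.toFinset, α n • h1.waveD (scl_pos N).ne' n := by
  refine fun N => ⟨?_, LocalOperator.GenEig.sum fun n hn => ?_⟩
  · have h2 : ∀ᵐ z : ℝ × ℝ, ∀ n ∈ hfin.toFinset, (α n • wave S (scl_pos N).ne' n : L2Plane q) z =
        α n • wp (scl N) (-1) z.1 • S.psi n z := by
      refine (Finset.eventually_all _).2 fun n _ => ?_
      filter_upwards [Lp.coeFn_smul (α n) (wave S (scl_pos N).ne' n), wave_coe S (scl_pos N).ne' n]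
        with z h3 h4
      rw [h3, Pi.smul_apply, h4]
    filter_upwards [h2, Lp.coeFn_finsetSum hfin.toFinset fun n => α n • wave S (scl_pos N).ne' n]
      with z h3 h4
    rw [Submodule.coe_sum, ScatteringSystem.comb_eq_sum hfin, Finset.smul_sum]
    simp only [Submodule.coe_smul, waveD_coe]
    rw [h4, Finset.sum_apply]
    exact Finset.sum_congr rfl fun n hn => (h3 n hn).trans (smul_comm _ _ _)
  · have h2 := (h1.genEig_waveD (scl_pos N).ne' n).smul (α n)
    have h3 : S.energy n.1 n.2 = e := hfin.mem_toFinset.1 hn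
    rwa [h3] at h2

theorem form_comb {ε : ℝ} (hε : ε ≠ 0) {e : ℝ} (hfin : (S.modes e).Finite) {c d : ℝ} {P : ℝ → ℝ}
    (h : IsSmoothSwitch c d P) (α β : ℕ × ℝ → ℂ) :
    h1.free.form ε P (∑ n ∈ hfin.toFinset, α n • h1.waveD hε n)
      (∑ n ∈ hfin.toFinset, β n • h1.waveD hε n) =
      ∑ n ∈ hfin.toFinset, starRingEnd ℂ (α n) * β n * ((S.current n : ℂ) / (2 * Real.pi)) := by
  rw [LocalOperator.form_sum_smul]
  refine Finset.sum_congr rfl fun m hm => ?_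
  rw [Finset.sum_eq_single_of_mem m hm]
  · rw [h1.form_wave hε h rfl, if_pos rfl]
  · intro n hn hne
    rw [h1.form_wave hε h, if_neg hne.symm, mul_zero]
    exact (hfin.mem_toFinset.1 hm : S.energy m.1 m.2 = e).trans
      (hfin.mem_toFinset.1 hn : S.energy n.1 n.2 = e).symm

variable (hQ : BddHermitian S.Q) (h2 : S.HypH2)

include h1 hQ h2 in
theorem aestronglyMeasurable_psiQ (m : ℕ × ℝ) : AEStronglyMeasurable (S.psiQ m) volume := by
  have h3 : (fun z : ℝ × ℝ => wp 1 1 z.1 • (h1.waveQ hQ h2 one_ne_zero m).1 z) =ᵐ[volume]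
      S.psiQ m := by
    filter_upwards [h1.waveQ_coe hQ h2 one_ne_zero m] with z hz
    rw [hz, smul_smul, wp_mul, add_neg_cancel, wp_zero, one_smul]
  refine AEStronglyMeasurable.congr ?_ h3
  exact ((contDiff_wp 1 1).continuous.comp continuous_fst).aestronglyMeasurable.smul
    (Lp.aestronglyMeasurable _)

theorem isWaveFamily_psiQ {e : ℝ} {m : ℕ × ℝ} (hm : m ∈ S.modes e) :
    (h1.localOperator hQ).IsWaveFamily e (S.psiQ m) fun N => h1.waveQ hQ h2 (scl_pos N).ne' m := by
  refine fun N => ⟨h1.waveQ_coe hQ h2 _ m, ?_⟩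
  have h3 := h1.genEig_waveQ hQ h2 (scl_pos N).ne' m
  rwa [show S.energy m.1 m.2 = e from hm] at h3

include h1 hQ h2 in
/-- The slices of the perturbed waves are bounded at large distances. -/
theorem exists_bound_psiQ_slice (h3 : S.HypH3) {e : ℝ} (he : e ∉ S.criticalValues) {m : ℕ × ℝ}
    (hm : m ∈ S.modes e) : ∃ X B : ℝ, 0 ≤ B ∧ ∀ᵐ x : ℝ, X ≤ |x| →
      ∫⁻ y, ‖S.psiQ m (x, y)‖ₑ ^ 2 ≤ ENNReal.ofReal B := by
  have hfin := h1.finite_modes he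
  have hside : ∀ {l : Filter ℝ} {α : ℕ × ℝ → ℂ}, Tendsto (fun x => eLpNorm (fun y : ℝ =>
      S.psiQ m (x, y) - S.comb e α (x, y)) 2 volume) (l ⊓ ae volume) (𝓝 0) →
      ∃ B : ℝ, 0 ≤ B ∧ ∃ s ∈ l, ∀ᵐ x : ℝ, x ∈ s →
        ∫⁻ y, ‖S.psiQ m (x, y)‖ₑ ^ 2 ≤ ENNReal.ofReal B := by
    intro l α hl
    obtain ⟨B, hB, hBx⟩ := exists_eLpNorm_comb_le hfin α
    have h4 := hl.eventually (gt_mem_nhds one_pos)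
    obtain ⟨s, hs, t, ht, hst⟩ := mem_inf_iff.1 h4
    refine ⟨(1 + B) ^ 2, by positivity, s, hs, ?_⟩
    filter_upwards [ht, (h1.aestronglyMeasurable_psiQ hQ h2 m).prodMk_left] with x hx hmx hxs
    have h5 : eLpNorm (fun y : ℝ => S.psiQ m (x, y) - S.comb e α (x, y)) 2 volume < 1 := by
      have : x ∈ s ∩ t := ⟨hxs, hx⟩
      rw [← hst] at this
      exact this
    have h6 : eLpNorm (fun y : ℝ => S.psiQ m (x, y)) 2 volume ≤ ENNReal.ofReal (1 + B) := by
      have h7 := eLpNorm_add_le (p := 2) (μ := volume)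
        (hmx.sub (memLp_comb_slice hfin α x).1) (memLp_comb_slice hfin α x).1 (by norm_num)
      have h8 : ((fun y : ℝ => S.psiQ m (x, y)) - fun y => S.comb e α (x, y)) +
          (fun y => S.comb e α (x, y)) = fun y : ℝ => S.psiQ m (x, y) := sub_add_cancel _ _
      have h9 : (fun y : ℝ => S.psiQ m (x, y) - S.comb e α (x, y)) +
          (fun y => S.comb e α (x, y)) = fun y : ℝ => S.psiQ m (x, y) := h8
      rw [ENNReal.ofReal_add zero_le_one hB, ENNReal.ofReal_one]
      refine le_trans (le_of_eq ?_) (h7.trans (add_le_add h5.le (hBx x)))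
      exact congrArg (fun f => eLpNorm f 2 volume) h8.symm
    rw [lintegral_enorm_sq, ENNReal.ofReal_pow (by positivity)]
    exact pow_le_pow_left₀ zero_le h6 2
  obtain ⟨B₁, hB₁, s, hs, h4⟩ := hside (h3.plus e he m hm)
  obtain ⟨B₂, hB₂, t, ht, h5⟩ := hside (h3.minus e he m hm)
  obtain ⟨a, ha⟩ := mem_atTop_sets.1 hs
  obtain ⟨b, hb⟩ := mem_atBot_sets.1 ht
  refine ⟨max |a| |b|, max B₁ B₂, le_max_of_le_left hB₁, ?_⟩
  filter_upwards [h4, h5] with x h4 h5 hx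
  rcases le_total 0 x with h0 | h0
  · rw [abs_of_nonneg h0] at hx
    exact (h4 (ha x ((le_abs_self a).trans ((le_max_left _ _).trans hx)))).trans
      (ENNReal.ofReal_le_ofReal (le_max_left _ _))
  · rw [abs_of_nonpos h0] at hx
    exact (h5 (hb x (by linarith [neg_abs_le b, le_max_right |a| |b|]))).trans
      (ENNReal.ofReal_le_ofReal (le_max_right _ _))

theorem form_waveQ_of_tendsto (h3 : S.HypH3) {e : ℝ} (he : e ∉ S.criticalValues)
    {l : Filter ℝ} {α : ℕ × ℝ → ℕ × ℝ → ℂ}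
    (hα : ∀ m ∈ S.modes e, Tendsto (fun x => eLpNorm (fun y : ℝ =>
      S.psiQ m (x, y) - S.comb e (α m) (x, y)) 2 volume) (l ⊓ ae volume) (𝓝 0))
    {c d : ℝ} (hcd : c ≤ d) {P₀ : ℝ → ℝ} (hP₀ : IsSmoothSwitch c d P₀)
    (hl : ∀ s ∈ l, ∀ᶠ N in atTop, ∀ x, scl N * x ∈ Icc c d → x ∈ s)
    {ε : ℝ} (hε : ε ≠ 0) {c' d' : ℝ} {P : ℝ → ℝ} (hP : IsSmoothSwitch c' d' P) {m n : ℕ × ℝ}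
    (hm : m ∈ S.modes e) (hn : n ∈ S.modes e) :
    (h1.localOperator hQ).form ε P (h1.waveQ hQ h2 hε m) (h1.waveQ hQ h2 hε n) =
      ∑ k ∈ (h1.finite_modes he).toFinset,
        starRingEnd ℂ (α m k) * α n k * ((S.current k : ℂ) / (2 * Real.pi)) := by
  have hfin := h1.finite_modes he
  have hr : ∀ m ∈ S.modes e, ∀ δ > 0, ∀ᶠ N in atTop, ∀ᵐ x : ℝ, scl N * x ∈ Icc c d →
      ∫⁻ y, ‖S.psiQ m (x, y) - S.comb e (α m) (x, y)‖ₑ ^ 2 ≤ ENNReal.ofReal δ := by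
    intro m hm δ hδ
    have h4 := (hα m hm).eventually (gt_mem_nhds (ENNReal.ofReal_pos.2 (Real.sqrt_pos.2 hδ)))
    obtain ⟨s, hs, t, ht, hst⟩ := mem_inf_iff.1 h4
    filter_upwards [hl s hs] with N hN
    filter_upwards [ht] with x hx hxN
    have h5 : x ∈ s ∩ t := ⟨hN x hxN, hx⟩
    rw [← hst] at h5
    rw [lintegral_enorm_sq]
    refine (pow_le_pow_left₀ zero_le (le_of_lt h5) 2).trans ?_
    rw [← ENNReal.ofReal_pow (Real.sqrt_nonneg _), Real.sq_sqrt hδ.le]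
  obtain ⟨X, B₁, hB₁, hX⟩ := h1.exists_bound_psiQ_slice hQ h2 h3 he hn
  obtain ⟨B₂, hB₂, hB₂x⟩ := exists_eLpNorm_comb_le hfin (α m)
  have hm' := h1.isWaveFamily_psiQ hQ h2 hm
  have hn' := h1.isWaveFamily_psiQ hQ h2 hn
  have key := LocalOperator.form_eq_form_asymptotic (L := h1.localOperator hQ) (L' := h1.free)
    LinearMap.id (fun _ => rfl) (fun _ _ => rfl) hcd hP₀ hm' hn'
    (h1.isWaveFamily_comb hfin (α m)) (h1.isWaveFamily_comb hfin (α n)) (X := X)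
    (B := max B₁ (B₂ ^ 2)) (le_max_of_le_left hB₁)
    (hX.mono fun x hx h => (hx h).trans (ENNReal.ofReal_le_ofReal (le_max_left _ _)))
    (Eventually.of_forall fun x _ => by
      rw [lintegral_enorm_sq]
      refine (pow_le_pow_left₀ zero_le (hB₂x x) 2).trans ?_
      rw [← ENNReal.ofReal_pow hB₂]
      exact ENNReal.ofReal_le_ofReal (le_max_right _ _)) (hr m hm) (hr n hn)
  rw [h1.form_comb (scl_pos 0).ne' hfin hP₀] at key
  rw [← key]
  have h4 := h1.genEig_waveQ hQ h2 hε m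
  have h5 := h1.genEig_waveQ hQ h2 hε n
  rw [show S.energy m.1 m.2 = e from hm] at h4
  rw [show S.energy n.1 n.2 = e from hn] at h5
  exact (LocalOperator.form_switch hP hP₀ h4 h5).trans (LocalOperator.form_congr hP₀.isCut
    (h1.waveQ_coe hQ h2 hε m) (h1.waveQ_coe hQ h2 hε n) (hm' 0).1 (hn' 0).1)

theorem _root_.EdgeScattering.exists_isSmoothSwitch {c d : ℝ} (h : c < d) :
    ∃ P, IsSmoothSwitch c d P := by
  refine ⟨fun x => Real.smoothTransition ((x - c) / (d - c)), ?_, fun x hx => ?_, fun x hx => ?_⟩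
  · exact Real.smoothTransition.contDiff.comp ((contDiff_id.sub contDiff_const).div_const _)
  · exact Real.smoothTransition.zero_of_nonpos
      (div_nonpos_of_nonpos_of_nonneg (by linarith) (by linarith))
  · exact Real.smoothTransition.one_of_one_le
      ((one_le_div (by linarith)).2 (by linarith))

theorem form_waveQ_plus (h3 : S.HypH3) {e : ℝ} (he : e ∉ S.criticalValues) {ε : ℝ} (hε : ε ≠ 0)
    {c d : ℝ} {P : ℝ → ℝ} (hP : IsSmoothSwitch c d P) {m n : ℕ × ℝ} (hm : m ∈ S.modes e)
    (hn : n ∈ S.modes e) :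
    (h1.localOperator hQ).form ε P (h1.waveQ hQ h2 hε m) (h1.waveQ hQ h2 hε n) =
      ∑ k ∈ (h1.finite_modes he).toFinset,
        starRingEnd ℂ (S.αplus m k) * S.αplus n k * ((S.current k : ℂ) / (2 * Real.pi)) := by
  obtain ⟨P₀, hP₀⟩ := exists_isSmoothSwitch (c := 1) (d := 2) (by norm_num)
  refine h1.form_waveQ_of_tendsto hQ h2 h3 he (h3.plus e he) (by norm_num) hP₀ (fun s hs => ?_)
    hε hP hm hn
  obtain ⟨a, ha⟩ := mem_atTop_sets.1 hs
  filter_upwards [tendsto_natCast_atTop_atTop.eventually_ge_atTop a] with N hN x hx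
  refine ha x ?_
  have h4 := hx.1
  rw [scl, inv_mul_eq_div, le_div_iff₀ (by positivity)] at h4
  linarith

theorem form_waveQ_minus (h3 : S.HypH3) {e : ℝ} (he : e ∉ S.criticalValues) {ε : ℝ} (hε : ε ≠ 0)
    {c d : ℝ} {P : ℝ → ℝ} (hP : IsSmoothSwitch c d P) {m n : ℕ × ℝ} (hm : m ∈ S.modes e)
    (hn : n ∈ S.modes e) :
    (h1.localOperator hQ).form ε P (h1.waveQ hQ h2 hε m) (h1.waveQ hQ h2 hε n) =
      ∑ k ∈ (h1.finite_modes he).toFinset,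
        starRingEnd ℂ (S.αminus m k) * S.αminus n k * ((S.current k : ℂ) / (2 * Real.pi)) := by
  obtain ⟨P₀, hP₀⟩ := exists_isSmoothSwitch (c := -2) (d := -1) (by norm_num)
  refine h1.form_waveQ_of_tendsto hQ h2 h3 he (h3.minus e he) (by norm_num) hP₀ (fun s hs => ?_)
    hε hP hm hn
  obtain ⟨a, ha⟩ := mem_atBot_sets.1 hs
  filter_upwards [tendsto_natCast_atTop_atTop.eventually_ge_atTop (-a)] with N hN x hx
  refine ha x ?_
  have h4 := hx.2
  rw [scl, inv_mul_eq_div, div_le_iff₀ (by positivity)] at h4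
  linarith

end ScatteringSystem.HypH1

end PerturbedCurrent

/-! ### Unitarity of the scattering matrix -/

section Unitarity

variable {p q : ℕ} {S : ScatteringSystem p q}

theorem ScatteringSystem.current_ne_zero {e : ℝ} (he : e ∉ S.criticalValues) {m : ℕ × ℝ}
    (hm : m ∈ S.modes e) : S.current m ≠ 0 := fun h => he ⟨m.1, m.2, hm, h⟩

theorem ScatteringSystem.HypH1.finite_posMode (h1 : S.HypH1) {e : ℝ} (he : e ∉ S.criticalValues) :
    Finite (S.PosMode e) :=
  ((h1.finite_modes he).subset fun _ h => h.1 : {m | m ∈ S.modes e ∧ 0 < S.current m}.Finite)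

theorem ScatteringSystem.HypH1.finite_negMode (h1 : S.HypH1) {e : ℝ} (he : e ∉ S.criticalValues) :
    Finite (S.NegMode e) :=
  ((h1.finite_modes he).subset fun _ h => h.1 : {m | m ∈ S.modes e ∧ S.current m < 0}.Finite)

theorem ScatteringSystem.sum_modes {e : ℝ} (he : e ∉ S.criticalValues) (hfin : (S.modes e).Finite)
    [Fintype (S.PosMode e)] [Fintype (S.NegMode e)] (f : ℕ × ℝ → ℂ) :
    ∑ k ∈ hfin.toFinset, f k = ∑ k : S.PosMode e, f k + ∑ k : S.NegMode e, f k := by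
  rw [← Finset.sum_filter_add_sum_filter_not hfin.toFinset (fun k => 0 < S.current k)]
  congr 1
  · exact Finset.sum_subtype _ (fun x => by simp) f
  · refine Finset.sum_subtype _ (fun x => ?_) f
    rw [Finset.mem_filter, Set.Finite.mem_toFinset, not_lt]
    exact ⟨fun h => ⟨h.1, lt_of_le_of_ne h.2 (current_ne_zero he h.1)⟩, fun h => ⟨h.1, h.2.le⟩⟩

theorem ScatteringSystem.weight_mul_conj_weight (k m n : ℕ × ℝ) :
    S.weight m k * starRingEnd ℂ (S.weight n k) =
      (|S.current k| : ℝ) * ((Real.sqrt |S.current m| * Real.sqrt |S.current n| : ℝ) : ℂ)⁻¹ := by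
  rw [weight, weight, Complex.conj_ofReal, ← Complex.ofReal_mul, ← Complex.ofReal_inv,
    ← Complex.ofReal_mul, Real.sqrt_div (abs_nonneg _), Real.sqrt_div (abs_nonneg _),
    div_mul_div_comm, Real.mul_self_sqrt (abs_nonneg _), div_eq_mul_inv]

theorem ScatteringSystem.nPlus_eq {e : ℝ} [Fintype (S.PosMode e)] :
    (S.nPlus e : ℂ) = Fintype.card (S.PosMode e) := by
  rw [nPlus, Nat.card_eq_fintype_card]

theorem ScatteringSystem.nMinus_eq {e : ℝ} [Fintype (S.NegMode e)] :
    (S.nMinus e : ℂ) = Fintype.card (S.NegMode e) := by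
  rw [nMinus, Nat.card_eq_fintype_card]

namespace ScatteringSystem.HypH1

section

variable (h1 : S.HypH1) (hQ : BddHermitian S.Q) (h2 : S.HypH2) (h3 : S.HypH3)
  {e : ℝ} (he : e ∉ S.criticalValues) [Fintype (S.PosMode e)] [Fintype (S.NegMode e)]

include h3 he in
theorem flux_plus (hfin : (S.modes e).Finite) {m n : ℕ × ℝ} (hm : m ∈ S.modes e)
    (hn : n ∈ S.modes e) :
    ∑ k ∈ hfin.toFinset, starRingEnd ℂ (S.αplus m k) * S.αplus n k * (S.current k : ℂ) =
      ∑ k : S.PosMode e, starRingEnd ℂ (S.αplus m k) * S.αplus n k * (|S.current k| : ℝ) -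
        if m = n ∧ S.current n < 0 then ((|S.current n| : ℝ) : ℂ) else 0 := by
  rw [sum_modes he, sub_eq_add_neg]
  congr 1
  · exact Finset.sum_congr rfl fun k _ => by rw [abs_of_pos k.2.2]
  · have h4 : ∀ k : S.NegMode e, starRingEnd ℂ (S.αplus m k) * S.αplus n k * (S.current k : ℂ) =
        -(if m = k.1 ∧ n = k.1 then ((|S.current k| : ℝ) : ℂ) else 0) := fun k => by
      rw [h3.incoming_plus e he m hm k k.2.1 k.2.2, h3.incoming_plus e he n hn k k.2.1 k.2.2,
        abs_of_neg k.2.2]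
      split_ifs <;> simp_all
    rw [Finset.sum_congr rfl fun k _ => h4 k, Finset.sum_neg_distrib]
    congr 1
    by_cases hneg : S.current n < 0
    · rw [Finset.sum_eq_single (⟨n, hn, hneg⟩ : S.NegMode e)]
      · simp [hneg]
      · intro k _ hk
        rw [if_neg]
        exact fun h => hk (Subtype.ext h.2.symm)
      · exact fun h => absurd (Finset.mem_univ _) h
    · rw [if_neg (fun h => hneg h.2)]
      refine Finset.sum_eq_zero fun k _ => if_neg fun h => hneg ?_
      rw [h.2]; exact k.2.2

include h3 he in
theorem flux_minus (hfin : (S.modes e).Finite) {m n : ℕ × ℝ} (hm : m ∈ S.modes e)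
    (hn : n ∈ S.modes e) :
    ∑ k ∈ hfin.toFinset, starRingEnd ℂ (S.αminus m k) * S.αminus n k * (S.current k : ℂ) =
      (if m = n ∧ 0 < S.current n then ((|S.current n| : ℝ) : ℂ) else 0) -
        ∑ k : S.NegMode e, starRingEnd ℂ (S.αminus m k) * S.αminus n k * (|S.current k| : ℝ) := by
  rw [sum_modes he, sub_eq_add_neg]
  congr 1
  · have h4 : ∀ k : S.PosMode e, starRingEnd ℂ (S.αminus m k) * S.αminus n k * (S.current k : ℂ) =
        if m = k.1 ∧ n = k.1 then ((|S.current k| : ℝ) : ℂ) else 0 := fun k => by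
      rw [h3.incoming_minus e he m hm k k.2.1 k.2.2, h3.incoming_minus e he n hn k k.2.1 k.2.2,
        abs_of_pos k.2.2]
      split_ifs <;> simp_all
    rw [Finset.sum_congr rfl fun k _ => h4 k]
    by_cases hpos : 0 < S.current n
    · rw [Finset.sum_eq_single (⟨n, hn, hpos⟩ : S.PosMode e)]
      · simp [hpos]
      · intro k _ hk
        rw [if_neg]
        exact fun h => hk (Subtype.ext h.2.symm)
      · exact fun h => absurd (Finset.mem_univ _) h
    · rw [if_neg (fun h => hpos h.2)]
      refine Finset.sum_eq_zero fun k _ => if_neg fun h => hpos ?_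
      rw [h.2]; exact k.2.2
  · rw [← Finset.sum_neg_distrib]
    exact Finset.sum_congr rfl fun k _ => by rw [abs_of_neg k.2.2]; push_cast; ring

include h1 hQ h2 h3 he in
/-- Conservation of the current. -/
theorem flux_balance {m n : ℕ × ℝ} (hm : m ∈ S.modes e) (hn : n ∈ S.modes e) :
    ∑ k : S.PosMode e, starRingEnd ℂ (S.αplus m k) * S.αplus n k * (|S.current k| : ℝ) +
      ∑ k : S.NegMode e, starRingEnd ℂ (S.αminus m k) * S.αminus n k * (|S.current k| : ℝ) =
      if m = n then ((|S.current n| : ℝ) : ℂ) else 0 := by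
  obtain ⟨P, hP⟩ := exists_isSmoothSwitch (c := 0) (d := 1) (by norm_num)
  have hfin := h1.finite_modes he
  have h4 := (h1.form_waveQ_plus hQ h2 h3 he one_ne_zero hP hm hn).symm.trans
    (h1.form_waveQ_minus hQ h2 h3 he one_ne_zero hP hm hn)
  simp only [← mul_div_assoc] at h4
  rw [← Finset.sum_div, ← Finset.sum_div, div_left_inj' (by simp [Real.pi_ne_zero]),
    flux_plus h3 he hfin hm hn, flux_minus h3 he hfin hm hn] at h4
  have h5 : ((if m = n ∧ 0 < S.current n then ((|S.current n| : ℝ) : ℂ) else 0) +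
      if m = n ∧ S.current n < 0 then ((|S.current n| : ℝ) : ℂ) else 0) =
      if m = n then ((|S.current n| : ℝ) : ℂ) else 0 := by
    rcases lt_or_gt_of_ne (current_ne_zero he hn) with h | h
    · simp [h, h.not_gt]
    · simp [h, h.not_gt]
  rw [← h5]
  linear_combination h4

include h1 hQ h2 h3 he in
theorem scatteringMatrix_mul_conjTranspose :
    S.scatteringMatrix e * (S.scatteringMatrix e)ᴴ = 1 := by
  have hσ : ∀ x : S.PosMode e ⊕ S.NegMode e, Sum.elim Subtype.val Subtype.val x ∈ S.modes e := by
    rintro (x | x)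
    · exact x.2.1
    · exact x.2.1
  have hinj : Function.Injective
      (Sum.elim Subtype.val Subtype.val : S.PosMode e ⊕ S.NegMode e → ℕ × ℝ) := by
    rintro (x | x) (y | y) h
    · exact congrArg _ (Subtype.ext h)
    · have : x.1 = y.1 := h
      exact absurd (this ▸ x.2.2) y.2.2.not_gt
    · have : x.1 = y.1 := h
      exact absurd (this ▸ x.2.2) y.2.2.not_gt
    · exact congrArg _ (Subtype.ext h)
  have hl : ∀ (x : S.PosMode e ⊕ S.NegMode e) (k : S.PosMode e), S.scatteringMatrix e x (.inl k) =
      S.weight (Sum.elim Subtype.val Subtype.val x) k *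
        S.αplus (Sum.elim Subtype.val Subtype.val x) k := by
    rintro (x | x) k <;> rfl
  have hr : ∀ (x : S.PosMode e ⊕ S.NegMode e) (k : S.NegMode e), S.scatteringMatrix e x (.inr k) =
      S.weight (Sum.elim Subtype.val Subtype.val x) k *
        S.αminus (Sum.elim Subtype.val Subtype.val x) k := by
    rintro (x | x) k <;> rfl
  ext x y
  have h4 := h1.flux_balance hQ h2 h3 he (hσ y) (hσ x)
  rw [Matrix.mul_apply, Fintype.sum_sum_type]
  simp only [Matrix.conjTranspose_apply, hl, hr]
  set m := (Sum.elim Subtype.val Subtype.val x : ℕ × ℝ) with hm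
  set n := (Sum.elim Subtype.val Subtype.val y : ℕ × ℝ) with hn
  set D := ((Real.sqrt |S.current m| * Real.sqrt |S.current n| : ℝ) : ℂ)⁻¹ with hD
  have h5 : ∀ (k : ℕ × ℝ) (a b : ℂ), S.weight m k * a * star (S.weight n k * b) =
      D * (starRingEnd ℂ b * a * (|S.current k| : ℝ)) := fun k a b => by
    have h6 := S.weight_mul_conj_weight k m n
    rw [← starRingEnd_apply, map_mul]
    linear_combination (a * starRingEnd ℂ b) * h6
  simp only [h5]
  rw [← Finset.mul_sum, ← Finset.mul_sum, ← mul_add, h4, Matrix.one_apply]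
  by_cases hxy : x = y
  · have hmn : n = m := by rw [hm, hn, hxy]
    rw [if_pos hmn, if_pos hxy, hD, hmn, Real.mul_self_sqrt (abs_nonneg _)]
    refine inv_mul_cancel₀ ?_
    exact_mod_cast abs_ne_zero.2 (current_ne_zero he (hσ x))
  · rw [if_neg hxy, if_neg (fun h => hxy (hinj h.symm)), mul_zero]

include h1 hQ h2 h3 he in
theorem conjTranspose_mul_scatteringMatrix :
    (S.scatteringMatrix e)ᴴ * S.scatteringMatrix e = 1 :=
  mul_eq_one_comm.1 (h1.scatteringMatrix_mul_conjTranspose hQ h2 h3 he)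

include h1 hQ h2 h3 he in
theorem trace_column : ((S.Tplus e)ᴴ * S.Tplus e).trace + ((S.Rplus e)ᴴ * S.Rplus e).trace =
    S.nPlus e := by
  have h4 := h1.conjTranspose_mul_scatteringMatrix hQ h2 h3 he
  rw [scatteringMatrix, Matrix.fromBlocks_conjTranspose, Matrix.fromBlocks_multiply,
    ← Matrix.fromBlocks_one, Matrix.fromBlocks_inj] at h4
  rw [← Matrix.trace_add, h4.1, Matrix.trace_one, nPlus_eq]

include h1 hQ h2 h3 he in
theorem trace_row : (S.Rplus e * (S.Rplus e)ᴴ).trace + (S.Tminus e * (S.Tminus e)ᴴ).trace =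
    S.nMinus e := by
  have h4 := h1.scatteringMatrix_mul_conjTranspose hQ h2 h3 he
  rw [scatteringMatrix, Matrix.fromBlocks_conjTranspose, Matrix.fromBlocks_multiply,
    ← Matrix.fromBlocks_one, Matrix.fromBlocks_inj] at h4
  rw [← Matrix.trace_add, h4.2.2.2, Matrix.trace_one, nMinus_eq]

include h1 hQ h2 h3 he in
theorem trace_sub_trace : ((S.Tplus e)ᴴ * S.Tplus e).trace - ((S.Tminus e)ᴴ * S.Tminus e).trace =
    (S.nPlus e : ℂ) - S.nMinus e := by
  rw [← h1.trace_column hQ h2 h3 he, ← h1.trace_row hQ h2 h3 he, Matrix.trace_mul_comm (S.Rplus e),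
    Matrix.trace_mul_comm (S.Tminus e)]
  ring

end

/-- The total current carried by the perturbed waves at energy `e`. -/
theorem sum_form_waveQ (h1 : S.HypH1) (hQ : BddHermitian S.Q) (h2 : S.HypH2) (h3 : S.HypH3)
    {e : ℝ} (he : e ∉ S.criticalValues) {ε : ℝ} (hε : ε ≠ 0) {c d : ℝ} {P : ℝ → ℝ} (hP : IsSmoothSwitch c d P) :
    ∑ m ∈ (h1.finite_modes he).toFinset, ((|S.current m| : ℝ) : ℂ)⁻¹ *
      (h1.localOperator hQ).form ε P (h1.waveQ hQ h2 hε m) (h1.waveQ hQ h2 hε m) =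
      ((S.nPlus e : ℂ) - S.nMinus e) / (2 * Real.pi) := by
  have := h1.finite_posMode he
  have := h1.finite_negMode he
  have := Fintype.ofFinite (S.PosMode e)
  have := Fintype.ofFinite (S.NegMode e)
  have hfin := h1.finite_modes he
  have h4 : ∀ m ∈ S.modes e, ((|S.current m| : ℝ) : ℂ)⁻¹ *
      (h1.localOperator hQ).form ε P (h1.waveQ hQ h2 hε m) (h1.waveQ hQ h2 hε m) =
      (∑ k : S.PosMode e, S.weight m k * S.αplus m k * star (S.weight m k * S.αplus m k) -
        if S.current m < 0 then 1 else 0) / (2 * Real.pi) := fun m hm => by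
    rw [h1.form_waveQ_plus hQ h2 h3 he hε hP hm hm]
    simp only [← mul_div_assoc]
    rw [← Finset.sum_div, flux_plus h3 he hfin hm hm, ← mul_div_assoc, mul_sub]
    congr 2
    · rw [Finset.mul_sum]
      refine Finset.sum_congr rfl fun k _ => ?_
      have h6 := S.weight_mul_conj_weight k m m
      rw [Real.mul_self_sqrt (abs_nonneg _)] at h6
      rw [← starRingEnd_apply, map_mul]
      linear_combination (-(S.αplus m k * starRingEnd ℂ (S.αplus m k))) * h6
    · by_cases h : S.current m < 0
      · rw [if_pos ⟨rfl, h⟩, if_pos h]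
        refine inv_mul_cancel₀ ?_
        exact_mod_cast abs_ne_zero.2 (current_ne_zero he hm)
      · rw [if_neg (fun h' => h h'.2), if_neg h, mul_zero]
  rw [Finset.sum_congr rfl fun m hm => h4 m (hfin.mem_toFinset.1 hm), ← Finset.sum_div]
  congr 1
  rw [Finset.sum_sub_distrib, sum_modes he, sum_modes he, ← h1.trace_column hQ h2 h3 he, nMinus_eq]
  congr 1
  · simp only [Matrix.trace, Matrix.diag, Matrix.mul_apply, Matrix.conjTranspose_apply]
    rw [Finset.sum_comm, Finset.sum_comm (s := (Finset.univ : Finset (S.NegMode e)))]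
    congr 1 <;> exact Finset.sum_congr rfl fun _ _ => Finset.sum_congr rfl fun _ _ => mul_comm _ _
  · rw [Finset.sum_congr rfl fun (k : S.PosMode e) _ => if_neg k.2.2.not_gt,
      Finset.sum_congr rfl fun (k : S.NegMode e) _ => if_pos k.2.2]
    simp

end ScatteringSystem.HypH1

end Unitarity

/-! ### Branches over an interval of regular values -/

section Branches

variable {f : ℝ → ℝ} {a b : ℝ}

/-- The component of `f⁻¹ [a, b]` that contains `x`. -/
def branch (f : ℝ → ℝ) (a b x : ℝ) : Set ℝ := connectedComponentIn (f ⁻¹' Icc a b) x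

theorem branch_neg (x : ℝ) : branch (fun x => -f x) (-b) (-a) x = branch f a b x := by
  have : (fun x => -f x) ⁻¹' Icc (-b) (-a) = f ⁻¹' Icc a b := by
    ext y; simp [and_comm]
  rw [branch, branch, this]

theorem branch_subset (x : ℝ) : branch f a b x ⊆ f ⁻¹' Icc a b := connectedComponentIn_subset _ _

theorem isPreconnected_branch (x : ℝ) : IsPreconnected (branch f a b x) :=
  isPreconnected_connectedComponentIn

theorem mem_branch {x : ℝ} (hx : f x ∈ Icc a b) : x ∈ branch f a b x :=
  mem_connectedComponentIn hx

theorem branch_eq {x y : ℝ} (h : y ∈ branch f a b x) : branch f a b x = branch f a b y :=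
  connectedComponentIn_eq h

theorem subset_branch {s : Set ℝ} (hs : IsPreconnected s) (hsf : s ⊆ f ⁻¹' Icc a b) {x y : ℝ}
    (hy : y ∈ branch f a b x) (hys : y ∈ s) : s ⊆ branch f a b x := by
  rw [branch_eq hy]
  exact hs.subset_connectedComponentIn hys hsf

theorem isCompact_branch (hf : Continuous f) (hc : IsCompact (f ⁻¹' Icc a b)) {x : ℝ}
    (hx : f x ∈ Icc a b) : IsCompact (branch f a b x) := by
  refine hc.of_isClosed_subset ?_ (branch_subset x)
  refine isClosed_of_closure_subset ?_
  exact subset_branch (isPreconnected_branch x).closure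
    (closure_minimal (branch_subset x) (isClosed_Icc.preimage hf)) (mem_branch hx)
    (subset_closure (mem_branch hx))

variable (hf : ContDiff ℝ ∞ f) (hd : ∀ x ∈ f ⁻¹' Icc a b, deriv f x ≠ 0)

include hf in
theorem continuous_deriv_of_smooth : Continuous (deriv f) :=
  hf.continuous_deriv (by simp)

include hf hd in
theorem deriv_pos_iff_of_mem_branch {x y z : ℝ} (hx : x ∈ branch f a b z) (hy : y ∈ branch f a b z) :
    0 < deriv f x → 0 < deriv f y := by
  intro h
  by_contra hn
  have h2 := ((isPreconnected_branch z).image _ (continuous_deriv_of_smooth hf).continuousOn).Icc_subset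
    (mem_image_of_mem _ hy) (mem_image_of_mem _ hx)
  obtain ⟨w, hw, hw0⟩ := h2 ⟨not_lt.1 hn, h.le⟩
  exact hd w (branch_subset z hw) hw0

include hf hd in
theorem injOn_branch (z : ℝ) : InjOn f (branch f a b z) := by
  have hconv : Convex ℝ (branch f a b z) := (isPreconnected_branch z).ordConnected.convex
  by_cases h : ∃ x ∈ branch f a b z, 0 < deriv f x
  · obtain ⟨x, hx, hpos⟩ := h
    refine (strictMonoOn_of_deriv_pos hconv hf.continuous.continuousOn fun y hy => ?_).injOn
    exact deriv_pos_iff_of_mem_branch hf hd hx (interior_subset hy) hpos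
  · push Not at h
    refine (strictAntiOn_of_deriv_neg hconv hf.continuous.continuousOn fun y hy => ?_).injOn
    have hy' := interior_subset hy
    exact lt_of_le_of_ne (h y hy') (hd y (branch_subset z hy'))

include hf hd in
theorem exists_gt_of_mem_branch {x z : ℝ} (hx : x ∈ branch f a b z) (hlt : f x < b) :
    ∃ y ∈ branch f a b z, f x < f y := by
  have hxa : a ≤ f x := (branch_subset z hx).1
  have hcont := continuous_deriv_of_smooth hf
  have hU : ∀ᶠ y in 𝓝 x, f y < b := hf.continuous.continuousAt.eventually_lt continuousAt_const hlt
  rcases lt_or_gt_of_ne (hd x (branch_subset z hx)) with h | h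
  · have hV : ∀ᶠ y in 𝓝 x, deriv f y < 0 :=
      hcont.continuousAt.eventually_lt continuousAt_const h
    obtain ⟨δ, hδ, hball⟩ := Metric.eventually_nhds_iff.1 (hU.and hV)
    have hin : ∀ y ∈ Icc (x - δ / 2) x, f y < b ∧ deriv f y < 0 := fun y hy => hball (by
      rw [Real.dist_eq, abs_lt]; constructor <;> linarith [hy.1, hy.2])
    have hanti : StrictAntiOn f (Icc (x - δ / 2) x) :=
      strictAntiOn_of_deriv_neg (convex_Icc _ _) hf.continuous.continuousOn fun y hy =>
        (hin y (interior_subset hy)).2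
    have hr : x ∈ Icc (x - δ / 2) x := ⟨by linarith, le_rfl⟩
    have hl : x - δ / 2 ∈ Icc (x - δ / 2) x := ⟨le_rfl, by linarith⟩
    refine ⟨x - δ / 2, subset_branch isPreconnected_Icc (fun y hy => ⟨?_, (hin y hy).1.le⟩) hx hr hl,
      hanti hl hr (by linarith)⟩
    exact hxa.trans (hanti.antitoneOn hy hr hy.2)
  · have hV : ∀ᶠ y in 𝓝 x, 0 < deriv f y :=
      continuousAt_const.eventually_lt hcont.continuousAt h
    obtain ⟨δ, hδ, hball⟩ := Metric.eventually_nhds_iff.1 (hU.and hV)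
    have hin : ∀ y ∈ Icc x (x + δ / 2), f y < b ∧ 0 < deriv f y := fun y hy => hball (by
      rw [Real.dist_eq, abs_lt]; constructor <;> linarith [hy.1, hy.2])
    have hmono : StrictMonoOn f (Icc x (x + δ / 2)) :=
      strictMonoOn_of_deriv_pos (convex_Icc _ _) hf.continuous.continuousOn fun y hy =>
        (hin y (interior_subset hy)).2
    have hl : x ∈ Icc x (x + δ / 2) := ⟨le_rfl, by linarith⟩
    have hr : x + δ / 2 ∈ Icc x (x + δ / 2) := ⟨by linarith, le_rfl⟩
    refine ⟨x + δ / 2, subset_branch isPreconnected_Icc (fun y hy => ⟨?_, (hin y hy).1.le⟩) hx hl hr,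
      hmono hl hr (by linarith)⟩
    exact hxa.trans (hmono.monotoneOn hl hy hy.1)

include hf hd in
theorem right_mem_image_branch (hc : IsCompact (f ⁻¹' Icc a b)) {x : ℝ} (hx : f x ∈ Icc a b) :
    b ∈ f '' branch f a b x := by
  obtain ⟨y, hy, hmax⟩ := (isCompact_branch hf.continuous hc hx).exists_isMaxOn ⟨x, mem_branch hx⟩
    hf.continuous.continuousOn
  refine ⟨y, hy, le_antisymm (branch_subset x hy).2 ?_⟩
  by_contra hlt
  obtain ⟨z, hz, hlt2⟩ := exists_gt_of_mem_branch hf hd hy (not_le.1 hlt)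
  exact (hmax hz).not_gt hlt2

include hf hd in
/-- Over an interval of regular values, a smooth proper function is a bijection on each component. -/
theorem bijOn_branch (hc : IsCompact (f ⁻¹' Icc a b)) {x : ℝ} (hx : f x ∈ Icc a b) :
    BijOn f (branch f a b x) (Icc a b) := by
  refine ⟨branch_subset x, injOn_branch hf hd x, ?_⟩
  have hpre : (fun x => -f x) ⁻¹' Icc (-b) (-a) = f ⁻¹' Icc a b := by
    ext y; simp [and_comm]
  have h1 := right_mem_image_branch hf hd hc hx
  have h2 := right_mem_image_branch (f := fun x => -f x) (a := -b) (b := -a) hf.neg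
    (by rw [hpre]; intro y hy; simpa using hd y hy) (by rwa [hpre])
    (x := x) ⟨neg_le_neg hx.2, neg_le_neg hx.1⟩
  rw [branch_neg] at h2
  obtain ⟨y, hy, hya⟩ := h2
  exact ((isPreconnected_branch x).image f hf.continuous.continuousOn).Icc_subset
    ⟨y, hy, neg_injective hya⟩ h1

end Branches

/-! ### Integration over the branches -/

section BranchIntegral

variable {p q : ℕ} {S : ScatteringSystem p q}

namespace ScatteringSystem.HypH1

variable (h1 : S.HypH1) {Em Ep : ℝ} (hK : Icc Em Ep ∩ S.criticalValues = ∅)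

include h1 in
theorem isCompact_preimage_energy (j : ℕ) : IsCompact (S.energy j ⁻¹' Icc Em Ep) := by
  have h2 := (h1.energy_tendsto j).eventually (eventually_gt_atTop (max |Em| |Ep|))
  obtain ⟨K, hK, hKs⟩ := mem_cocompact.1 h2
  refine hK.of_isClosed_subset (isClosed_Icc.preimage (h1.energy_smooth j).continuous)
    fun ξ hξ => ?_
  by_contra hcon
  have h3 : max |Em| |Ep| < |S.energy j ξ| := hKs hcon
  exact h3.not_ge (abs_le_max_abs_abs hξ.1 hξ.2)

include hK in
theorem notMem_criticalValues {e : ℝ} (he : e ∈ Icc Em Ep) : e ∉ S.criticalValues := fun h =>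
  (Set.ext_iff.1 hK e).1 ⟨he, h⟩

include hK in
theorem deriv_energy_ne_zero (j : ℕ) : ∀ x ∈ S.energy j ⁻¹' Icc Em Ep, deriv (S.energy j) x ≠ 0 :=
  fun x hx h => notMem_criticalValues hK hx ⟨j, x, rfl, h⟩

/-- The mode at energy `e` on the same component as `m`. -/
def _root_.EdgeScattering.ScatteringSystem.transport (S : ScatteringSystem p q) (Em Ep e : ℝ)
    (m : ℕ × ℝ) : ℕ × ℝ :=
  (m.1, Function.invFunOn (S.energy m.1) (branch (S.energy m.1) Em Ep m.2) e)

include h1 hK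

theorem bijOn_energy {E : ℝ} (hE : E ∈ Icc Em Ep) {m : ℕ × ℝ} (hm : m ∈ S.modes E) :
    BijOn (S.energy m.1) (branch (S.energy m.1) Em Ep m.2) (Icc Em Ep) :=
  bijOn_branch (h1.energy_smooth _) (deriv_energy_ne_zero hK _) (h1.isCompact_preimage_energy _)
    (by rwa [show S.energy m.1 m.2 = E from hm])

theorem transport_mem {E e : ℝ} (hE : E ∈ Icc Em Ep) (he : e ∈ Icc Em Ep) {m : ℕ × ℝ}
    (hm : m ∈ S.modes E) : (S.transport Em Ep e m).2 ∈ branch (S.energy m.1) Em Ep m.2 :=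
  Function.invFunOn_mem ((h1.bijOn_energy hK hE hm).surjOn he)

theorem energy_transport {E e : ℝ} (hE : E ∈ Icc Em Ep) (he : e ∈ Icc Em Ep) {m : ℕ × ℝ}
    (hm : m ∈ S.modes E) : S.transport Em Ep e m ∈ S.modes e :=
  Function.invFunOn_eq ((h1.bijOn_energy hK hE hm).surjOn he)

theorem eq_of_mem_branch {E : ℝ} (hE : E ∈ Icc Em Ep) {m n : ℕ × ℝ} (hm : m ∈ S.modes E)
    (hn : n ∈ S.modes E) (hj : m.1 = n.1) {x : ℝ} (hx : x ∈ branch (S.energy m.1) Em Ep m.2)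
    (hx' : x ∈ branch (S.energy n.1) Em Ep n.2) : m = n := by
  refine Prod.ext hj ((h1.bijOn_energy hK hE hm).injOn ?_ ?_ ?_)
  · exact mem_branch (by rwa [show S.energy m.1 m.2 = E from hm])
  · rw [branch_eq hx, hj, ← branch_eq hx']
    exact mem_branch (by rwa [show S.energy n.1 n.2 = E from hn])
  · rw [show S.energy m.1 m.2 = E from hm, hj]
    exact (show S.energy n.1 n.2 = E from hn).symm

theorem bijOn_transport {E e : ℝ} (hE : E ∈ Icc Em Ep) (he : e ∈ Icc Em Ep) :
    BijOn (S.transport Em Ep e) (S.modes E) (S.modes e) := by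
  refine ⟨fun m hm => h1.energy_transport hK hE he hm, fun m hm n hn hmn => ?_, fun n hn => ?_⟩
  · have h2 := h1.transport_mem hK hE he hn
    have h3 : (S.transport Em Ep e m).1 = (S.transport Em Ep e n).1 := by rw [hmn]
    rw [← hmn] at h2
    exact h1.eq_of_mem_branch hK hE hm hn h3 (h1.transport_mem hK hE he hm) h2
  · obtain ⟨ξ, hξ, hξE⟩ := (h1.bijOn_energy hK he hn).surjOn hE
    have hm : ((n.1, ξ) : ℕ × ℝ) ∈ S.modes E := hξE
    refine ⟨(n.1, ξ), hm, h1.eq_of_mem_branch hK he (h1.energy_transport hK hE he hm) hn rfl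
      (mem_branch ?_) ?_⟩
    · rw [show S.energy _ (S.transport Em Ep e (n.1, ξ)).2 = e from h1.energy_transport hK hE he hm]
      exact he
    · have h2 := h1.transport_mem hK hE he hm
      rwa [branch_eq hξ]

theorem current_transport_pos_iff {E e : ℝ} (hE : E ∈ Icc Em Ep) (he : e ∈ Icc Em Ep) {m : ℕ × ℝ}
    (hm : m ∈ S.modes E) : 0 < S.current (S.transport Em Ep e m) ↔ 0 < S.current m := by
  have h2 := h1.transport_mem hK hE he hm
  have h3 : m.2 ∈ branch (S.energy m.1) Em Ep m.2 :=
    mem_branch (by rwa [show S.energy m.1 m.2 = E from hm])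
  exact ⟨deriv_pos_iff_of_mem_branch (h1.energy_smooth _) (deriv_energy_ne_zero hK _) h2 h3,
    deriv_pos_iff_of_mem_branch (h1.energy_smooth _) (deriv_energy_ne_zero hK _) h3 h2⟩

theorem nPlus_eq_nPlus {E e : ℝ} (hE : E ∈ Icc Em Ep) (he : e ∈ Icc Em Ep) :
    S.nPlus e = S.nPlus E := by
  have hb := h1.bijOn_transport hK hE he
  have h2 : BijOn (S.transport Em Ep e) {m | m ∈ S.modes E ∧ 0 < S.current m}
      {m | m ∈ S.modes e ∧ 0 < S.current m} := by
    refine ⟨fun m hm => ⟨hb.mapsTo hm.1, (h1.current_transport_pos_iff hK hE he hm.1).2 hm.2⟩,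
      hb.injOn.mono fun m hm => hm.1, fun n hn => ?_⟩
    obtain ⟨m, hm, rfl⟩ := hb.surjOn hn.1
    exact ⟨m, ⟨hm, (h1.current_transport_pos_iff hK hE he hm).1 hn.2⟩, rfl⟩
  exact (Nat.card_congr (h2.equiv _)).symm

theorem nMinus_eq_nMinus {E e : ℝ} (hE : E ∈ Icc Em Ep) (he : e ∈ Icc Em Ep) :
    S.nMinus e = S.nMinus E := by
  have hb := h1.bijOn_transport hK hE he
  have hneg : ∀ {e' : ℝ}, e' ∈ Icc Em Ep → ∀ m ∈ S.modes e',
      (S.current m < 0 ↔ ¬ 0 < S.current m) := fun he' m hm =>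
    ⟨fun h => h.not_gt, fun h => lt_of_le_of_ne (not_lt.1 h)
      (current_ne_zero (notMem_criticalValues hK he') hm)⟩
  have h2 : BijOn (S.transport Em Ep e) {m | m ∈ S.modes E ∧ S.current m < 0}
      {m | m ∈ S.modes e ∧ S.current m < 0} := by
    refine ⟨fun m hm => ⟨hb.mapsTo hm.1, ?_⟩, hb.injOn.mono fun m hm => hm.1, fun n hn => ?_⟩
    · rw [hneg he _ (hb.mapsTo hm.1), h1.current_transport_pos_iff hK hE he hm.1,
        ← hneg hE _ hm.1]
      exact hm.2
    · obtain ⟨m, hm, rfl⟩ := hb.surjOn hn.1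
      refine ⟨m, ⟨hm, ?_⟩, rfl⟩
      rw [hneg hE _ hm, ← h1.current_transport_pos_iff hK hE he hm, ← hneg he _ hn.1]
      exact hn.2
  exact (Nat.card_congr (h2.equiv _)).symm

theorem setIntegral_branch {E : ℝ} (hE : E ∈ Icc Em Ep) {m : ℕ × ℝ} (hm : m ∈ S.modes E)
    (g : ℝ → ℂ) (F : ℕ × ℝ → ℂ) :
    ∫ x in branch (S.energy m.1) Em Ep m.2, g (S.energy m.1 x) * F (m.1, x) =
      ∫ e in Icc Em Ep, g e * (((|S.current (S.transport Em Ep e m)| : ℝ) : ℂ)⁻¹ *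
        F (S.transport Em Ep e m)) := by
  have hb := h1.bijOn_energy hK hE hm
  have hs : MeasurableSet (branch (S.energy m.1) Em Ep m.2) :=
    (isCompact_branch (h1.energy_smooth _).continuous (h1.isCompact_preimage_energy _)
      (by rwa [show S.energy m.1 m.2 = E from hm])).measurableSet
  rw [← hb.image_eq, integral_image_eq_integral_abs_deriv_smul hs
    (fun x _ => ((h1.energy_smooth m.1).differentiable (by simp) x).hasDerivAt.hasDerivWithinAt)
    hb.injOn]
  refine setIntegral_congr_fun hs fun x hx => ?_
  have h2 : S.transport Em Ep (S.energy m.1 x) m = (m.1, x) :=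
    Prod.ext rfl (hb.injOn.leftInvOn_invFunOn hx)
  have h3 : ((|deriv (S.energy m.1) x| : ℝ) : ℂ) ≠ 0 := by
    exact_mod_cast abs_ne_zero.2 (deriv_energy_ne_zero hK _ _ (branch_subset _ hx))
  simp only [h2, ScatteringSystem.current, Complex.real_smul]
  field_simp

theorem integrableOn_branch {E : ℝ} (hE : E ∈ Icc Em Ep) {m : ℕ × ℝ} (hm : m ∈ S.modes E)
    {g : ℝ → ℂ} {F : ℕ × ℝ → ℂ} (hi : Integrable fun x => g (S.energy m.1 x) * F (m.1, x)) :
    IntegrableOn (fun e => g e * (((|S.current (S.transport Em Ep e m)| : ℝ) : ℂ)⁻¹ *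
        F (S.transport Em Ep e m))) (Icc Em Ep) := by
  have hb := h1.bijOn_energy hK hE hm
  have hs : MeasurableSet (branch (S.energy m.1) Em Ep m.2) :=
    (isCompact_branch (h1.energy_smooth _).continuous (h1.isCompact_preimage_energy _)
      (by rwa [show S.energy m.1 m.2 = E from hm])).measurableSet
  rw [← hb.image_eq, integrableOn_image_iff_integrableOn_abs_deriv_smul hs
    (fun x _ => ((h1.energy_smooth m.1).differentiable (by simp) x).hasDerivAt.hasDerivWithinAt)
    hb.injOn]
  refine hi.integrableOn.congr_fun (fun x hx => ?_) hs
  have h2 : S.transport Em Ep (S.energy m.1 x) m = (m.1, x) :=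
    Prod.ext rfl (hb.injOn.leftInvOn_invFunOn hx)
  have h3 : ((|deriv (S.energy m.1) x| : ℝ) : ℂ) ≠ 0 := by
    exact_mod_cast abs_ne_zero.2 (deriv_energy_ne_zero hK _ _ (branch_subset _ hx))
  simp only [h2, ScatteringSystem.current, Complex.real_smul]
  field_simp

theorem integral_energy {E : ℝ} (hE : E ∈ Icc Em Ep) (hfin : (S.modes E).Finite)
    {g : ℝ → ℂ} (hg : ∀ e ∉ Icc Em Ep, g e = 0) {F : ℕ × ℝ → ℂ} (j : ℕ)
    (hi : Integrable fun x => g (S.energy j x) * F (j, x)) :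
    ∫ x, g (S.energy j x) * F (j, x) = ∑ m ∈ hfin.toFinset, if j = m.1 then
      ∫ e in Icc Em Ep, g e * (((|S.current (S.transport Em Ep e m)| : ℝ) : ℂ)⁻¹ *
        F (S.transport Em Ep e m)) else 0 := by
  rw [← Finset.sum_filter, ← setIntegral_eq_integral_of_forall_compl_eq_zero
    (s := S.energy j ⁻¹' Icc Em Ep) fun x hx => by rw [hg _ hx, zero_mul]]
  have hmem : ∀ m ∈ hfin.toFinset.filter (fun m => j = m.1), m ∈ S.modes E ∧ j = m.1 := fun m hm => by
    simpa using hm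
  have hU : S.energy j ⁻¹' Icc Em Ep = ⋃ m ∈ hfin.toFinset.filter (fun m => j = m.1),
      branch (S.energy m.1) Em Ep m.2 := by
    refine Subset.antisymm (fun x hx => ?_) (iUnion₂_subset fun m hm => ?_)
    · obtain ⟨ξ, hξ, hξE⟩ := (bijOn_branch (h1.energy_smooth j) (deriv_energy_ne_zero hK _)
        (h1.isCompact_preimage_energy _) hx).surjOn hE
      have h4 := branch_eq hξ
      refine mem_iUnion₂.2 ⟨(j, ξ), by
        rw [Finset.mem_filter, Set.Finite.mem_toFinset]; exact ⟨hξE, rfl⟩, ?_⟩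
      rw [← h4]
      exact mem_branch hx
    · rw [(hmem m hm).2]
      exact branch_subset _
  rw [hU, integral_biUnion_finset]
  · refine Finset.sum_congr rfl fun m hm => ?_
    rw [← h1.setIntegral_branch hK hE (hmem m hm).1, (hmem m hm).2]
  · exact fun m hm => (isCompact_branch (h1.energy_smooth _).continuous
      (h1.isCompact_preimage_energy _)
      (by rwa [show S.energy m.1 m.2 = E from (hmem m hm).1])).measurableSet
  · intro m hm n hn hne
    refine disjoint_left.2 fun x hx hx' => hne ?_
    exact h1.eq_of_mem_branch hK hE (hmem m hm).1 (hmem n hn).1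
      ((hmem m hm).2.symm.trans (hmem n hn).2) hx hx'
  · exact fun m _ => hi.integrableOn

/-- The coarea formula for the branches. -/
theorem tsum_integral_energy {E : ℝ} (hE : E ∈ Icc Em Ep) {g : ℝ → ℂ}
    (hg : ∀ e ∉ Icc Em Ep, g e = 0) {F : ℕ × ℝ → ℂ}
    (hi : ∀ j, Integrable fun x => g (S.energy j x) * F (j, x)) {κ : ℂ}
    (hκ : ∀ e (he : e ∈ Icc Em Ep), ∑ m ∈ (h1.finite_modes (notMem_criticalValues hK he)).toFinset,
      ((|S.current m| : ℝ) : ℂ)⁻¹ * F m = κ) :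
    ∑' j, ∫ x, g (S.energy j x) * F (j, x) = (∫ e, g e) * κ := by
  have hfin := h1.finite_modes (notMem_criticalValues hK hE)
  have h5 : ∀ I : ℕ × ℝ → ℂ, ∑' j, ∑ m ∈ hfin.toFinset, (if j = m.1 then I m else 0) =
      ∑ m ∈ hfin.toFinset, I m := fun I =>
    (hasSum_sum fun m _ => hasSum_ite_eq m.1 (I m)).tsum_eq
  rw [tsum_congr fun j => h1.integral_energy hK hE hfin hg j (hi j), h5, ← integral_finsetSum]
  · rw [← setIntegral_eq_integral_of_forall_compl_eq_zero (s := Icc Em Ep) hg,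
      ← integral_mul_const]
    refine setIntegral_congr_fun measurableSet_Icc fun e he => ?_
    rw [← Finset.mul_sum, ← hκ e he]
    congr 1
    have hb := h1.bijOn_transport hK hE he
    refine Finset.sum_nbij (S.transport Em Ep e) (fun m hm => ?_) ?_ ?_ fun _ _ => rfl
    · rw [Set.Finite.mem_toFinset] at hm ⊢
      exact hb.mapsTo hm
    · rw [Set.Finite.coe_toFinset]; exact hb.injOn
    · rw [Set.Finite.coe_toFinset, Set.Finite.coe_toFinset]; exact hb.surjOn
  · exact fun m hm => h1.integrableOn_branch hK hE (hfin.mem_toFinset.1 hm) (hi m.1)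

end ScatteringSystem.HypH1

end BranchIntegral

/-! ### The interface current -/

section InterfaceCurrent

variable {p q : ℕ} {S : ScatteringSystem p q}

theorem ScatteringSystem.ShortRange.bddHermitian (h : S.ShortRange) : BddHermitian S.Q := by
  obtain ⟨ε, -, C, hC⟩ := h.decay
  exact ⟨h.measurable, h.hermitian, C, fun z i j => le_trans
    (le_mul_of_one_le_left (norm_nonneg _) (one_le_pow₀ (one_le_bracket _))) (hC z i j)⟩

theorem IsSmoothSwitch.contDiff_deriv {c d : ℝ} {φ : ℝ → ℝ} (h : IsSmoothSwitch c d φ) :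
    ContDiff ℝ ∞ (deriv φ) :=
  (contDiff_infty_iff_deriv.1 h.1).2

theorem IsSmoothSwitch.deriv_eq_zero {c d : ℝ} {φ : ℝ → ℝ} (h : IsSmoothSwitch c d φ) {x : ℝ}
    (hx : x ∉ Icc c d) : deriv φ x = 0 := by
  rw [mem_Icc, not_and_or, not_le, not_le] at hx
  rcases hx with hx | hx
  · have : φ =ᶠ[𝓝 x] fun _ => 0 := by
      filter_upwards [Iio_mem_nhds hx] with y hy using h.2.1 y hy
    rw [this.deriv_eq, deriv_const]
  · have : φ =ᶠ[𝓝 x] fun _ => 1 := by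
      filter_upwards [Ioi_mem_nhds hx] with y hy using h.2.2 y hy
    rw [this.deriv_eq, deriv_const]

theorem IsSmoothSwitch.integral_deriv {c d : ℝ} {φ : ℝ → ℝ}
    (h : IsSmoothSwitch c d φ) : ∫ x, deriv φ x = 1 := by
  have h1 : ∫ x, deriv φ x = ∫ x in (c - 1)..(d + 1), deriv φ x := by
    refine (intervalIntegral.integral_eq_integral_of_support_subset fun x hx => ?_).symm
    by_contra hcon
    refine hx (h.deriv_eq_zero fun hmem => hcon ⟨by linarith [hmem.1], by linarith [hmem.2]⟩)
  rw [h1, intervalIntegral.integral_deriv_eq_sub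
    (fun x _ => h.1.differentiable (by simp) x)
    (h.contDiff_deriv.continuous.intervalIntegrable _ _), h.2.1 (c - 1) (by linarith),
    h.2.2 (d + 1) (by linarith), sub_zero]

theorem IsSmoothSwitch.isTest_deriv {c d : ℝ} {φ : ℝ → ℝ} (h : IsSmoothSwitch c d φ) :
    IsTest fun t => ((deriv φ t : ℝ) : ℂ) := by
  refine ⟨Complex.ofRealCLM.contDiff.comp h.contDiff_deriv, ?_⟩
  refine HasCompactSupport.of_support_subset_isCompact (K := Icc c d) isCompact_Icc fun x hx => ?_
  by_contra hcon
  exact hx (by simp only [h.deriv_eq_zero hcon, Complex.ofReal_zero])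

namespace ScatteringSystem.HypH1

variable (h1 : S.HypH1) (hQ : BddHermitian S.Q)

include hQ in
theorem mem_H_domain {u : L2Plane q} : u ∈ S.H.domain ↔ u ∈ S.H₀.domain := by
  change u ∈ S.H₀.domain ⊓ mulDomain S.Q ↔ _
  rw [hQ.mulDomain_eq, inf_top_eq]

theorem isResolvent : IsResolvent S.H Complex.I ((h1.localOperator hQ).selfAdjoint.res true) := by
  intro f u
  constructor
  · rintro rfl
    refine ⟨(mem_H_domain hQ).2 ((h1.localOperator hQ).selfAdjoint.resD true f).2, ?_⟩
    rw [h1.H_apply hQ]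
    exact (h1.localOperator hQ).selfAdjoint.resD_spec true f
  · rintro ⟨hu, h⟩
    rw [h1.H_apply hQ] at h
    exact (congrArg Subtype.val ((h1.localOperator hQ).selfAdjoint.resD_eq (b := true) h)).symm

theorem isFunctionOf (g : ℝ → ℝ) :
    IsFunctionOf S.H g ((h1.localOperator hQ).fn fun t => ((g t : ℝ) : ℂ)) :=
  ⟨_, h1.isResolvent hQ, rfl⟩

theorem isCurrentOperator {P : ℝ → ℝ} (hP : IsCut P) {G C : L2Plane q →L[ℂ] L2Plane q}
    (D : L2Plane q → (h1.localOperator hQ).dom) (hG : ∀ f, G f = D f)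
    (hC : ∀ f, C f = (h1.localOperator hQ).brk hP (D f)) : IsCurrentOperator S.H P G C := by
  intro f
  have hmem : G f ∈ S.H.domain := by
    rw [hG]; exact (mem_H_domain hQ).2 (D f).2
  have hmemv : mulX (fun x => (P x : ℂ)) (D f : L2Plane q) ∈ S.H.domain :=
    (mem_H_domain hQ).2 ((h1.localOperator hQ).mulD hP.smoothBdd (D f)).2
  have hDf : (⟨G f, hmem.1⟩ : (h1.localOperator hQ).dom) = D f := Subtype.ext (hG f)
  refine ⟨hmem, ⟨_, hmemv⟩, mulX (fun x => (P x : ℂ)) (S.H ⟨G f, hmem⟩), ?_, ?_, ?_⟩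
  · rw [hG]
    exact mulX_coe hP.smoothBdd.bddMeas _
  · exact mulX_coe hP.smoothBdd.bddMeas _
  · rw [hC, LocalOperator.brk_apply, h1.H_apply hQ, h1.H_apply hQ]
    refine Eq.trans ?_ (congrArg (fun u => Complex.I • ((h1.localOperator hQ).comm 0
      ((h1.localOperator hQ).mulD hP.smoothBdd (D f)) -
      mulX (fun x => (P x : ℂ)) ((h1.localOperator hQ).comm 0 u))) hDf.symm)
    rfl

include h1 hQ in
/-- The interface current is quantized. -/
theorem isInterfaceCurrent (h2 : S.HypH2) (h3 : S.HypH3) {E Em Ep c d : ℝ} {φ P : ℝ → ℝ}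
    (hE : E ∈ Icc Em Ep) (hK : Icc Em Ep ∩ S.criticalValues = ∅) (hφ : IsSmoothSwitch Em Ep φ)
    (hP : IsSmoothSwitch c d P) :
    IsInterfaceCurrent S.H P (deriv φ) (((S.nPlus E : ℝ) - S.nMinus E) / (2 * Real.pi)) := by
  obtain ⟨ε, hε, hall⟩ := h1.hasTrace hQ h2
  obtain ⟨C, hC, hint, htr⟩ := hall hP.isCut hφ.isTest_deriv
  refine ⟨_, C, h1.isFunctionOf hQ (deriv φ), h1.isCurrentOperator hQ hP.isCut _
    (fun f => (h1.localOperator hQ).fn_apply hφ.isTest_deriv f) hC, ?_⟩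
  have key := h1.tsum_integral_energy hK hE (g := fun t => ((deriv φ t : ℝ) : ℂ))
    (fun e he => by rw [hφ.deriv_eq_zero he, Complex.ofReal_zero])
    (F := fun m => (h1.localOperator hQ).form ε P (h1.waveQ hQ h2 hε m) (h1.waveQ hQ h2 hε m)) hint
    (κ := ((S.nPlus E : ℂ) - S.nMinus E) / (2 * Real.pi)) fun e he => by
      rw [h1.sum_form_waveQ hQ h2 h3 (notMem_criticalValues hK he) hε hP,
        h1.nPlus_eq_nPlus hK hE he, h1.nMinus_eq_nMinus hK hE he]
  rw [key, integral_complex_ofReal, hφ.integral_deriv, Complex.ofReal_one,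
    one_mul] at htr
  push_cast
  exact htr

end ScatteringSystem.HypH1

/-- The scattering matrix is unitary and the interface current equals the difference of the
numbers of transmitted modes, for every bounded Hermitian perturbation. -/
theorem ScatteringSystem.HypH1.scattering_and_current (h1 : S.HypH1) (hQ : BddHermitian S.Q)
    (h2 : S.HypH2) (h3 : S.HypH3) {E : ℝ} (hE : E ∉ S.criticalValues) :
    ∃ (_ : Fintype (S.PosMode E)) (_ : Fintype (S.NegMode E)),
      ((S.scatteringMatrix E)ᴴ * S.scatteringMatrix E = 1 ∧
        S.scatteringMatrix E * (S.scatteringMatrix E)ᴴ = 1) ∧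
      ∀ (Em Ep : ℝ) (φ P : ℝ → ℝ) (c d : ℝ),
        E ∈ Set.Icc Em Ep → Set.Icc Em Ep ∩ S.criticalValues = ∅ →
        IsSmoothSwitch Em Ep φ → c < d → IsSmoothSwitch c d P →
        ∃ σ : ℝ, IsInterfaceCurrent S.H P (deriv φ) σ ∧
          ((2 * Real.pi * σ : ℝ) : ℂ) =
            ((S.Tplus E)ᴴ * S.Tplus E).trace - ((S.Tminus E)ᴴ * S.Tminus E).trace ∧
          ((S.Tplus E)ᴴ * S.Tplus E).trace - ((S.Tminus E)ᴴ * S.Tminus E).trace =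
            (S.nPlus E : ℂ) - (S.nMinus E : ℂ) := by
  have := h1.finite_posMode hE
  have := h1.finite_negMode hE
  let i₁ : Fintype (S.PosMode E) := Fintype.ofFinite _
  let i₂ : Fintype (S.NegMode E) := Fintype.ofFinite _
  refine ⟨i₁, i₂,
    ⟨h1.conjTranspose_mul_scatteringMatrix hQ h2 h3 hE,
      h1.scatteringMatrix_mul_conjTranspose hQ h2 h3 hE⟩,
    fun Em Ep φ P c d hEm hK hφ _ hP => ⟨_, h1.isInterfaceCurrent hQ h2 h3 hEm hK hφ hP, ?_,
      h1.trace_sub_trace hQ h2 h3 hE⟩⟩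
  rw [h1.trace_sub_trace hQ h2 h3 hE]
  push_cast
  exact mul_div_cancel₀ _ (by simp [Real.pi_ne_zero])

end InterfaceCurrent

end EdgeScattering

end

open EdgeScattering in
theorem theorem2p1 {p q : ℕ} (S : ScatteringSystem p q)
    (h1 : S.HypH1) (hQ : S.ShortRange) (h2 : S.HypH2) (h3 : S.HypH3)
    (E : ℝ) (hE : E ∉ S.criticalValues) :
    ∃ (_ : Fintype (S.PosMode E)) (_ : Fintype (S.NegMode E)),
      ((S.scatteringMatrix E)ᴴ * S.scatteringMatrix E = 1 ∧
        S.scatteringMatrix E * (S.scatteringMatrix E)ᴴ = 1) ∧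
      ∀ (Em Ep : ℝ) (φ P : ℝ → ℝ) (c d : ℝ),
        E ∈ Set.Icc Em Ep → Set.Icc Em Ep ∩ S.criticalValues = ∅ →
        IsSmoothSwitch Em Ep φ → c < d → IsSmoothSwitch c d P →
        ∃ σ : ℝ, IsInterfaceCurrent S.H P (deriv φ) σ ∧
          ((2 * Real.pi * σ : ℝ) : ℂ) =
            ((S.Tplus E)ᴴ * S.Tplus E).trace - ((S.Tminus E)ᴴ * S.Tminus E).trace ∧
          ((S.Tplus E)ᴴ * S.Tplus E).trace - ((S.Tminus E)ᴴ * S.Tminus E).trace =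
            (S.nPlus E : ℂ) - (S.nMinus E : ℂ) :=
  h1.scattering_and_current hQ.bddHermitian h2 h3 hE
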